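/- Setting. Let $G$ be a compact Lie group with semisimple Lie algebra $\mathfrak g$, realized as a closed subgroup of some unitary group $U(N)$, let $K\subset G$ be a closed subgroup with Lie algebra $\mathfrak k$, and let $B$ be the Killing form of $\mathfrak g$ and $\mathfrak g=\mathfrak k\oplus\mathfrak p$ the $B$-orthogonal decomposition, so that $\mathfrak p=T_o(G/K)$. Let $g_B$ be the standard metric on $M=G/K$, i.e. the $G$-invariant metric with $\langle\cdot,\cdot\rangle=-B|_{\mathfrak p\times\mathfrak p}$. Let $\mathcal M_1^G$ be the set of all $G$-invariant metrics on $M$ of the same volume as $g_B$, $\mathrm{Sc}$ the scalar curvature, and $\mathcal{TT}^G$ the space of $G$-invariant symmetric 2-tensors on $M$ that are traceless and divergence-free with respect to $g_B$. Let $\Delta_L$ be the Lichnerowicz Laplacian of $g_B$, and let $\lambda_{\mathfrak p}$ and $\lambda_{\mathfrak p}^{\max}$ be the smallest and the largest eigenvalue of $\Delta_L|_{\mathcal{TT}^G}$; they exist if $M$ is not isotropy irreducible, i.e. if $\mathfrak p$ has an $\mathrm{Ad}(K)$-invariant subspace other than $0$ and $\mathfrak p$. Let $\lambda_\tau$ and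 $\lambda_\tau^{\max}$ be the smallest and the largest eigenvalue of the Casimir operator $\mathrm{Cas}_\tau A=-\sum_i[\operatorname{ad}e_i,[\operatorname{ad}e_i,A]]$ ($e_i$ a $(-B)$-orthonormal basis of $\mathfrak g$) on the space of traceless $B$-symmetric endomorphisms $A$ of $\mathfrak g$. If $g_B$ is Einstein, let $\mathrm{Sc}''$ be the second derivative of $\mathrm{Sc}|_{\mathcal M_1^G}$ at its critical point $g_B$; then $g_B$ is called $G$-stable if $\mathrm{Sc}''(T,T)<0$ for all $0\neq T\in\mathcal{TT}^G$, $G$-semistable if $\mathrm{Sc}''(T,T)\le 0$ for all $T\in\mathcal{TT}^G$, and $G$-unstable if it is not $G$-semistable. Statement. Assume that $\mathrm{Ric}(g_B)=\rho\, g_B$. (i) If $8\rho-1<\lambda_\tau$, then $g_B$ is $G$-stable, and $2\rho<\lambda_{\mathfrak p}$ if $M$ is not isotropy irreducible. (ii) If $8\rho-1=\lambda_\tau$, then $g_B$ is $G$-semistable, and $2\rho\le\lambda_{\mathfrak p}$ if $M$ is not isotropy irreducible. (iii) If $\lambda_\tau^{\max}<8\rho-1$, then $g_B$ is a local minimum of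 $\mathrm{Sc}|_{\mathcal M_1^G}$; if moreover $M$ is not isotropy irreducible, then $\lambda_{\mathfrak p}^{\max}<2\rho$ and $g_B$ is $G$-unstable. (iv) If $\lambda_\tau^{\max}=8\rho-1$ and $M$ is not isotropy irreducible, then $\lambda_{\mathfrak p}^{\max}\le 2\rho$. As applications, on each of the following spaces $\mathrm{Ric}(g_B)=\frac5{12}g_B$, and $g_B$ is $G$-unstable and a local minimum of $\mathrm{Sc}|_{\mathcal M_1^G}$: (a) $Sp(3n-1)/(Sp(n)\times U(2n-1))$ for every $n\ge 3$, where $U(2n-1)\subset Sp(2n-1)$ and $Sp(n)\times Sp(2n-1)\subset Sp(3n-1)$ are the standard inclusions; (b) $SO(3n+2)/(SO(n)\times U(n+1))$ for every $n\ge 3$, where $U(n+1)\subset SO(2n+2)$ and $SO(n)\times SO(2n+2)\subset SO(3n+2)$ are the standard inclusions; (c) $E_6/(\mathrm{Spin}(8)\cdot T^2)$. Here $E_6$ is the group of the unitary transformations of the space $\mathbb C^{27}$ of triples $(X,Y,Z)$ of complex $3\times3$ matrices that preserve the cubic form $\det X+\det Y+\det Z-\operatorname{tr}(XYZ)$, and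 $\mathrm{Spin}(8)\cdot T^2$ (with Lie algebra $\mathfrak{so}(8)\oplus\mathbb R^2$) is the subgroup of the elements that preserve each of the three lines spanned by $(E_{ii},0,0)$, $i=1,2,3$. -/

import Mathlib

open Matrix

attribute [local instance 100] LieRing.ofAssociativeRing

namespace HomGeom

noncomputable section

/-! ### Linear algebra of bilinear forms -/

section Contraction

variable {V : Type*} [AddCommGroup V] [Module ℝ V] [FiniteDimensional ℝ V]

/-- The isomorphism `V* → V` induced by a nondegenerate bilinear form `h`
(`h (sharp h φ) Y = φ Y`); it is `0` if `h` is degenerate. -/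
def sharp (h : LinearMap.BilinForm ℝ V) : Module.Dual ℝ V →ₗ[ℝ] V :=
  open Classical in
  if hn : h.Nondegenerate then (h.toDual hn).symm.toLinearMap else 0

/-- Contraction with respect to `h`: `∑ i, f (e i) (eⁱ)`, where `e` is a basis and `eⁱ` is its
`h`-dual basis. If `h` is an inner product and `f` is bilinear, this is `∑ i, f (e i) (e i)` for
any `h`-orthonormal basis `e`. -/
def contr (h : LinearMap.BilinForm ℝ V) {W : Type*} [AddCommGroup W] (f : V → V → W) : W :=
  ∑ i, f (Module.finBasis ℝ V i) (sharp h ((Module.finBasis ℝ V).coord i))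

/-- Inner products: symmetric positive definite bilinear forms. -/
def IsInner (h : LinearMap.BilinForm ℝ V) : Prop :=
  (∀ X Y, h X Y = h Y X) ∧ ∀ X, X ≠ 0 → 0 < h X X

end Contraction

/-! ### The Casimir operator on symmetric endomorphisms of a Lie algebra -/

section Casimir

variable (L : Type*) [LieRing L] [LieAlgebra ℝ L] [FiniteDimensional ℝ L]

/-- The action `τ(X) A = [ad X, A] = ad X ∘ A - A ∘ ad X` of `L` on endomorphisms of `L`. -/
def tau (X : L) (A : Module.End ℝ L) : Module.End ℝ L :=
  LieAlgebra.ad ℝ L X * A - A * LieAlgebra.ad ℝ L X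

/-- `Cas_τ A = - ∑ τ(eᵢ) (τ(eᵢ) A)`, for a basis `e` of the Lie algebra that is orthonormal
with respect to minus the Killing form. -/
def casTau (A : Module.End ℝ L) : Module.End ℝ L :=
  -contr (-(killingForm ℝ L)) fun X Y => tau L X (tau L Y A)

/-- The eigenvalues of `Cas_τ` on the traceless endomorphisms that are symmetric with respect to
the Killing form. -/
def casSpec : Set ℝ :=
  {c | ∃ A : Module.End ℝ L, A ≠ 0 ∧ (∀ X Y, killingForm ℝ L (A X) Y = killingForm ℝ L X (A Y)) ∧
    LinearMap.trace ℝ L A = 0 ∧ casTau L A = c • A}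

/-- `λ_τ`, the smallest eigenvalue. -/
def lamTau : ℝ := sInf (casSpec L)

/-- `λ_τ^max`, the largest eigenvalue. -/
def lamTauMax : ℝ := sSup (casSpec L)

end Casimir

/-! ### Invariant geometry of a homogeneous space, described at the base point

`L` is the Lie algebra of `G`, `k` is the Lie subalgebra of `K`, and `S` is the set of the
operators `Ad(x) : L → L`, `x ∈ K`. -/

section Homogeneous

variable {L : Type*} [LieRing L] [LieAlgebra ℝ L] [FiniteDimensional ℝ L]

/-- The orthogonal complement of `k` with respect to the Killing form, identified with the tangent
space of `G/K` at the base point. -/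
abbrev tang (k : LieSubalgebra ℝ L) : Submodule ℝ L :=
  LinearMap.BilinForm.orthogonal (killingForm ℝ L) k.toSubmodule

/-- The projection onto `tang k` along `k` (the two are always complementary if the Killing form
of `L` is negative definite). -/
def projP (k : LieSubalgebra ℝ L) : L →ₗ[ℝ] tang k :=
  open Classical in
  if hc : IsCompl (tang k) k.toSubmodule then
    (tang k).projectionOnto k.toSubmodule hc else 0

/-- The standard metric: minus the Killing form, restricted to `tang k`. -/
def stdMetric (k : LieSubalgebra ℝ L) : LinearMap.BilinForm ℝ (tang k) :=
  -(killingForm ℝ L).restrict (tang k)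

/-- The `tang k`-component of the bracket. -/
def brP (k : LieSubalgebra ℝ L) (X Y : tang k) : tang k := projP k ⁅(X : L), (Y : L)⁆

/-- The `k`-component of the bracket. -/
def brK (k : LieSubalgebra ℝ L) (X Y : tang k) : L := ⁅(X : L), (Y : L)⁆ - (brP k X Y : L)

/-- The right-hand side of Koszul's formula
`2 h(Λ(X)Y, Z) = h([X,Y]_p, Z) - h([Y,Z]_p, X) + h([Z,X]_p, Y)`, as a functional of `Z`. -/
def koszul (k : LieSubalgebra ℝ L) (h : LinearMap.BilinForm ℝ (tang k)) (X Y : tang k) :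
    Module.Dual ℝ (tang k) :=
  h (brP k X Y)
    - (h.flip X) ∘ₗ (projP k) ∘ₗ (LieAlgebra.ad ℝ L (Y : L)) ∘ₗ (tang k).subtype
    - (h.flip Y) ∘ₗ (projP k) ∘ₗ (LieAlgebra.ad ℝ L (X : L)) ∘ₗ (tang k).subtype

/-- The Levi-Civita connection of the invariant metric `h`, as the bilinear map
`Λ : p × p → p` (Nomizu operators). -/
def nomizu (k : LieSubalgebra ℝ L) (h : LinearMap.BilinForm ℝ (tang k)) (X Y : tang k) : tang k :=
  (1 / 2 : ℝ) • sharp h (koszul k h X Y)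

/-- The Riemann curvature `R(X,Y)Z = Λ(X)Λ(Y)Z - Λ(Y)Λ(X)Z - Λ([X,Y]_p)Z - [[X,Y]_k, Z]`. -/
def curv (k : LieSubalgebra ℝ L) (h : LinearMap.BilinForm ℝ (tang k)) (X Y Z : tang k) : tang k :=
  nomizu k h X (nomizu k h Y Z) - nomizu k h Y (nomizu k h X Z) - nomizu k h (brP k X Y) Z
    - projP k ⁅brK k X Y, (Z : L)⁆

/-- The Ricci tensor `Ric(Y,Z) = ∑ h(R(eᵢ,Y)Z, eᵢ)`. -/
def ric (k : LieSubalgebra ℝ L) (h : LinearMap.BilinForm ℝ (tang k)) (Y Z : tang k) : ℝ :=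
  contr h fun V W => h (curv k h V Y Z) W

/-- The scalar curvature, the `h`-trace of the Ricci tensor. -/
def scal (k : LieSubalgebra ℝ L) (h : LinearMap.BilinForm ℝ (tang k)) : ℝ :=
  contr h (ric k h)

/-- `Ric(h) = ρ h`. -/
def IsEinstein (k : LieSubalgebra ℝ L) (h : LinearMap.BilinForm ℝ (tang k)) (ρ : ℝ) : Prop :=
  ∀ X Y, ric k h X Y = ρ * h X Y

/-- The covariant derivative `∇_X T` of an invariant 2-tensor `T`. -/
def covD (k : LieSubalgebra ℝ L) (h : LinearMap.BilinForm ℝ (tang k)) (T : tang k → tang k → ℝ)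
    (X : tang k) (Y Z : tang k) : ℝ :=
  -T (nomizu k h X Y) Z - T Y (nomizu k h X Z)

/-- The second covariant derivative `∇²_{V,X} T` of an invariant 2-tensor `T`. -/
def covD2 (k : LieSubalgebra ℝ L) (h : LinearMap.BilinForm ℝ (tang k)) (T : tang k → tang k → ℝ)
    (V X : tang k) (Y Z : tang k) : ℝ :=
  covD k h (covD k h T X) V Y Z - covD k h T (nomizu k h V X) Y Z

/-- The Lichnerowicz Laplacian of the metric `h` on invariant symmetric 2-tensors,
`Δ_L T = ∇*∇T + Ric∘T + T∘Ric - 2 R°T`, with `∇*∇T = -∑ ∇²_{eᵢ,eᵢ} T` and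
`(R°T)(Y,Z) = ∑ T(R(eᵢ,Y)Z, eᵢ)`. -/
def lich (k : LieSubalgebra ℝ L) (h : LinearMap.BilinForm ℝ (tang k)) (T : tang k → tang k → ℝ)
    (Y Z : tang k) : ℝ :=
  -(contr h fun V W => covD2 k h T V W Y Z)
    + (contr h fun V W => ric k h Y V * T W Z) + (contr h fun V W => ric k h Z V * T Y W)
    - 2 * contr h fun V W => T (curv k h V Y Z) W

/-- `Ad(K)`-invariance of a bilinear form on the tangent space. -/
def IsInvariant (k : LieSubalgebra ℝ L) (S : Set (L →ₗ[ℝ] L))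
    (T : LinearMap.BilinForm ℝ (tang k)) : Prop :=
  ∀ φ ∈ S, ∀ X Y : tang k, T (projP k (φ X)) (projP k (φ Y)) = T X Y

/-- The isotropy representation of `K` has a nontrivial invariant subspace, that is, `G/K` is not
isotropy irreducible. -/
def IsotropyReducible (k : LieSubalgebra ℝ L) (S : Set (L →ₗ[ℝ] L)) : Prop :=
  ∃ W : Submodule ℝ (tang k), W ≠ ⊥ ∧ W ≠ ⊤ ∧ ∀ φ ∈ S, ∀ X ∈ W, projP k (φ (X : L)) ∈ W

/-- `G`-invariant TT-tensors of the standard metric: invariant symmetric 2-tensors that are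
traceless and divergence-free. -/
def IsTT (k : LieSubalgebra ℝ L) (S : Set (L →ₗ[ℝ] L))
    (T : LinearMap.BilinForm ℝ (tang k)) : Prop :=
  (∀ X Y, T X Y = T Y X) ∧ IsInvariant k S T ∧
    contr (stdMetric k) (fun X Y => T X Y) = 0 ∧
    ∀ X, contr (stdMetric k)
      (fun V W => covD k (stdMetric k) (fun Y Z => T Y Z) V W X) = 0

/-- The eigenvalues of the Lichnerowicz Laplacian of the standard metric on the `G`-invariant
TT-tensors. -/
def lichSpec (k : LieSubalgebra ℝ L) (S : Set (L →ₗ[ℝ] L)) : Set ℝ :=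
  {c | ∃ T : LinearMap.BilinForm ℝ (tang k), T ≠ 0 ∧ IsTT k S T ∧
    ∀ X Y, lich k (stdMetric k) (fun Y Z => T Y Z) X Y = c * T X Y}

/-- `λ_p`, the smallest eigenvalue. -/
def lamP (k : LieSubalgebra ℝ L) (S : Set (L →ₗ[ℝ] L)) : ℝ := sInf (lichSpec k S)

/-- `λ_p^max`, the largest eigenvalue. -/
def lamPMax (k : LieSubalgebra ℝ L) (S : Set (L →ₗ[ℝ] L)) : ℝ := sSup (lichSpec k S)

/-- The square of the ratio of the volume of `h` to the volume of the standard metric. -/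
def volRatioSq (k : LieSubalgebra ℝ L) (h : LinearMap.BilinForm ℝ (tang k)) : ℝ :=
  (LinearMap.BilinForm.toMatrix (Module.finBasis ℝ (tang k)) h).det /
    (LinearMap.BilinForm.toMatrix (Module.finBasis ℝ (tang k)) (stdMetric k)).det

/-- The `G`-invariant metrics on `G/K` of the same volume as the standard metric. -/
def unitMetrics (k : LieSubalgebra ℝ L) (S : Set (L →ₗ[ℝ] L)) :
    Set (LinearMap.BilinForm ℝ (tang k)) :=
  {h | IsInner h ∧ IsInvariant k S h ∧ volRatioSq k h = 1}

/-- The standard metric is a local minimum of the scalar curvature among the `G`-invariant metrics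
of the same volume. -/
def IsLocalMinScal (k : LieSubalgebra ℝ L) (S : Set (L →ₗ[ℝ] L)) : Prop :=
  ∃ ε > (0 : ℝ), ∀ h ∈ unitMetrics k S,
    (∀ X, |h X X - stdMetric k X X| ≤ ε * stdMetric k X X) → scal k (stdMetric k) ≤ scal k h

/-- The curve `t ↦ g + tT` through the standard metric `g`, rescaled to constant volume. If `T` is
traceless, its derivative at `0` is `T`. -/
def unitCurve (k : LieSubalgebra ℝ L) (T : LinearMap.BilinForm ℝ (tang k)) (t : ℝ) :
    LinearMap.BilinForm ℝ (tang k) :=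
  (volRatioSq k (stdMetric k + t • T)) ^ (-(1 / (Module.finrank ℝ (tang k) : ℝ))) •
    (stdMetric k + t • T)

/-- The second variation `Sc''(T,T)` at the standard metric of the scalar curvature on metrics of
fixed volume (the standard metric being a critical point, it does not depend on the curve with
velocity `T`). -/
def scalHess (k : LieSubalgebra ℝ L) (T : LinearMap.BilinForm ℝ (tang k)) : ℝ :=
  iteratedDeriv 2 (fun t : ℝ => scal k (unitCurve k T t)) 0

/-- `G`-stability of the standard metric: `Sc'' < 0` on `G`-invariant TT-tensors. -/
def GStable (k : LieSubalgebra ℝ L) (S : Set (L →ₗ[ℝ] L)) : Prop :=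
  ∀ T, IsTT k S T → T ≠ 0 → scalHess k T < 0

/-- `G`-semistability of the standard metric: `Sc'' ≤ 0` on `G`-invariant TT-tensors. -/
def GSemistable (k : LieSubalgebra ℝ L) (S : Set (L →ₗ[ℝ] L)) : Prop :=
  ∀ T, IsTT k S T → scalHess k T ≤ 0

/-- `G`-instability: the negation of `G`-semistability. -/
def GUnstable (k : LieSubalgebra ℝ L) (S : Set (L →ₗ[ℝ] L)) : Prop := ¬GSemistable k S

end Homogeneous

/-! ### Compact Lie groups as closed subgroups of unitary groups -/

section Groups

variable {ι : Type*} [Fintype ι] [DecidableEq ι]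

/-- The Lie algebra of a closed subgroup `G` of `U(N)`, namely the real Lie algebra of all `X` such
that `exp(tX) ∈ G` for all real `t`. (For closed `G` this set is a Lie algebra, so that taking the
Lie span does not enlarge it.) -/
def lieAlg (G : Subgroup (unitaryGroup ι ℂ)) : LieSubalgebra ℝ (Matrix ι ι ℂ) :=
  LieSubalgebra.lieSpan ℝ (Matrix ι ι ℂ)
    {X | ∀ t : ℝ, ∃ g ∈ G, (g : Matrix ι ι ℂ) = NormedSpace.exp (t • X)}

/-- Conjugation by a unitary matrix, as a Lie algebra homomorphism. -/
def conjHom (g : unitaryGroup ι ℂ) : Matrix ι ι ℂ →ₗ⁅ℝ⁆ Matrix ι ι ℂ where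
  toFun X := (g : Matrix ι ι ℂ) * X * ((g⁻¹ : unitaryGroup ι ℂ) : Matrix ι ι ℂ)
  map_add' X Y := by rw [mul_add, add_mul]
  map_smul' c X := by simp
  map_lie' := by
    intro X Y
    have h : ((g⁻¹ : unitaryGroup ι ℂ) : Matrix ι ι ℂ) * (g : Matrix ι ι ℂ) = 1 := by
      rw [← Submonoid.coe_mul]; simp
    have key : ∀ A B : Matrix ι ι ℂ,
        (g : Matrix ι ι ℂ) * (A * B) * ((g⁻¹ : unitaryGroup ι ℂ) : Matrix ι ι ℂ) =
        ((g : Matrix ι ι ℂ) * A * ((g⁻¹ : unitaryGroup ι ℂ) : Matrix ι ι ℂ)) *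
          ((g : Matrix ι ι ℂ) * B * ((g⁻¹ : unitaryGroup ι ℂ) : Matrix ι ι ℂ)) := by
      intro A B
      calc _ = (g : Matrix ι ι ℂ) * A * 1 * B * ((g⁻¹ : unitaryGroup ι ℂ) : Matrix ι ι ℂ) := by
            simp only [mul_assoc, one_mul]
        _ = _ := by rw [← h]; simp only [mul_assoc]
    simp only [Ring.lie_def, mul_sub, sub_mul, key]

theorem conjHom_mem (G : Subgroup (unitaryGroup ι ℂ)) (g : unitaryGroup ι ℂ) (hg : g ∈ G)
    (X : Matrix ι ι ℂ) (hX : X ∈ lieAlg G) : conjHom g X ∈ lieAlg G := by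
  have hle : lieAlg G ≤ (lieAlg G).comap (conjHom g) := by
    refine LieSubalgebra.lieSpan_le.2 ?_
    intro Y hY
    refine LieSubalgebra.subset_lieSpan ?_
    intro t
    obtain ⟨x, hx, hxe⟩ := hY t
    refine ⟨g * x * g⁻¹, G.mul_mem (G.mul_mem hg hx) (G.inv_mem hg), ?_⟩
    have hs : t • conjHom g Y = conjHom g (t • Y) := ((conjHom g).map_smul t Y).symm
    have hu := Matrix.exp_units_conj (Unitary.toUnits g) (t • Y)
    change _ = NormedSpace.exp (t • conjHom g Y)
    rw [hs]
    refine Eq.trans ?_ hu.symm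
    rw [← hxe]
    rfl
  exact hle hX

/-- The adjoint representation of `G` on its Lie algebra. -/
def Ad (G : Subgroup (unitaryGroup ι ℂ)) (g : G) : lieAlg G →ₗ[ℝ] lieAlg G where
  toFun X := ⟨conjHom (g : unitaryGroup ι ℂ) X, conjHom_mem G g g.2 X X.2⟩
  map_add' X Y := by ext1; simp
  map_smul' c X := by ext1; simp

/-- For `K ≤ G`, the Lie algebra of `K` as a Lie subalgebra of the Lie algebra of `G`. -/
def subK (G K : Subgroup (unitaryGroup ι ℂ)) : LieSubalgebra ℝ (lieAlg G) :=
  (lieAlg K).comap (lieAlg G).incl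

/-- For `K ≤ G`, the operators `Ad(x)`, `x ∈ K`, on the Lie algebra of `G`. -/
def AdK (G K : Subgroup (unitaryGroup ι ℂ)) : Set (lieAlg G →ₗ[ℝ] lieAlg G) :=
  {φ | ∃ g : G, (g : unitaryGroup ι ℂ) ∈ K ∧ φ = Ad G g}

/-- The unitary matrices that commute with `S`. -/
def commutant (S : Matrix ι ι ℂ) : Subgroup (unitaryGroup ι ℂ) where
  carrier := {g | (g : Matrix ι ι ℂ) * S = S * (g : Matrix ι ι ℂ)}
  one_mem' := by simp
  mul_mem' := by
    intro a b ha hb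
    simp only [Set.mem_ofPred_eq, Submonoid.coe_mul] at *
    rw [mul_assoc, hb, ← mul_assoc, ha, mul_assoc]
  inv_mem' := by
    intro a ha
    simp only [Set.mem_ofPred_eq] at *
    have h1 : ((a⁻¹ : unitaryGroup ι ℂ) : Matrix ι ι ℂ) * (a : Matrix ι ι ℂ) = 1 := by
      rw [← Submonoid.coe_mul]; simp
    have h2 : (a : Matrix ι ι ℂ) * ((a⁻¹ : unitaryGroup ι ℂ) : Matrix ι ι ℂ) = 1 := by
      rw [← Submonoid.coe_mul]; simp
    calc _ = ((a⁻¹ : unitaryGroup ι ℂ) : Matrix ι ι ℂ) * (S * (a : Matrix ι ι ℂ)) *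
          ((a⁻¹ : unitaryGroup ι ℂ) : Matrix ι ι ℂ) := by
          rw [mul_assoc, mul_assoc, h2, mul_one]
      _ = _ := by rw [← ha, ← mul_assoc, h1, one_mul]

variable (ι) in
/-- `SO(N)`: the real unitary matrices of determinant one. -/
def soGroup : Subgroup (unitaryGroup ι ℂ) where
  carrier := {g | (∀ i j, ((g : Matrix ι ι ℂ) i j).im = 0) ∧ (g : Matrix ι ι ℂ).det = 1}
  one_mem' := by
    refine ⟨fun i j => ?_, by simp⟩
    by_cases h : i = j <;> simp [h]
  mul_mem' := by
    rintro a b ⟨ha, ha'⟩ ⟨hb, hb'⟩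
    refine ⟨fun i j => ?_, by simp [ha', hb']⟩
    simp [Matrix.mul_apply, Complex.mul_im, ha, hb]
  inv_mem' := by
    rintro a ⟨ha, ha'⟩
    refine ⟨fun i j => ?_, ?_⟩
    · rw [UnitaryGroup.inv_val]
      simp [Matrix.star_apply, ha]
    · rw [UnitaryGroup.inv_val]
      simp [Matrix.star_eq_conjTranspose, Matrix.det_conjTranspose, ha']

variable (ι) in
/-- The compact symplectic group `Sp(N) = {g ∈ U(2N) : gᵀ J g = J}`. -/
def spGroup : Subgroup (unitaryGroup (ι ⊕ ι) ℂ) where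
  carrier := {g | (g : Matrix (ι ⊕ ι) (ι ⊕ ι) ℂ)ᵀ * J ι ℂ * (g : Matrix (ι ⊕ ι) (ι ⊕ ι) ℂ)
    = J ι ℂ}
  one_mem' := by simp
  mul_mem' := by
    intro a b ha hb
    simp only [Set.mem_ofPred_eq, Submonoid.coe_mul, Matrix.transpose_mul] at *
    calc _ = (b : Matrix (ι ⊕ ι) (ι ⊕ ι) ℂ)ᵀ * ((a : Matrix (ι ⊕ ι) (ι ⊕ ι) ℂ)ᵀ * J ι ℂ *
          (a : Matrix (ι ⊕ ι) (ι ⊕ ι) ℂ)) * (b : Matrix (ι ⊕ ι) (ι ⊕ ι) ℂ) := by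
          simp only [mul_assoc]
      _ = _ := by rw [ha, hb]
  inv_mem' := by
    intro a ha
    simp only [Set.mem_ofPred_eq] at *
    have h2 : (a : Matrix (ι ⊕ ι) (ι ⊕ ι) ℂ) *
        ((a⁻¹ : unitaryGroup (ι ⊕ ι) ℂ) : Matrix (ι ⊕ ι) (ι ⊕ ι) ℂ) = 1 := by
      rw [← Submonoid.coe_mul]; simp
    have h3 : ((a⁻¹ : unitaryGroup (ι ⊕ ι) ℂ) : Matrix (ι ⊕ ι) (ι ⊕ ι) ℂ)ᵀ *
        (a : Matrix (ι ⊕ ι) (ι ⊕ ι) ℂ)ᵀ = 1 := by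
      rw [← Matrix.transpose_mul, h2, Matrix.transpose_one]
    calc _ = ((a⁻¹ : unitaryGroup (ι ⊕ ι) ℂ) : Matrix (ι ⊕ ι) (ι ⊕ ι) ℂ)ᵀ *
          ((a : Matrix (ι ⊕ ι) (ι ⊕ ι) ℂ)ᵀ * J ι ℂ * (a : Matrix (ι ⊕ ι) (ι ⊕ ι) ℂ)) *
          ((a⁻¹ : unitaryGroup (ι ⊕ ι) ℂ) : Matrix (ι ⊕ ι) (ι ⊕ ι) ℂ) := by rw [ha]
      _ = (((a⁻¹ : unitaryGroup (ι ⊕ ι) ℂ) : Matrix (ι ⊕ ι) (ι ⊕ ι) ℂ)ᵀ *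
          (a : Matrix (ι ⊕ ι) (ι ⊕ ι) ℂ)ᵀ) * J ι ℂ * ((a : Matrix (ι ⊕ ι) (ι ⊕ ι) ℂ) *
          ((a⁻¹ : unitaryGroup (ι ⊕ ι) ℂ) : Matrix (ι ⊕ ι) (ι ⊕ ι) ℂ)) := by
          simp only [mul_assoc]
      _ = _ := by rw [h2, h3, one_mul, mul_one]

end Groups

/-! ### The three families of examples -/

/-- `SO(3n+2)`, acting on `ℝⁿ ⊕ ℝ^{2n+2}`. -/
def soG (n : ℕ) : Subgroup (unitaryGroup (Fin n ⊕ (Fin (n + 1) ⊕ Fin (n + 1))) ℂ) :=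
  soGroup (Fin n ⊕ (Fin (n + 1) ⊕ Fin (n + 1)))

/-- `SO(n) × U(n+1) ⊂ SO(n) × SO(2n+2) ⊂ SO(3n+2)`, as the elements of `SO(3n+2)` that commute with
the complex structure of `ℝ^{2n+2} = ℂ^{n+1}`, extended by zero to `ℝⁿ`. (Such an element is block
diagonal, with second block in `U(n+1) ⊂ SO(2n+2)`, so that its first block is in `SO(n)`.) -/
def soK (n : ℕ) : Subgroup (unitaryGroup (Fin n ⊕ (Fin (n + 1) ⊕ Fin (n + 1))) ℂ) :=
  soG n ⊓ commutant (Matrix.fromBlocks 0 0 0 (J (Fin (n + 1)) ℂ))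

/-- `Sp(3n-1)`, acting on `ℂ^{3n-1} ⊕ ℂ^{3n-1}`, with `ℂ^{3n-1} = ℂⁿ ⊕ ℂ^{2n-1}`. -/
def spG (n : ℕ) :
    Subgroup (unitaryGroup ((Fin n ⊕ Fin (2 * n - 1)) ⊕ (Fin n ⊕ Fin (2 * n - 1))) ℂ) :=
  spGroup (Fin n ⊕ Fin (2 * n - 1))

/-- `Sp(n) × U(2n-1) ⊂ Sp(n) × Sp(2n-1) ⊂ Sp(3n-1)`, where `U(m) ⊂ Sp(m)` consists of the matrices
`diag(u, conj u)`, as the elements of `Sp(3n-1)` that preserve each summand of the decomposition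
of `ℂ^{6n-2}` into `ℂ^{2n}`, `ℂ^{2n-1}` and (conjugate) `ℂ^{2n-1}`, that is, that commute with
`diag(0, 1, 0, -1)`. -/
def spK (n : ℕ) :
    Subgroup (unitaryGroup ((Fin n ⊕ Fin (2 * n - 1)) ⊕ (Fin n ⊕ Fin (2 * n - 1))) ℂ) :=
  spG n ⊓ commutant (Matrix.diagonal
    (Sum.elim (Sum.elim (fun _ => 0) (fun _ => 1)) (Sum.elim (fun _ => 0) (fun _ => -1))))

/-- The `m`-th component of a triple of complex `3 × 3` matrices. -/
def triple (v : Fin 3 × Fin 3 × Fin 3 → ℂ) (m : Fin 3) : Matrix (Fin 3) (Fin 3) ℂ :=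
  Matrix.of fun i j => v (m, i, j)

/-- The `E₆`-invariant cubic form `det A + det B + det C - tr(ABC)` (the norm form of the complex
Albert algebra) on the 27-dimensional space of triples of complex `3 × 3` matrices. -/
def cubicForm (v : Fin 3 × Fin 3 × Fin 3 → ℂ) : ℂ :=
  (triple v 0).det + (triple v 1).det + (triple v 2).det
    - (triple v 0 * triple v 1 * triple v 2).trace

/-- The compact group `E₆`: the unitary transformations of the 27-dimensional space that preserve
the cubic form. -/
def e6G : Subgroup (unitaryGroup (Fin 3 × Fin 3 × Fin 3) ℂ) where
  carrier := {g | ∀ v, cubicForm ((g : Matrix _ _ ℂ) *ᵥ v) = cubicForm v}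
  one_mem' := by simp
  mul_mem' := by
    intro a b ha hb v
    rw [Submonoid.coe_mul, ← Matrix.mulVec_mulVec, ha, hb]
  inv_mem' := by
    intro a ha v
    rw [← ha, Matrix.mulVec_mulVec, ← Submonoid.coe_mul]
    simp

/-- `Spin(8) · T² ⊂ E₆`: the elements that preserve each of the three lines spanned by the diagonal
matrix units `(E_ii, 0, 0)`, that is, that commute with the orthogonal projections onto them. -/
def e6K : Subgroup (unitaryGroup (Fin 3 × Fin 3 × Fin 3) ℂ) :=
  e6G ⊓ ⨅ i : Fin 3, commutant (Matrix.diagonal (Pi.single (0, i, i) 1))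

end

end HomGeom

open HomGeom

/-! Everything is computed at the base point in a `-B`-orthonormal basis `e` of `p`. By
ad-invariance of `B` the structure constants c(i,j,l) = ⟨[e_i, e_j]_p, e_l⟩ are totally skew, and
the Levi-Civita connection of the standard metric is half the bracket. Splitting tr(ad X ad Y) into
blocks along g = k ⊕ p gives Ric = -B/2 + tr_p/4, where tr_p is the trace form of the compressed
operators `adP`. Hence Ric = ρg means that the weights c(i,j,l)² sum to 2 - 4ρ as soon as one index
is fixed.

Let T be symmetric, traceless and invariant, with eigenvalues a_i in `e`, and put |a|² = Σ a_i² and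
Q = Σ a_j a_l c(i,j,l)² (`bracketSum`). Let A be the extension of the operator of T by zero to g.
Three quadratic forms become combinations of |a|² and Q: ⟨Δ_L T, T⟩ = (2 - 4ρ)|a|² - Q (from
`lich_stdMetric`), Sc''(T, T) = (3ρ - 1)|a|² + Q/2 (`scalHess_eq`), ⟨Cas_τ A, A⟩ = (3 - 4ρ)|a|² - 2Q
(`trace_casTau_extOp`). Eliminating Q gives, as quadratic forms, 2Δ_L = Cas_τ + 1 - 4ρ and 4Sc'' =
8ρ - 1 - Cas_τ. Since A is traceless and symmetric, the Casimir form lies between λ_τ|a|² and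
λ_τ^max|a|², and (i)-(iv) follow. The divergence condition is automatic, being the trace of a
symmetric times a skew operator, and a reducible isotropy representation supplies a nonzero T.

For the local minimum, an invariant metric is diagonalized as diag(exp s_i) in some `e`; equality of
volumes says Σ s_i = 0, and the scalar curvature is an explicit sum of exponentials in s
(`scal_diagonal`). Its linear part vanishes because the weights have constant marginals, its
quadratic part is half of Sc'' at the logarithm of the metric, which is again an invariant tensor,
and the remainder is a small multiple of Σ s_i².

The applications need no Casimir eigenvalue: |Q| ≤ (2 - 4ρ)|a|² gives Sc'' ≥ (5ρ - 2)|a|², and 5/12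
> 2/5. What remains is reducibility and tr_p = B/3. For the classical families both forms are
multiples of Re tr(XY), found from one formula for traces of X ↦ Σ A X D on a real form
(`trace_eq_of_sandwich`). For E₆, sign changes in K grade the Lie algebra by a Klein four-group, p =
p_0 ⊕ p_1 ⊕ p_2, with [p_l, p_l] ⊆ k and [p_l, p_m] in the third summand. For Y in p_m given by a
vector u of the m-th octonion, (ad Y)² has trace -16|u|² on p_m and -8|u|² on each of the other two,
whence tr_p(Y, Y) = -16|u|² and B(Y, Y) = -48|u|². -/

namespace HomGeom

/-! ### Bilinear forms, orthonormal bases and contractions. -/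

section LinAlg

variable {V : Type*} [AddCommGroup V] [Module ℝ V] [FiniteDimensional ℝ V]
  {W : Type*} [AddCommGroup W] [Module ℝ W] {ι : Type*} [Fintype ι] [DecidableEq ι]

/-- Bilinear maps, unbundled. -/
structure IsBilin (f : V → V → W) : Prop where
  add_left : ∀ x y z, f (x + y) z = f x z + f y z
  smul_left : ∀ (c : ℝ) x z, f (c • x) z = c • f x z
  add_right : ∀ x y z, f x (y + z) = f x y + f x z
  smul_right : ∀ (c : ℝ) x z, f x (c • z) = c • f x z

/-- Orthonormal bases of a bilinear form. -/
def IsONB (h : LinearMap.BilinForm ℝ V) (e : Module.Basis ι ℝ V) : Prop :=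
  ∀ i j, h (e i) (e j) = if i = j then 1 else 0

omit [FiniteDimensional ℝ V] in
theorem IsInner.nondegenerate {h : LinearMap.BilinForm ℝ V} (hh : IsInner h) :
    h.Nondegenerate := by
  refine ⟨fun x hx => ?_, fun x hx => ?_⟩ <;>
  · by_contra hne
    exact (hh.2 x hne).ne' (hx x)

theorem apply_sharp {h : LinearMap.BilinForm ℝ V} (hh : IsInner h) (φ : Module.Dual ℝ V) (y : V) :
    h (sharp h φ) y = φ y := by
  rw [sharp, dif_pos hh.nondegenerate]
  exact LinearMap.BilinForm.apply_toDual_symm_apply φ y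

omit [FiniteDimensional ℝ V] in
theorem IsONB.repr_apply {h : LinearMap.BilinForm ℝ V} {e : Module.Basis ι ℝ V} (he : IsONB h e)
    (x : V) (i : ι) : e.repr x i = h x (e i) := by
  have h1 : h (∑ j, e.repr x j • e j) (e i) = e.repr x i := by
    simp only [map_sum, LinearMap.sum_apply, map_smul, LinearMap.smul_apply, he _ i]
    simp
  rw [← h1, e.sum_repr]

omit [FiniteDimensional ℝ V] in
theorem IsONB.sum_eq {h : LinearMap.BilinForm ℝ V} {e : Module.Basis ι ℝ V} (he : IsONB h e)
    (x : V) : ∑ i, h x (e i) • e i = x := by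
  conv_rhs => rw [← e.sum_repr x]
  simp [he.repr_apply]

omit [FiniteDimensional ℝ V] in
theorem IsONB.sum_mul {h : LinearMap.BilinForm ℝ V} {e : Module.Basis ι ℝ V} (he : IsONB h e)
    (hs : ∀ x y, h x y = h y x) (x y : V) : ∑ i, h x (e i) * h y (e i) = h x y := by
  conv_rhs => rw [← he.sum_eq x]
  simp [map_sum, LinearMap.sum_apply, hs _ y]

omit [FiniteDimensional ℝ V] in
theorem IsBilin.sum_left {f : V → V → W} (hf : IsBilin f) {κ : Type*} (s : Finset κ) (c : κ → ℝ)
    (x : κ → V) (y : V) : f (∑ i ∈ s, c i • x i) y = ∑ i ∈ s, c i • f (x i) y := by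
  classical
  induction s using Finset.induction_on with
  | empty =>
    have := hf.smul_left 0 0 y
    simpa using this
  | insert a s ha ih => rw [Finset.sum_insert ha, Finset.sum_insert ha, hf.add_left, ih, hf.smul_left]

omit [FiniteDimensional ℝ V] in
theorem IsBilin.sum_right {f : V → V → W} (hf : IsBilin f) {κ : Type*} (s : Finset κ) (c : κ → ℝ)
    (x : κ → V) (y : V) : f y (∑ i ∈ s, c i • x i) = ∑ i ∈ s, c i • f y (x i) := by
  classical
  induction s using Finset.induction_on with
  | empty =>
    have := hf.smul_right 0 y 0
    simpa using this
  | insert a s ha ih => rw [Finset.sum_insert ha, Finset.sum_insert ha, hf.add_right, ih, hf.smul_right]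

/-- A contraction does not depend on the pair of dual bases: expanding the `h`-dual basis in `e`,
the coefficients reassemble the vectors of `e` in the other slot. All contractions in the geometric
definitions are evaluated through this. -/
theorem contr_eq_sum {h : LinearMap.BilinForm ℝ V} (hh : IsInner h) {e : Module.Basis ι ℝ V}
    (he : IsONB h e) {f : V → V → W} (hf : IsBilin f) : contr h f = ∑ i, f (e i) (e i) := by
  set b := Module.finBasis ℝ V
  have h1 : ∀ i, sharp h (b.coord i) = ∑ j, b.coord i (e j) • e j := fun i => by
    rw [← he.sum_eq (sharp h (b.coord i))]
    simp [apply_sharp hh]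
  calc contr h f = ∑ i, f (b i) (∑ j, b.coord i (e j) • e j) := by
        unfold contr
        simp only [← h1]
        rfl
    _ = ∑ j, ∑ i, b.coord i (e j) • f (b i) (e j) := by
        simp only [hf.sum_right]
        rw [Finset.sum_comm]
    _ = ∑ j, f (e j) (e j) := by
        refine Finset.sum_congr rfl fun j _ => ?_
        rw [← hf.sum_left]
        congr 1
        exact b.sum_repr (e j)

omit [FiniteDimensional ℝ V] in
theorem trace_eq_sum {h : LinearMap.BilinForm ℝ V} {e : Module.Basis ι ℝ V} (he : IsONB h e)
    (f : V →ₗ[ℝ] V) : LinearMap.trace ℝ V f = ∑ i, h (f (e i)) (e i) := by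
  rw [LinearMap.trace_eq_matrix_trace ℝ e, Matrix.trace]
  simp [LinearMap.toMatrix_apply, he.repr_apply]

/-- The spectral theorem; the inner product space structure is built from `h` and stays local to the
proof. -/
theorem exists_eigenbasis {h : LinearMap.BilinForm ℝ V} (hh : IsInner h) (f : V →ₗ[ℝ] V)
    (hf : ∀ x y, h (f x) y = h x (f y)) :
    ∃ (e : Module.Basis (Fin (Module.finrank ℝ V)) ℝ V) (μ : Fin (Module.finrank ℝ V) → ℝ),
      IsONB h e ∧ ∀ i, f (e i) = μ i • e i := by
  let core : InnerProductSpace.Core ℝ V :=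
    { inner := fun x y => h x y
      conj_inner_symm := fun x y => by simpa using hh.1 y x
      re_inner_nonneg := fun x => by
        rcases eq_or_ne x 0 with rfl | hx
        · simp
        · simpa using (hh.2 x hx).le
      add_left := fun x y z => by simp
      smul_left := fun x y r => by simp
      definite := fun x hx => by
        by_contra hne
        exact (hh.2 x hne).ne' hx }
  let _ : NormedAddCommGroup V := core.toNormedAddCommGroup
  let _ : InnerProductSpace ℝ V := InnerProductSpace.ofCore core.toCore
  have hsym : f.IsSymmetric := fun x y => hf x y
  refine ⟨(hsym.eigenvectorBasis rfl).toBasis, hsym.eigenvalues rfl, fun i j => ?_, fun i => ?_⟩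
  · have := orthonormal_iff_ite.1 (hsym.eigenvectorBasis rfl).orthonormal i j
    simp only [OrthonormalBasis.coe_toBasis]
    exact this
  · simp

theorem exists_onb {h : LinearMap.BilinForm ℝ V} (hh : IsInner h) :
    ∃ e : Module.Basis (Fin (Module.finrank ℝ V)) ℝ V, IsONB h e :=
  let ⟨e, _, he, _⟩ := exists_eigenbasis hh 0 (by simp)
  ⟨e, he⟩

/-- The operator representing a bilinear form `T` with respect to an inner product `h`. -/
noncomputable def repOp (h T : LinearMap.BilinForm ℝ V) : V →ₗ[ℝ] V := sharp h ∘ₗ T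

theorem apply_repOp {h : LinearMap.BilinForm ℝ V} (hh : IsInner h) (T : LinearMap.BilinForm ℝ V)
    (x y : V) : h (repOp h T x) y = T x y := apply_sharp hh _ _

theorem exists_diagonal {h : LinearMap.BilinForm ℝ V} (hh : IsInner h)
    {T : LinearMap.BilinForm ℝ V} (hT : ∀ x y, T x y = T y x) :
    ∃ (e : Module.Basis (Fin (Module.finrank ℝ V)) ℝ V) (μ : Fin (Module.finrank ℝ V) → ℝ),
      IsONB h e ∧ ∀ i, repOp h T (e i) = μ i • e i :=
  exists_eigenbasis hh _ fun x y => by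
    rw [apply_repOp hh, hT, ← apply_repOp hh, hh.1]

omit [FiniteDimensional ℝ V] in
theorem IsInner.eq_of_forall {h : LinearMap.BilinForm ℝ V} (hh : IsInner h) {x y : V}
    (hxy : ∀ z, h x z = h y z) : x = y := by
  by_contra hne
  have := hh.2 (x - y) (sub_ne_zero.2 hne)
  simp [hxy] at this

omit [FiniteDimensional ℝ V] in
/-- The spectrum of a symmetric operator is contained in the list of eigenvalues of an
eigenbasis. -/
theorem eigenvalue_mem_range {κ : Type*} {f : V →ₗ[ℝ] V} {e : Module.Basis κ ℝ V} {μ : κ → ℝ}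
    (he : ∀ i, f (e i) = μ i • e i) {x : V} (hx : x ≠ 0) {c : ℝ} (hc : f x = c • x) :
    c ∈ Set.range μ := by
  by_contra hne
  apply hx
  apply e.repr.injective
  ext i
  have hfi : ∀ y, e.repr (f y) i = μ i * e.repr y i := fun y => by
    have : (e.coord i) ∘ₗ f = μ i • e.coord i := by
      refine e.ext fun j => ?_
      by_cases hij : j = i
      · subst hij; simp [he]
      · simp [he, hij]
    simpa using LinearMap.congr_fun this y
  have h1 := hfi x
  rw [hc] at h1
  simp only [map_smul, Finsupp.smul_apply, smul_eq_mul] at h1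
  have h2 : (c - μ i) * e.repr x i = 0 := by linarith
  rcases mul_eq_zero.1 h2 with h3 | h3
  · exact absurd ⟨i, by linarith⟩ hne
  · simpa using h3

end LinAlg

/-! ### The splitting of the Lie algebra into `k` and its orthogonal complement. -/

section Splitting

variable {L : Type*} [LieRing L] [LieAlgebra ℝ L]

/-- The operator `π_p ∘ ad X ∘ π_p`, restricted to the tangent space. -/
noncomputable def adP [FiniteDimensional ℝ L] (k : LieSubalgebra ℝ L) (X : tang k) : tang k →ₗ[ℝ] tang k :=
  projP k ∘ₗ (LieAlgebra.ad ℝ L (X : L)) ∘ₗ (tang k).subtype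

end Splitting

section Splitting

variable {L : Type*} [LieRing L] [LieAlgebra ℝ L] [FiniteDimensional ℝ L]
  {k : LieSubalgebra ℝ L}

theorem killing_symm (x y : L) : killingForm ℝ L x y = killingForm ℝ L y x :=
  LieModule.traceForm_comm ℝ L L x y

theorem killing_lie (x y z : L) : killingForm ℝ L ⁅x, y⁆ z = killingForm ℝ L x ⁅y, z⁆ :=
  LieModule.traceForm_apply_lie_apply ℝ L L x y z

theorem killing_lie' (x y z : L) : killingForm ℝ L ⁅x, y⁆ z = -killingForm ℝ L y ⁅x, z⁆ := by
  rw [← lie_skew, map_neg, LinearMap.neg_apply, killing_lie]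

theorem mem_tang_iff {x : L} : x ∈ tang k ↔ ∀ z ∈ k, killingForm ℝ L z x = 0 := Iff.rfl

theorem killing_pos (hL : IsInner (-(killingForm ℝ L))) {x : L} (hx : x ≠ 0) :
    killingForm ℝ L x x < 0 := by
  have := hL.2 x hx
  simpa using this

theorem killing_self_eq_zero (hL : IsInner (-(killingForm ℝ L))) {x : L}
    (hx : killingForm ℝ L x x = 0) : x = 0 := by
  by_contra hne
  exact (killing_pos hL hne).ne hx

/-- Definiteness passes to the restriction to `k`, which is therefore nondegenerate. Hence `projP`
is the genuine projection and not its default value. -/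
theorem isCompl_tang (hL : IsInner (-(killingForm ℝ L))) : IsCompl (tang k) k.toSubmodule := by
  refine (LinearMap.BilinForm.isCompl_orthogonal_of_restrict_nondegenerate
    (B := killingForm ℝ L) (fun x y h => ?_) ?_).symm
  · rw [killing_symm]; exact h
  · refine ⟨fun x hx => ?_, fun x hx => ?_⟩ <;>
    · have := hx x
      exact Subtype.ext (killing_self_eq_zero hL this)

theorem projP_coe (hL : IsInner (-(killingForm ℝ L))) (X : tang k) : projP k (X : L) = X := by
  rw [projP, dif_pos (isCompl_tang hL)]
  exact Submodule.projectionOnto_apply_left _ _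

theorem projP_of_mem (hL : IsInner (-(killingForm ℝ L))) {z : L} (hz : z ∈ k) : projP k z = 0 := by
  rw [projP, dif_pos (isCompl_tang hL)]
  exact Submodule.projectionOnto_apply_right _ ⟨z, hz⟩

theorem sub_projP_mem (hL : IsInner (-(killingForm ℝ L))) (x : L) : x - (projP k x : L) ∈ k := by
  obtain ⟨y, hy, z, hz, rfl⟩ := Submodule.mem_sup.1
    ((isCompl_tang (k := k) hL).sup_eq_top ▸ Submodule.mem_top : x ∈ tang k ⊔ k.toSubmodule)
  have h1 : projP k y = ⟨y, hy⟩ := projP_coe hL ⟨y, hy⟩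
  rw [map_add, h1, projP_of_mem hL hz]
  simpa using hz

theorem projP_eq (hL : IsInner (-(killingForm ℝ L))) {x y : L} (hy : y ∈ tang k)
    (hxy : x - y ∈ k) : (projP k x : L) = y := by
  have h1 := projP_of_mem hL hxy
  rw [map_sub, projP_coe hL ⟨y, hy⟩, sub_eq_zero] at h1
  rw [h1]

theorem killing_tang_right {z : L} (hz : z ∈ k) (X : tang k) : killingForm ℝ L z X = 0 := X.2 z hz

theorem killing_tang_left {z : L} (hz : z ∈ k) (X : tang k) : killingForm ℝ L X z = 0 := by
  rw [killing_symm, killing_tang_right hz]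

theorem killing_projP (hL : IsInner (-(killingForm ℝ L))) (x : L) (Y : tang k) :
    killingForm ℝ L (projP k x : L) Y = killingForm ℝ L x Y := by
  have h := killing_tang_right (sub_projP_mem (k := k) hL x) Y
  rw [map_sub, LinearMap.sub_apply] at h
  linarith

theorem lie_mem_tang {z : L} (hz : z ∈ k) (X : tang k) : ⁅z, (X : L)⁆ ∈ tang k := by
  intro w hw
  change killingForm ℝ L w ⁅z, (X : L)⁆ = 0
  rw [← killing_lie]
  exact killing_tang_right (k.lie_mem hw hz) X

theorem lie_mem_tang' {z : L} (hz : z ∈ k) (X : tang k) : ⁅(X : L), z⁆ ∈ tang k := by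
  rw [← lie_skew]
  exact (tang k).neg_mem (lie_mem_tang hz X)

theorem stdMetric_apply (X Y : tang k) : stdMetric k X Y = -killingForm ℝ L X Y := rfl

theorem stdMetric_isInner (hL : IsInner (-(killingForm ℝ L))) : IsInner (stdMetric k) := by
  refine ⟨fun X Y => ?_, fun X hX => ?_⟩
  · rw [stdMetric_apply, stdMetric_apply, killing_symm]
  · rw [stdMetric_apply]
    have : (X : L) ≠ 0 := by simpa using hX
    linarith [killing_pos hL this]

theorem adP_apply (X Y : tang k) : adP k X Y = brP k X Y := rfl

theorem brP_skew (X Y : tang k) : brP k X Y = -brP k Y X := by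
  rw [brP, brP, ← lie_skew, map_neg]

theorem brP_add_left (X Y Z : tang k) : brP k (X + Y) Z = brP k X Z + brP k Y Z := by
  simp [brP]

theorem brP_add_right (X Y Z : tang k) : brP k X (Y + Z) = brP k X Y + brP k X Z := by
  simp [brP]

theorem brP_smul_left (c : ℝ) (X Z : tang k) : brP k (c • X) Z = c • brP k X Z := by
  simp [brP]

theorem brP_smul_right (c : ℝ) (X Z : tang k) : brP k X (c • Z) = c • brP k X Z := by
  simp [brP]

theorem brP_self (X : tang k) : brP k X X = 0 := by simp [brP]

theorem brP_zero_left (X : tang k) : brP k 0 X = 0 := by simp [brP]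

theorem stdMetric_brP (hL : IsInner (-(killingForm ℝ L))) (X Y Z : tang k) :
    stdMetric k (brP k X Y) Z = -killingForm ℝ L ⁅(X : L), (Y : L)⁆ Z := by
  rw [stdMetric_apply, brP, killing_projP hL]

/-- Ad-invariance of the Killing form, compressed to `p`: the standard metric is naturally
reductive. -/
theorem stdMetric_brP_skew (hL : IsInner (-(killingForm ℝ L))) (X Y Z : tang k) :
    stdMetric k (brP k X Y) Z = -stdMetric k Y (brP k X Z) := by
  rw [stdMetric_brP hL, (stdMetric_isInner hL).1 Y, stdMetric_brP hL, killing_lie',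
    killing_symm _ (Y : L)]

theorem brK_mem (hL : IsInner (-(killingForm ℝ L))) (X Y : tang k) : brK k X Y ∈ k :=
  sub_projP_mem hL _

theorem brP_add_brK (X Y : tang k) : (brP k X Y : L) + brK k X Y = ⁅(X : L), (Y : L)⁆ := by
  simp [brK]

/-- The trace of an operator on `L` whose composition with the projection to `k` is traceless. -/
theorem trace_projP (f : L →ₗ[ℝ] L) :
    LinearMap.trace ℝ (tang k) (projP k ∘ₗ f ∘ₗ (tang k).subtype) =
      LinearMap.trace ℝ L (((tang k).subtype ∘ₗ projP k) ∘ₗ f) := by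
  rw [← LinearMap.comp_assoc, LinearMap.trace_comp_comm', LinearMap.comp_assoc]

/-- The projection to the tangent space, as an operator on `L`. -/
noncomputable def projL (k : LieSubalgebra ℝ L) : Module.End ℝ L := (tang k).subtype ∘ₗ projP k

theorem projL_apply (x : L) : projL k x = projP k x := rfl

/-- Since `[p, k] ⊆ p`, the operator `ad X` with `X` in `p` has no block from `k` to `k`. -/
theorem compl_ad_compl (hL : IsInner (-(killingForm ℝ L))) (X : tang k) :
    (1 - projL k) * (LieAlgebra.ad ℝ L (X : L)) * (1 - projL k) = 0 := by
  ext x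
  have h1 := lie_mem_tang' (sub_projP_mem (k := k) hL x) X
  have h2 := projP_coe hL ⟨_, h1⟩
  have h3 := congrArg Subtype.val h2
  simp only [Module.End.mul_apply, LinearMap.sub_apply, Module.End.one_apply, projL_apply,
    LinearMap.zero_apply]
  change ⁅(X : L), x - (projP k x : L)⁆ - (projP k ⁅(X : L), x - (projP k x : L)⁆ : L) = 0
  rw [sub_eq_zero]
  exact h3.symm

/-- The trace of the `p`-component of `ad Y` composed with the `k`-component of `ad X`. -/
noncomputable def isoForm (k : LieSubalgebra ℝ L) (X Y : tang k) : ℝ :=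
  LinearMap.trace ℝ L (projL k * (LieAlgebra.ad ℝ L (X : L)) * (1 - projL k) *
    (LieAlgebra.ad ℝ L (Y : L)))

/-- The trace form of `X ↦ adP k X`. -/
noncomputable def trP (k : LieSubalgebra ℝ L) (X Y : tang k) : ℝ :=
  LinearMap.trace ℝ (tang k) (adP k X ∘ₗ adP k Y)

theorem trP_eq (X Y : tang k) : trP k X Y =
    LinearMap.trace ℝ L (projL k * (LieAlgebra.ad ℝ L (X : L)) * projL k *
      (LieAlgebra.ad ℝ L (Y : L))) := by
  have := trace_projP (k := k)
    ((LieAlgebra.ad ℝ L (X : L)) ∘ₗ projL k ∘ₗ (LieAlgebra.ad ℝ L (Y : L)))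
  exact this

theorem trP_symm (X Y : tang k) : trP k X Y = trP k Y X :=
  LinearMap.trace_comp_comm' _ _

theorem trace_transpose_eq {V : Type*} [AddCommGroup V] [Module ℝ V] [FiniteDimensional ℝ V]
    {h : LinearMap.BilinForm ℝ V} (hh : IsInner h) {f g : V →ₗ[ℝ] V}
    (hfg : ∀ x y, h (f x) y = h x (g y)) : LinearMap.trace ℝ V f = LinearMap.trace ℝ V g := by
  obtain ⟨e, he⟩ := exists_onb hh
  rw [trace_eq_sum he, trace_eq_sum he]
  exact Finset.sum_congr rfl fun i _ => by rw [hfg, hh.1]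

theorem killing_projL (hL : IsInner (-(killingForm ℝ L))) (x y : L) :
    killingForm ℝ L (projL k x) y = killingForm ℝ L x (projL k y) := by
  have h1 := killing_tang_left (sub_projP_mem (k := k) hL y) (projP k x)
  have h2 := killing_projP hL x (projP k y)
  rw [map_sub] at h1
  simp only [projL_apply]
  linarith

/-- Transposition with respect to the Killing form reverses the product, fixes the projections and
changes two signs; cyclicity of the trace does the rest. -/
theorem isoForm_symm (hL : IsInner (-(killingForm ℝ L))) (X Y : tang k) :
    isoForm k X Y = isoForm k Y X := by
  have h1 : isoForm k X Y = LinearMap.trace ℝ L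
      ((LieAlgebra.ad ℝ L (Y : L)) * (1 - projL k) *
        (LieAlgebra.ad ℝ L (X : L)) * projL k) := by
    refine trace_transpose_eq hL fun x y => ?_
    simp only [LinearMap.neg_apply, neg_inj, Module.End.mul_apply, LinearMap.sub_apply,
      Module.End.one_apply]
    rw [killing_projL hL]
    change killingForm ℝ L ⁅(X : L), ⁅(Y : L), x⁆ - projL k ⁅(Y : L), x⁆⁆ (projL k y) =
      killingForm ℝ L x ⁅(Y : L), ⁅(X : L), projL k y⁆ - projL k ⁅(X : L), projL k y⁆⁆
    rw [killing_lie', map_sub, LinearMap.sub_apply, killing_projL hL, ← map_sub, killing_lie',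
      neg_neg]
  rw [h1, LinearMap.trace_mul_comm, isoForm]
  simp only [mul_assoc]

/-- Block decomposition of `ad X ad Y`: the `p`-`p` path contributes `trP`, the two paths through
`k` contribute `isoForm` each, and the `k`-`k` path vanishes. This is how the isotropy term is
removed from all curvature formulas. -/
theorem killing_eq_trP_add (hL : IsInner (-(killingForm ℝ L))) (X Y : tang k) :
    killingForm ℝ L X Y = trP k X Y + 2 * isoForm k X Y := by
  have h0 : killingForm ℝ L X Y = LinearMap.trace ℝ L
    ((LieAlgebra.ad ℝ L (X : L)) * (LieAlgebra.ad ℝ L (Y : L))) := rfl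
  set x : Module.End ℝ L := (LieAlgebra.ad ℝ L (X : L))
  set y : Module.End ℝ L := (LieAlgebra.ad ℝ L (Y : L))
  set π := projL k
  have e1 : x * y = π * x * π * y + π * x * (1 - π) * y + (1 - π) * x * π * y
      + (1 - π) * x * (1 - π) * y := by noncomm_ring
  have e2 : LinearMap.trace ℝ L ((1 - π) * x * π * y) = isoForm k X Y := by
    rw [isoForm_symm hL, isoForm, mul_assoc, LinearMap.trace_mul_comm]
    simp only [mul_assoc]
    rfl
  have e3 : (1 - π) * x * (1 - π) = 0 := compl_ad_compl hL X
  have e4 : LinearMap.trace ℝ L (π * x * (1 - π) * y) = isoForm k X Y := rfl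
  have e5 : LinearMap.trace ℝ L (π * x * π * y) = trP k X Y := (trP_eq X Y).symm
  rw [h0, e1, e3, zero_mul, add_zero, map_add, map_add, e2, e4, e5]
  ring

theorem trace_adP (hL : IsInner (-(killingForm ℝ L))) (X : tang k) :
    LinearMap.trace ℝ (tang k) (adP k X) = 0 := by
  obtain ⟨e, he⟩ := exists_onb (stdMetric_isInner (k := k) hL)
  rw [trace_eq_sum he]
  refine Finset.sum_eq_zero fun i _ => ?_
  have h1 := stdMetric_brP_skew hL X (e i) (e i)
  rw [(stdMetric_isInner hL).1 (e i)] at h1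
  rw [adP_apply]
  linarith

theorem trP_eq_sum {h : LinearMap.BilinForm ℝ (tang k)} {ι : Type*} [Fintype ι] [DecidableEq ι]
    {e : Module.Basis ι ℝ (tang k)} (he : IsONB h e) (X Y : tang k) :
    trP k X Y = ∑ i, h (brP k X (brP k Y (e i))) (e i) := by
  rw [trP, trace_eq_sum he]
  rfl

theorem isoForm_eq_sum (h : LinearMap.BilinForm ℝ (tang k)) {ι : Type*} [Fintype ι] [DecidableEq ι]
    {e : Module.Basis ι ℝ (tang k)} (he : IsONB h e) (X Y : tang k) :
    isoForm k X Y = ∑ i, h (projP k ⁅(X : L), brK k Y (e i)⁆) (e i) := by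
  have := trace_projP (k := k)
    ((LieAlgebra.ad ℝ L (X : L)) ∘ₗ (1 - projL k) ∘ₗ
      (LieAlgebra.ad ℝ L (Y : L)))
  rw [trace_eq_sum he] at this
  exact this.symm

end Splitting

/-! ### Curvature of invariant metrics and the Einstein condition. -/

section Curvature

variable {L : Type*} [LieRing L] [LieAlgebra ℝ L] [FiniteDimensional ℝ L]
  {k : LieSubalgebra ℝ L} {h : LinearMap.BilinForm ℝ (tang k)}

theorem koszul_apply (X Y Z : tang k) : koszul k h X Y Z =
    h (brP k X Y) Z - h (brP k Y Z) X - h (brP k X Z) Y := rfl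

theorem apply_nomizu (hh : IsInner h) (X Y Z : tang k) : h (nomizu k h X Y) Z =
    1 / 2 * (h (brP k X Y) Z - h (brP k Y Z) X + h (brP k Z X) Y) := by
  rw [nomizu, map_smul, LinearMap.smul_apply, apply_sharp hh, koszul_apply, brP_skew Z X, map_neg,
    LinearMap.neg_apply, smul_eq_mul]
  ring

theorem nomizu_add_left (hh : IsInner h) (X Y Z : tang k) :
    nomizu k h (X + Y) Z = nomizu k h X Z + nomizu k h Y Z := by
  refine hh.eq_of_forall fun W => ?_
  simp only [map_add, LinearMap.add_apply, apply_nomizu hh, brP_add_left, brP_add_right]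
  ring

theorem nomizu_add_right (hh : IsInner h) (X Y Z : tang k) :
    nomizu k h X (Y + Z) = nomizu k h X Y + nomizu k h X Z := by
  refine hh.eq_of_forall fun W => ?_
  simp only [map_add, LinearMap.add_apply, apply_nomizu hh, brP_add_left, brP_add_right]
  ring

theorem nomizu_smul_left (hh : IsInner h) (c : ℝ) (X Z : tang k) :
    nomizu k h (c • X) Z = c • nomizu k h X Z := by
  refine hh.eq_of_forall fun W => ?_
  simp only [map_smul, LinearMap.smul_apply, apply_nomizu hh, brP_smul_left, brP_smul_right,
    smul_eq_mul]
  ring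

theorem nomizu_smul_right (hh : IsInner h) (c : ℝ) (X Z : tang k) :
    nomizu k h X (c • Z) = c • nomizu k h X Z := by
  refine hh.eq_of_forall fun W => ?_
  simp only [map_smul, LinearMap.smul_apply, apply_nomizu hh, brP_smul_left, brP_smul_right,
    smul_eq_mul]
  ring

theorem brK_add_left (X Y Z : tang k) : brK k (X + Y) Z = brK k X Z + brK k Y Z := by
  simp only [brK, brP_add_left, Submodule.coe_add, add_lie]; abel

theorem brK_add_right (X Y Z : tang k) : brK k X (Y + Z) = brK k X Y + brK k X Z := by
  simp only [brK, brP_add_right, Submodule.coe_add, lie_add]; abel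

theorem brK_smul_left (c : ℝ) (X Z : tang k) : brK k (c • X) Z = c • brK k X Z := by
  simp only [brK, brP_smul_left, Submodule.coe_smul, smul_lie, smul_sub]

theorem brK_smul_right (c : ℝ) (X Z : tang k) : brK k X (c • Z) = c • brK k X Z := by
  simp only [brK, brP_smul_right, Submodule.coe_smul, lie_smul, smul_sub]

theorem brK_skew (X Y : tang k) : brK k X Y = -brK k Y X := by
  rw [brK, brK, brP_skew, ← lie_skew, Submodule.coe_neg]
  abel

theorem curv_add_left (hh : IsInner h) (X X' Y Z : tang k) :
    curv k h (X + X') Y Z = curv k h X Y Z + curv k h X' Y Z := by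
  simp only [curv, nomizu_add_left hh, nomizu_add_right hh, brP_add_left, brK_add_left, add_lie,
    map_add]
  abel

theorem curv_smul_left (hh : IsInner h) (c : ℝ) (X Y Z : tang k) :
    curv k h (c • X) Y Z = c • curv k h X Y Z := by
  simp only [curv, nomizu_smul_left hh, nomizu_smul_right hh, brP_smul_left, brK_smul_left,
    smul_lie, map_smul, smul_sub]

theorem curv_add_mid (hh : IsInner h) (X Y Y' Z : tang k) :
    curv k h X (Y + Y') Z = curv k h X Y Z + curv k h X Y' Z := by
  simp only [curv, nomizu_add_left hh, nomizu_add_right hh, brP_add_right, brK_add_right, add_lie,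
    map_add]
  abel

theorem curv_smul_mid (hh : IsInner h) (c : ℝ) (X Y Z : tang k) :
    curv k h X (c • Y) Z = c • curv k h X Y Z := by
  simp only [curv, nomizu_smul_left hh, nomizu_smul_right hh, brP_smul_right, brK_smul_right,
    smul_lie, map_smul, smul_sub]

theorem curv_add_right (hh : IsInner h) (X Y Z Z' : tang k) :
    curv k h X Y (Z + Z') = curv k h X Y Z + curv k h X Y Z' := by
  simp only [curv, nomizu_add_right hh, Submodule.coe_add, lie_add, map_add]
  abel

theorem curv_smul_right (hh : IsInner h) (c : ℝ) (X Y Z : tang k) :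
    curv k h X Y (c • Z) = c • curv k h X Y Z := by
  simp only [curv, nomizu_smul_right hh, Submodule.coe_smul, lie_smul, map_smul, smul_sub]

variable {ι : Type*} [Fintype ι] [DecidableEq ι] {e : Module.Basis ι ℝ (tang k)}

theorem ric_eq_sum (hh : IsInner h) (he : IsONB h e) (Y Z : tang k) :
    ric k h Y Z = ∑ i, h (curv k h (e i) Y Z) (e i) :=
  contr_eq_sum hh he
    ⟨fun x y z => by simp [curv_add_left hh], fun c x z => by simp [curv_smul_left hh],
      fun x y z => by simp, fun c x z => by simp⟩

theorem scal_eq_sum (hh : IsInner h) (he : IsONB h e) :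
    scal k h = ∑ j, ∑ i, h (curv k h (e i) (e j) (e j)) (e i) := by
  have hb : IsBilin (ric k h) := by
    constructor <;> intros <;>
      simp [ric_eq_sum hh he, curv_add_mid hh, curv_smul_mid hh, curv_add_right hh,
        curv_smul_right hh, Finset.sum_add_distrib, Finset.mul_sum]
  rw [scal, contr_eq_sum hh he hb]
  exact Finset.sum_congr rfl fun j _ => ric_eq_sum hh he _ _

/-- The structure constants of the bracket of the tangent space. -/
noncomputable def strConst (k : LieSubalgebra ℝ L) (h : LinearMap.BilinForm ℝ (tang k)) {ι : Type*}
    (e : Module.Basis ι ℝ (tang k)) (i j l : ι) : ℝ := h (brP k (e i) (e j)) (e l)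

omit [Fintype ι] [DecidableEq ι] in
theorem strConst_skew (i j l : ι) : strConst k h e i j l = -strConst k h e j i l := by
  rw [strConst, strConst, brP_skew, map_neg, LinearMap.neg_apply]

/-- The sum is the trace of `adP k (e i)`, which does not depend on the metric; so skewness for the
standard metric settles it for every `h`. -/
theorem sum_strConst_right (hL : IsInner (-(killingForm ℝ L))) (he : IsONB h e) (i : ι) :
    ∑ j, strConst k h e i j j = 0 := by
  rw [← trace_adP hL (e i), trace_eq_sum he]
  rfl

omit [Fintype ι] [DecidableEq ι] in
theorem apply_nomizu_basis (hh : IsInner h) (i j l : ι) : h (nomizu k h (e i) (e j)) (e l) =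
    1 / 2 * (strConst k h e i j l - strConst k h e j l i + strConst k h e l i j) :=
  apply_nomizu hh _ _ _

theorem apply_nomizu_skew (hh : IsInner h) (X Y Z : tang k) :
    h (nomizu k h X Y) Z = -h Y (nomizu k h X Z) := by
  rw [hh.1 Y, apply_nomizu hh, apply_nomizu hh, brP_skew Z Y, brP_skew X Z, brP_skew Y X]
  simp only [map_neg, LinearMap.neg_apply]
  ring

/-- Unimodularity: Koszul's formula reduces each component to the trace of some `adP`. This
eliminates the term with Λ(e_j)e_j from the scalar curvature. -/
theorem sum_nomizu_self (hL : IsInner (-(killingForm ℝ L))) (hh : IsInner h) (he : IsONB h e) :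
    ∑ j, nomizu k h (e j) (e j) = 0 := by
  refine hh.eq_of_forall fun Z => ?_
  rw [← he.sum_eq Z]
  simp only [map_sum, LinearMap.sum_apply, map_smul, apply_nomizu_basis hh, map_zero,
    LinearMap.zero_apply]
  have hj : ∀ i j, 1 / 2 * (strConst k h e j j i - strConst k h e j i j + strConst k h e i j j) =
      strConst k h e i j j := fun i j => by
    have : strConst k h e j j i = 0 := by simp [strConst, brP_self]
    rw [this, strConst_skew j i j]
    ring
  simp only [hj, Finset.sum_comm (γ := ι), smul_eq_mul, ← Finset.mul_sum, LinearMap.smul_apply,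
    sum_strConst_right hL he, mul_zero, Finset.sum_const_zero]

theorem killing_eq_sum (hL : IsInner (-(killingForm ℝ L))) (he : IsONB h e) (X : tang k) :
    killingForm ℝ L X X = ∑ i, (h (brP k X (brP k X (e i))) (e i) +
      2 * h (projP k ⁅brK k (e i) X, (X : L)⁆) (e i)) := by
  rw [killing_eq_trP_add hL, trP_eq_sum he, isoForm_eq_sum h he, Finset.mul_sum,
    ← Finset.sum_add_distrib]
  refine Finset.sum_congr rfl fun i _ => ?_
  rw [← lie_skew, brK_skew (e i) X, neg_lie]

theorem apply_comp_eq_sum (hh : IsInner h) (he : IsONB h e) (f : tang k →ₗ[ℝ] tang k)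
    (X Y : tang k) : h (f X) Y = ∑ l, h X (e l) * h (f (e l)) Y := by
  conv_lhs => rw [← he.sum_eq X]
  simp [map_sum, LinearMap.sum_apply]

/-- The scalar curvature of an invariant metric in terms of the structure constants of an
orthonormal basis. -/
theorem scal_eq (hL : IsInner (-(killingForm ℝ L))) (hh : IsInner h) (he : IsONB h e) :
    scal k h = -(1 / 2) * ∑ j, killingForm ℝ L (e j) (e j)
      - 1 / 4 * ∑ i, ∑ j, ∑ l, strConst k h e i j l ^ 2 := by
  set c := strConst k h e with hc
  have hskew : ∀ i j l, c i j l = -c j i l := strConst_skew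
  set Λ : ι → ι → ι → ℝ := fun i j l => 1 / 2 * (c i j l - c j l i + c l i j) with hΛ
  have hΛ' : ∀ i j l, h (nomizu k h (e i) (e j)) (e l) = Λ i j l := apply_nomizu_basis hh
  have t1 : ∑ j, ∑ i, h (nomizu k h (e i) (nomizu k h (e j) (e j))) (e i) = 0 := by
    rw [Finset.sum_comm]
    refine Finset.sum_eq_zero fun i _ => ?_
    simp only [apply_nomizu_skew hh (e i)]
    have := congrArg (fun v => -h v (nomizu k h (e i) (e i))) (sum_nomizu_self hL hh he)
    simpa using this
  have t2 : ∀ i j, h (nomizu k h (e j) (nomizu k h (e i) (e j))) (e i) =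
      -∑ l, Λ i j l * Λ j i l := fun i j => by
    rw [apply_nomizu_skew hh, ← he.sum_mul hh.1]
    simp only [hΛ']
  have t3 : ∀ i j, h (nomizu k h (brP k (e i) (e j)) (e j)) (e i) = ∑ l, c i j l * Λ l j i :=
    fun i j => by
    have h1 := he.sum_eq (brP k (e i) (e j))
    have hb : IsBilin (nomizu k h) := ⟨nomizu_add_left hh, nomizu_smul_left hh,
      nomizu_add_right hh, nomizu_smul_right hh⟩
    conv_lhs => rw [← h1, hb.sum_left]
    simp only [map_sum, LinearMap.sum_apply, map_smul, LinearMap.smul_apply, smul_eq_mul, hΛ']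
    rfl
  -- The `k`-part of the bracket is what the Killing form leaves after its `p`-part has been split
  -- off.
  have t4 : ∑ j, ∑ i, h (projP k ⁅brK k (e i) (e j), (e j : L)⁆) (e i) =
      1 / 2 * ∑ j, killingForm ℝ L (e j) (e j) -
        1 / 2 * ∑ j, ∑ i, ∑ l, c j i l * c j l i := by
    rw [Finset.mul_sum, Finset.mul_sum, ← Finset.sum_sub_distrib]
    refine Finset.sum_congr rfl fun j _ => ?_
    rw [killing_eq_sum hL he, Finset.sum_add_distrib, ← Finset.mul_sum]
    have : ∑ i, h (brP k (e j) (brP k (e j) (e i))) (e i) = ∑ i, ∑ l, c j i l * c j l i :=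
      Finset.sum_congr rfl fun i _ => apply_comp_eq_sum hh he (adP k (e j)) _ _
    rw [this]
    ring
  have hsum : scal k h = ∑ j, ∑ i, ∑ l, Λ i j l * Λ j i l - ∑ j, ∑ i, ∑ l, c i j l * Λ l j i -
      ∑ j, ∑ i, h (projP k ⁅brK k (e i) (e j), (e j : L)⁆) (e i) := by
    rw [scal_eq_sum hh he]
    simp only [curv, map_sub, LinearMap.sub_apply, Finset.sum_sub_distrib, t1, t2, t3,
      Finset.sum_neg_distrib]
    ring
  -- Cyclic renaming of indices; it identifies the sums that remain once `key` has expanded the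
  -- connection coefficients.
  have cyc : ∀ F : ι → ι → ι → ℝ, ∑ j, ∑ i, ∑ l, F i j l = ∑ j, ∑ i, ∑ l, F j l i := fun F => by
    rw [Finset.sum_comm]
    refine Finset.sum_congr rfl fun i _ => ?_
    rw [Finset.sum_comm]
  have s1 : ∑ j, ∑ i, ∑ l, c j l i ^ 2 = ∑ j, ∑ i, ∑ l, c i j l ^ 2 :=
    (cyc fun i j l => c i j l ^ 2).symm
  have s2 : ∑ j, ∑ i, ∑ l, c l i j ^ 2 = ∑ j, ∑ i, ∑ l, c j l i ^ 2 :=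
    (cyc fun i j l => c j l i ^ 2).symm
  have s3 : ∑ j, ∑ i, ∑ l, c j l i * c l i j = ∑ j, ∑ i, ∑ l, c i j l * c j l i :=
    (cyc fun i j l => c i j l * c j l i).symm
  have s4 : ∑ j, ∑ i, ∑ l, c l i j * c i j l = ∑ j, ∑ i, ∑ l, c j l i * c l i j :=
    (cyc fun i j l => c j l i * c l i j).symm
  have s5 : ∑ i, ∑ j, ∑ l, c i j l ^ 2 = ∑ j, ∑ i, ∑ l, c i j l ^ 2 := Finset.sum_comm
  have key : ∀ i j l, Λ i j l * Λ j i l - c i j l * Λ l j i + 1 / 2 * (c j i l * c j l i) =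
      1 / 4 * c j l i ^ 2 + 1 / 4 * c l i j ^ 2 - 3 / 4 * c i j l ^ 2 +
        1 / 2 * (c l i j * c i j l) - 1 / 2 * (c j l i * c l i j) := fun i j l => by
    simp only [hΛ]
    rw [hskew j i l, hskew i l j, hskew l j i]
    ring
  have key2 := Finset.sum_congr rfl fun j (_ : j ∈ Finset.univ) =>
    Finset.sum_congr rfl fun i (_ : i ∈ Finset.univ) =>
      Finset.sum_congr rfl fun l (_ : l ∈ Finset.univ) => key i j l
  simp only [Finset.sum_add_distrib, Finset.sum_sub_distrib, ← Finset.mul_sum] at key2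
  rw [hsum, t4, s5]
  linarith

/-- By skewness of the brackets the last two terms of Koszul's formula cancel. -/
theorem nomizu_stdMetric (hL : IsInner (-(killingForm ℝ L))) (X Y : tang k) :
    nomizu k (stdMetric k) X Y = (1 / 2 : ℝ) • brP k X Y := by
  have hg := stdMetric_isInner (k := k) hL
  refine hg.eq_of_forall fun Z => ?_
  rw [apply_nomizu hg, map_smul, LinearMap.smul_apply, smul_eq_mul, brP_skew Y Z, map_neg,
    LinearMap.neg_apply, stdMetric_brP_skew hL Z Y X, hg.1 Y]
  ring

/-- The curvature operator `V ↦ R(V,Y)Z` of the standard metric. -/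
theorem curv_stdMetric (hL : IsInner (-(killingForm ℝ L))) (V Y Z : tang k) :
    curv k (stdMetric k) V Y Z = (-(1 / 4) : ℝ) • adP k (brP k Y Z) V
      + (1 / 4 : ℝ) • adP k Y (adP k Z V) - (1 / 2 : ℝ) • adP k Z (adP k Y V)
      - projP k ⁅(Z : L), brK k Y V⁆ := by
  simp only [curv, nomizu_stdMetric hL, adP_apply, brP_smul_left, brP_smul_right]
  rw [brP_skew V (brP k Y Z), brP_skew V Z, brP_skew V Y, brK_skew V Y, neg_lie, lie_skew]
  have h1 : brP k Y (-brP k Z V) = -brP k Y (brP k Z V) := by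
    rw [← neg_one_smul ℝ, brP_smul_right, neg_one_smul]
  have h2 : brP k (-brP k Y V) Z = brP k Z (brP k Y V) := by
    rw [brP_skew, ← neg_one_smul ℝ (brP k Y V), brP_smul_right, neg_one_smul, neg_neg]
  rw [h1, h2]
  module

/-- Trace of `curv_stdMetric`: the first term is traceless, the two middle ones give `trP` with
total coefficient -1/4, and the last gives `-isoForm`, which `killing_eq_trP_add` replaces by (`trP`
- B)/2. -/
theorem ric_stdMetric (hL : IsInner (-(killingForm ℝ L))) (Y Z : tang k) :
    ric k (stdMetric k) Y Z = -(1 / 2) * killingForm ℝ L Y Z + 1 / 4 * trP k Y Z := by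
  have hg := stdMetric_isInner (k := k) hL
  obtain ⟨e, he⟩ := exists_onb hg
  rw [ric_eq_sum hg he]
  simp only [curv_stdMetric hL, map_add, map_sub, map_smul, LinearMap.add_apply,
    LinearMap.sub_apply, LinearMap.smul_apply, smul_eq_mul, Finset.sum_add_distrib,
    Finset.sum_sub_distrib, ← Finset.mul_sum]
  rw [← trace_eq_sum he, trace_adP hL, ← isoForm_eq_sum _ he]
  have h1 : ∑ i, stdMetric k (adP k Y (adP k Z (e i))) (e i) = trP k Y Z := (trP_eq_sum he Y Z).symm
  have h2 : ∑ i, stdMetric k (adP k Z (adP k Y (e i))) (e i) = trP k Z Y := (trP_eq_sum he Z Y).symm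
  rw [h1, h2, killing_eq_trP_add hL, trP_symm Z Y, isoForm_symm hL Z Y]
  ring

/-- The standard metric is Einstein if and only if the trace form of the tangent space is
proportional to the Killing form. -/
theorem isEinstein_iff (hL : IsInner (-(killingForm ℝ L))) (ρ : ℝ) :
    IsEinstein k (stdMetric k) ρ ↔
      ∀ Y Z : tang k, trP k Y Z = (2 - 4 * ρ) * killingForm ℝ L Y Z := by
  refine forall₂_congr fun Y Z => ?_
  rw [ric_stdMetric hL, stdMetric_apply]
  constructor <;> intro h <;> linarith

end Curvature

/-! ### The Lichnerowicz Laplacian of an Einstein standard metric. -/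

section Lichnerowicz

variable {L : Type*} [LieRing L] [LieAlgebra ℝ L] [FiniteDimensional ℝ L]
  {k : LieSubalgebra ℝ L} {T : LinearMap.BilinForm ℝ (tang k)}
  {ι : Type*} [Fintype ι] [DecidableEq ι] {e : Module.Basis ι ℝ (tang k)}

/-- Invariance of a bilinear form on the tangent space under `ad z`, `z ∈ k`. -/
def IsAdInvariant (k : LieSubalgebra ℝ L) (T : LinearMap.BilinForm ℝ (tang k)) : Prop :=
  ∀ z ∈ k, ∀ X Y : tang k, T (projP k ⁅z, (X : L)⁆) Y + T X (projP k ⁅z, (Y : L)⁆) = 0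

theorem isAdInvariant_stdMetric (hL : IsInner (-(killingForm ℝ L))) :
    IsAdInvariant k (stdMetric k) := by
  intro z _ X Y
  have hg := stdMetric_isInner (k := k) hL
  rw [hg.1 X, stdMetric_apply, stdMetric_apply, killing_projP hL, killing_projP hL, killing_lie',
    killing_symm (X : L)]
  ring

theorem stdMetric_adP_skew (hL : IsInner (-(killingForm ℝ L))) (X Y Z : tang k) :
    stdMetric k (adP k X Y) Z = -stdMetric k Y (adP k X Z) := stdMetric_brP_skew hL X Y Z

omit [Fintype ι] [DecidableEq ι] in
theorem strConst_skew_right (hL : IsInner (-(killingForm ℝ L))) (i j l : ι) :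
    strConst k (stdMetric k) e i j l = -strConst k (stdMetric k) e i l j := by
  rw [strConst, strConst, stdMetric_brP_skew hL, (stdMetric_isInner hL).1]

omit [Fintype ι] [DecidableEq ι] in
theorem strConst_sq_left (i j l : ι) :
    strConst k (stdMetric k) e i j l ^ 2 = strConst k (stdMetric k) e j i l ^ 2 := by
  rw [strConst_skew, neg_sq]

omit [Fintype ι] [DecidableEq ι] in
theorem strConst_sq_right (hL : IsInner (-(killingForm ℝ L))) (i j l : ι) :
    strConst k (stdMetric k) e i j l ^ 2 = strConst k (stdMetric k) e i l j ^ 2 := by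
  rw [strConst_skew_right hL, neg_sq]

theorem sum_adP_sq (hL : IsInner (-(killingForm ℝ L))) (he : IsONB (stdMetric k) e) (X Y : tang k) :
    ∑ i, stdMetric k (adP k X (e i)) (adP k Y (e i)) = -trP k X Y := by
  rw [trP_symm, trP_eq_sum he, ← Finset.sum_neg_distrib]
  refine Finset.sum_congr rfl fun i _ => ?_
  rw [stdMetric_brP_skew hL, neg_neg]
  rfl

/-- The form in which the Einstein condition is used: the double sum is the squared norm of `adP k
(e i)`, that is, -`trP` at `e i`. With total skewness, the squared structure constants are symmetric
weights with constant marginals. -/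
theorem sum_strConst_sq (hL : IsInner (-(killingForm ℝ L))) {ρ : ℝ}
    (hρ : IsEinstein k (stdMetric k) ρ) (he : IsONB (stdMetric k) e) (i : ι) :
    ∑ j, ∑ l, strConst k (stdMetric k) e i j l ^ 2 = 2 - 4 * ρ := by
  have h1 := sum_adP_sq hL he (e i) (e i)
  have h2 : -killingForm ℝ L (e i) (e i) = 1 := (he i i).trans (if_pos rfl)
  rw [(isEinstein_iff hL ρ).1 hρ] at h1
  have h3 : ∀ j, ∑ l, strConst k (stdMetric k) e i j l ^ 2 =
      stdMetric k (adP k (e i) (e j)) (adP k (e i) (e j)) := fun j => by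
    rw [← he.sum_mul (stdMetric_isInner hL).1]
    exact Finset.sum_congr rfl fun l _ => sq _
  simp only [h3, h1]
  linear_combination (2 - 4 * ρ) * h2

theorem sum_brP_brP (hL : IsInner (-(killingForm ℝ L))) {ρ : ℝ}
    (hρ : IsEinstein k (stdMetric k) ρ) (he : IsONB (stdMetric k) e) (Y : tang k) :
    ∑ i, brP k (e i) (brP k (e i) Y) = -(2 - 4 * ρ) • Y := by
  have hg := stdMetric_isInner (k := k) hL
  refine hg.eq_of_forall fun Z => ?_
  have h1 := sum_adP_sq hL he Y Z
  rw [(isEinstein_iff hL ρ).1 hρ] at h1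
  simp only [map_sum, LinearMap.sum_apply, map_smul, LinearMap.smul_apply, smul_eq_mul]
  have h2 : ∀ i, stdMetric k (brP k (e i) (brP k (e i) Y)) Z =
      -stdMetric k (adP k Y (e i)) (adP k Z (e i)) := fun i => by
    rw [stdMetric_brP_skew hL, adP_apply, adP_apply, brP_skew Y, brP_skew Z]
    simp
  simp only [h2, Finset.sum_neg_distrib, h1]
  rw [stdMetric_apply]
  ring

theorem repOp_symm (hL : IsInner (-(killingForm ℝ L))) (hT : ∀ X Y, T X Y = T Y X) (X Y : tang k) :
    stdMetric k (repOp (stdMetric k) T X) Y = stdMetric k X (repOp (stdMetric k) T Y) := by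
  have hg := stdMetric_isInner (k := k) hL
  rw [apply_repOp hg, hT, ← apply_repOp hg, hg.1]

theorem sum_apply_eq_trace (hL : IsInner (-(killingForm ℝ L))) (he : IsONB (stdMetric k) e)
    (f : tang k →ₗ[ℝ] tang k) :
    ∑ i, T (f (e i)) (e i) = LinearMap.trace ℝ (tang k) (repOp (stdMetric k) T * f) := by
  rw [trace_eq_sum he]
  exact Finset.sum_congr rfl fun i _ => (apply_repOp (stdMetric_isInner hL) T _ _).symm

/-- A symmetric operator times a skew one equals, after transposition, minus the product in the
other order. -/
theorem trace_repOp_adP (hL : IsInner (-(killingForm ℝ L))) (hT : ∀ X Y, T X Y = T Y X)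
    (X : tang k) : LinearMap.trace ℝ (tang k) (repOp (stdMetric k) T * adP k X) = 0 := by
  have h1 : LinearMap.trace ℝ (tang k) (repOp (stdMetric k) T * adP k X) =
      LinearMap.trace ℝ (tang k) (-(adP k X * repOp (stdMetric k) T)) := by
    refine trace_transpose_eq (stdMetric_isInner hL) fun x y => ?_
    simp only [Module.End.mul_apply, LinearMap.neg_apply, map_neg]
    rw [repOp_symm hL hT, stdMetric_adP_skew hL]
  rw [map_neg, LinearMap.trace_mul_comm] at h1
  rw [LinearMap.trace_mul_comm]
  linarith

/-- The quadratic form `(Y, Z) ↦ tr(T ad_p Y ad_p Z)` of a bilinear form `T`. -/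
noncomputable def twist (k : LieSubalgebra ℝ L) (T : LinearMap.BilinForm ℝ (tang k))
    (Y Z : tang k) : ℝ :=
  LinearMap.trace ℝ (tang k) (repOp (stdMetric k) T * (adP k Y * adP k Z))

theorem twist_symm (hL : IsInner (-(killingForm ℝ L))) (hT : ∀ X Y, T X Y = T Y X) (Y Z : tang k) :
    twist k T Y Z = twist k T Z Y := by
  have h1 : twist k T Y Z =
      LinearMap.trace ℝ (tang k) (adP k Z * adP k Y * repOp (stdMetric k) T) := by
    refine trace_transpose_eq (stdMetric_isInner hL) fun x y => ?_
    simp only [Module.End.mul_apply]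
    rw [repOp_symm hL hT, stdMetric_adP_skew hL, stdMetric_adP_skew hL, neg_neg]
  rw [h1, LinearMap.trace_mul_comm]
  rfl

theorem sum_brP_brP_apply (hL : IsInner (-(killingForm ℝ L)))
    (he : IsONB (stdMetric k) e) (Y Z : tang k) :
    ∑ i, T (brP k (e i) Y) (brP k (e i) Z) = -twist k T Y Z := by
  have hg := stdMetric_isInner (k := k) hL
  have h1 : twist k T Y Z =
      LinearMap.trace ℝ (tang k) (adP k Z * (repOp (stdMetric k) T * adP k Y)) := by
    rw [twist, LinearMap.trace_mul_comm _ (adP k Z), mul_assoc]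
  rw [h1, trace_eq_sum he, ← Finset.sum_neg_distrib]
  refine Finset.sum_congr rfl fun i _ => ?_
  simp only [Module.End.mul_apply]
  rw [stdMetric_adP_skew hL, neg_neg, apply_repOp hg, adP_apply, adP_apply, brP_skew Y, brP_skew Z]
  simp

/-- The curvature term of the Lichnerowicz Laplacian. Its isotropy part becomes `isoForm` at the
operator of `T` applied to `Z`, which the Einstein condition turns into a multiple of `T` itself. -/
theorem sum_curv_apply (hL : IsInner (-(killingForm ℝ L))) {ρ : ℝ}
    (hρ : IsEinstein k (stdMetric k) ρ) (hT : ∀ X Y, T X Y = T Y X) (hTk : IsAdInvariant k T)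
    (he : IsONB (stdMetric k) e) (Y Z : tang k) :
    ∑ i, T (curv k (stdMetric k) (e i) Y Z) (e i) =
      -(1 / 4) * twist k T Y Z + (2 * ρ - 1 / 2) * T Y Z := by
  have hg := stdMetric_isInner (k := k) hL
  -- The operator of `T` commutes with `ad w` for `w` in `k`, so it can be moved onto `Z` inside the
  -- bracket.
  have h1 : ∀ w ∈ k, ∀ X, T (projP k ⁅(Z : L), w⁆) X =
      stdMetric k (projP k ⁅(repOp (stdMetric k) T Z : L), w⁆) X := fun w hw X => by
    have e1 := hTk w hw Z X
    have e2 := isAdInvariant_stdMetric hL w hw (repOp (stdMetric k) T Z) X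
    rw [← apply_repOp hg T Z] at e1
    rw [← lie_skew, map_neg, map_neg, LinearMap.neg_apply,
      ← lie_skew (repOp (stdMetric k) T Z : L), map_neg, map_neg, LinearMap.neg_apply]
    linarith
  simp only [curv_stdMetric hL, map_add, map_sub, map_smul, LinearMap.add_apply,
    LinearMap.sub_apply, LinearMap.smul_apply, smul_eq_mul, Finset.sum_add_distrib,
    Finset.sum_sub_distrib, ← Finset.mul_sum, h1 _ (brK_mem hL _ _)]
  rw [sum_apply_eq_trace hL he, trace_repOp_adP hL hT]
  have h2 : ∀ Y Z, ∑ i, T (adP k Y (adP k Z (e i))) (e i) = twist k T Y Z := fun Y Z =>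
    sum_apply_eq_trace hL he (adP k Y * adP k Z)
  have h3 := killing_eq_trP_add hL (repOp (stdMetric k) T Z) Y
  rw [(isEinstein_iff hL ρ).1 hρ] at h3
  have h4 : killingForm ℝ L (repOp (stdMetric k) T Z) Y = - T Y Z := by
    rw [hT, ← apply_repOp hg T Z Y, stdMetric_apply, neg_neg]
  rw [h2, h2, ← isoForm_eq_sum _ he, twist_symm hL hT Z Y]
  rw [h4] at h3
  linarith

theorem covD_stdMetric (hL : IsInner (-(killingForm ℝ L))) (X Y Z : tang k) :
    covD k (stdMetric k) (fun Y Z => T Y Z) X Y Z =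
      -(1 / 2) * (T (brP k X Y) Z + T Y (brP k X Z)) := by
  simp only [covD, nomizu_stdMetric hL, map_smul, LinearMap.smul_apply, smul_eq_mul]
  ring

theorem covD2_stdMetric (hL : IsInner (-(killingForm ℝ L))) (V X Y Z : tang k) :
    covD2 k (stdMetric k) (fun Y Z => T Y Z) V X Y Z =
      1 / 4 * (T (brP k X (brP k V Y)) Z + T (brP k V Y) (brP k X Z) + T (brP k X Y) (brP k V Z)
        + T Y (brP k X (brP k V Z))
        + T (brP k (brP k V X) Y) Z + T Y (brP k (brP k V X) Z)) := by
  simp only [covD2, covD, nomizu_stdMetric hL, map_smul, LinearMap.smul_apply, smul_eq_mul,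
    brP_smul_left, brP_smul_right]
  ring

/-- The Lichnerowicz Laplacian of an Einstein standard metric. -/
theorem lich_stdMetric (hL : IsInner (-(killingForm ℝ L))) {ρ : ℝ}
    (hρ : IsEinstein k (stdMetric k) ρ) (hT : ∀ X Y, T X Y = T Y X) (hTk : IsAdInvariant k T)
    (Y Z : tang k) :
    lich k (stdMetric k) (fun Y Z => T Y Z) Y Z = (2 - 4 * ρ) * T Y Z + twist k T Y Z := by
  have hg := stdMetric_isInner (k := k) hL
  obtain ⟨e, he⟩ := exists_onb hg
  have h1 : contr (stdMetric k) (fun V W => covD2 k (stdMetric k) (fun Y Z => T Y Z) V W Y Z) =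
      -(1 / 2) * ((2 - 4 * ρ) * T Y Z + twist k T Y Z) := by
    rw [contr_eq_sum hg he]
    · simp only [covD2_stdMetric hL, brP_self, brP_zero_left, map_zero, LinearMap.zero_apply,
        add_zero, ← Finset.mul_sum, Finset.sum_add_distrib]
      have e1 : ∑ i, T (brP k (e i) (brP k (e i) Y)) Z = -(2 - 4 * ρ) * T Y Z := by
        have := congrArg (fun v => T v Z) (sum_brP_brP hL hρ he Y)
        simpa [map_sum, LinearMap.sum_apply] using this
      have e2 : ∑ i, T Y (brP k (e i) (brP k (e i) Z)) = -(2 - 4 * ρ) * T Y Z := by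
        have := congrArg (fun v => T Y v) (sum_brP_brP hL hρ he Z)
        simpa [map_sum, LinearMap.sum_apply] using this
      rw [e1, e2, sum_brP_brP_apply hL he]
      ring
    · constructor <;> intros <;>
        simp only [covD2_stdMetric hL, brP_add_left, brP_add_right, brP_smul_left, brP_smul_right,
          map_add, map_smul, LinearMap.add_apply, LinearMap.smul_apply, smul_eq_mul] <;> ring
  have h2 : ∀ Y Z, contr (stdMetric k) (fun V W => ric k (stdMetric k) Y V * T W Z) =
      ρ * T Y Z := fun Y Z => by
    simp only [show ∀ X Y, ric k (stdMetric k) X Y = ρ * stdMetric k X Y from hρ]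
    rw [contr_eq_sum hg he]
    · conv_rhs => rw [← he.sum_eq Y]
      simp [map_sum, LinearMap.sum_apply, Finset.mul_sum, mul_assoc]
    · constructor <;> intros <;> simp <;> ring
  have h3 : ∀ Y Z, contr (stdMetric k) (fun V W => ric k (stdMetric k) Z V * T Y W) =
      ρ * T Y Z := fun Y Z => by
    simpa only [hT] using h2 Z Y
  have h4 : contr (stdMetric k) (fun V W => T (curv k (stdMetric k) V Y Z) W) =
      -(1 / 4) * twist k T Y Z + (2 * ρ - 1 / 2) * T Y Z := by
    rw [contr_eq_sum hg he, sum_curv_apply hL hρ hT hTk he]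
    constructor <;> intros <;> simp [curv_add_left hg, curv_smul_left hg]
  simp only [lich]
  rw [h1, h2, h3, h4]
  ring

/-- The divergence in direction `X` is half the trace of the operator of `T` times `adP k X`, a
symmetric times a skew operator. -/
theorem divergence_eq_zero (hL : IsInner (-(killingForm ℝ L))) (hT : ∀ X Y, T X Y = T Y X)
    (X : tang k) : contr (stdMetric k)
      (fun V W => covD k (stdMetric k) (fun Y Z => T Y Z) V W X) = 0 := by
  have hg := stdMetric_isInner (k := k) hL
  obtain ⟨e, he⟩ := exists_onb hg
  rw [contr_eq_sum hg he]
  · simp only [covD_stdMetric hL, brP_self, map_zero, LinearMap.zero_apply, zero_add,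
      ← Finset.mul_sum]
    have h1 : ∀ i, T (e i) (brP k (e i) X) = -T (adP k X (e i)) (e i) := fun i => by
      rw [brP_skew, map_neg, hT]; rfl
    simp only [h1, Finset.sum_neg_distrib]
    rw [sum_apply_eq_trace hL he, trace_repOp_adP hL hT]
    simp
  · constructor <;> intros <;>
      simp only [covD_stdMetric hL, brP_add_left, brP_add_right, brP_smul_left, brP_smul_right,
          map_add, map_smul, LinearMap.add_apply, LinearMap.smul_apply, smul_eq_mul] <;> ring

theorem contr_stdMetric (hL : IsInner (-(killingForm ℝ L))) :
    contr (stdMetric k) (fun X Y => T X Y) =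
      LinearMap.trace ℝ (tang k) (repOp (stdMetric k) T) := by
  have hg := stdMetric_isInner (k := k) hL
  obtain ⟨e, he⟩ := exists_onb hg
  rw [contr_eq_sum hg he, trace_eq_sum he]
  · exact Finset.sum_congr rfl fun i _ => (apply_repOp hg T _ _).symm
  · constructor <;> intros <;> simp

theorem isTT_iff (hL : IsInner (-(killingForm ℝ L))) {S : Set (L →ₗ[ℝ] L)} :
    IsTT k S T ↔ (∀ X Y, T X Y = T Y X) ∧ IsInvariant k S T ∧
      LinearMap.trace ℝ (tang k) (repOp (stdMetric k) T) = 0 := by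
  rw [IsTT, contr_stdMetric hL]
  exact ⟨fun h => ⟨h.1, h.2.1, h.2.2.1⟩, fun h => ⟨h.1, h.2.1, h.2.2, divergence_eq_zero hL h.1⟩⟩

variable {a : ι → ℝ}

omit [DecidableEq ι] in
theorem trace_eq_sum_of_eigen (f : tang k →ₗ[ℝ] tang k) (ha : ∀ i, f (e i) = a i • e i) :
    LinearMap.trace ℝ (tang k) f = ∑ i, a i := by
  classical
  rw [LinearMap.trace_eq_matrix_trace ℝ e, Matrix.trace]
  simp [LinearMap.toMatrix_apply, ha]

/-- Moving `T` and one factor `adP` across the metric turns the diagonal entries of the trace into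
squared norms weighted by the eigenvalues of `T`. -/
theorem twist_basis (hL : IsInner (-(killingForm ℝ L))) (hT : ∀ X Y, T X Y = T Y X)
    (he : IsONB (stdMetric k) e)
    (ha : ∀ i, repOp (stdMetric k) T (e i) = a i • e i) (i : ι) :
    twist k T (e i) (e i) = -∑ j, ∑ l, a j * strConst k (stdMetric k) e i j l ^ 2 := by
  have hg := stdMetric_isInner (k := k) hL
  rw [twist, trace_eq_sum he, ← Finset.sum_neg_distrib]
  refine Finset.sum_congr rfl fun j _ => ?_
  rw [Module.End.mul_apply, repOp_symm hL hT, ha, map_smul, smul_eq_mul, Module.End.mul_apply,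
    stdMetric_adP_skew hL, ← he.sum_mul hg.1, mul_neg, Finset.mul_sum]
  refine congrArg _ (Finset.sum_congr rfl fun l _ => ?_)
  rw [strConst, sq]
  rfl

end Lichnerowicz

/-! ### Rayleigh quotients and extremal eigenvalues of the Casimir operator. -/

theorem rayleigh {V ι : Type*} [AddCommGroup V] [Module ℝ V] [Fintype ι] [DecidableEq ι]
    {h : LinearMap.BilinForm ℝ V} (hh : IsInner h) {f : V →ₗ[ℝ] V} {e : Module.Basis ι ℝ V}
    (he : IsONB h e) {μ : ι → ℝ} (hμ : ∀ i, f (e i) = μ i • e i) (x : V) :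
    h (f x) x = ∑ i, μ i * h x (e i) ^ 2 := by
  have hx : f x = ∑ i, h x (e i) • μ i • e i := by
    conv_lhs => rw [← he.sum_eq x]
    simp only [map_sum, map_smul, hμ]
  simp only [hx, map_sum, LinearMap.sum_apply, map_smul, LinearMap.smul_apply, smul_eq_mul]
  refine Finset.sum_congr rfl fun i _ => ?_
  rw [hh.1 (e i)]
  ring

/-- In an orthonormal basis the trace of `D * D` is the sum of the squared norms of the `D (e i)`.
It makes the trace form an inner product on symmetric operators. -/
theorem trace_sq_pos {V : Type*} [AddCommGroup V] [Module ℝ V] [FiniteDimensional ℝ V]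
    {h : LinearMap.BilinForm ℝ V} (hh : IsInner h) {D : Module.End ℝ V}
    (hD : ∀ x y, h (D x) y = h x (D y)) (hD0 : D ≠ 0) : 0 < LinearMap.trace ℝ V (D * D) := by
  obtain ⟨e, he⟩ := exists_onb hh
  rw [trace_eq_sum he]
  simp only [Module.End.mul_apply, hD]
  have hnn : ∀ x, 0 ≤ h x x := fun x => by
    rcases eq_or_ne x 0 with rfl | hx
    · simp
    · exact (hh.2 x hx).le
  obtain ⟨i, hi⟩ : ∃ i, D (e i) ≠ 0 := by
    by_contra! hne
    exact hD0 (e.ext fun i => by simp [hne i])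
  refine Finset.sum_pos' (fun i _ => ?_) ⟨i, Finset.mem_univ _, ?_⟩
  · rw [← hD]; exact hnn _
  · rw [← hD]; exact hh.2 _ hi

section CasimirBound

variable {L : Type*} [LieRing L] [LieAlgebra ℝ L] [FiniteDimensional ℝ L]
  {ι : Type*} [Fintype ι] [DecidableEq ι] {e : Module.Basis ι ℝ L}

theorem casTau_eq_sum (hL : IsInner (-(killingForm ℝ L))) (he : IsONB (-(killingForm ℝ L)) e)
    (A : Module.End ℝ L) : casTau L A = -∑ i, tau L (e i) (tau L (e i) A) := by
  rw [casTau, contr_eq_sum hL he]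
  constructor <;> intros <;>
    simp only [tau, map_add, map_smul, add_mul, mul_add, smul_mul_assoc, mul_smul_comm, mul_sub,
      sub_mul, smul_sub] <;> abel

variable (L) in
/-- The traceless endomorphisms that are symmetric with respect to the Killing form. -/
noncomputable def symTraceless : Submodule ℝ (Module.End ℝ L) where
  carrier := {A | (∀ X Y, killingForm ℝ L (A X) Y = killingForm ℝ L X (A Y)) ∧
    LinearMap.trace ℝ L A = 0}
  zero_mem' := by simp
  add_mem' := by
    rintro A C ⟨hA, hA'⟩ ⟨hC, hC'⟩
    exact ⟨fun X Y => by simp [hA, hC], by simp [hA', hC']⟩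
  smul_mem' := by
    rintro c A ⟨hA, hA'⟩
    exact ⟨fun X Y => by simp [hA], by simp [hA']⟩

theorem trace_tau (X : L) (A : Module.End ℝ L) : LinearMap.trace ℝ L (tau L X A) = 0 := by
  rw [tau, map_sub, LinearMap.trace_mul_comm, sub_self]

theorem tau_symm {A : Module.End ℝ L} (X : L)
    (hA : ∀ X Y, killingForm ℝ L (A X) Y = killingForm ℝ L X (A Y)) (Y Z : L) :
    killingForm ℝ L (tau L X A Y) Z = killingForm ℝ L Y (tau L X A Z) := by
  simp only [tau, LinearMap.sub_apply, Module.End.mul_apply, LieAlgebra.ad_apply, map_sub]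
  rw [killing_lie', hA, hA, killing_lie' X Y]
  ring

/-- `tau` acts by commutators, hence is skew for the trace form by cyclicity; being minus a sum of
squares of such operators, the Casimir operator is symmetric. -/
theorem trace_mul_tau (X : L) (A C : Module.End ℝ L) :
    LinearMap.trace ℝ L (tau L X A * C) = -LinearMap.trace ℝ L (A * tau L X C) := by
  simp only [tau, sub_mul, mul_sub, map_sub]
  rw [mul_assoc, LinearMap.trace_mul_comm ℝ _ (A * C)]
  simp only [mul_assoc]
  ring

theorem casTau_mem (hL : IsInner (-(killingForm ℝ L))) {A : Module.End ℝ L}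
    (hA : A ∈ symTraceless L) : casTau L A ∈ symTraceless L := by
  obtain ⟨e, he⟩ := exists_onb hL
  rw [casTau_eq_sum hL he]
  refine (symTraceless L).neg_mem ((symTraceless L).sum_mem fun i _ => ?_)
  exact ⟨tau_symm _ (tau_symm _ hA.1), trace_tau _ _⟩

/-- The Casimir operator on the space of traceless symmetric endomorphisms. -/
noncomputable def casOp (hL : IsInner (-(killingForm ℝ L))) : symTraceless L →ₗ[ℝ] symTraceless L where
  toFun A := ⟨casTau L A, casTau_mem hL A.2⟩
  map_add' A C := by
    obtain ⟨e, he⟩ := exists_onb hL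
    ext1
    simp only [casTau_eq_sum hL he, Submodule.coe_add, tau, mul_add, add_mul, mul_sub, sub_mul]
    rw [← neg_add, ← Finset.sum_add_distrib]
    refine congrArg _ (Finset.sum_congr rfl fun i _ => ?_)
    abel
  map_smul' c A := by
    obtain ⟨e, he⟩ := exists_onb hL
    ext1
    simp only [casTau_eq_sum hL he, Submodule.coe_smul, tau, mul_smul_comm, smul_mul_assoc,
      mul_sub, sub_mul, RingHom.id_apply, smul_neg, Finset.smul_sum, smul_sub]

variable (L) in
/-- The trace form on traceless symmetric endomorphisms. -/
noncomputable def symForm : LinearMap.BilinForm ℝ (symTraceless L) :=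
  LinearMap.mk₂ ℝ (fun A C => LinearMap.trace ℝ L ((A : Module.End ℝ L) * (C : Module.End ℝ L)))
    (by intros; simp [add_mul]) (by intros; simp) (by intros; simp [mul_add]) (by intros; simp)

theorem symForm_apply (A C : symTraceless L) :
    symForm L A C = LinearMap.trace ℝ L ((A : Module.End ℝ L) * (C : Module.End ℝ L)) := rfl

theorem symForm_isInner (hL : IsInner (-(killingForm ℝ L))) : IsInner (symForm L) := by
  refine ⟨fun A C => by rw [symForm_apply, symForm_apply, LinearMap.trace_mul_comm], fun A hA => ?_⟩
  exact trace_sq_pos hL (fun x y => by simp [A.2.1]) fun h => hA (Subtype.ext h)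

theorem casOp_symm (hL : IsInner (-(killingForm ℝ L))) (A C : symTraceless L) :
    symForm L (casOp hL A) C = symForm L A (casOp hL C) := by
  obtain ⟨e, he⟩ := exists_onb hL
  rw [symForm_apply, symForm_apply]
  change LinearMap.trace ℝ L (casTau L A * (C : Module.End ℝ L)) =
    LinearMap.trace ℝ L ((A : Module.End ℝ L) * casTau L C)
  rw [casTau_eq_sum hL he, casTau_eq_sum hL he, neg_mul, mul_neg, map_neg, map_neg,
    Finset.sum_mul, Finset.mul_sum, map_sum, map_sum]
  refine congrArg _ (Finset.sum_congr rfl fun i _ => ?_)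
  rw [trace_mul_tau, trace_mul_tau, neg_neg]

/-- Bounds for the Casimir operator by its extremal eigenvalues. -/
theorem casTau_bounds (hL : IsInner (-(killingForm ℝ L))) {A : Module.End ℝ L}
    (hA : A ∈ symTraceless L) :
    lamTau L * LinearMap.trace ℝ L (A * A) ≤ LinearMap.trace ℝ L (casTau L A * A) ∧
    LinearMap.trace ℝ L (casTau L A * A) ≤ lamTauMax L * LinearMap.trace ℝ L (A * A) := by
  have hi := symForm_isInner hL
  obtain ⟨e, μ, he, hμ⟩ := exists_eigenbasis hi (casOp hL) (casOp_symm hL)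
  -- Finiteness of the spectrum makes it bounded, so that `sInf` and `sSup` bound the eigenvalues.
  have hfin : (casSpec L).Finite := by
    refine (Set.finite_range μ).subset ?_
    rintro c ⟨C, hC0, hC1, hC2, hC⟩
    exact eigenvalue_mem_range (x := (⟨C, hC1, hC2⟩ : symTraceless L)) hμ
      (fun h => hC0 (congrArg Subtype.val h)) (Subtype.ext hC)
  have hmem : ∀ i, μ i ∈ casSpec L := fun i =>
    ⟨e i, fun h => e.ne_zero i (Subtype.ext h), (e i).2.1, (e i).2.2,
      congrArg Subtype.val (hμ i)⟩
  have h1 : LinearMap.trace ℝ L (casTau L A * A) = ∑ i, μ i * symForm L ⟨A, hA⟩ (e i) ^ 2 :=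
    rayleigh hi he hμ ⟨A, hA⟩
  have h2 : LinearMap.trace ℝ L (A * A) = ∑ i, symForm L ⟨A, hA⟩ (e i) ^ 2 := by
    have := he.sum_mul hi.1 ⟨A, hA⟩ ⟨A, hA⟩
    simp only [← sq] at this
    exact this.symm
  rw [h1, h2, Finset.mul_sum, Finset.mul_sum]
  exact ⟨Finset.sum_le_sum fun i _ => mul_le_mul_of_nonneg_right
      (csInf_le hfin.bddBelow (hmem i)) (sq_nonneg _),
    Finset.sum_le_sum fun i _ => mul_le_mul_of_nonneg_right
      (le_csSup hfin.bddAbove (hmem i)) (sq_nonneg _)⟩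

end CasimirBound

/-! ### Extension of invariant tensors by zero and their Casimir quadratic form. -/

section Extension

variable {L : Type*} [LieRing L] [LieAlgebra ℝ L] [FiniteDimensional ℝ L]
  {k : LieSubalgebra ℝ L} {T : LinearMap.BilinForm ℝ (tang k)}
  {ι : Type*} [Fintype ι] [DecidableEq ι] {e : Module.Basis ι ℝ (tang k)}

theorem exists_adapted_basis (hL : IsInner (-(killingForm ℝ L))) (he : IsONB (stdMetric k) e) :
    ∃ (m : ℕ) (E : Module.Basis (ι ⊕ Fin m) ℝ L), IsONB (-(killingForm ℝ L)) E ∧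
      (∀ i, E (Sum.inl i) = e i) ∧ ∀ j, E (Sum.inr j) ∈ k := by
  have hk : IsInner ((-(killingForm ℝ L)).restrict k.toSubmodule) :=
    ⟨fun x y => hL.1 x y, fun x hx => hL.2 x fun h => hx (Subtype.ext h)⟩
  obtain ⟨z, hz⟩ := exists_onb hk
  let E := (e.prod z).map (Submodule.prodEquivOfIsCompl _ _ (isCompl_tang (k := k) hL))
  have h1 : ∀ i, E (Sum.inl i) = e i := fun i => by simp [E]
  have h2 : ∀ j, E (Sum.inr j) = z j := fun j => by simp [E]
  refine ⟨_, E, ?_, h1, fun j => ?_⟩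
  · rintro (i | i) (j | j)
    · simp only [h1, Sum.inl.injEq]
      exact he i j
    · simp only [h1, h2, reduceCtorEq, if_false, LinearMap.neg_apply]
      rw [killing_tang_left (z j).2, neg_zero]
    · simp only [h1, h2, reduceCtorEq, if_false, LinearMap.neg_apply]
      rw [killing_tang_right (z i).2, neg_zero]
    · simp only [h2, Sum.inr.injEq]
      exact hz i j
  · rw [h2]
    exact (z j).2

/-- The extension by zero of the operator of a bilinear form on the tangent space. -/
noncomputable def extOp (k : LieSubalgebra ℝ L) (T : LinearMap.BilinForm ℝ (tang k)) :
    Module.End ℝ L :=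
  (tang k).subtype ∘ₗ repOp (stdMetric k) T ∘ₗ projP k

theorem extOp_apply (x : L) : extOp k T x = repOp (stdMetric k) T (projP k x) := rfl

theorem extOp_of_mem (hL : IsInner (-(killingForm ℝ L))) {z : L} (hz : z ∈ k) :
    extOp k T z = 0 := by
  rw [extOp_apply, projP_of_mem hL hz, map_zero]
  rfl

theorem trace_extOp (hL : IsInner (-(killingForm ℝ L))) : LinearMap.trace ℝ L (extOp k T) =
    LinearMap.trace ℝ (tang k) (repOp (stdMetric k) T) := by
  rw [extOp, LinearMap.trace_comp_comm', LinearMap.comp_assoc]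
  congr 1
  ext X
  simp [projP_coe hL]

theorem killing_extOp (hL : IsInner (-(killingForm ℝ L))) (x y : L) :
    killingForm ℝ L (extOp k T x) y = -T (projP k x) (projP k y) := by
  rw [← apply_repOp (stdMetric_isInner hL), stdMetric_apply, neg_neg, ← projL_apply y,
    ← killing_projL hL, projL_apply, projP_coe hL]
  rfl

theorem extOp_symm (hL : IsInner (-(killingForm ℝ L))) (hT : ∀ X Y, T X Y = T Y X) (x y : L) :
    killingForm ℝ L (extOp k T x) y = killingForm ℝ L x (extOp k T y) := by
  rw [killing_extOp hL, killing_symm x, killing_extOp hL, hT]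

theorem projP_lie (hL : IsInner (-(killingForm ℝ L))) {z : L} (hz : z ∈ k) (x : L) :
    projP k ⁅z, x⁆ = projP k ⁅z, (projP k x : L)⁆ := by
  rw [← sub_eq_zero, ← map_sub, ← lie_sub]
  exact projP_of_mem hL (k.lie_mem hz (sub_projP_mem hL x))

/-- The extended operator commutes with `ad z` for `z` in `k`: on `p` by invariance, on `k` because
it vanishes there. Only directions in `p` therefore contribute to the Casimir operator. -/
theorem tau_extOp (hL : IsInner (-(killingForm ℝ L)))
    (hTk : IsAdInvariant k T) {z : L} (hz : z ∈ k) : tau L z (extOp k T) = 0 := by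
  refine LinearMap.ext fun x => hL.eq_of_forall fun y => ?_
  simp only [tau, LinearMap.sub_apply, Module.End.mul_apply, LieAlgebra.ad_apply, map_sub,
    LinearMap.zero_apply, map_zero, LinearMap.neg_apply]
  rw [killing_lie', killing_extOp hL, killing_extOp hL, projP_lie hL hz, projP_lie hL hz x]
  have := hTk z hz (projP k x) (projP k y)
  linarith

/-- Splitting the full bracket into its two components gives `trP + isoForm`, that is (`trP` + B)/2,
at `e j`. This is the origin of the coefficient 3 - 4ρ. -/
theorem sum_strConst_mul_sq (hL : IsInner (-(killingForm ℝ L))) {ρ : ℝ}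
    (hρ : IsEinstein k (stdMetric k) ρ) (he : IsONB (stdMetric k) e) (j : ι) :
    ∑ i, killingForm ℝ L ⁅(e i : L), (e j : L)⁆ ⁅(e i : L), (e j : L)⁆ =
      -(3 - 4 * ρ) / 2 := by
  have h1 : ∀ i, killingForm ℝ L ⁅(e i : L), (e j : L)⁆ ⁅(e i : L), (e j : L)⁆ =
      stdMetric k (brP k (e j) (brP k (e j) (e i))) (e i) +
        stdMetric k (projP k ⁅(e j : L), brK k (e j) (e i)⁆) (e i) := fun i => by
    rw [← LinearMap.add_apply, ← map_add, brP, ← map_add, ← lie_add, brP_add_brK, stdMetric_apply,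
      killing_projP hL, killing_lie' (e j : L), neg_neg, ← lie_skew (e i : L) (e j : L), map_neg,
      map_neg, LinearMap.neg_apply, neg_neg]
  have h2 : killingForm ℝ L (e j) (e j) = -1 := by
    have : -killingForm ℝ L (e j) (e j) = 1 := (he j j).trans (if_pos rfl)
    linarith
  have h3 := killing_eq_trP_add hL (e j) (e j)
  have h4 := (isEinstein_iff hL ρ).1 hρ (e j) (e j)
  simp only [h1, Finset.sum_add_distrib]
  rw [← trP_eq_sum he, ← isoForm_eq_sum _ he]
  rw [h2] at h3 h4
  linarith

/-- The quadratic form of the Casimir operator at an extended tensor. -/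
theorem trace_casTau_extOp (hL : IsInner (-(killingForm ℝ L))) {ρ : ℝ}
    (hρ : IsEinstein k (stdMetric k) ρ) (hT : ∀ X Y, T X Y = T Y X) (hTk : IsAdInvariant k T)
    (he : IsONB (stdMetric k) e) {a : ι → ℝ}
    (ha : ∀ i, repOp (stdMetric k) T (e i) = a i • e i) :
    LinearMap.trace ℝ L (casTau L (extOp k T) * extOp k T) = (3 - 4 * ρ) * ∑ i, a i ^ 2
      - 2 * ∑ i, ∑ j, ∑ l, a j * a l * strConst k (stdMetric k) e i j l ^ 2 := by
  obtain ⟨m, E, hE, hE1, hE2⟩ := exists_adapted_basis hL he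
  set A := extOp k T with hA
  have hAe : ∀ i, A (e i) = a i • (e i : L) := fun i => by
    rw [hA, extOp_apply, projP_coe hL, ha]; rfl
  have hAk : ∀ j, A (E (Sum.inr j)) = 0 := fun j => extOp_of_mem hL (hE2 j)
  have hAs := extOp_symm (k := k) hL hT
  have htr : ∀ f : Module.End ℝ L, LinearMap.trace ℝ L (f * A) =
      ∑ j, a j * -killingForm ℝ L (f (e j)) (e j) := fun f => by
    rw [trace_eq_sum hE, Fintype.sum_sum_type]
    simp only [Module.End.mul_apply, hAk, map_zero, LinearMap.zero_apply, Finset.sum_const_zero,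
      add_zero, hE1, hAe, map_smul, LinearMap.smul_apply, smul_eq_mul, LinearMap.neg_apply]
  have hquad : ∀ V : tang k, T V V = ∑ l, a l * stdMetric k V (e l) ^ 2 := fun V => by
    rw [← apply_repOp (stdMetric_isInner hL), rayleigh (stdMetric_isInner hL) he ha]
  have q1 : ∀ i, LinearMap.trace ℝ L (tau L (e i) (tau L (e i) A) * A) =
      2 * ∑ j, a j ^ 2 * killingForm ℝ L ⁅(e i : L), (e j : L)⁆ ⁅(e i : L), (e j : L)⁆ +
        2 * ∑ j, ∑ l, a j * a l * strConst k (stdMetric k) e i j l ^ 2 := fun i => by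
    set x : Module.End ℝ L := LieAlgebra.ad ℝ L (e i)
    have e1 : tau L (e i) (tau L (e i) A) * A = x * x * A * A - (x * A * x) * A - (x * A * x) * A
        + A * (x * x * A) := by
      simp only [tau]
      noncomm_ring
    have e2 : LinearMap.trace ℝ L (x * x * A * A) =
        ∑ j, a j ^ 2 * killingForm ℝ L ⁅(e i : L), (e j : L)⁆ ⁅(e i : L), (e j : L)⁆ := by
      rw [htr]
      refine Finset.sum_congr rfl fun j _ => ?_
      simp only [Module.End.mul_apply, hAe, map_smul, LinearMap.smul_apply, smul_eq_mul]
      change a j * -(a j * killingForm ℝ L ⁅(e i : L), ⁅(e i : L), (e j : L)⁆⁆ (e j)) = _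
      rw [killing_lie']
      ring
    -- Here `A` stands between the two brackets and sees only their `p`-component, so structure
    -- constants appear; in `e2` the full bracket counts.
    have e3 : LinearMap.trace ℝ L (x * A * x * A) =
        -∑ j, ∑ l, a j * a l * strConst k (stdMetric k) e i j l ^ 2 := by
      rw [htr, ← Finset.sum_neg_distrib]
      refine Finset.sum_congr rfl fun j _ => ?_
      simp only [Module.End.mul_apply]
      change a j * -(killingForm ℝ L ⁅(e i : L), A ⁅(e i : L), (e j : L)⁆⁆ (e j)) = _
      rw [killing_lie', killing_extOp hL, hquad, neg_neg, mul_neg, Finset.mul_sum]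
      refine congrArg _ (Finset.sum_congr rfl fun l _ => ?_)
      rw [strConst, brP]
      ring
    rw [e1, map_add, map_sub, map_sub, LinearMap.trace_mul_comm ℝ A, e2, e3]
    ring
  rw [casTau_eq_sum hL hE, neg_mul, Finset.sum_mul, map_neg, map_sum, Fintype.sum_sum_type]
  have hzero : ∀ j, tau L (E (Sum.inr j)) A = 0 := fun j => tau_extOp hL hTk (hE2 j)
  have htz : ∀ x : L, tau L x 0 = 0 := fun x => by simp [tau]
  simp only [hE1, hzero, htz, zero_mul, map_zero, Finset.sum_const_zero, add_zero, q1,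
    Finset.sum_add_distrib, ← Finset.mul_sum]
  rw [Finset.sum_comm]
  simp only [← Finset.mul_sum, sum_strConst_mul_sq hL hρ he, ← Finset.sum_mul]
  ring

theorem trace_extOp_sq (hL : IsInner (-(killingForm ℝ L)))
    (he : IsONB (stdMetric k) e) {a : ι → ℝ}
    (ha : ∀ i, repOp (stdMetric k) T (e i) = a i • e i) :
    LinearMap.trace ℝ L (extOp k T * extOp k T) = ∑ i, a i ^ 2 := by
  obtain ⟨m, E, hE, hE1, hE2⟩ := exists_adapted_basis hL he
  have hAe : ∀ i, extOp k T (e i) = a i • (e i : L) := fun i => by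
    rw [extOp_apply, projP_coe hL, ha]; rfl
  rw [trace_eq_sum hE, Fintype.sum_sum_type]
  simp only [Module.End.mul_apply, extOp_of_mem hL (hE2 _), map_zero, LinearMap.zero_apply,
    Finset.sum_const_zero, add_zero, hE1, hAe, map_smul, LinearMap.smul_apply, smul_eq_mul]
  refine Finset.sum_congr rfl fun i _ => ?_
  have : (-killingForm ℝ L) (e i : L) (e i) = 1 := (he i i).trans (if_pos rfl)
  rw [this]
  ring

/-- Bounds for the bracket term by the extremal eigenvalues of the Casimir operator. -/
theorem casTau_bounds_tensor (hL : IsInner (-(killingForm ℝ L))) {ρ : ℝ}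
    (hρ : IsEinstein k (stdMetric k) ρ) (hT : ∀ X Y, T X Y = T Y X) (hTk : IsAdInvariant k T)
    (he : IsONB (stdMetric k) e) {a : ι → ℝ}
    (ha : ∀ i, repOp (stdMetric k) T (e i) = a i • e i) (hsum : ∑ i, a i = 0) :
    lamTau L * ∑ i, a i ^ 2 ≤ (3 - 4 * ρ) * ∑ i, a i ^ 2
      - 2 * ∑ i, ∑ j, ∑ l, a j * a l * strConst k (stdMetric k) e i j l ^ 2 ∧
    (3 - 4 * ρ) * ∑ i, a i ^ 2
      - 2 * ∑ i, ∑ j, ∑ l, a j * a l * strConst k (stdMetric k) e i j l ^ 2 ≤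
      lamTauMax L * ∑ i, a i ^ 2 := by
  have hmem : extOp k T ∈ symTraceless L := by
    refine ⟨extOp_symm hL hT, ?_⟩
    rw [trace_extOp hL, trace_eq_sum_of_eigen _ ha, hsum]
  rw [← trace_casTau_extOp hL hρ hT hTk he ha, ← trace_extOp_sq hL he ha]
  exact casTau_bounds hL hmem

end Extension

/-! ### Second-order jets of functions of one real variable. -/

open Filter Topology in
/-- `f` has the second-order Taylor expansion `v + f₁ t + f₂ t² / 2` at `0`, and is differentiable
near `0`. -/
def HasJet (f : ℝ → ℝ) (v f₁ f₂ : ℝ) : Prop :=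
  f 0 = v ∧ ∃ f' : ℝ → ℝ, (∀ᶠ t in 𝓝 0, HasDerivAt f (f' t) t) ∧ f' 0 = f₁ ∧ HasDerivAt f' f₂ 0

namespace HasJet

open Filter Topology

variable {f g : ℝ → ℝ} {v f₁ f₂ w g₁ g₂ : ℝ}

theorem const (c : ℝ) : HasJet (fun _ => c) c 0 0 :=
  ⟨rfl, fun _ => 0, Eventually.of_forall fun _ => hasDerivAt_const _ _, rfl, hasDerivAt_const _ _⟩

theorem add (hf : HasJet f v f₁ f₂) (hg : HasJet g w g₁ g₂) :
    HasJet (fun t => f t + g t) (v + w) (f₁ + g₁) (f₂ + g₂) := by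
  obtain ⟨h0, f', h1, h2, h3⟩ := hf
  obtain ⟨k0, g', k1, k2, k3⟩ := hg
  refine ⟨by simp only [h0, k0], fun t => f' t + g' t, ?_, by simp only [h2, k2], h3.add k3⟩
  filter_upwards [h1, k1] with t a b using a.add b

theorem const_mul (c : ℝ) (hf : HasJet f v f₁ f₂) :
    HasJet (fun t => c * f t) (c * v) (c * f₁) (c * f₂) := by
  obtain ⟨h0, f', h1, h2, h3⟩ := hf
  refine ⟨by simp only [h0], fun t => c * f' t, ?_, by simp only [h2], h3.const_mul c⟩
  filter_upwards [h1] with t a using a.const_mul c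

theorem neg (hf : HasJet f v f₁ f₂) : HasJet (fun t => -f t) (-v) (-f₁) (-f₂) := by
  simpa using hf.const_mul (-1)

theorem sub (hf : HasJet f v f₁ f₂) (hg : HasJet g w g₁ g₂) :
    HasJet (fun t => f t - g t) (v - w) (f₁ - g₁) (f₂ - g₂) := by
  simpa [sub_eq_add_neg] using hf.add hg.neg

theorem sum {ι : Type*} (s : Finset ι) {f : ι → ℝ → ℝ} {v f₁ f₂ : ι → ℝ}
    (hf : ∀ i, HasJet (f i) (v i) (f₁ i) (f₂ i)) :
    HasJet (fun t => ∑ i ∈ s, f i t) (∑ i ∈ s, v i) (∑ i ∈ s, f₁ i) (∑ i ∈ s, f₂ i) := by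
  classical
  induction s using Finset.induction_on with
  | empty => simpa using const 0
  | insert a s ha ih => simpa [Finset.sum_insert ha] using (hf a).add ih

theorem exp (hf : HasJet f v f₁ f₂) :
    HasJet (fun t => Real.exp (f t)) (Real.exp v) (Real.exp v * f₁)
      (Real.exp v * (f₂ + f₁ ^ 2)) := by
  obtain ⟨h0, f', h1, h2, h3⟩ := hf
  refine ⟨by simp only [h0], fun t => Real.exp (f t) * f' t, ?_, by simp only [h0, h2], ?_⟩
  · filter_upwards [h1] with t a using a.exp
  · have h4 := h1.self_of_nhds.exp.mul h3
    refine h4.congr_deriv ?_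
    rw [h0, h2]
    ring

theorem log_one_add (a : ℝ) : HasJet (fun t => Real.log (1 + t * a)) 0 a (-a ^ 2) := by
  have hd : ∀ t : ℝ, HasDerivAt (fun t : ℝ => 1 + t * a) a t := fun t => by
    simpa using ((hasDerivAt_id t).mul_const a).const_add 1
  refine ⟨by simp, fun t => a / (1 + t * a), ?_, by simp, ?_⟩
  · have : ∀ᶠ t in 𝓝 (0 : ℝ), 1 + t * a ≠ 0 :=
      (hd 0).continuousAt.eventually_ne (by simp)
    filter_upwards [this] with t ht using (hd t).log ht
  · have h := (hasDerivAt_const (0 : ℝ) a).div (hd 0) (by simp)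
    refine h.congr_deriv ?_
    simp
    ring

/-- Only the germ at 0 matters; the diagonal formula for the scalar curvature is applied along the
curve only while the metric stays positive. -/
theorem iteratedDeriv_eq (hf : HasJet f v f₁ f₂) (hg : g =ᶠ[𝓝 0] f) :
    iteratedDeriv 2 g 0 = f₂ := by
  obtain ⟨h0, f', h1, h2, h3⟩ := hf
  rw [Filter.EventuallyEq.iteratedDeriv_eq 2 hg, iteratedDeriv_succ, iteratedDeriv_one]
  have : deriv f =ᶠ[𝓝 0] f' := by
    filter_upwards [h1] with t a using a.deriv
  rw [this.deriv_eq, h3.deriv]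

end HasJet

/-! ### Diagonal metrics: scalar curvature, volume and second variation. -/

section Diagonal

variable {L : Type*} [LieRing L] [LieAlgebra ℝ L] [FiniteDimensional ℝ L]
  {k : LieSubalgebra ℝ L} {h T : LinearMap.BilinForm ℝ (tang k)}
  {ι : Type*} [Fintype ι] [DecidableEq ι] {e : Module.Basis ι ℝ (tang k)}

theorem isInner_of_diagonal {s : ι → ℝ} (hs : ∀ i j, h (e i) (e j) = if i = j then Real.exp (s i) else 0) :
    IsInner h := by
  have h1 : ∀ X Y, h X Y = ∑ i, Real.exp (s i) * e.repr X i * e.repr Y i := fun X Y => by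
    conv_lhs => rw [← e.sum_repr X, ← e.sum_repr Y]
    simp only [map_sum, LinearMap.sum_apply, map_smul, LinearMap.smul_apply, hs, smul_eq_mul]
    simp
    refine Finset.sum_congr rfl fun i _ => ?_
    ring
  refine ⟨fun X Y => ?_, fun X hX => ?_⟩
  · rw [h1, h1]
    exact Finset.sum_congr rfl fun i _ => by ring
  · rw [h1]
    obtain ⟨i, hi⟩ : ∃ i, e.repr X i ≠ 0 := by
      by_contra! hne
      exact hX (e.repr.map_eq_zero_iff.1 (Finsupp.ext hne))
    refine Finset.sum_pos' (fun j _ => ?_) ⟨i, Finset.mem_univ _, ?_⟩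
    · rw [mul_assoc]
      exact mul_nonneg (Real.exp_pos _).le (mul_self_nonneg _)
    · rw [mul_assoc]
      exact mul_pos (Real.exp_pos _) (mul_self_pos.2 hi)

/-- The scalar curvature of an invariant metric that is diagonal in an orthonormal basis of the
standard metric. -/
theorem scal_diagonal (hL : IsInner (-(killingForm ℝ L))) (he : IsONB (stdMetric k) e) {s : ι → ℝ}
    (hs : ∀ i j, h (e i) (e j) = if i = j then Real.exp (s i) else 0) :
    scal k h = 1 / 2 * ∑ i, Real.exp (-s i) - 1 / 4 * ∑ i, ∑ j, ∑ l,
      strConst k (stdMetric k) e i j l ^ 2 * Real.exp (s l - s i - s j) := by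
  have hh := isInner_of_diagonal hs
  -- Rescaling `e i` by exp(-s_i/2) makes the basis orthonormal for `h`, so that `scal_eq` applies.
  let w : ι → ℝˣ := fun i => Units.mk0 (Real.exp (-s i / 2)) (Real.exp_pos _).ne'
  let f := e.unitsSMul w
  have hf : ∀ i, f i = Real.exp (-s i / 2) • e i := fun i => by
    simp [f, w, Module.Basis.unitsSMul_apply, Units.smul_def]
  have hfh : IsONB h f := fun i j => by
    simp only [hf, map_smul, LinearMap.smul_apply, hs, smul_eq_mul]
    split_ifs with hij
    · subst hij
      rw [← Real.exp_add, ← Real.exp_add, ← Real.exp_zero]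
      congr 1
      ring
    · simp
  have hrow : ∀ X l, h X (e l) = Real.exp (s l) * stdMetric k X (e l) := fun X l => by
    conv_lhs => rw [← he.sum_eq X]
    simp [map_sum, LinearMap.sum_apply, hs, mul_comm]
  rw [scal_eq hL hh hfh, sub_eq_add_neg, sub_eq_add_neg]
  congr 1
  · rw [neg_mul, ← mul_neg, ← Finset.sum_neg_distrib]
    refine congrArg _ (Finset.sum_congr rfl fun i _ => ?_)
    have h1 : -killingForm ℝ L (e i) (e i) = 1 := (he i i).trans (if_pos rfl)
    rw [hf]
    simp only [Submodule.coe_smul, map_smul, LinearMap.smul_apply, smul_eq_mul]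
    have h2 : Real.exp (-s i) = Real.exp (-s i / 2) * Real.exp (-s i / 2) := by
      rw [← Real.exp_add]
      congr 1
      ring
    rw [h2]
    linear_combination (Real.exp (-s i / 2) * Real.exp (-s i / 2)) * h1
  · refine congrArg _ (congrArg _ (Finset.sum_congr rfl fun i _ => Finset.sum_congr rfl fun j _ =>
      Finset.sum_congr rfl fun l _ => ?_))
    have h1 : strConst k h f i j l = Real.exp (-s i / 2) * Real.exp (-s j / 2) *
        Real.exp (-s l / 2) * Real.exp (s l) * strConst k (stdMetric k) e i j l := by
      rw [strConst, hf, hf, hf, brP_smul_left, brP_smul_right]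
      simp only [map_smul, LinearMap.smul_apply, smul_eq_mul, hrow, strConst]
      ring
    rw [h1, mul_pow, ← Real.exp_add, ← Real.exp_add, ← Real.exp_add, sq (Real.exp _),
      ← Real.exp_add, mul_comm]
    congr 2
    ring

/-- Writing `h` as the standard metric precomposed with its operator, the two Gram determinants
differ by the determinant of that operator, which may then be computed in an eigenbasis. -/
theorem volRatioSq_eq_det (hL : IsInner (-(killingForm ℝ L))) :
    volRatioSq k h = LinearMap.det (repOp (stdMetric k) h) := by
  have hg := stdMetric_isInner (k := k) hL
  set b := Module.finBasis ℝ (tang k)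
  have h1 : h = (stdMetric k).comp (repOp (stdMetric k) h) LinearMap.id := by
    ext X Y
    simp [apply_repOp hg]
  have h2 : (LinearMap.BilinForm.toMatrix b (stdMetric k)).det ≠ 0 :=
    (LinearMap.BilinForm.nondegenerate_iff_det_ne_zero b).1 hg.nondegenerate
  have h3 : (LinearMap.BilinForm.toMatrix b h).det =
      LinearMap.det (repOp (stdMetric k) h) * (LinearMap.BilinForm.toMatrix b (stdMetric k)).det := by
    conv_lhs => rw [h1]
    rw [LinearMap.BilinForm.toMatrix_comp b b, Matrix.det_mul, Matrix.det_mul, Matrix.det_transpose,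
      LinearMap.det_toMatrix]
    simp
  rw [volRatioSq, h3, mul_div_cancel_right₀ _ h2]

theorem volRatioSq_diagonal (hL : IsInner (-(killingForm ℝ L))) {a : ι → ℝ}
    (ha : ∀ i, repOp (stdMetric k) h (e i) = a i • e i) : volRatioSq k h = ∏ i, a i := by
  rw [volRatioSq_eq_det hL, ← LinearMap.det_toMatrix e]
  have : LinearMap.toMatrix e e (repOp (stdMetric k) h) = Matrix.diagonal a := by
    ext i j
    by_cases hij : i = j
    · subst hij; simp [LinearMap.toMatrix_apply, ha]
    · simp [LinearMap.toMatrix_apply, ha, hij, Finsupp.single_apply, Ne.symm hij]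
  rw [this, Matrix.det_diagonal]

/-- Constant marginals of the weights: a function of one index can be pulled out of the triple sum.
The two companions follow by permuting indices. -/
theorem sum_weight_left (hL : IsInner (-(killingForm ℝ L))) {ρ : ℝ}
    (hρ : IsEinstein k (stdMetric k) ρ) (he : IsONB (stdMetric k) e) (f : ι → ℝ) :
    ∑ i, ∑ j, ∑ l, strConst k (stdMetric k) e i j l ^ 2 * f i = (2 - 4 * ρ) * ∑ i, f i := by
  simp only [← Finset.sum_mul, sum_strConst_sq hL hρ he, Finset.mul_sum]

theorem sum_weight_mid (hL : IsInner (-(killingForm ℝ L))) {ρ : ℝ}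
    (hρ : IsEinstein k (stdMetric k) ρ) (he : IsONB (stdMetric k) e) (f : ι → ℝ) :
    ∑ i, ∑ j, ∑ l, strConst k (stdMetric k) e i j l ^ 2 * f j = (2 - 4 * ρ) * ∑ i, f i := by
  rw [← sum_weight_left hL hρ he, Finset.sum_comm]
  simp only [strConst_sq_left]

theorem sum_weight_right (hL : IsInner (-(killingForm ℝ L))) {ρ : ℝ}
    (hρ : IsEinstein k (stdMetric k) ρ) (he : IsONB (stdMetric k) e) (f : ι → ℝ) :
    ∑ i, ∑ j, ∑ l, strConst k (stdMetric k) e i j l ^ 2 * f l = (2 - 4 * ρ) * ∑ i, f i := by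
  rw [← sum_weight_mid hL hρ he]
  refine Finset.sum_congr rfl fun i _ => ?_
  rw [Finset.sum_comm]
  simp only [strConst_sq_right hL i]

/-- The quadratic expression `∑ [ijl]² aⱼ aₗ`. -/
noncomputable def bracketSum (k : LieSubalgebra ℝ L) {ι : Type*} [Fintype ι]
    (e : Module.Basis ι ℝ (tang k)) (a : ι → ℝ) : ℝ :=
  ∑ i, ∑ j, ∑ l, a j * a l * strConst k (stdMetric k) e i j l ^ 2

/-- The quadratic part of the scalar curvature. -/
theorem sum_quadratic (hL : IsInner (-(killingForm ℝ L))) {ρ : ℝ}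
    (hρ : IsEinstein k (stdMetric k) ρ) (he : IsONB (stdMetric k) e) (a : ι → ℝ) :
    ∑ i, ∑ j, ∑ l, strConst k (stdMetric k) e i j l ^ 2 * (a l - a i - a j) ^ 2 =
      3 * (2 - 4 * ρ) * ∑ i, a i ^ 2 - 2 * bracketSum k e a := by
  have h1 : ∑ i, ∑ j, ∑ l, a i * a l * strConst k (stdMetric k) e i j l ^ 2 = bracketSum k e a := by
    rw [bracketSum, Finset.sum_comm]
    simp only [strConst_sq_left]
  have h2 : ∑ i, ∑ j, ∑ l, a i * a j * strConst k (stdMetric k) e i j l ^ 2 = bracketSum k e a := by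
    rw [← h1]
    refine Finset.sum_congr rfl fun i _ => ?_
    rw [Finset.sum_comm]
    simp only [strConst_sq_right hL i]
  have h3 : ∀ i j l, strConst k (stdMetric k) e i j l ^ 2 * (a l - a i - a j) ^ 2 =
      strConst k (stdMetric k) e i j l ^ 2 * a i ^ 2 + strConst k (stdMetric k) e i j l ^ 2 * a j ^ 2
      + strConst k (stdMetric k) e i j l ^ 2 * a l ^ 2
      + 2 * (a i * a j * strConst k (stdMetric k) e i j l ^ 2)
      - 2 * (a i * a l * strConst k (stdMetric k) e i j l ^ 2)
      - 2 * (a j * a l * strConst k (stdMetric k) e i j l ^ 2) := fun i j l => by ring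
  have h7 : ∑ i, ∑ j, ∑ l, 2 * (a i * a l * strConst k (stdMetric k) e i j l ^ 2) =
      2 * bracketSum k e a := by simp only [← h1, Finset.mul_sum]
  have h8 : ∑ i, ∑ j, ∑ l, 2 * (a i * a j * strConst k (stdMetric k) e i j l ^ 2) =
      2 * bracketSum k e a := by simp only [← h2, Finset.mul_sum]
  have h9 : ∑ i, ∑ j, ∑ l, 2 * (a j * a l * strConst k (stdMetric k) e i j l ^ 2) =
      2 * bracketSum k e a := by simp only [bracketSum, Finset.mul_sum]
  simp only [h3, Finset.sum_add_distrib, Finset.sum_sub_distrib, h7, h8, h9]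
  have h4 := sum_weight_left hL hρ he fun i => a i ^ 2
  have h5 := sum_weight_mid hL hρ he fun i => a i ^ 2
  have h6 := sum_weight_right hL hρ he fun i => a i ^ 2
  beta_reduce at h4 h5 h6
  rw [h4, h5, h6]
  ring

theorem sum_linear (hL : IsInner (-(killingForm ℝ L))) {ρ : ℝ}
    (hρ : IsEinstein k (stdMetric k) ρ) (he : IsONB (stdMetric k) e) (a : ι → ℝ) :
    ∑ i, ∑ j, ∑ l, strConst k (stdMetric k) e i j l ^ 2 * (a l - a i - a j) =
      -(2 - 4 * ρ) * ∑ i, a i := by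
  simp only [mul_sub, Finset.sum_sub_distrib, sum_weight_left hL hρ he, sum_weight_mid hL hρ he,
    sum_weight_right hL hρ he]
  ring

open Filter Topology in
/-- The second variation of the scalar curvature at an Einstein standard metric. -/
theorem scalHess_eq (hL : IsInner (-(killingForm ℝ L))) {ρ : ℝ}
    (hρ : IsEinstein k (stdMetric k) ρ) (he : IsONB (stdMetric k) e) {a : ι → ℝ}
    (ha : ∀ i, repOp (stdMetric k) T (e i) = a i • e i) (hsum : ∑ i, a i = 0) :
    scalHess k T = (3 * ρ - 1) * ∑ i, a i ^ 2 + 1 / 2 * bracketSum k e a := by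
  have hg := stdMetric_isInner (k := k) hL
  set n : ℝ := (Module.finrank ℝ (tang k) : ℝ) with hn
  have hcard : (Fintype.card ι : ℝ) = n := by rw [hn, Module.finrank_eq_card_basis e]
  -- Logarithms of the eigenvalues of the rescaled metric: the volume normalization subtracts their
  -- mean. `s2` are the second derivatives at 0.
  let s : ι → ℝ → ℝ := fun i t => Real.log (1 + t * a i) - 1 / n * ∑ j, Real.log (1 + t * a j)
  let s2 : ι → ℝ := fun i => -a i ^ 2 - 1 / n * ∑ j, -a j ^ 2
  have hs : ∀ i, HasJet (s i) 0 (a i) (s2 i) := fun i => by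
    have h1 := (HasJet.log_one_add (a i)).sub
      ((HasJet.sum Finset.univ fun j => HasJet.log_one_add (a j)).const_mul (1 / n))
    rw [hsum] at h1
    simpa [s, s2] using h1
  -- Constant volume to second order; it makes all contributions of the second derivatives `s2`
  -- cancel. An empty index set is treated apart because of the division by `n`.
  have hs2 : ∑ i, s2 i = 0 := by
    rcases isEmpty_or_nonempty ι with hι | hι
    · simp
    · have : n ≠ 0 := by rw [← hcard]; exact_mod_cast Fintype.card_ne_zero
      simp only [s2, Finset.sum_sub_distrib, Finset.sum_const, Finset.card_univ, nsmul_eq_mul, hcard]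
      field_simp
      ring
  -- The coefficients of the jet are left to unification and simplified afterwards with `sum_linear`
  -- and `sum_quadratic`.
  have hjet : HasJet (fun t => 1 / 2 * ∑ i, Real.exp (-s i t) - 1 / 4 * ∑ i, ∑ j, ∑ l,
      strConst k (stdMetric k) e i j l ^ 2 * Real.exp (s l t - s i t - s j t)) _ _ _ :=
    ((HasJet.sum Finset.univ fun i => (hs i).neg.exp).const_mul (1 / 2)).sub
      ((HasJet.sum Finset.univ fun i => HasJet.sum Finset.univ fun j => HasJet.sum Finset.univ
        fun l => ((((hs l).sub (hs i)).sub (hs j)).exp).const_mul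
          (strConst k (stdMetric k) e i j l ^ 2)).const_mul (1 / 4))
  have hpos : ∀ᶠ t in 𝓝 (0 : ℝ), ∀ i, 0 < 1 + t * a i := by
    rw [eventually_all]
    intro i
    have hc : ContinuousAt (fun t : ℝ => 1 + t * a i) 0 := by fun_prop
    exact hc.eventually (lt_mem_nhds (by simp))
  rw [scalHess, hjet.iteratedDeriv_eq (g := fun t => scal k (unitCurve k T t))]
  · simp only [neg_zero, sub_zero, Real.exp_zero, one_mul, mul_add, Finset.sum_add_distrib,
      sum_quadratic hL hρ he, sum_linear hL hρ he, hs2, neg_sq, Finset.sum_neg_distrib]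
    ring
  · filter_upwards [hpos] with t ht
    have hrep : ∀ i, repOp (stdMetric k) (stdMetric k + t • T) (e i) = (1 + t * a i) • e i :=
      fun i => hg.eq_of_forall fun Y => by
        rw [apply_repOp hg, LinearMap.add_apply, LinearMap.smul_apply, LinearMap.add_apply,
          LinearMap.smul_apply, ← apply_repOp hg T, ha]
        simp [add_mul, mul_assoc]
    refine scal_diagonal hL he fun i j => ?_
    rw [unitCurve, volRatioSq_diagonal hL hrep, LinearMap.smul_apply, LinearMap.smul_apply,
      ← apply_repOp hg (stdMetric k + t • T), hrep, map_smul, LinearMap.smul_apply, he i j,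
      ← hn, ← Real.exp_log (Finset.prod_pos fun i _ => ht i), ← Real.exp_mul,
      Real.log_prod fun i _ => (ht i).ne']
    split_ifs with hij
    · simp only [smul_eq_mul, mul_one, s]
      conv_lhs => rw [← Real.exp_log (ht i)]
      rw [← Real.exp_add]
      congr 1
      ring
    · simp

end Diagonal

/-! ### The isotropy representation and the space of invariant TT-tensors. -/

section Isotropy

variable {L : Type*} [LieRing L] [LieAlgebra ℝ L] [FiniteDimensional ℝ L]

/-- A set of Lie algebra automorphisms that preserve the subalgebra `k`. -/
structure IsAutSet (k : LieSubalgebra ℝ L) (S : Set (L →ₗ[ℝ] L)) : Prop where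
  map_lie : ∀ φ ∈ S, ∀ x y, φ ⁅x, y⁆ = ⁅φ x, φ y⁆
  bijective : ∀ φ ∈ S, Function.Bijective φ
  mem : ∀ φ ∈ S, ∀ z ∈ k, φ z ∈ k

variable {k : LieSubalgebra ℝ L} {S : Set (L →ₗ[ℝ] L)} {T : LinearMap.BilinForm ℝ (tang k)}
  {φ : L →ₗ[ℝ] L}

theorem IsAutSet.killing (hS : IsAutSet k S) (hφ : φ ∈ S) (x y : L) :
    killingForm ℝ L (φ x) (φ y) = killingForm ℝ L x y := by
  let f : L →ₗ⁅ℝ⁆ L := { φ with map_lie' := fun {x y} => hS.map_lie φ hφ x y }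
  exact LieAlgebra.killingForm_of_equiv_apply (LieEquiv.ofBijective f (hS.bijective φ hφ)) x y

/-- `S` need not be closed under inverses; an injective endomorphism of the finite-dimensional `k`
is surjective. -/
theorem IsAutSet.exists_preimage (hS : IsAutSet k S) (hφ : φ ∈ S) {z : L} (hz : z ∈ k) :
    ∃ w ∈ k, φ w = z := by
  let f : k.toSubmodule →ₗ[ℝ] k.toSubmodule := φ.restrict (hS.mem φ hφ)
  have hf : Function.Injective f := fun x y h =>
    Subtype.ext ((hS.bijective φ hφ).1 (congrArg Subtype.val h))
  obtain ⟨w, hw⟩ := LinearMap.injective_iff_surjective.1 hf ⟨z, hz⟩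
  exact ⟨w, w.2, congrArg Subtype.val hw⟩

theorem IsAutSet.mem_tang (hS : IsAutSet k S) (hφ : φ ∈ S) (X : tang k) : φ X ∈ tang k := by
  rw [mem_tang_iff]
  intro z hz
  obtain ⟨w, hw, rfl⟩ := hS.exists_preimage hφ hz
  rw [hS.killing hφ]
  exact X.2 w hw

/-- The operator on the tangent space induced by an automorphism. -/
noncomputable def autP (k : LieSubalgebra ℝ L) (φ : L →ₗ[ℝ] L) : tang k →ₗ[ℝ] tang k :=
  projP k ∘ₗ φ ∘ₗ (tang k).subtype

theorem autP_apply (X : tang k) : autP k φ X = projP k (φ X) := rfl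

theorem coe_autP (hL : IsInner (-(killingForm ℝ L))) (hS : IsAutSet k S) (hφ : φ ∈ S) (X : tang k) :
    (autP k φ X : L) = φ X :=
  projP_eq hL (hS.mem_tang hφ X) (by simp)

theorem stdMetric_autP (hL : IsInner (-(killingForm ℝ L))) (hS : IsAutSet k S) (hφ : φ ∈ S)
    (X Y : tang k) : stdMetric k (autP k φ X) (autP k φ Y) = stdMetric k X Y := by
  rw [stdMetric_apply, stdMetric_apply, coe_autP hL hS hφ, coe_autP hL hS hφ, hS.killing hφ]

theorem autP_injective (hL : IsInner (-(killingForm ℝ L))) (hS : IsAutSet k S) (hφ : φ ∈ S) :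
    Function.Injective (autP k φ) := fun X Y h => by
  have := congrArg Subtype.val h
  rw [coe_autP hL hS hφ, coe_autP hL hS hφ] at this
  exact Subtype.ext ((hS.bijective φ hφ).1 this)

theorem autP_surjective (hL : IsInner (-(killingForm ℝ L))) (hS : IsAutSet k S) (hφ : φ ∈ S) :
    Function.Surjective (autP k φ) :=
  LinearMap.injective_iff_surjective.1 (autP_injective hL hS hφ)

theorem autP_brP (hL : IsInner (-(killingForm ℝ L))) (hS : IsAutSet k S) (hφ : φ ∈ S)
    (X Y : tang k) : autP k φ (brP k X Y) = brP k (autP k φ X) (autP k φ Y) := by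
  apply Subtype.ext
  rw [coe_autP hL hS hφ, brP, brP, coe_autP hL hS hφ, coe_autP hL hS hφ, ← hS.map_lie φ hφ]
  refine (projP_eq hL (hS.mem_tang hφ _) ?_).symm
  rw [← map_sub]
  exact hS.mem φ hφ _ (sub_projP_mem hL _)

/-- The bilinear form represented by an operator. -/
noncomputable def formOf (k : LieSubalgebra ℝ L) (D : tang k →ₗ[ℝ] tang k) :
    LinearMap.BilinForm ℝ (tang k) := stdMetric k ∘ₗ D

theorem formOf_apply (D : tang k →ₗ[ℝ] tang k) (X Y : tang k) :
    formOf k D X Y = stdMetric k (D X) Y := rfl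

theorem repOp_formOf (hL : IsInner (-(killingForm ℝ L))) (D : tang k →ₗ[ℝ] tang k) :
    repOp (stdMetric k) (formOf k D) = D :=
  LinearMap.ext fun X => (stdMetric_isInner hL).eq_of_forall fun Y => by
    rw [apply_repOp (stdMetric_isInner hL), formOf_apply]

/-- Invariance of a bilinear form in terms of its operator. -/
theorem isInvariant_iff (hL : IsInner (-(killingForm ℝ L))) (hS : IsAutSet k S) :
    IsInvariant k S T ↔ ∀ φ ∈ S, ∀ X, repOp (stdMetric k) T (autP k φ X) =
      autP k φ (repOp (stdMetric k) T X) := by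
  have hg := stdMetric_isInner (k := k) hL
  constructor
  · intro h φ hφ X
    refine hg.eq_of_forall fun Z => ?_
    obtain ⟨Y, rfl⟩ := autP_surjective hL hS hφ Z
    rw [apply_repOp hg, stdMetric_autP hL hS hφ, apply_repOp hg]
    exact h φ hφ X Y
  · intro h φ hφ X Y
    rw [← autP_apply, ← autP_apply, ← apply_repOp hg, h φ hφ, stdMetric_autP hL hS hφ,
      apply_repOp hg]

/-- Functional calculus preserves invariance. -/
theorem isInvariant_of_diagonal (hL : IsInner (-(killingForm ℝ L))) (hS : IsAutSet k S)
    {ι : Type*} {e : Module.Basis ι ℝ (tang k)} {a b : ι → ℝ}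
    (hT : IsInvariant k S T) (ha : ∀ i, repOp (stdMetric k) T (e i) = a i • e i)
    {D : tang k →ₗ[ℝ] tang k} (hD : ∀ i, D (e i) = b i • e i)
    (hab : ∀ i j, a i = a j → b i = b j) : IsInvariant k S (formOf k D) := by
  have hrepr : ∀ (F : tang k →ₗ[ℝ] tang k) (c : ι → ℝ), (∀ i, F (e i) = c i • e i) →
      ∀ X i, e.repr (F X) i = c i * e.repr X i := fun F c hF X i => by
    have : (e.coord i) ∘ₗ F = c i • e.coord i := by
      refine e.ext fun j => ?_
      by_cases hij : j = i
      · subst hij; simp [hF]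
      · simp [hF, hij]
    simpa using LinearMap.congr_fun this X
  rw [isInvariant_iff hL hS] at hT ⊢
  rw [repOp_formOf hL]
  intro φ hφ X
  have : D ∘ₗ autP k φ = autP k φ ∘ₗ D := by
    refine e.ext fun j => e.repr.injective (Finsupp.ext fun i => ?_)
    have h1 := congrArg (fun v => e.repr v i) (hT φ hφ (e j))
    simp only [hrepr _ a ha, ha, map_smul, Finsupp.smul_apply, smul_eq_mul] at h1
    simp only [LinearMap.comp_apply, hrepr _ b hD, hD, map_smul, Finsupp.smul_apply, smul_eq_mul]
    -- An operator commuting with `T` has no entries between different eigenvalues of `T`; within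
    -- one eigenvalue `b` is constant.
    by_cases hij : a i = a j
    · rw [hab i j hij]
    · have : e.repr (autP k φ (e j)) i = 0 := by
        have h2 : (a i - a j) * e.repr (autP k φ (e j)) i = 0 := by linarith
        exact (mul_eq_zero.1 h2).resolve_left (sub_ne_zero.2 hij)
      simp [this]
  exact LinearMap.congr_fun this X

/-- If the isotropy representation is reducible, there are nonzero invariant TT-tensors. -/
theorem exists_isTT (hL : IsInner (-(killingForm ℝ L))) (hS : IsAutSet k S)
    (h : IsotropyReducible k S) : ∃ T, T ≠ 0 ∧ IsTT k S T := by
  have hg := stdMetric_isInner (k := k) hL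
  obtain ⟨W, hW0, hW1, hW⟩ := h
  set W' := LinearMap.BilinForm.orthogonal (stdMetric k) W with hW'
  have hc : IsCompl W W' := by
    refine LinearMap.BilinForm.isCompl_orthogonal_of_restrict_nondegenerate
      (fun x y h => by rw [hg.1]; exact h) ?_
    refine IsInner.nondegenerate (h := (stdMetric k).restrict W) ⟨fun x y => hg.1 x y,
      fun x hx => hg.2 x fun h => hx (Subtype.ext h)⟩
  set P : tang k →ₗ[ℝ] tang k := W.subtype ∘ₗ W.projectionOnto W' hc with hP
  have hP1 : ∀ X ∈ W, P X = X := fun X hX => by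
    have := Submodule.projectionOnto_apply_left hc ⟨X, hX⟩
    rw [hP, LinearMap.comp_apply, this]
    rfl
  have hP2 : ∀ X ∈ W', P X = 0 := fun X hX => by
    have := Submodule.projectionOnto_apply_right hc ⟨X, hX⟩
    rw [hP, LinearMap.comp_apply, this]
    rfl
  have horth : ∀ X ∈ W, ∀ Y ∈ W', stdMetric k X Y = 0 := fun X hX Y hY => hY X hX
  have hdec : ∀ X, ∃ Y ∈ W, ∃ Z ∈ W', X = Y + Z := fun X => by
    obtain ⟨y, hy, z, hz, h⟩ := Submodule.mem_sup.1
      (hc.sup_eq_top ▸ Submodule.mem_top : X ∈ W ⊔ W')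
    exact ⟨y, hy, z, hz, h.symm⟩
  have hsymP : ∀ X Y, stdMetric k (P X) Y = stdMetric k X (P Y) := fun X Y => by
    obtain ⟨X1, h1, X2, h2, rfl⟩ := hdec X
    obtain ⟨Y1, k1, Y2, k2, rfl⟩ := hdec Y
    rw [map_add P X1, map_add P Y1, hP1 _ h1, hP2 _ h2, hP1 _ k1, hP2 _ k2]
    simp only [map_add, LinearMap.add_apply, add_zero, horth X1 h1 Y2 k2]
    rw [hg.1 X2, horth Y1 k1 X2 h2, add_zero]
  have hcomm : ∀ φ ∈ S, ∀ X, P (autP k φ X) = autP k φ (P X) := fun φ hφ X => by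
    have hmem : ∀ Y ∈ W, autP k φ Y ∈ W := fun Y hY => hW φ hφ Y hY
    have hsurj : ∀ Y ∈ W, ∃ Z ∈ W, autP k φ Z = Y := fun Y hY => by
      let f : W →ₗ[ℝ] W := (autP k φ).restrict hmem
      have hf : Function.Injective f := fun x y h =>
        Subtype.ext (autP_injective hL hS hφ (congrArg Subtype.val h))
      obtain ⟨w, hw⟩ := LinearMap.injective_iff_surjective.1 hf ⟨Y, hY⟩
      exact ⟨w, w.2, congrArg Subtype.val hw⟩
    -- The complement is preserved because `autP k φ` maps `W` onto itself and is an isometry.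
    have hmem' : ∀ Y ∈ W', autP k φ Y ∈ W' := fun Y hY Z hZ => by
      obtain ⟨Z, hZ', rfl⟩ := hsurj Z hZ
      change stdMetric k _ _ = 0
      rw [stdMetric_autP hL hS hφ]
      exact horth Z hZ' Y hY
    obtain ⟨X1, h1, X2, h2, rfl⟩ := hdec X
    rw [map_add, map_add, map_add, map_add, hP1 _ h1, hP2 _ h2, hP1 _ (hmem _ h1),
      hP2 _ (hmem' _ h2), map_zero]
  obtain ⟨w, hw, hw0⟩ := Submodule.exists_mem_ne_zero_of_ne_bot hW0
  obtain ⟨v, hv, hv0⟩ : ∃ v ∈ W', v ≠ 0 := by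
    refine Submodule.exists_mem_ne_zero_of_ne_bot fun h => hW1 ?_
    have := hc.sup_eq_top
    rwa [h, sup_bot_eq] at this
  set n : ℝ := (Module.finrank ℝ (tang k) : ℝ)
  have : Nontrivial (tang k) := ⟨w, 0, hw0⟩
  have hn : n ≠ 0 := Nat.cast_ne_zero.2 (Module.finrank_pos (R := ℝ) (M := tang k)).ne'
  -- Subtracting the mean makes the projection onto `W` traceless; the result is nonzero since the
  -- projection has both eigenvalues 1 and 0.
  set c := LinearMap.trace ℝ (tang k) P / n
  refine ⟨formOf k (P - c • LinearMap.id), fun h0 => ?_, (isTT_iff hL).2 ⟨fun X Y => ?_, ?_, ?_⟩⟩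
  · have h1 : P - c • LinearMap.id = 0 := by
      rw [← repOp_formOf hL (P - c • LinearMap.id), h0, repOp, LinearMap.comp_zero]
    have h2 := LinearMap.congr_fun h1 w
    have h3 := LinearMap.congr_fun h1 v
    simp only [LinearMap.sub_apply, LinearMap.smul_apply, LinearMap.id_apply, LinearMap.zero_apply,
      hP1 w hw, hP2 v hv, zero_sub, neg_eq_zero, smul_eq_zero, hv0, or_false] at h2 h3
    rw [h3, zero_smul, sub_zero] at h2
    exact hw0 h2
  · simp only [formOf_apply, LinearMap.sub_apply, LinearMap.smul_apply, LinearMap.id_apply,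
      map_sub, map_smul, hsymP]
    rw [hg.1 Y, hg.1 Y X, hsymP]
  · rw [isInvariant_iff hL hS, repOp_formOf hL]
    intro φ hφ X
    simp [hcomm φ hφ]
  · rw [repOp_formOf hL, map_sub, map_smul, LinearMap.trace_id, smul_eq_mul,
      div_mul_cancel₀ _ hn, sub_self]

/-- The space of invariant TT-tensors. -/
noncomputable def ttSpace (k : LieSubalgebra ℝ L) (S : Set (L →ₗ[ℝ] L)) :
    Submodule ℝ (LinearMap.BilinForm ℝ (tang k)) where
  carrier := {T | (∀ X Y, T X Y = T Y X) ∧ IsInvariant k S T ∧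
      LinearMap.trace ℝ (tang k) (repOp (stdMetric k) T) = 0}
  zero_mem' := ⟨by simp, fun _ _ _ _ => rfl, by simp [repOp]⟩
  add_mem' := by
    rintro T U ⟨h1, h2, h3⟩ ⟨k1, k2, k3⟩
    refine ⟨fun X Y => by simp [h1 X, k1 X], fun φ hφ X Y => ?_, ?_⟩
    · simp only [LinearMap.add_apply]
      rw [h2 φ hφ, k2 φ hφ]
    · rw [repOp, LinearMap.comp_add, map_add]
      change LinearMap.trace ℝ (tang k) (repOp (stdMetric k) T) +
        LinearMap.trace ℝ (tang k) (repOp (stdMetric k) U) = 0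
      rw [h3, k3, add_zero]
  smul_mem' := by
    rintro c T ⟨h1, h2, h3⟩
    refine ⟨fun X Y => by simp [h1 X], fun φ hφ X Y => ?_, ?_⟩
    · simp only [LinearMap.smul_apply]
      rw [h2 φ hφ]
    · rw [repOp, LinearMap.comp_smul, map_smul]
      change c • LinearMap.trace ℝ (tang k) (repOp (stdMetric k) T) = 0
      rw [h3, smul_zero]

theorem mem_ttSpace_iff (hL : IsInner (-(killingForm ℝ L))) : T ∈ ttSpace k S ↔ IsTT k S T :=
  (isTT_iff hL).symm

theorem repOp_add (T U : LinearMap.BilinForm ℝ (tang k)) :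
    repOp (stdMetric k) (T + U) = repOp (stdMetric k) T + repOp (stdMetric k) U :=
  LinearMap.comp_add _ _ _

theorem repOp_smul (c : ℝ) (T : LinearMap.BilinForm ℝ (tang k)) :
    repOp (stdMetric k) (c • T) = c • repOp (stdMetric k) T :=
  LinearMap.comp_smul _ _ _

/-- `twist`, as a bilinear form. -/
noncomputable def twistForm (k : LieSubalgebra ℝ L) (T : LinearMap.BilinForm ℝ (tang k)) :
    LinearMap.BilinForm ℝ (tang k) :=
  LinearMap.mk₂ ℝ (twist k T)
    (fun X Y Z => by
      have : adP k (X + Y) = adP k X + adP k Y := LinearMap.ext fun V => brP_add_left X Y V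
      simp only [twist, this, add_mul, mul_add, map_add])
    (fun c X Z => by
      have : adP k (c • X) = c • adP k X := LinearMap.ext fun V => brP_smul_left c X V
      simp only [twist, this, smul_mul_assoc, mul_smul_comm, map_smul])
    (fun Z X Y => by
      have : adP k (X + Y) = adP k X + adP k Y := LinearMap.ext fun V => brP_add_left X Y V
      simp only [twist, this, mul_add, map_add])
    (fun c Z X => by
      have : adP k (c • X) = c • adP k X := LinearMap.ext fun V => brP_smul_left c X V
      simp only [twist, this, mul_smul_comm, map_smul])

theorem twistForm_apply (X Y : tang k) : twistForm k T X Y = twist k T X Y := rfl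

theorem repOp_twistForm (hL : IsInner (-(killingForm ℝ L))) {ι : Type*} [Fintype ι]
    [DecidableEq ι] {e : Module.Basis ι ℝ (tang k)} (he : IsONB (stdMetric k) e) :
    repOp (stdMetric k) (twistForm k T) =
      ∑ i, adP k (e i) * (repOp (stdMetric k) T * adP k (e i)) := by
  have hg := stdMetric_isInner (k := k) hL
  refine LinearMap.ext fun X => hg.eq_of_forall fun Y => ?_
  rw [apply_repOp hg, twistForm_apply, ← neg_neg (twist k T X Y), ← sum_brP_brP_apply hL he,
    LinearMap.sum_apply, map_sum, LinearMap.sum_apply, ← Finset.sum_neg_distrib]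
  refine Finset.sum_congr rfl fun i _ => ?_
  simp only [Module.End.mul_apply]
  rw [stdMetric_adP_skew hL, apply_repOp hg]
  rfl

/-- Invariance holds because isotropy operators commute with `T` and respect brackets, so the trace
is merely conjugated. Tracelessness uses the Einstein condition: by cyclicity the trace of the twist
is that of `T` times Σ `adP`², and this sum is a scalar. -/
theorem twistForm_mem (hL : IsInner (-(killingForm ℝ L))) (hS : IsAutSet k S) {ρ : ℝ}
    (hρ : IsEinstein k (stdMetric k) ρ) (hT : T ∈ ttSpace k S) : twistForm k T ∈ ttSpace k S := by
  have hg := stdMetric_isInner (k := k) hL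
  obtain ⟨h1, h2, h3⟩ := hT
  refine ⟨fun X Y => twist_symm hL h1 X Y, fun φ hφ X Y => ?_, ?_⟩
  · rw [isInvariant_iff hL hS] at h2
    rw [twistForm_apply, twistForm_apply, ← autP_apply, ← autP_apply]
    let f : tang k ≃ₗ[ℝ] tang k := LinearEquiv.ofBijective (autP k φ)
      ⟨autP_injective hL hS hφ, autP_surjective hL hS hφ⟩
    rw [twist, twist,
      ← LinearMap.trace_conj' (repOp (stdMetric k) T * (adP k X * adP k Y)) f]
    congr 1
    refine LinearMap.ext fun V => ?_
    obtain ⟨V, rfl⟩ := f.surjective V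
    rw [LinearEquiv.conj_apply_apply, f.symm_apply_apply]
    change repOp (stdMetric k) T (brP k (autP k φ X) (brP k (autP k φ Y) (autP k φ V))) =
      autP k φ (repOp (stdMetric k) T (brP k X (brP k Y V)))
    rw [← autP_brP hL hS hφ, ← autP_brP hL hS hφ, h2 φ hφ]
  · obtain ⟨e, he⟩ := exists_onb hg
    have h4 : ∑ i, adP k (e i) * adP k (e i) = -(2 - 4 * ρ) • LinearMap.id := by
      refine LinearMap.ext fun X => ?_
      rw [LinearMap.sum_apply]
      exact sum_brP_brP hL hρ he X
    rw [repOp_twistForm hL he, map_sum]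
    have h5 : ∀ i, LinearMap.trace ℝ (tang k) (adP k (e i) * (repOp (stdMetric k) T * adP k (e i)))
        = LinearMap.trace ℝ (tang k) (repOp (stdMetric k) T * (adP k (e i) * adP k (e i))) :=
      fun i => by rw [LinearMap.trace_mul_comm, mul_assoc]
    simp only [h5]
    rw [← map_sum, ← Finset.mul_sum, h4, mul_smul_comm, map_smul]
    change _ • LinearMap.trace ℝ (tang k) (repOp (stdMetric k) T) = 0
    rw [h3, smul_zero]

set_option synthInstance.maxHeartbeats 200000
set_option maxSynthPendingDepth 3
/-- The Lichnerowicz Laplacian as an operator on the space of invariant TT-tensors. -/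
noncomputable def lichOp (hL : IsInner (-(killingForm ℝ L))) (hS : IsAutSet k S) {ρ : ℝ}
    (hρ : IsEinstein k (stdMetric k) ρ) : ttSpace k S →ₗ[ℝ] ttSpace k S where
  toFun T := (2 - 4 * ρ) • T + ⟨twistForm k T, twistForm_mem hL hS hρ T.2⟩
  map_add' T U := by
    apply Subtype.ext
    refine LinearMap.ext₂ fun X Y => ?_
    simp [twistForm_apply, twist, repOp_add, add_mul]
    ring
  map_smul' c T := by
    apply Subtype.ext
    refine LinearMap.ext₂ fun X Y => ?_
    simp [twistForm_apply, twist, repOp_smul]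
    ring

/-- The trace form on invariant TT-tensors. -/
noncomputable def ttForm (k : LieSubalgebra ℝ L) (S : Set (L →ₗ[ℝ] L)) :
    LinearMap.BilinForm ℝ (ttSpace k S) :=
  LinearMap.mk₂ ℝ (fun T U => LinearMap.trace ℝ (tang k)
      (repOp (stdMetric k) T.1 * repOp (stdMetric k) U.1))
    (by intros; simp [add_mul, repOp_add]) (by intros; simp [repOp_smul])
    (by intros; simp [mul_add, repOp_add]) (by intros; simp [repOp_smul])

theorem ttForm_apply (T U : ttSpace k S) : ttForm k S T U = LinearMap.trace ℝ (tang k)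
      (repOp (stdMetric k) T.1 * repOp (stdMetric k) U.1) := rfl

theorem ttForm_isInner (hL : IsInner (-(killingForm ℝ L))) : IsInner (V := ttSpace k S) (ttForm k S) := by
  refine ⟨fun T U => by rw [ttForm_apply, ttForm_apply, LinearMap.trace_mul_comm], fun T hT => ?_⟩
  refine trace_sq_pos (stdMetric_isInner hL) (fun X Y => repOp_symm hL T.2.1 X Y) fun h => hT ?_
  apply Subtype.ext
  refine LinearMap.ext₂ fun X Y => ?_
  rw [← apply_repOp (stdMetric_isInner hL), h]
  simp

/-- The twist sends the operator of `T` to Σ ad_p(e_i) T ad_p(e_i), which cyclicity moves from one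
argument of the trace form to the other. -/
theorem lichOp_symm (hL : IsInner (-(killingForm ℝ L))) (hS : IsAutSet k S) {ρ : ℝ}
    (hρ : IsEinstein k (stdMetric k) ρ) (T U : ttSpace k S) :
    ttForm k S (lichOp hL hS hρ T) U = ttForm k S T (lichOp hL hS hρ U) := by
  obtain ⟨e, he⟩ := exists_onb (stdMetric_isInner (k := k) hL)
  simp only [lichOp, LinearMap.coe_mk, AddHom.coe_mk, map_add, map_smul, LinearMap.add_apply,
    LinearMap.smul_apply]
  congr 1
  simp only [ttForm_apply]
  rw [repOp_twistForm hL he, repOp_twistForm hL he, Finset.sum_mul, Finset.mul_sum, map_sum,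
    map_sum]
  refine Finset.sum_congr rfl fun i _ => ?_
  rw [mul_assoc, LinearMap.trace_mul_comm]
  simp only [mul_assoc]

/-- A symmetric operator on a nonzero finite-dimensional space has an eigenvector. Nonemptiness is
needed to bound `sInf` from below and `sSup` from above. -/
theorem lichSpec_nonempty (hL : IsInner (-(killingForm ℝ L))) (hS : IsAutSet k S) {ρ : ℝ}
    (hρ : IsEinstein k (stdMetric k) ρ)
    (hk : ∀ T, IsInvariant k S T → IsAdInvariant k T) (h : IsotropyReducible k S) :
    (lichSpec k S).Nonempty := by
  obtain ⟨T, hT0, hT⟩ := exists_isTT hL hS h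
  obtain ⟨e, μ, he, hμ⟩ := exists_eigenbasis (ttForm_isInner (S := S) hL) (lichOp hL hS hρ)
    (lichOp_symm hL hS hρ)
  have hnt : Nontrivial (ttSpace k S) :=
    ⟨⟨T, (mem_ttSpace_iff hL).2 hT⟩, 0, fun h => hT0 (congrArg Subtype.val h)⟩
  let i : Fin (Module.finrank ℝ (ttSpace k S)) := ⟨0, Module.finrank_pos⟩
  refine ⟨μ i, (e i).1, fun h => e.ne_zero i (Subtype.ext h), (mem_ttSpace_iff hL).1 (e i).2,
    fun X Y => ?_⟩
  rw [lich_stdMetric hL hρ (e i).2.1 (hk _ (e i).2.2.1)]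
  have := congrArg (fun U : ttSpace k S => U.1 X Y) (hμ i)
  simpa [lichOp, twistForm_apply] using this

end Isotropy

/-! ### Stability criteria and local minima of the scalar curvature. -/

section Stability

variable {L : Type*} [LieRing L] [LieAlgebra ℝ L] [FiniteDimensional ℝ L]
  {k : LieSubalgebra ℝ L} {S : Set (L →ₗ[ℝ] L)} {T : LinearMap.BilinForm ℝ (tang k)}
  {ι : Type*} [Fintype ι] [DecidableEq ι] {e : Module.Basis ι ℝ (tang k)} {a : ι → ℝ} {ρ : ℝ}

/-- 2|a_j a_l| ≤ a_j² + a_l² together with the constant marginals. This crude bound is all that the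
three applications require. -/
theorem abs_bracketSum_le (hL : IsInner (-(killingForm ℝ L)))
    (hρ : IsEinstein k (stdMetric k) ρ) (he : IsONB (stdMetric k) e) (a : ι → ℝ) :
    |bracketSum k e a| ≤ (2 - 4 * ρ) * ∑ i, a i ^ 2 := by
  have h2 := sum_weight_mid hL hρ he fun i => a i ^ 2
  have h3 := sum_weight_right hL hρ he fun i => a i ^ 2
  have h4 : ∑ i, ∑ j, ∑ l, strConst k (stdMetric k) e i j l ^ 2 * ((a j ^ 2 + a l ^ 2) / 2) =
      (2 - 4 * ρ) * ∑ i, a i ^ 2 := by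
    have : ∀ i j l, strConst k (stdMetric k) e i j l ^ 2 * ((a j ^ 2 + a l ^ 2) / 2) =
        1 / 2 * (strConst k (stdMetric k) e i j l ^ 2 * a j ^ 2) +
        1 / 2 * (strConst k (stdMetric k) e i j l ^ 2 * a l ^ 2) := fun i j l => by ring
    simp only [this, Finset.sum_add_distrib, ← Finset.mul_sum] at *
    linarith
  rw [← h4, bracketSum, abs_le]
  constructor
  · simp only [← Finset.sum_neg_distrib]
    refine Finset.sum_le_sum fun i _ => Finset.sum_le_sum fun j _ => Finset.sum_le_sum fun l _ => ?_
    nlinarith [mul_nonneg (sq_nonneg (strConst k (stdMetric k) e i j l)) (sq_nonneg (a j + a l))]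
  · refine Finset.sum_le_sum fun i _ => Finset.sum_le_sum fun j _ => Finset.sum_le_sum fun l _ => ?_
    nlinarith [mul_nonneg (sq_nonneg (strConst k (stdMetric k) e i j l)) (sq_nonneg (a j - a l))]

theorem sum_sq_pos (hL : IsInner (-(killingForm ℝ L))) (he : IsONB (stdMetric k) e)
    (ha : ∀ i, repOp (stdMetric k) T (e i) = a i • e i) (hT0 : T ≠ 0) : 0 < ∑ i, a i ^ 2 := by
  refine lt_of_le_of_ne (Finset.sum_nonneg fun i _ => sq_nonneg _) fun h => hT0 ?_
  have h0 : ∀ i, a i = 0 := fun i => by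
    have := (Finset.sum_eq_zero_iff_of_nonneg fun i _ => sq_nonneg (a i)).1 h.symm i
      (Finset.mem_univ i)
    exact pow_eq_zero_iff two_ne_zero |>.1 this
  refine e.ext fun i => LinearMap.ext fun Y => ?_
  rw [← apply_repOp (stdMetric_isInner hL), ha, h0]
  simp

/-- An eigenvalue of the Lichnerowicz Laplacian in terms of structure constants. -/
theorem lich_eigenvalue (hL : IsInner (-(killingForm ℝ L)))
    (hρ : IsEinstein k (stdMetric k) ρ) (hT : ∀ X Y, T X Y = T Y X) (hTk : IsAdInvariant k T)
    (he : IsONB (stdMetric k) e) (ha : ∀ i, repOp (stdMetric k) T (e i) = a i • e i) {c : ℝ}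
    (hc : ∀ X Y, lich k (stdMetric k) (fun Y Z => T Y Z) X Y = c * T X Y) :
    (2 - 4 * ρ) * ∑ i, a i ^ 2 - bracketSum k e a = c * ∑ i, a i ^ 2 := by
  have hTi : ∀ i, T (e i) (e i) = a i := fun i => by
    rw [← apply_repOp (stdMetric_isInner hL), ha, map_smul, LinearMap.smul_apply, he i i]
    simp
  have h1 : ∀ i, (2 - 4 * ρ) * a i ^ 2
      - ∑ j, ∑ l, a i * a j * strConst k (stdMetric k) e i j l ^ 2 = c * a i ^ 2 := fun i => by
    have h := hc (e i) (e i)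
    rw [lich_stdMetric hL hρ hT hTk, twist_basis hL hT he ha, hTi] at h
    have h2 : ∑ j, ∑ l, a i * a j * strConst k (stdMetric k) e i j l ^ 2 =
        a i * ∑ j, ∑ l, a j * strConst k (stdMetric k) e i j l ^ 2 := by
      simp only [Finset.mul_sum, mul_assoc]
    rw [h2]
    linear_combination a i * h
  have h3 : ∑ i, ∑ j, ∑ l, a i * a j * strConst k (stdMetric k) e i j l ^ 2 = bracketSum k e a := by
    have h4 : ∑ i, ∑ j, ∑ l, a i * a l * strConst k (stdMetric k) e i j l ^ 2 =
        bracketSum k e a := by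
      rw [bracketSum, Finset.sum_comm]
      simp only [strConst_sq_left]
    rw [← h4]
    refine Finset.sum_congr rfl fun i _ => ?_
    rw [Finset.sum_comm]
    simp only [strConst_sq_right hL i]
  rw [Finset.mul_sum, Finset.mul_sum, ← h3, ← Finset.sum_sub_distrib]
  exact Finset.sum_congr rfl fun i _ => h1 i

theorem exists_diagonal_tt (hL : IsInner (-(killingForm ℝ L))) (hT : IsTT k S T) :
    ∃ (e : Module.Basis (Fin (Module.finrank ℝ (tang k))) ℝ (tang k))
      (a : Fin (Module.finrank ℝ (tang k)) → ℝ), IsONB (stdMetric k) e ∧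
      (∀ i, repOp (stdMetric k) T (e i) = a i • e i) ∧ ∑ i, a i = 0 := by
  obtain ⟨h1, -, h3⟩ := (isTT_iff hL).1 hT
  obtain ⟨e, a, he, ha⟩ := exists_diagonal (stdMetric_isInner hL) h1
  exact ⟨e, a, he, ha, by rw [← h3, trace_eq_sum_of_eigen _ ha]⟩

/-- For an eigentensor, Q = (2 - 4ρ - c)|a|²; inserting this into the Casimir form gives (2c + 4ρ -
1)|a|², to which the Casimir bounds apply. -/
theorem lichSpec_bounds (hL : IsInner (-(killingForm ℝ L)))
    (hk : ∀ T, IsInvariant k S T → IsAdInvariant k T) (hρ : IsEinstein k (stdMetric k) ρ) {c : ℝ}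
    (hc : c ∈ lichSpec k S) :
    (1 - 4 * ρ + lamTau L) / 2 ≤ c ∧ c ≤ (1 - 4 * ρ + lamTauMax L) / 2 := by
  obtain ⟨T, hT0, hT, hc⟩ := hc
  obtain ⟨e, a, he, ha, hsum⟩ := exists_diagonal_tt hL hT
  have hpos := sum_sq_pos hL he ha hT0
  have h1 := lich_eigenvalue hL hρ hT.1 (hk T hT.2.1) he ha hc
  obtain ⟨h2, h3⟩ := casTau_bounds_tensor hL hρ hT.1 (hk T hT.2.1) he ha hsum
  rw [← bracketSum] at h2 h3
  constructor
  · refine le_of_mul_le_mul_right ?_ hpos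
    linarith
  · refine le_of_mul_le_mul_right ?_ hpos
    linarith

/-- Elimination of Q between the second variation and the Casimir form; the number `n` is |a|². -/
theorem scalHess_bounds (hL : IsInner (-(killingForm ℝ L)))
    (hk : ∀ T, IsInvariant k S T → IsAdInvariant k T) (hρ : IsEinstein k (stdMetric k) ρ)
    (hT : IsTT k S T) : ∃ n : ℝ, 0 ≤ n ∧ (T ≠ 0 → 0 < n) ∧
      (8 * ρ - 1 - lamTauMax L) / 4 * n ≤ scalHess k T ∧
      scalHess k T ≤ (8 * ρ - 1 - lamTau L) / 4 * n := by
  obtain ⟨e, a, he, ha, hsum⟩ := exists_diagonal_tt hL hT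
  obtain ⟨h2, h3⟩ := casTau_bounds_tensor hL hρ hT.1 (hk T hT.2.1) he ha hsum
  rw [← bracketSum] at h2 h3
  refine ⟨∑ i, a i ^ 2, Finset.sum_nonneg fun i _ => sq_nonneg _, sum_sq_pos hL he ha, ?_, ?_⟩ <;>
  · rw [scalHess_eq hL hρ he ha hsum]
    linarith

/-- Cubic Taylor remainder in which one factor |x| is traded for `δ`, leaving an error comparable to
the quadratic term. -/
theorem abs_exp_sub_le {x δ : ℝ} (hx : |x| ≤ δ) (hδ : δ ≤ 1) :
    |Real.exp x - (1 + x + x ^ 2 / 2)| ≤ δ * x ^ 2 := by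
  have h := Real.exp_bound (hx.trans hδ) (n := 3) (by norm_num)
  simp only [Finset.sum_range_succ, Finset.sum_range_zero, Nat.factorial] at h
  norm_num at h
  refine h.trans ?_
  have h1 : |x| ^ 3 = |x| * x ^ 2 := by rw [pow_succ' |x| 2, sq_abs]
  rw [h1]
  nlinarith [mul_le_mul_of_nonneg_right hx (sq_nonneg x), abs_nonneg x, sq_nonneg x,
    mul_nonneg (abs_nonneg x) (sq_nonneg x)]

theorem abs_log_le {x ε : ℝ} (hx : |x - 1| ≤ ε) (hε : ε ≤ 1 / 2) : |Real.log x| ≤ 2 * ε := by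
  have h0 := abs_nonneg (x - 1)
  rw [abs_le] at hx
  have hx0 : 0 < x := by linarith
  rw [abs_le]
  constructor
  · have h1 := Real.one_sub_inv_le_log_of_pos hx0
    have h2 : x⁻¹ ≤ 1 + 2 * ε := by
      rw [inv_le_iff_one_le_mul₀ hx0]
      nlinarith
    linarith
  · have := Real.log_le_sub_one_of_pos hx0
    linarith

/-- If the second variation is uniformly positive on diagonal directions, then the standard metric
is a local minimum of the scalar curvature. -/
theorem isLocalMinScal_of_pos (hL : IsInner (-(killingForm ℝ L))) (hS : IsAutSet k S)
    (hρ : IsEinstein k (stdMetric k) ρ) {δ : ℝ} (hδ : 0 < δ)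
    (h : ∀ T, (∀ X Y, T X Y = T Y X) → IsInvariant k S T →
      ∀ (e : Module.Basis (Fin (Module.finrank ℝ (tang k))) ℝ (tang k))
      (a : Fin (Module.finrank ℝ (tang k)) → ℝ), IsONB (stdMetric k) e →
      (∀ i, repOp (stdMetric k) T (e i) = a i • e i) → ∑ i, a i = 0 →
      δ * ∑ i, a i ^ 2 ≤ (3 * ρ - 1) * ∑ i, a i ^ 2 + 1 / 2 * bracketSum k e a) :
    IsLocalMinScal k S := by
  have hg := stdMetric_isInner (k := k) hL
  set C := |2 - 4 * ρ| with hC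
  have hC0 : 0 ≤ C := abs_nonneg _
  -- With eigenvalues within ε of 1, their logarithms are at most 2ε and the exponents at most 6ε ≤
  -- 1/2. The quadratic part is at least δ/2 times Σ s_i², and the Taylor errors are at most ε(1 +
  -- 8C) times it, which dictates the second bound.
  refine ⟨min (1 / 12) (δ / (2 * (1 + 8 * C))), by positivity, fun m hm hε => ?_⟩
  set ε := min (1 / 12) (δ / (2 * (1 + 8 * C))) with hεd
  have hε0 : 0 < ε := by positivity
  have hε1 : ε ≤ 1 / 12 := min_le_left _ _
  have hε2 : ε * (2 * (1 + 8 * C)) ≤ δ :=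
    (le_div_iff₀ (by positivity)).1 (min_le_right _ _)
  obtain ⟨e, μ, he, hμ⟩ := exists_diagonal hg hm.1.1
  have hme : ∀ i j, m (e i) (e j) = if i = j then μ i else 0 := fun i j => by
    rw [← apply_repOp hg, hμ, map_smul, LinearMap.smul_apply, he i j]
    simp
  have hμε : ∀ i, |μ i - 1| ≤ ε := fun i => by
    have := hε (e i)
    rwa [hme, he i i, if_pos rfl, if_pos rfl, mul_one] at this
  have hμ0 : ∀ i, 0 < μ i := fun i => by linarith [(abs_le.1 (hμε i)).1]
  set s : Fin (Module.finrank ℝ (tang k)) → ℝ := fun i => Real.log (μ i) with hs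
  have hs1 : ∀ i, |s i| ≤ 2 * ε := fun i => abs_log_le (hμε i) (by linarith)
  have hsum : ∑ i, s i = 0 := by
    have := hm.2.2
    rw [volRatioSq_diagonal hL hμ] at this
    rw [← Real.log_prod fun i _ => (hμ0 i).ne', this, Real.log_one]
  have hexp : ∀ i j, m (e i) (e j) = if i = j then Real.exp (s i) else 0 := fun i j => by
    rw [hme, Real.exp_log (hμ0 i)]
  have hstd : ∀ i j, stdMetric k (e i) (e j) =
      if i = j then Real.exp ((fun _ => (0 : ℝ)) i) else 0 := fun i j => by
    rw [he i j, Real.exp_zero]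
  let D : tang k →ₗ[ℝ] tang k := e.constr ℝ fun i => s i • e i
  have hD : ∀ i, D (e i) = s i • e i := fun i => e.constr_basis ℝ _ i
  have hDs : ∀ X Y, formOf k D X Y = formOf k D Y X := fun X Y => by
    have : formOf k D = LinearMap.flip (formOf k D) := by
      refine e.ext fun i => e.ext fun j => ?_
      change formOf k D (e i) (e j) = formOf k D (e j) (e i)
      rw [formOf_apply, formOf_apply, hD, hD, map_smul, map_smul,
        LinearMap.smul_apply, LinearMap.smul_apply, he i j, he j i]
      by_cases hij : i = j
      · subst hij; rfl
      · rw [if_neg hij, if_neg (Ne.symm hij), smul_zero, smul_zero]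
    exact LinearMap.congr_fun₂ this X Y
  have hpos := h (formOf k D) hDs (isInvariant_of_diagonal hL hS hm.2.1 hμ hD
    fun i j hij => by simp only [hs, hij]) e s he (by rw [repOp_formOf hL]; exact hD) hsum
  rw [scal_diagonal hL he hexp, scal_diagonal hL he hstd]
  have hlin := sum_linear hL hρ he s
  have hquad := sum_quadratic hL hρ he s
  have hbd := abs_bracketSum_le hL hρ he s
  rw [hsum, mul_zero] at hlin
  set Q := ∑ i, s i ^ 2 with hQ
  have hQ0 : 0 ≤ Q := Finset.sum_nonneg fun i _ => sq_nonneg _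
  have h1 : (Module.finrank ℝ (tang k) : ℝ) + (1 / 2 - 2 * ε) * Q ≤ ∑ i, Real.exp (-s i) := by
    have : ∑ i, (1 - s i + (1 / 2 - 2 * ε) * s i ^ 2) =
        (Module.finrank ℝ (tang k) : ℝ) + (1 / 2 - 2 * ε) * Q := by
      rw [Finset.sum_add_distrib, Finset.sum_sub_distrib, hsum, ← Finset.mul_sum, ← hQ]
      simp
    rw [← this]
    refine Finset.sum_le_sum fun i _ => ?_
    have := (abs_le.1 (abs_exp_sub_le (x := -s i) (δ := 2 * ε) (by rw [abs_neg]; exact hs1 i)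
      (by linarith))).1
    rw [neg_sq] at this
    linarith
  have h2 : ∑ i, ∑ j, ∑ l, strConst k (stdMetric k) e i j l ^ 2 * Real.exp (s l - s i - s j) ≤
      ∑ i, ∑ j, ∑ l, strConst k (stdMetric k) e i j l ^ 2 + (1 / 2 + 6 * ε) *
      ∑ i, ∑ j, ∑ l, strConst k (stdMetric k) e i j l ^ 2 * (s l - s i - s j) ^ 2 := by
    have : ∑ i, ∑ j, ∑ l, (strConst k (stdMetric k) e i j l ^ 2 +
        strConst k (stdMetric k) e i j l ^ 2 * (s l - s i - s j) +
        (1 / 2 + 6 * ε) * (strConst k (stdMetric k) e i j l ^ 2 * (s l - s i - s j) ^ 2)) =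
        ∑ i, ∑ j, ∑ l, strConst k (stdMetric k) e i j l ^ 2 + (1 / 2 + 6 * ε) *
      ∑ i, ∑ j, ∑ l, strConst k (stdMetric k) e i j l ^ 2 * (s l - s i - s j) ^ 2 := by
      simp only [Finset.sum_add_distrib, hlin, ← Finset.mul_sum, add_zero]
    rw [← this]
    refine Finset.sum_le_sum fun i _ => Finset.sum_le_sum fun j _ => Finset.sum_le_sum fun l _ => ?_
    have hx : |s l - s i - s j| ≤ 6 * ε := by
      refine (abs_sub _ _).trans ?_
      have := abs_sub (s l) (s i)
      linarith [hs1 l, hs1 i, hs1 j]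
    have := (abs_le.1 (abs_exp_sub_le hx (by linarith))).2
    nlinarith [sq_nonneg (strConst k (stdMetric k) e i j l)]
  rw [hquad] at h2
  simp only [neg_zero, Real.exp_zero, sub_zero, mul_one, Finset.sum_const, Finset.card_univ,
    Fintype.card_fin, nsmul_eq_mul]
  have h3 : (2 - 4 * ρ) * Q ≤ C * Q := mul_le_mul_of_nonneg_right (le_abs_self _) hQ0
  have h4 := (abs_le.1 hbd).1
  have h5 : ε * (3 * (2 - 4 * ρ) * Q - 2 * bracketSum k e s) ≤ ε * (5 * (C * Q)) :=
    mul_le_mul_of_nonneg_left (by linarith) hε0.le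
  have h6 : ε * (2 * (1 + 8 * C)) * Q ≤ δ * Q := mul_le_mul_of_nonneg_right hε2 hQ0
  have h7 : 0 ≤ ε * (C * Q) := by positivity
  nlinarith

/-- For Einstein constants greater than `2/5` the second variation is positive. -/
theorem isLocalMinScal_of_lt (hL : IsInner (-(killingForm ℝ L))) (hS : IsAutSet k S)
    (hρ : IsEinstein k (stdMetric k) ρ) (h : 2 / 5 < ρ) : IsLocalMinScal k S := by
  refine isLocalMinScal_of_pos hL hS hρ (δ := 5 * ρ - 2) (by linarith) fun T _ _ e a he _ _ => ?_
  have := (abs_le.1 (abs_bracketSum_le hL hρ he a)).1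
  linarith

/-- Reducibility provides a nonzero TT-tensor, and the bound on `bracketSum` gives it second
variation at least (5ρ - 2)|a|². -/
theorem gUnstable_of_lt (hL : IsInner (-(killingForm ℝ L))) (hS : IsAutSet k S)
    (hρ : IsEinstein k (stdMetric k) ρ) (h : 2 / 5 < ρ) (hred : IsotropyReducible k S) :
    GUnstable k S := by
  intro hst
  obtain ⟨T, hT0, hT⟩ := exists_isTT hL hS hred
  obtain ⟨e, a, he, ha, hsum⟩ := exists_diagonal_tt hL hT
  have h1 := hst T hT
  rw [scalHess_eq hL hρ he ha hsum] at h1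
  have h2 := (abs_le.1 (abs_bracketSum_le hL hρ he a)).1
  have h3 := mul_pos (sub_pos.2 h) (sum_sq_pos hL he ha hT0)
  linarith

/-- The stability criteria for the standard metric. -/
theorem stability_criteria (hL : IsInner (-(killingForm ℝ L))) (hS : IsAutSet k S)
    (hk : ∀ T, IsInvariant k S T → IsAdInvariant k T) (hρ : IsEinstein k (stdMetric k) ρ) :
    (8 * ρ - 1 < lamTau L →
      GStable k S ∧ (IsotropyReducible k S → 2 * ρ < lamP k S)) ∧
    (8 * ρ - 1 = lamTau L →
      GSemistable k S ∧ (IsotropyReducible k S → 2 * ρ ≤ lamP k S)) ∧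
    (lamTauMax L < 8 * ρ - 1 →
      IsLocalMinScal k S ∧
      (IsotropyReducible k S → lamPMax k S < 2 * ρ ∧ GUnstable k S)) ∧
    (lamTauMax L = 8 * ρ - 1 → IsotropyReducible k S → lamPMax k S ≤ 2 * ρ) := by
  -- The numbers (1 - 4ρ + λ)/2 compare with 2ρ exactly as λ compares with 8ρ - 1.
  have hmin : IsotropyReducible k S → (1 - 4 * ρ + lamTau L) / 2 ≤ lamP k S := fun hr =>
    le_csInf (lichSpec_nonempty hL hS hρ hk hr) fun c hc => (lichSpec_bounds hL hk hρ hc).1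
  have hmax : IsotropyReducible k S → lamPMax k S ≤ (1 - 4 * ρ + lamTauMax L) / 2 := fun hr =>
    csSup_le (lichSpec_nonempty hL hS hρ hk hr) fun c hc => (lichSpec_bounds hL hk hρ hc).2
  refine ⟨fun h => ⟨fun T hT hT0 => ?_, fun hr => ?_⟩, fun h => ⟨fun T hT => ?_, fun hr => ?_⟩,
    fun h => ⟨?_, fun hr => ⟨?_, fun hst => ?_⟩⟩, fun h hr => ?_⟩
  · obtain ⟨n, -, hn, -, h1⟩ := scalHess_bounds hL hk hρ hT
    nlinarith [hn hT0]
  · linarith [hmin hr]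
  · obtain ⟨n, -, hn, -, h1⟩ := scalHess_bounds hL hk hρ hT
    rw [h, sub_self, zero_div, zero_mul] at h1
    exact h1
  · linarith [hmin hr]
  · refine isLocalMinScal_of_pos hL hS hρ (δ := (8 * ρ - 1 - lamTauMax L) / 4) (by linarith)
      fun T hT hTS e a he ha hsum => ?_
    have h1 := (casTau_bounds_tensor hL hρ hT (hk T hTS) he ha hsum).2
    rw [← bracketSum] at h1
    linarith
  · linarith [hmax hr]
  · obtain ⟨T, hT0, hT⟩ := exists_isTT hL hS hr
    obtain ⟨n, -, hn, h1, -⟩ := scalHess_bounds hL hk hρ hT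
    have := hst T hT
    nlinarith [hn hT0]
  · linarith [hmax hr]

end Stability

/-! ### Matrix exponentials, the Killing form of a compact group and infinitesimal invariance. -/

section Exponential

variable {ι : Type*} [Fintype ι] [DecidableEq ι]

attribute [local instance] Matrix.linftyOpNormedRing Matrix.linftyOpNormedAlgebra in
-- The curve is differentiated after applying a linear map to a normed space, so that no norm on
-- matrices enters the statement.
theorem hasDerivAt_exp_mul {E : Type*} [NormedAddCommGroup E] [NormedSpace ℝ E]
    (f : Matrix ι ι ℂ →ₗ[ℝ] E) (X : Matrix ι ι ℂ) (t : ℝ) :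
    HasDerivAt (fun t : ℝ => f (NormedSpace.exp (t • X))) (f (X * NormedSpace.exp (t • X))) t :=
  (LinearMap.toContinuousLinearMap f).hasFDerivAt.comp_hasDerivAt t
    (hasDerivAt_exp_smul_const' X t)

theorem hasDerivAt_exp {E : Type*} [NormedAddCommGroup E] [NormedSpace ℝ E]
    (f : Matrix ι ι ℂ →ₗ[ℝ] E) (X : Matrix ι ι ℂ) :
    HasDerivAt (fun t : ℝ => f (NormedSpace.exp (t • X))) (f X) 0 := by
  simpa using hasDerivAt_exp_mul f X 0

attribute [local instance] Matrix.linftyOpNormedRing Matrix.linftyOpNormedAlgebra in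
theorem hasDerivAt_exp_conj {E : Type*} [NormedAddCommGroup E] [NormedSpace ℝ E]
    (f : Matrix ι ι ℂ →ₗ[ℝ] E) (X Y : Matrix ι ι ℂ) :
    HasDerivAt (fun t : ℝ => f (NormedSpace.exp (t • X) * Y * NormedSpace.exp (t • -X)))
      (f (X * Y - Y * X)) 0 := by
  have h1 := hasDerivAt_exp_smul_const' (𝕂 := ℝ) X 0
  have h2 := hasDerivAt_exp_smul_const' (𝕂 := ℝ) (-X) 0
  have h := (LinearMap.toContinuousLinearMap f).hasFDerivAt.comp_hasDerivAt 0
    ((h1.mul_const Y).mul h2)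
  refine h.congr_deriv (congrArg f ?_)
  simp [sub_eq_add_neg]

/-- A linear map that vanishes on a one-parameter group vanishes on its generator. -/
theorem map_generator_eq_zero (f : Matrix ι ι ℂ →ₗ[ℝ] ℂ) (X : Matrix ι ι ℂ)
    (h : ∀ t : ℝ, f (NormedSpace.exp (t • X)) = 0) : f X = 0 := by
  have h1 := hasDerivAt_exp f X
  simp only [h] at h1
  exact h1.unique (hasDerivAt_const 0 0)

theorem exp_smul_mul_exp_smul_neg (X : Matrix ι ι ℂ) (t : ℝ) :
    NormedSpace.exp (t • X) * NormedSpace.exp (t • -X) = 1 := by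
  have := Matrix.exp_neg (t • X)
  rw [smul_neg, this]
  exact Matrix.mul_nonsing_inv _ ((Matrix.isUnit_iff_isUnit_det _).1 (Matrix.isUnit_exp _))

theorem conjTranspose_exp_smul {X : Matrix ι ι ℂ} {t : ℝ} {g : unitaryGroup ι ℂ}
    (h : (g : Matrix ι ι ℂ) = NormedSpace.exp (t • X)) :
    (NormedSpace.exp (t • X))ᴴ = NormedSpace.exp (t • -X) := by
  have h1 : (NormedSpace.exp (t • X))ᴴ * NormedSpace.exp (t • X) = 1 := by
    rw [← h]
    exact (Unitary.mem_iff.1 g.2).1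
  calc _ = (NormedSpace.exp (t • X))ᴴ * (NormedSpace.exp (t • X) * NormedSpace.exp (t • -X)) := by
        rw [exp_smul_mul_exp_smul_neg, mul_one]
    _ = _ := by rw [← mul_assoc, h1, one_mul]

/-- Skew-Hermitian matrices form a real Lie algebra. -/
def skewHerm (ι : Type*) [Fintype ι] [DecidableEq ι] : LieSubalgebra ℝ (Matrix ι ι ℂ) where
  carrier := {X | Xᴴ = -X}
  add_mem' := fun {a b} ha hb => by
    simp only [Set.mem_ofPred_eq] at *
    rw [conjTranspose_add, ha, hb, neg_add]
  zero_mem' := by simp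
  smul_mem' := fun c X hX => by
    simp only [Set.mem_ofPred_eq] at *
    rw [conjTranspose_smul, hX]; simp
  lie_mem' := fun {a b} ha hb => by
    simp only [Set.mem_ofPred_eq, Submodule.mem_mk] at *
    simp only [Ring.lie_def, conjTranspose_sub, conjTranspose_mul]
    erw [ha, hb]
    simp

variable {G K : Subgroup (unitaryGroup ι ℂ)}

/-- Differentiation at 0 of the unitarity relation exp(tX)ᴴ = exp(-tX), entry by entry. It suffices
to treat generators, since skew-Hermitian matrices form a Lie algebra. -/
theorem lieAlg_le_skewHerm : lieAlg G ≤ skewHerm ι := by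
  refine LieSubalgebra.lieSpan_le.2 fun X hX => ?_
  change Xᴴ = -X
  ext i j
  let f : Matrix ι ι ℂ →ₗ[ℝ] ℂ :=
    { toFun := fun A => star (A j i)
      map_add' := by simp
      map_smul' := by simp }
  let f' : Matrix ι ι ℂ →ₗ[ℝ] ℂ := { toFun := fun A => A i j, map_add' := by simp, map_smul' := by simp }
  have h1 := hasDerivAt_exp f X
  have h2 := hasDerivAt_exp f' (-X)
  have h3 : (fun t : ℝ => f (NormedSpace.exp (t • X))) =
      fun t : ℝ => f' (NormedSpace.exp (t • -X)) := funext fun t => by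
    obtain ⟨g, -, hg⟩ := hX t
    rw [← conjTranspose_exp_smul hg]
    rfl
  rw [h3] at h1
  exact h1.unique h2

theorem conjTranspose_lieAlg (X : lieAlg G) : (X : Matrix ι ι ℂ)ᴴ = -(X : Matrix ι ι ℂ) :=
  lieAlg_le_skewHerm X.2

/-- The real trace form on a Lie algebra of skew-Hermitian matrices. -/
noncomputable def reTraceForm (G : Subgroup (unitaryGroup ι ℂ)) :
    LinearMap.BilinForm ℝ (lieAlg G) :=
  LinearMap.mk₂ ℝ (fun X Y => -((X : Matrix ι ι ℂ) * (Y : Matrix ι ι ℂ)).trace.re)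
    (by intros; simp [add_mul]; ring) (by intros; simp)
    (by intros; simp [mul_add]; ring) (by intros; simp)

theorem re_trace_conjTranspose_mul_self (A : Matrix ι ι ℂ) :
    (Aᴴ * A).trace.re = ∑ i, ∑ j, ‖A i j‖ ^ 2 := by
  rw [Finset.sum_comm]
  simp [Matrix.trace, Matrix.mul_apply, Complex.sq_norm, Complex.normSq_apply]

theorem re_trace_neg_sq_pos {A : Matrix ι ι ℂ} (hA : Aᴴ = -A) (h0 : A ≠ 0) :
    0 < -(A * A).trace.re := by
  have h1 : -(A * A).trace.re = (Aᴴ * A).trace.re := by rw [hA]; simp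
  rw [h1, re_trace_conjTranspose_mul_self]
  by_contra! h
  refine h0 (Matrix.ext fun i j => ?_)
  have h2 := (Finset.sum_eq_zero_iff_of_nonneg fun i _ =>
    Finset.sum_nonneg fun j _ => sq_nonneg ‖A i j‖).1
    (le_antisymm h (Finset.sum_nonneg fun i _ => Finset.sum_nonneg fun j _ => sq_nonneg _)) i
    (Finset.mem_univ i)
  have h3 := (Finset.sum_eq_zero_iff_of_nonneg fun j _ => sq_nonneg ‖A i j‖).1 h2 j
    (Finset.mem_univ j)
  simpa using h3

theorem reTraceForm_isInner : IsInner (reTraceForm G) := by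
  refine ⟨fun X Y => ?_, fun X hX => ?_⟩
  · change -_ = -_
    rw [Matrix.trace_mul_comm]
  · exact re_trace_neg_sq_pos (conjTranspose_lieAlg X) fun h => hX (Subtype.ext h)

theorem reTraceForm_lie (X Y Z : lieAlg G) :
    reTraceForm G ⁅X, Y⁆ Z = -reTraceForm G Y ⁅X, Z⁆ := by
  change -(((X : Matrix ι ι ℂ) * (Y : Matrix ι ι ℂ) - (Y : Matrix ι ι ℂ) * (X : Matrix ι ι ℂ)) *
    (Z : Matrix ι ι ℂ)).trace.re = - -((Y : Matrix ι ι ℂ) * ((X : Matrix ι ι ℂ) * (Z : Matrix ι ι ℂ)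
      - (Z : Matrix ι ι ℂ) * (X : Matrix ι ι ℂ))).trace.re
  rw [sub_mul, mul_sub, Matrix.trace_sub, Matrix.trace_sub, mul_assoc, Matrix.trace_mul_comm,
    mul_assoc, mul_assoc]
  simp

/-- The Killing form of a compact Lie algebra with trivial center is negative definite. -/
theorem killing_isInner_of_center (hc : ∀ X : lieAlg G, (∀ Y : lieAlg G, ⁅X, Y⁆ = 0) → X = 0) :
    IsInner (-(killingForm ℝ (lieAlg G))) := by
  have hq := reTraceForm_isInner (G := G)
  obtain ⟨e, he⟩ := exists_onb hq
  refine ⟨fun X Y => ?_, fun X hX => ?_⟩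
  · exact congrArg Neg.neg (killing_symm X Y)
  -- The real trace form is an ad-invariant inner product, so -B(X, X) is the sum of the squared
  -- norms of [X, e_i] and vanishes only for central X.
  · have h1 : (-(killingForm ℝ (lieAlg G))) X X =
        ∑ i, reTraceForm G ⁅X, e i⁆ ⁅X, e i⁆ := by
      rw [LinearMap.neg_apply, LinearMap.neg_apply, killingForm_apply_apply, trace_eq_sum he,
        ← Finset.sum_neg_distrib]
      refine Finset.sum_congr rfl fun i _ => ?_
      rw [LinearMap.comp_apply, LieAlgebra.ad_apply, LieAlgebra.ad_apply, reTraceForm_lie, neg_neg,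
        hq.1]
    have hnn : ∀ Y, 0 ≤ reTraceForm G Y Y := fun Y => by
      by_cases h : Y = 0
      · simp [h]
      · exact (hq.2 Y h).le
    rw [h1]
    refine lt_of_le_of_ne (Finset.sum_nonneg fun i _ => hnn _) fun h => hX (hc X fun Y => ?_)
    have h2 : ∀ i, ⁅X, e i⁆ = 0 := fun i => by
      by_contra hne
      have := (Finset.sum_eq_zero_iff_of_nonneg fun i _ => hnn _).1 h.symm i (Finset.mem_univ i)
      exact (hq.2 _ hne).ne' this
    have h3 : LieAlgebra.ad ℝ (lieAlg G) X = 0 := e.ext fun i => h2 i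
    exact LinearMap.congr_fun h3 Y

/-- A semisimple Lie algebra has trivial center, which is all that negative definiteness needs here.
-/
theorem killing_isInner_of_semisimple (h : LieAlgebra.IsSemisimple ℝ (lieAlg G)) :
    IsInner (-(killingForm ℝ (lieAlg G))) := by
  refine killing_isInner_of_center fun X hX => ?_
  have h1 : LieAlgebra.center ℝ (lieAlg G) = ⊥ := LieAlgebra.center_eq_bot ℝ _
  have h2 : X ∈ LieAlgebra.center ℝ (lieAlg G) := by
    rw [LieModule.mem_maxTrivSubmodule]
    intro Y
    rw [← lie_skew, hX, neg_zero]
  rwa [h1, LieSubmodule.mem_bot] at h2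

theorem lieAlg_mono (h : K ≤ G) : lieAlg K ≤ lieAlg G :=
  LieSubalgebra.lieSpan_mono fun X hX t =>
    let ⟨g, hg, he⟩ := hX t
    ⟨g, h hg, he⟩

theorem mem_subK (z : lieAlg G) : z ∈ subK G K ↔ (z : Matrix ι ι ℂ) ∈ lieAlg K := Iff.rfl

theorem coe_Ad (g : G) (X : lieAlg G) : (Ad G g X : Matrix ι ι ℂ) =
    (g : Matrix ι ι ℂ) * (X : Matrix ι ι ℂ) *
      (((g : unitaryGroup ι ℂ)⁻¹ : unitaryGroup ι ℂ) : Matrix ι ι ℂ) := rfl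

theorem isAutSet_AdK : IsAutSet (subK G K) (AdK G K) where
  map_lie := by
    rintro φ ⟨g, -, rfl⟩ x y
    exact Subtype.ext (LieHom.map_lie (conjHom (g : unitaryGroup ι ℂ)) x y)
  bijective := by
    rintro φ ⟨g, -, rfl⟩
    have h : ∀ (g : G) (X : lieAlg G), Ad G g (Ad G g⁻¹ X) = X := fun g X => Subtype.ext <| by
      have h2 : (g : Matrix ι ι ℂ) *
          (((g : unitaryGroup ι ℂ)⁻¹ : unitaryGroup ι ℂ) : Matrix ι ι ℂ) = 1 := by
        rw [← Submonoid.coe_mul]; simp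
      rw [coe_Ad, coe_Ad]
      simp only [Subgroup.coe_inv, inv_inv]
      rw [mul_assoc, mul_assoc, h2, mul_one, ← mul_assoc, h2, one_mul]
    refine Function.bijective_iff_has_inverse.2 ⟨Ad G g⁻¹, fun X => ?_, h g⟩
    have := h g⁻¹ X
    rwa [inv_inv] at this
  mem := by
    rintro φ ⟨g, hg, rfl⟩ z hz
    exact conjHom_mem K g hg z hz

/-- A tensor that is invariant under `Ad(K)` is invariant under the Lie algebra of `K`. -/
theorem isAdInvariant_of_isInvariant (hL : IsInner (-(killingForm ℝ (lieAlg G)))) (hKG : K ≤ G)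
    (T : LinearMap.BilinForm ℝ (tang (subK G K))) (hT : IsInvariant (subK G K) (AdK G K) T) :
    IsAdInvariant (subK G K) T := by
  have hg := stdMetric_isInner (k := subK G K) hL
  have hA := (isInvariant_iff hL isAutSet_AdK).1 hT
  set A := repOp (stdMetric (subK G K)) T
  -- `lieAlg K` is a Lie span, so the elements of `k` whose adjoint action commutes with `A` are
  -- shown to form a subalgebra; only generators of one-parameter groups are then left.
  let N : LieSubalgebra ℝ (lieAlg G) :=
    { carrier := {z | z ∈ subK G K ∧ ∀ X : tang (subK G K),
        A (projP (subK G K) ⁅z, (X : lieAlg G)⁆) = projP (subK G K) ⁅z, (A X : lieAlg G)⁆}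
      add_mem' := fun {a b} ha hb => ⟨add_mem ha.1 hb.1, fun X => by
        simp only [add_lie, map_add, ha.2, hb.2]⟩
      zero_mem' := ⟨zero_mem _, fun X => by simp⟩
      smul_mem' := fun c z hz => ⟨SMulMemClass.smul_mem c hz.1, fun X => by
        simp only [smul_lie, map_smul, hz.2]⟩
      lie_mem' := fun {a b} ha hb => ⟨LieSubalgebra.lie_mem _ ha.1 hb.1, fun X => by
        have h1 : ∀ z ∈ subK G K, ∀ Y : tang (subK G K),
            (projP (subK G K) ⁅z, (Y : lieAlg G)⁆ : lieAlg G) = ⁅z, (Y : lieAlg G)⁆ :=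
          fun z hz Y => congrArg Subtype.val (projP_coe hL ⟨_, lie_mem_tang hz Y⟩)
        have h2 : ∀ z w, (z ∈ subK G K) → (w ∈ subK G K) → (∀ X : tang (subK G K),
          A (projP (subK G K) ⁅z, (X : lieAlg G)⁆) = projP (subK G K) ⁅z, (A X : lieAlg G)⁆) →
          (∀ X : tang (subK G K),
          A (projP (subK G K) ⁅w, (X : lieAlg G)⁆) = projP (subK G K) ⁅w, (A X : lieAlg G)⁆) →
          ∀ X : tang (subK G K), A (projP (subK G K) ⁅z, ⁅w, (X : lieAlg G)⁆⁆) =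
            projP (subK G K) ⁅z, ⁅w, (A X : lieAlg G)⁆⁆ := fun z w hz hw h3 h4 X => by
          rw [← h1 w hw X, h3, h4, h1 w hw]
        rw [lie_lie, lie_lie, map_sub, map_sub, map_sub, h2 a b ha.1 hb.1 ha.2 hb.2,
          h2 b a hb.1 ha.1 hb.2 ha.2]⟩ }
  have hN : lieAlg K ≤ N.map (lieAlg G).incl := by
    refine LieSubalgebra.lieSpan_le.2 fun X hX => ?_
    have hXK : X ∈ lieAlg K := LieSubalgebra.subset_lieSpan hX
    refine ⟨⟨X, lieAlg_mono hKG hXK⟩, ⟨hXK, fun Y => hg.eq_of_forall fun Z => ?_⟩, rfl⟩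
    set x : lieAlg G := ⟨X, lieAlg_mono hKG hXK⟩
    -- The two functionals live on the Lie algebra only; extended to all matrices, they can be
    -- differentiated along conjugation by exp(tX).
    obtain ⟨f₁, hf₁⟩ := LinearMap.exists_extend (p := (lieAlg G).toSubmodule)
      ((stdMetric (subK G K)).flip Z ∘ₗ A ∘ₗ projP (subK G K))
    obtain ⟨f₂, hf₂⟩ := LinearMap.exists_extend (p := (lieAlg G).toSubmodule)
      ((stdMetric (subK G K)).flip Z ∘ₗ projP (subK G K))
    have d₁ := hasDerivAt_exp_conj f₁ X (Y : lieAlg G)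
    have d₂ := hasDerivAt_exp_conj f₂ X (A Y : lieAlg G)
    have e₁ : ∀ W : lieAlg G, f₁ W = stdMetric (subK G K) (A (projP (subK G K) W)) Z :=
      fun W => LinearMap.congr_fun hf₁ W
    have e₂ : ∀ W : lieAlg G, f₂ W = stdMetric (subK G K) (projP (subK G K) W) Z :=
      fun W => LinearMap.congr_fun hf₂ W
    have h3 : (fun t : ℝ => f₁ (NormedSpace.exp (t • X) * ((Y : lieAlg G) : Matrix ι ι ℂ) *
        NormedSpace.exp (t • -X))) = fun t : ℝ => f₂ (NormedSpace.exp (t • X) *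
          ((A Y : lieAlg G) : Matrix ι ι ℂ) * NormedSpace.exp (t • -X)) := funext fun t => by
      obtain ⟨g, hgK, hge⟩ := hX t
      have hinv : ((g⁻¹ : unitaryGroup ι ℂ) : Matrix ι ι ℂ) = NormedSpace.exp (t • -X) := by
        rw [UnitaryGroup.inv_val, Matrix.star_eq_conjTranspose, hge, conjTranspose_exp_smul hge]
      have h4 : ∀ W : lieAlg G, NormedSpace.exp (t • X) * (W : Matrix ι ι ℂ) *
        NormedSpace.exp (t • -X) = (Ad G ⟨g, hKG hgK⟩ W : Matrix ι ι ℂ) := fun W => by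
          rw [coe_Ad, ← hge, ← hinv]
      rw [h4, h4, e₁, e₂]
      have := hA (Ad G ⟨g, hKG hgK⟩) ⟨⟨g, hKG hgK⟩, hgK, rfl⟩ Y
      rw [autP_apply, autP_apply] at this
      rw [this]
    rw [h3] at d₁
    have h5 := d₁.unique d₂
    exact (e₁ ⁅x, (Y : lieAlg G)⁆).symm.trans (h5.trans (e₂ ⁅x, (A Y : lieAlg G)⁆))
  intro z hz X Y
  obtain ⟨w, hw, hwz⟩ := hN hz
  have hwz' : w = z := Subtype.ext hwz
  subst hwz'
  have h6 := isAdInvariant_stdMetric hL w hz (A X) Y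
  rw [← apply_repOp hg, ← apply_repOp hg T X]
  change stdMetric _ (A _) Y + _ = 0
  rw [hw.2]
  exact h6

end Exponential

/-! ### Traces of matrix operators on real forms. -/

section ComplexTrace

/-- On the real basis formed by `b i` and `I • b i`, a diagonal entry z contributes Re z twice. -/
theorem trace_restrictScalars_eq {V ι : Type*} [AddCommGroup V] [Module ℂ V] [Fintype ι]
    [Module ℝ V] [IsScalarTower ℝ ℂ V] [DecidableEq ι] (b : Module.Basis ι ℂ V) (f : V →ₗ[ℂ] V) :
    LinearMap.trace ℝ V (f.restrictScalars ℝ) = 2 * (LinearMap.trace ℂ V f).re := by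
  rw [LinearMap.trace_eq_matrix_trace ℝ (Complex.basisOneI.smulTower b),
    LinearMap.trace_eq_matrix_trace ℂ b, Matrix.trace, Matrix.trace, Fintype.sum_prod_type,
    Fin.sum_univ_two, Complex.re_sum, two_mul]
  congr 1 <;> refine Finset.sum_congr rfl fun i _ => ?_ <;>
    simp [LinearMap.toMatrix_apply, Module.Basis.smulTower_repr, Module.Basis.smulTower_apply]

/-- An antilinear map anticommutes with multiplication by I, so conjugating it by I changes its sign
but not its trace. -/
theorem trace_eq_zero_of_antilinear {V : Type*} [AddCommGroup V] [Module ℂ V] [Module ℝ V]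
    [IsScalarTower ℝ ℂ V] (g : V →ₗ[ℝ] V) (h : ∀ v, g (Complex.I • v) = -(Complex.I • g v)) :
    LinearMap.trace ℝ V g = 0 := by
  let m : V →ₗ[ℝ] V := (Complex.I • (LinearMap.id : V →ₗ[ℂ] V)).restrictScalars ℝ
  have hm : m * m = -1 := LinearMap.ext fun v => by
    change Complex.I • Complex.I • v = -v
    rw [smul_smul, Complex.I_mul_I, neg_smul, one_smul]
  have h1 : g * m = -(m * g) := LinearMap.ext h
  have h2 : LinearMap.trace ℝ V (g * m * m) = -LinearMap.trace ℝ V (g * m * m) := by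
    conv_lhs => rw [h1, neg_mul, map_neg, mul_assoc, LinearMap.trace_mul_comm]
  rw [mul_assoc, hm, mul_neg, mul_one, map_neg] at h2
  linarith

variable {ι : Type*} [Fintype ι] [DecidableEq ι]

/-- The operator `Z ↦ A Z D` on matrices. -/
def sandwich (A D : Matrix ι ι ℂ) : Matrix ι ι ℂ →ₗ[ℂ] Matrix ι ι ℂ :=
  LinearMap.mulLeft ℂ A ∘ₗ LinearMap.mulRight ℂ D

theorem sandwich_apply (A D Z : Matrix ι ι ℂ) : sandwich A D Z = A * (Z * D) := rfl

theorem trace_sandwich (A D : Matrix ι ι ℂ) :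
    LinearMap.trace ℂ (Matrix ι ι ℂ) (sandwich A D) = A.trace * D.trace := by
  rw [LinearMap.trace_eq_matrix_trace ℂ (Matrix.stdBasis ℂ ι ι), Matrix.trace,
    Fintype.sum_prod_type, Matrix.trace, Matrix.trace, Finset.sum_mul_sum]
  refine Finset.sum_congr rfl fun i _ => Finset.sum_congr rfl fun j _ => ?_
  rw [Matrix.diag_apply, LinearMap.toMatrix_apply, Matrix.stdBasis_eq_single, sandwich_apply]
  simp [Matrix.stdBasis, Matrix.mul_apply, Matrix.single_apply, ite_and]

theorem trace_sandwich_transpose (A D : Matrix ι ι ℂ) :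
    LinearMap.trace ℂ (Matrix ι ι ℂ) (sandwich A D ∘ₗ
      (Matrix.transposeLinearEquiv ι ι ℂ ℂ).toLinearMap) = (A * Dᵀ).trace := by
  rw [LinearMap.trace_eq_matrix_trace ℂ (Matrix.stdBasis ℂ ι ι), Matrix.trace,
    Fintype.sum_prod_type, Matrix.trace]
  refine Finset.sum_congr rfl fun i _ => ?_
  rw [Matrix.diag_apply, Matrix.mul_apply]
  refine Finset.sum_congr rfl fun j _ => ?_
  rw [Matrix.diag_apply, LinearMap.toMatrix_apply, Matrix.stdBasis_eq_single]
  simp [Matrix.stdBasis, sandwich_apply, Matrix.mul_apply, Matrix.single_apply, ite_and]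

/-- The adjoint with respect to the bilinear form with matrix `C`. -/
def adjC (C : Matrix ι ι ℂ) : Matrix ι ι ℂ →ₗ[ℂ] Matrix ι ι ℂ :=
  sandwich Cᵀ C ∘ₗ (Matrix.transposeLinearEquiv ι ι ℂ ℂ).toLinearMap

theorem adjC_apply (C Z : Matrix ι ι ℂ) : adjC C Z = Cᵀ * (Zᵀ * C) := rfl

/-- Real orthogonal matrices that are symmetric (`ε = 1`) or skew (`ε = -1`). -/
structure IsForm (C : Matrix ι ι ℂ) (ε : ℝ) : Prop where
  transpose : Cᵀ = (ε : ℂ) • C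
  mul_transpose : C * Cᵀ = 1
  real : Cᴴ = Cᵀ
  sq : ε * ε = 1

variable {C : Matrix ι ι ℂ} {ε : ℝ}

theorem IsForm.transpose_mul (hC : IsForm C ε) : Cᵀ * C = 1 := mul_eq_one_comm.1 hC.mul_transpose

theorem adjC_mul (hC : IsForm C ε) (A D : Matrix ι ι ℂ) :
    adjC C (A * D) = adjC C D * adjC C A := by
  simp only [adjC_apply, transpose_mul, mul_assoc]
  rw [← mul_assoc C Cᵀ, hC.mul_transpose, one_mul]

theorem adjC_adjC (hC : IsForm C ε) (A : Matrix ι ι ℂ) : adjC C (adjC C A) = A := by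
  have h2 : (ε : ℂ) * ε = 1 := by exact_mod_cast hC.sq
  have h1 : C * C = (ε : ℂ) • 1 := by
    rw [← hC.mul_transpose, hC.transpose, mul_smul_comm, smul_smul, h2, one_smul]
  simp only [adjC_apply, transpose_mul, transpose_transpose, mul_assoc]
  rw [← mul_assoc Cᵀ Cᵀ, ← transpose_mul, h1]
  simp [smul_smul, hC.sq]

theorem adjC_conjTranspose (hC : IsForm C ε) (A : Matrix ι ι ℂ) : (adjC C A)ᴴ = adjC C Aᴴ := by
  have h1 : Cᵀᴴ = C := by rw [← hC.real, conjTranspose_conjTranspose]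
  have h2 : (Aᵀ)ᴴ = (Aᴴ)ᵀ := by ext; simp
  simp only [adjC_apply, conjTranspose_mul, hC.real, h1, h2, mul_assoc]

theorem trace_adjC (hC : IsForm C ε) (A : Matrix ι ι ℂ) : (adjC C A).trace = A.trace := by
  rw [adjC_apply, Matrix.trace_mul_comm, mul_assoc, hC.mul_transpose, mul_one, trace_transpose]

/-- The adjoint is a transposition between `Cᵀ` and `C`; transposing `C` once more produces the sign
ε. -/
theorem trace_sandwich_adjC (hC : IsForm C ε) (A D : Matrix ι ι ℂ) :
    LinearMap.trace ℂ (Matrix ι ι ℂ) (sandwich A D ∘ₗ adjC C) = ε * (A * adjC C D).trace := by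
  have h1 : sandwich A D ∘ₗ adjC C = sandwich (A * Cᵀ) (C * D) ∘ₗ
      (Matrix.transposeLinearEquiv ι ι ℂ ℂ).toLinearMap := LinearMap.ext fun Z => by
    simp [adjC_apply, sandwich_apply, mul_assoc]
  rw [h1, trace_sandwich_transpose, transpose_mul, hC.transpose, adjC_apply]
  conv_rhs => rw [hC.transpose]
  simp only [mul_smul_comm, smul_mul_assoc, Matrix.trace_smul, smul_eq_mul, mul_assoc]

/-- Traces of operators `X ↦ ∑ A X D` on the Lie algebra of skew-Hermitian matrices that are skew
with respect to `C`. -/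
theorem trace_eq_of_sandwich {L : LieSubalgebra ℝ (Matrix ι ι ℂ)} (hC : IsForm C ε)
    (hL : ∀ X, X ∈ L ↔ Xᴴ = -X ∧ adjC C X = -X) {κ : Type*} [Fintype κ] (A D : κ → Matrix ι ι ℂ)
    (f : L →ₗ[ℝ] L) (hf : ∀ X : L, (f X : Matrix ι ι ℂ) = ∑ α, A α * X * D α) :
    LinearMap.trace ℝ L f =
      1 / 2 * ∑ α, ((A α).trace * (D α).trace - ε * (A α * adjC C (D α)).trace).re := by
  let F : Matrix ι ι ℂ →ₗ[ℂ] Matrix ι ι ℂ := ∑ α, sandwich (A α) (D α)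
  have hF : ∀ Z, F Z = ∑ α, A α * Z * D α := fun Z => by
    simp [F, sandwich_apply, mul_assoc]
  -- The projection onto the Lie algebra: the average over the commuting involutions Z ↦ -`adjC C Z`
  -- and Z ↦ -Zᴴ.
  let p : Matrix ι ι ℂ →ₗ[ℝ] L :=
    { toFun := fun Z => ⟨(1 / 4 : ℝ) • (Z - adjC C Z - (Zᴴ - adjC C Zᴴ)), by
        rw [hL]
        constructor
        · simp only [conjTranspose_smul, conjTranspose_sub, adjC_conjTranspose hC,
            conjTranspose_conjTranspose, star_trivial, ← smul_neg, neg_sub]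
        · rw [LinearMap.map_smul_of_tower]
          simp only [map_sub, adjC_adjC hC, ← smul_neg]
          congr 1
          abel⟩
      map_add' := fun Z W => Subtype.ext <| by
        change (1 / 4 : ℝ) • (_ : Matrix ι ι ℂ) = (1 / 4 : ℝ) • _ + (1 / 4 : ℝ) • _
        simp only [conjTranspose_add, map_add, ← smul_add]
        congr 1
        abel
      map_smul' := fun c Z => Subtype.ext <| by
        change (1 / 4 : ℝ) • (_ : Matrix ι ι ℂ) = c • ((1 / 4 : ℝ) • _)
        simp only [conjTranspose_smul, star_trivial, LinearMap.map_smul_of_tower, ← smul_sub]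
        rw [smul_comm] }
  have hp : ∀ X : L, p X = X := fun X => Subtype.ext <| by
    obtain ⟨h1, h2⟩ := (hL X).1 X.2
    change (1 / 4 : ℝ) • (_ : Matrix ι ι ℂ) = _
    rw [h1, map_neg, h2, neg_neg]
    have : (X : Matrix ι ι ℂ) - -(X : Matrix ι ι ℂ) - (-(X : Matrix ι ι ℂ) - X) =
        (4 : ℝ) • (X : Matrix ι ι ℂ) := by
      rw [show (4 : ℝ) = 1 + 1 + 1 + 1 by norm_num]
      simp only [add_smul, one_smul]
      abel
    rw [this, smul_smul]
    norm_num
  let i : L →ₗ[ℝ] Matrix ι ι ℂ := L.toSubmodule.subtype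
  -- The part of the averaged operator involving Zᴴ is antilinear and has trace zero; the complex
  -- linear part gives the formula.
  let g : Matrix ι ι ℂ →ₗ[ℝ] Matrix ι ι ℂ :=
    (F - F ∘ₗ adjC C).restrictScalars ℝ ∘ₗ (conjTransposeLinearEquiv ι ι ℝ ℂ).toLinearMap
  have h1 : LinearMap.trace ℝ L f = LinearMap.trace ℝ (Matrix ι ι ℂ) (i ∘ₗ (f ∘ₗ p)) := by
    rw [LinearMap.trace_comp_comm']
    congr 1
    refine LinearMap.ext fun X => ?_
    change f X = f (p X)
    rw [hp]
  have h2 : i ∘ₗ (f ∘ₗ p) = (1 / 4 : ℝ) • ((F - F ∘ₗ adjC C).restrictScalars ℝ - g) := by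
    refine LinearMap.ext fun Z => ?_
    change (f (p Z) : Matrix ι ι ℂ) = (1 / 4 : ℝ) • ((F Z - F (adjC C Z)) -
      (F Zᴴ - F (adjC C Zᴴ)))
    rw [hf, ← hF]
    change F ((1 / 4 : ℝ) • (Z - adjC C Z - (Zᴴ - adjC C Zᴴ))) = _
    rw [LinearMap.map_smul_of_tower]
    simp only [map_sub]
  have h3 : LinearMap.trace ℝ (Matrix ι ι ℂ) g = 0 := by
    refine trace_eq_zero_of_antilinear g fun Z => ?_
    change (F - F ∘ₗ adjC C) (Complex.I • Z)ᴴ = -(Complex.I • (F - F ∘ₗ adjC C) Zᴴ)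
    rw [conjTranspose_smul, ← map_smul, ← map_neg]
    simp
  rw [h1, h2, map_smul, map_sub, h3, sub_zero,
    trace_restrictScalars_eq (Matrix.stdBasis ℂ ι ι), map_sub]
  have h4 : F ∘ₗ adjC C = ∑ α, sandwich (A α) (D α) ∘ₗ adjC C := by
    refine LinearMap.ext fun Z => ?_
    simp [F]
  rw [h4, map_sum, map_sum, ← Finset.sum_sub_distrib, Complex.re_sum, smul_eq_mul]
  simp only [trace_sandwich, trace_sandwich_adjC hC]
  ring

end ComplexTrace

/-! ### Classical pairs: Killing form, isotropy summands and their bracket relations. -/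

section Classical

variable {ι : Type*} [Fintype ι] [DecidableEq ι]

/-- A pair of groups of classical type: the Lie algebra of `G` consists of the skew-Hermitian
matrices that are skew with respect to `C`, and the Lie algebra of `K` is the centralizer in it of
an element `S` with `S³ = -S`; `q = -S²` is a projection. -/
structure IsClassicalPair (G K : Subgroup (unitaryGroup ι ℂ)) (C S q : Matrix ι ι ℂ)
    (ε d₀ d₁ : ℝ) : Prop where
  form : IsForm C ε
  mem_G : ∀ X, X ∈ lieAlg G ↔ Xᴴ = -X ∧ adjC C X = -X
  mem_K : ∀ X, X ∈ lieAlg K ↔ X ∈ lieAlg G ∧ X * S = S * X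
  comm : ∀ g ∈ K, (g : Matrix ι ι ℂ) * S = S * (g : Matrix ι ι ℂ)
  conj : Sᴴ = -S
  adj : adjC C S = -S
  sq : S * S = -q
  mul_q : S * q = S
  q_mul : q * S = S
  card : (Fintype.card ι : ℂ) = d₀ + 2 * d₁
  trace_q : q.trace = 2 * d₁
  eq_add : d₁ = d₀ + ε
  pos₀ : 0 < d₀
  pos₁ : 0 < d₁

variable {G K : Subgroup (unitaryGroup ι ℂ)} {C S q : Matrix ι ι ℂ} {ε d₀ d₁ : ℝ}

namespace IsClassicalPair

theorem q_sq (h : IsClassicalPair G K C S q ε d₀ d₁) : q * q = q := by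
  have h1 : q * q = -(S * S * q) := by rw [h.sq, neg_mul, neg_neg]
  rw [h1, mul_assoc, h.mul_q, h.sq, neg_neg]

theorem q_conj (h : IsClassicalPair G K C S q ε d₀ d₁) : qᴴ = q := by
  rw [← neg_eq_iff_eq_neg.2 h.sq, conjTranspose_neg, conjTranspose_mul, h.conj, neg_mul_neg]

theorem q_adj (h : IsClassicalPair G K C S q ε d₀ d₁) : adjC C q = q := by
  rw [← neg_eq_iff_eq_neg.2 h.sq, map_neg, adjC_mul h.form, h.adj, neg_mul_neg]

theorem trace_eq_zero (h : IsClassicalPair G K C S q ε d₀ d₁) {X : Matrix ι ι ℂ}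
    (hX : adjC C X = -X) : X.trace = 0 := by
  have := trace_adjC h.form X
  rw [hX, trace_neg] at this
  exact self_eq_neg.1 this.symm

theorem adjC_one (h : IsClassicalPair G K C S q ε d₀ d₁) : adjC C 1 = 1 := by
  rw [adjC_apply, transpose_one, one_mul, h.form.transpose_mul]

/-- ad X ad Y is the sum of the four sandwiches XYZ - XZY - YZX + ZYX. As X and Y are traceless, the
factor is N - 2ε with N the matrix size, and N = d₀ + 2d₁, d₁ = d₀ + ε make it 3d₀. -/
theorem killing_eq (h : IsClassicalPair G K C S q ε d₀ d₁) (X Y : lieAlg G) :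
    killingForm ℝ (lieAlg G) X Y = 3 * d₀ * ((X : Matrix ι ι ℂ) * (Y : Matrix ι ι ℂ)).trace.re := by
  obtain ⟨-, hX⟩ := (h.mem_G X).1 X.2
  obtain ⟨-, hY⟩ := (h.mem_G Y).1 Y.2
  rw [killingForm_apply_apply, trace_eq_of_sandwich h.form h.mem_G
    ![(X : Matrix ι ι ℂ) * Y, -X, -Y, 1] ![1, (Y : Matrix ι ι ℂ), X, Y * X]]
  · have hN := h.card
    rw [Fin.sum_univ_four]
    simp only [Matrix.cons_val, h.adjC_one, hX, hY, adjC_mul h.form, h.trace_eq_zero hX,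
      h.trace_eq_zero hY, trace_neg, trace_one, hN, mul_one, one_mul, neg_mul_neg, mul_zero,
      trace_mul_comm (Y : Matrix ι ι ℂ) X, ← Complex.add_re, h.eq_add]
    rw [← Complex.re_ofReal_mul, ← Complex.re_ofReal_mul]
    congr 1
    push_cast
    ring
  · intro Z
    simp only [Fin.sum_univ_four, Matrix.cons_val]
    change (X : Matrix ι ι ℂ) * ((Y : Matrix ι ι ℂ) * Z - Z * Y) - (Y * Z - Z * Y) * X = _
    noncomm_ring

theorem killing_isInner (h : IsClassicalPair G K C S q ε d₀ d₁) :
    IsInner (-(killingForm ℝ (lieAlg G))) := by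
  refine ⟨fun X Y => congrArg Neg.neg (killing_symm X Y), fun X hX => ?_⟩
  have h1 := re_trace_neg_sq_pos (conjTranspose_lieAlg X) fun h0 => hX (Subtype.ext h0)
  change 0 < -(killingForm ℝ (lieAlg G) X X)
  rw [h.killing_eq]
  have := mul_pos h.pos₀ h1
  linarith

/-- The projection to the off-diagonal part. -/
noncomputable def offDiag (h : IsClassicalPair G K C S q ε d₀ d₁) : Module.End ℝ (lieAlg G) where
  toFun Z := ⟨(Z : Matrix ι ι ℂ) * q + q * Z - (2 : ℝ) • (q * Z * q), by
    obtain ⟨h1, h2⟩ := (h.mem_G Z).1 Z.2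
    rw [h.mem_G]
    constructor
    · simp only [conjTranspose_sub, conjTranspose_add, conjTranspose_smul, conjTranspose_mul,
        h.q_conj, h1, star_trivial, mul_neg, neg_mul, smul_neg, mul_assoc]
      abel
    · simp only [map_sub, map_add, LinearMap.map_smul_of_tower, adjC_mul h.form, h.q_adj, h2,
        mul_neg, neg_mul, smul_neg, mul_assoc]
      abel⟩
  map_add' Z W := Subtype.ext <| by
    change ((Z : Matrix ι ι ℂ) + W) * q + q * (Z + W) - (2 : ℝ) • (q * (Z + W) * q) =
      (Z * q + q * Z - (2 : ℝ) • (q * Z * q)) + (W * q + q * W - (2 : ℝ) • (q * W * q))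
    simp only [mul_add, add_mul, smul_add]
    abel
  map_smul' c Z := Subtype.ext <| by
    change (c • (Z : Matrix ι ι ℂ)) * q + q * (c • (Z : Matrix ι ι ℂ)) -
      (2 : ℝ) • (q * (c • (Z : Matrix ι ι ℂ)) * q) =
      c • (Z * q + q * Z - (2 : ℝ) • (q * Z * q))
    simp only [mul_smul_comm, smul_mul_assoc, smul_add, smul_sub]
    rw [smul_comm c]

/-- The projection to the part that anticommutes with `S`. -/
noncomputable def anti (h : IsClassicalPair G K C S q ε d₀ d₁) : Module.End ℝ (lieAlg G) where
  toFun Z := ⟨(1 / 2 : ℝ) • (q * (Z : Matrix ι ι ℂ) * q + S * Z * S), by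
    obtain ⟨h1, h2⟩ := (h.mem_G Z).1 Z.2
    rw [h.mem_G]
    constructor
    · simp only [conjTranspose_add, conjTranspose_smul, conjTranspose_mul,
        h.q_conj, h.conj, h1, star_trivial, ← smul_neg]
      congr 1
      noncomm_ring
    · simp only [map_add, LinearMap.map_smul_of_tower, adjC_mul h.form, h.q_adj, h.adj, h2,
        ← smul_neg]
      congr 1
      noncomm_ring⟩
  map_add' Z W := Subtype.ext <| by
    change (1 / 2 : ℝ) • (q * ((Z : Matrix ι ι ℂ) + W) * q + S * (Z + W) * S) =
      (1 / 2 : ℝ) • (q * (Z : Matrix ι ι ℂ) * q + S * Z * S) +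
        (1 / 2 : ℝ) • (q * (W : Matrix ι ι ℂ) * q + S * W * S)
    rw [← smul_add]
    simp only [mul_add, add_mul]
    congr 1
    abel
  map_smul' c Z := Subtype.ext <| by
    change (1 / 2 : ℝ) • (q * (c • (Z : Matrix ι ι ℂ)) * q + S * (c • (Z : Matrix ι ι ℂ)) * S) =
      c • (1 / 2 : ℝ) • (q * (Z : Matrix ι ι ℂ) * q + S * Z * S)
    rw [smul_comm c]
    simp only [mul_smul_comm, smul_mul_assoc, smul_add]

theorem coe_offDiag (h : IsClassicalPair G K C S q ε d₀ d₁) (Z : lieAlg G) :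
    (h.offDiag Z : Matrix ι ι ℂ) = Z * q + q * Z - (2 : ℝ) • (q * Z * q) := rfl

theorem coe_anti (h : IsClassicalPair G K C S q ε d₀ d₁) (Z : lieAlg G) :
    (h.anti Z : Matrix ι ι ℂ) = (1 / 2 : ℝ) • (q * (Z : Matrix ι ι ℂ) * q + S * Z * S) := rfl

theorem mem_subK_iff (h : IsClassicalPair G K C S q ε d₀ d₁) (z : lieAlg G) :
    z ∈ subK G K ↔ (z : Matrix ι ι ℂ) * S = S * z := by
  rw [mem_subK, h.mem_K]
  exact and_iff_right z.2

theorem commute_q (h : IsClassicalPair G K C S q ε d₀ d₁) {z : Matrix ι ι ℂ} (hz : z * S = S * z) :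
    z * q = q * z := by
  rw [← neg_eq_iff_eq_neg.2 h.sq, mul_neg, neg_mul, ← mul_assoc, hz, mul_assoc, hz, mul_assoc]

theorem offDiag_mem (h : IsClassicalPair G K C S q ε d₀ d₁) (Z : lieAlg G) :
    h.offDiag Z ∈ tang (subK G K) := by
  rw [mem_tang_iff]
  intro z hz
  rw [h.mem_subK_iff] at hz
  have hzq := h.commute_q hz
  rw [h.killing_eq, coe_offDiag]
  have h1 : ((z : Matrix ι ι ℂ) * (Z * q)).trace = (z * (q * (Z : Matrix ι ι ℂ))).trace := by
    rw [← mul_assoc, Matrix.trace_mul_comm, ← mul_assoc, ← hzq, mul_assoc]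
  have h2 : ((z : Matrix ι ι ℂ) * (q * Z * q)).trace = (z * (q * (Z : Matrix ι ι ℂ))).trace := by
    rw [← mul_assoc, Matrix.trace_mul_comm, ← mul_assoc, ← hzq, mul_assoc, ← mul_assoc q q,
      h.q_sq]
  rw [mul_sub, mul_add, mul_smul_comm, trace_sub, trace_add, trace_smul, h1, h2]
  simp only [Complex.sub_re, Complex.add_re, Complex.smul_re, smul_eq_mul]
  ring

theorem anti_mem (h : IsClassicalPair G K C S q ε d₀ d₁) (Z : lieAlg G) :
    h.anti Z ∈ tang (subK G K) := by
  rw [mem_tang_iff]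
  intro z hz
  rw [h.mem_subK_iff] at hz
  have hzq := h.commute_q hz
  rw [h.killing_eq, coe_anti]
  have h1 : ((z : Matrix ι ι ℂ) * (S * Z * S)).trace = -(z * (q * (Z : Matrix ι ι ℂ))).trace := by
    rw [← mul_assoc, Matrix.trace_mul_comm, ← mul_assoc, ← hz, mul_assoc, ← mul_assoc S S,
      h.sq, neg_mul, mul_neg, trace_neg]
  have h2 : ((z : Matrix ι ι ℂ) * (q * Z * q)).trace = (z * (q * (Z : Matrix ι ι ℂ))).trace := by
    rw [← mul_assoc, Matrix.trace_mul_comm, ← mul_assoc, ← hzq, mul_assoc, ← mul_assoc q q,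
      h.q_sq]
  rw [mul_smul_comm, mul_add, trace_smul, trace_add, h1, h2]
  simp

/-- Both parts are orthogonal to the centralizer of `S`, and what remains after subtracting them
commutes with `S`. -/
theorem projL_eq (h : IsClassicalPair G K C S q ε d₀ d₁) :
    projL (subK G K) = h.offDiag + h.anti := by
  refine LinearMap.ext fun Z => ?_
  rw [projL_apply]
  refine projP_eq h.killing_isInner (add_mem (h.offDiag_mem Z) (h.anti_mem Z)) ?_
  rw [h.mem_subK_iff]
  change ((Z : Matrix ι ι ℂ) - ((h.offDiag Z : Matrix ι ι ℂ) + (h.anti Z : Matrix ι ι ℂ))) * S =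
    S * ((Z : Matrix ι ι ℂ) - ((h.offDiag Z : Matrix ι ι ℂ) + (h.anti Z : Matrix ι ι ℂ)))
  rw [coe_offDiag, coe_anti]
  have h1 : ∀ W, q * (S * W) = S * W := fun W => by rw [← mul_assoc, h.q_mul]
  have h2 : ∀ W, S * (q * W) = S * W := fun W => by rw [← mul_assoc, h.mul_q]
  have h3 : ∀ W, S * (S * W) = -(q * W) := fun W => by rw [← mul_assoc, h.sq, neg_mul]
  simp only [mul_add, add_mul, mul_sub, sub_mul, mul_smul_comm, smul_mul_assoc, mul_assoc, h.sq,
    h.mul_q, h.q_mul, h1, h2, h3, smul_add, smul_sub, smul_neg, mul_neg]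
  module

theorem mul_S_mul (h : IsClassicalPair G K C S q ε d₀ d₁) {Y : Matrix ι ι ℂ}
    (hY : q * Y * q = 0) : S * Y * S = 0 ∧ q * Y * S = 0 ∧ S * Y * q = 0 := by
  refine ⟨?_, ?_, ?_⟩
  · calc S * Y * S = (S * q) * Y * (q * S) := by rw [h.mul_q, h.q_mul]
      _ = S * (q * Y * q) * S := by simp only [mul_assoc]
      _ = 0 := by rw [hY, mul_zero, zero_mul]
  · rw [← h.q_mul, ← mul_assoc, hY, zero_mul]
  · rw [← h.mul_q, mul_assoc S q, mul_assoc S, hY, mul_zero]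

/-- Off-diagonal matrices. -/
def IsOff (q Y : Matrix ι ι ℂ) : Prop := q * Y * q = 0 ∧ Y = Y * q + q * Y

/-- Matrices that anticommute with `S`. -/
def IsAnti (S q Y : Matrix ι ι ℂ) : Prop := q * Y = Y ∧ Y * q = Y ∧ S * Y = -(Y * S)

theorem isOff_offDiag (h : IsClassicalPair G K C S q ε d₀ d₁) (Z : lieAlg G) :
    IsOff q (h.offDiag Z : Matrix ι ι ℂ) := by
  have h1 : ∀ W, q * (q * W) = q * W := fun W => by rw [← mul_assoc, h.q_sq]
  rw [IsOff, coe_offDiag]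
  constructor <;>
  · simp only [mul_add, add_mul, mul_sub, sub_mul, mul_smul_comm, smul_mul_assoc, mul_assoc, h.q_sq,
      h1]
    module

theorem isAnti_anti (h : IsClassicalPair G K C S q ε d₀ d₁) (Z : lieAlg G) :
    IsAnti S q (h.anti Z : Matrix ι ι ℂ) := by
  have h1 : ∀ W, q * (q * W) = q * W := fun W => by rw [← mul_assoc, h.q_sq]
  have h2 : ∀ W, q * (S * W) = S * W := fun W => by rw [← mul_assoc, h.q_mul]
  have h3 : ∀ W, S * (q * W) = S * W := fun W => by rw [← mul_assoc, h.mul_q]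
  have h4 : ∀ W, S * (S * W) = -(q * W) := fun W => by rw [← mul_assoc, h.sq, neg_mul]
  rw [IsAnti, coe_anti]
  refine ⟨?_, ?_, ?_⟩ <;>
  · simp only [mul_add, add_mul, mul_smul_comm, smul_mul_assoc, mul_assoc, h.q_sq, h.sq, h.mul_q,
      h.q_mul, h1, h2, h3, h4, mul_neg]
    try module

theorem offDiag_eq_of_diag (h : IsClassicalPair G K C S q ε d₀ d₁) {Z : lieAlg G}
    (hZ : (Z : Matrix ι ι ℂ) * q = q * Z) : h.offDiag Z = 0 := by
  apply Subtype.ext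
  rw [coe_offDiag, ← hZ, mul_assoc, h.q_sq, hZ, two_smul, sub_self]
  rfl

theorem anti_eq_of_off (h : IsClassicalPair G K C S q ε d₀ d₁) {Z : lieAlg G}
    (hZ : IsOff q (Z : Matrix ι ι ℂ)) : h.anti Z = 0 := by
  apply Subtype.ext
  rw [coe_anti, hZ.1, (h.mul_S_mul hZ.1).1, add_zero, smul_zero]
  rfl

theorem offDiag_of_off (h : IsClassicalPair G K C S q ε d₀ d₁) {Z : lieAlg G}
    (hZ : IsOff q (Z : Matrix ι ι ℂ)) : h.offDiag Z = Z := by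
  apply Subtype.ext
  rw [coe_offDiag, hZ.1, smul_zero, sub_zero]
  exact hZ.2.symm

theorem anti_eq_of_commute (h : IsClassicalPair G K C S q ε d₀ d₁) {Z : lieAlg G}
    (hZ : (Z : Matrix ι ι ℂ) * S = S * Z) : h.anti Z = 0 := by
  apply Subtype.ext
  rw [coe_anti, ← hZ, ← h.commute_q hZ, mul_assoc, mul_assoc, h.q_sq, h.sq, mul_neg,
    add_neg_cancel, smul_zero]
  rfl

theorem off_mul_off {Y V : Matrix ι ι ℂ} (hY : IsOff q Y) (hV : IsOff q V) :
    Y * V * q = q * (Y * V) := by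
  calc Y * V * q = (Y * q + q * Y) * V * q := by rw [← hY.2]
    _ = Y * (q * V * q) + q * Y * V * q := by noncomm_ring
    _ = q * Y * (V * q) + q * Y * q * V := by rw [hV.1, hY.1]; noncomm_ring
    _ = q * Y * (V * q + q * V) := by noncomm_ring
    _ = q * (Y * V) := by rw [← hV.2, mul_assoc]

theorem off_lie_anti {Y W : Matrix ι ι ℂ} (hY : IsOff q Y) (hW : q * W = W) (hW' : W * q = W) :
    IsOff q (Y * W - W * Y) := by
  have h1 : W * Y * q = 0 := by rw [← hW', mul_assoc, mul_assoc, ← mul_assoc q, hY.1, mul_zero]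
  have h2 : q * (Y * W) = 0 := by rw [← hW, ← mul_assoc, ← mul_assoc, hY.1, zero_mul]
  constructor
  · rw [mul_sub, h2, sub_mul, ← mul_assoc, hW, h1, zero_mul, sub_zero]
  · rw [mul_sub, h2, sub_mul, h1, ← mul_assoc, hW, mul_assoc, hW']
    abel

theorem coe_lie (Y Z : lieAlg G) : ((⁅Y, Z⁆ : lieAlg G) : Matrix ι ι ℂ) =
    (Y : Matrix ι ι ℂ) * Z - Z * Y := rfl

section Off

variable {Y : lieAlg G}

/-- In blocks for `q` and `1 - q`: the bracket of two off-diagonal elements is block diagonal, an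
off-diagonal with an anticommuting one gives an off-diagonal one, and two anticommuting ones give an
element commuting with `S`. This lemma and the following ones turn these relations into the block
structure of `ad Y` on `p`. -/
theorem offDiag_ad_offDiag_of_off (h : IsClassicalPair G K C S q ε d₀ d₁)
    (hY : IsOff q (Y : Matrix ι ι ℂ)) :
    h.offDiag * LieAlgebra.ad ℝ (lieAlg G) Y * h.offDiag = 0 :=
  LinearMap.ext fun Z => h.offDiag_eq_of_diag <| by
    have hV := h.isOff_offDiag Z
    change ((Y : Matrix ι ι ℂ) * (h.offDiag Z : Matrix ι ι ℂ) - (h.offDiag Z : Matrix ι ι ℂ) * Y) * q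
      = q * ((Y : Matrix ι ι ℂ) * (h.offDiag Z : Matrix ι ι ℂ) - (h.offDiag Z : Matrix ι ι ℂ) * Y)
    rw [sub_mul, mul_sub, off_mul_off hY hV, off_mul_off hV hY]

theorem anti_ad_anti_of_off (h : IsClassicalPair G K C S q ε d₀ d₁)
    (hY : IsOff q (Y : Matrix ι ι ℂ)) :
    h.anti * LieAlgebra.ad ℝ (lieAlg G) Y * h.anti = 0 :=
  LinearMap.ext fun Z => h.anti_eq_of_off <|
    off_lie_anti hY (h.isAnti_anti Z).1 (h.isAnti_anti Z).2.1

theorem offDiag_ad_anti_of_off (h : IsClassicalPair G K C S q ε d₀ d₁)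
    (hY : IsOff q (Y : Matrix ι ι ℂ)) :
    h.offDiag * LieAlgebra.ad ℝ (lieAlg G) Y * h.anti = LieAlgebra.ad ℝ (lieAlg G) Y * h.anti :=
  LinearMap.ext fun Z => h.offDiag_of_off <|
    off_lie_anti hY (h.isAnti_anti Z).1 (h.isAnti_anti Z).2.1

theorem anti_lie_anti_commute {Y W : Matrix ι ι ℂ} (hY : IsAnti S q Y) (hW : IsAnti S q W) :
    (Y * W - W * Y) * S = S * (Y * W - W * Y) := by
  have h1 : ∀ Y W : Matrix ι ι ℂ, IsAnti S q Y → IsAnti S q W → Y * W * S = S * (Y * W) :=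
    fun Y W hY hW => by
      rw [← mul_assoc, hY.2.2, neg_mul, mul_assoc Y S, hW.2.2, mul_neg, neg_neg, mul_assoc]
  rw [sub_mul, mul_sub, h1 Y W hY hW, h1 W Y hW hY]

theorem anti_ad_anti_of_anti (h : IsClassicalPair G K C S q ε d₀ d₁)
    (hY : IsAnti S q (Y : Matrix ι ι ℂ)) :
    h.anti * LieAlgebra.ad ℝ (lieAlg G) Y * h.anti = 0 :=
  LinearMap.ext fun Z => h.anti_eq_of_commute <| anti_lie_anti_commute hY (h.isAnti_anti Z)

theorem offDiag_ad_anti_of_anti (h : IsClassicalPair G K C S q ε d₀ d₁)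
    (hY : IsAnti S q (Y : Matrix ι ι ℂ)) :
    h.offDiag * LieAlgebra.ad ℝ (lieAlg G) Y * h.anti = 0 :=
  LinearMap.ext fun Z => h.offDiag_eq_of_diag <| h.commute_q <|
    anti_lie_anti_commute hY (h.isAnti_anti Z)

theorem isOff_lie_of_anti (h : IsClassicalPair G K C S q ε d₀ d₁)
    (hY : IsAnti S q (Y : Matrix ι ι ℂ)) (Z : lieAlg G) :
    IsOff q ((⁅Y, h.offDiag Z⁆ : lieAlg G) : Matrix ι ι ℂ) := by
  have h1 := off_lie_anti (h.isOff_offDiag Z) hY.1 hY.2.1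
  rw [coe_lie, ← neg_sub]
  refine ⟨by rw [mul_neg, neg_mul, h1.1, neg_zero], ?_⟩
  rw [mul_neg, neg_mul, ← neg_add, ← h1.2]

theorem anti_ad_offDiag_of_anti (h : IsClassicalPair G K C S q ε d₀ d₁)
    (hY : IsAnti S q (Y : Matrix ι ι ℂ)) :
    h.anti * LieAlgebra.ad ℝ (lieAlg G) Y * h.offDiag = 0 :=
  LinearMap.ext fun Z => h.anti_eq_of_off (h.isOff_lie_of_anti hY Z)

theorem offDiag_ad_offDiag_of_anti (h : IsClassicalPair G K C S q ε d₀ d₁)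
    (hY : IsAnti S q (Y : Matrix ι ι ℂ)) :
    h.offDiag * LieAlgebra.ad ℝ (lieAlg G) Y * h.offDiag =
      LieAlgebra.ad ℝ (lieAlg G) Y * h.offDiag :=
  LinearMap.ext fun Z => h.offDiag_of_off (h.isOff_lie_of_anti hY Z)

/-- The trace of `(ad Y)²` over the tangent space, for off-diagonal `Y`. -/
theorem trace_anti_of_off (h : IsClassicalPair G K C S q ε d₀ d₁)
    (hY : IsOff q (Y : Matrix ι ι ℂ)) :
    LinearMap.trace ℝ (lieAlg G)
      (LieAlgebra.ad ℝ (lieAlg G) Y * LieAlgebra.ad ℝ (lieAlg G) Y * h.anti) =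
      d₀ / 2 * ((Y : Matrix ι ι ℂ) * Y).trace.re := by
  obtain ⟨-, hYτ⟩ := (h.mem_G Y).1 Y.2
  set y : Matrix ι ι ℂ := Y.1
  -- y²W - 2yWy + Wy² with W = (qZq + SZS)/2, written as six sandwiches.
  rw [trace_eq_of_sandwich h.form h.mem_G
    ![(1 / 2 : ℂ) • (y * y * q), -(y * q), (1 / 2 : ℂ) • q,
      (1 / 2 : ℂ) • (y * y * S), -(y * S), (1 / 2 : ℂ) • S]
    ![q, q * y, q * (y * y), S, S * y, S * (y * y)]]
  · obtain ⟨hSS, hqS, hSq⟩ := h.mul_S_mul hY.1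
    have t1 : (y * q).trace = 0 := by
      rw [← h.q_sq, ← mul_assoc, Matrix.trace_mul_comm, ← mul_assoc, hY.1, trace_zero]
    have t2 : (y * S).trace = 0 := by
      rw [← h.mul_q, ← mul_assoc, Matrix.trace_mul_comm, ← mul_assoc, hqS, trace_zero]
    have t3 : S.trace = 0 := h.trace_eq_zero h.adj
    have t4 : (q * (y * y)).trace = (y * y * q).trace := Matrix.trace_mul_comm _ _
    have t5 : (y * y).trace = 2 * (y * y * q).trace := by
      have : y * y = y * y * q + y * (q * y) := by
        rw [mul_assoc y y q, ← mul_add, ← hY.2]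
      conv_lhs => rw [this, trace_add, Matrix.trace_mul_comm y, mul_assoc q, t4]
      ring
    have t6 : (y * y * q * q).trace = (y * y * q).trace := by rw [mul_assoc _ q q, h.q_sq]
    have t7 : y * q * -(y * q) = 0 := by
      rw [mul_neg, mul_assoc, ← mul_assoc q, hY.1, mul_zero, neg_zero]
    have t8 : (q * -(y * -y * q)).trace = (y * y * q).trace := by
      rw [Matrix.trace_mul_comm, mul_neg, neg_mul, neg_mul, neg_mul, neg_neg, t6]
    have t9 : (y * y * S * -S).trace = (y * y * q).trace := by
      rw [mul_neg, mul_assoc, h.sq, mul_neg, neg_neg]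
    have t10 : y * S * -(y * -S) = 0 := by
      rw [mul_neg y, neg_neg, mul_assoc, ← mul_assoc S, hSS, mul_zero]
    have t11 : (S * -(y * -y * -S)).trace = (y * y * q).trace := by
      rw [Matrix.trace_mul_comm, mul_neg y, neg_mul_neg, neg_mul, mul_assoc _ S, h.sq, mul_neg,
        neg_neg]
    simp only [Fin.sum_univ_six, Matrix.cons_val, adjC_mul h.form, h.q_adj, h.adj, hYτ,
      neg_mul_neg, trace_smul, trace_neg, smul_mul_assoc, t1, t2, t3, t6, h.trace_q, neg_mul, t4,
      t7, t8, t9, t10, t11, t5, trace_zero, smul_eq_mul, ← Complex.add_re]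
    rw [← Complex.re_ofReal_mul, ← Complex.re_ofReal_mul, h.eq_add]
    congr 1
    push_cast
    ring
  · intro Z
    simp only [Fin.sum_univ_six, Matrix.cons_val]
    change (y * (y * (h.anti Z : Matrix ι ι ℂ) - (h.anti Z : Matrix ι ι ℂ) * y) -
      (y * (h.anti Z : Matrix ι ι ℂ) - (h.anti Z : Matrix ι ι ℂ) * y) * y) = _
    rw [coe_anti]
    have : ∀ W : Matrix ι ι ℂ, (1 / 2 : ℝ) • W = (1 / 2 : ℂ) • W := fun W => by
      ext; simp
    rw [this]
    simp only [mul_sub, sub_mul, mul_add, add_mul, smul_add, mul_smul_comm, smul_mul_assoc,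
      mul_assoc, neg_mul]
    module

/-- Here y lives in the `q`-block, so (ad y)² on the off-diagonal part is y²Z(1 - q) + (1 - q)Zy².
The products with `1 - q` vanish and tr(1 - q) = d₀. -/
theorem trace_offDiag_of_anti (h : IsClassicalPair G K C S q ε d₀ d₁)
    (hY : IsAnti S q (Y : Matrix ι ι ℂ)) :
    LinearMap.trace ℝ (lieAlg G)
      (LieAlgebra.ad ℝ (lieAlg G) Y * LieAlgebra.ad ℝ (lieAlg G) Y * h.offDiag) =
      d₀ * ((Y : Matrix ι ι ℂ) * Y).trace.re := by
  obtain ⟨-, hYτ⟩ := (h.mem_G Y).1 Y.2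
  obtain ⟨h1, h2, h3⟩ := hY
  set y : Matrix ι ι ℂ := Y.1
  have hy1 : ∀ W, y * (q * W) = y * W := fun W => by rw [← mul_assoc, h2]
  have hy2 : ∀ W, q * (y * W) = y * W := fun W => by rw [← mul_assoc, h1]
  rw [trace_eq_of_sandwich h.form h.mem_G ![y * y, 1 - q] ![1 - q, y * y]]
  · have t1 : (1 - q).trace = d₀ := by
      rw [trace_sub, trace_one, h.card, h.trace_q]
      ring
    have t2 : y * y * (1 - q) = 0 := by rw [mul_sub, mul_one, mul_assoc, h2, sub_self]
    have t3 : (1 - q) * (y * y) = 0 := by rw [sub_mul, one_mul, hy2, sub_self]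
    simp only [Fin.sum_univ_two, Matrix.cons_val, adjC_mul h.form, map_sub, h.adjC_one, h.q_adj,
      hYτ, neg_mul_neg, t1, t2, t3, trace_zero, mul_zero, sub_zero, mul_comm (d₀ : ℂ),
      Complex.re_mul_ofReal]
    ring
  · intro Z
    simp only [Fin.sum_univ_two, Matrix.cons_val]
    change (y * (y * (h.offDiag Z : Matrix ι ι ℂ) - (h.offDiag Z : Matrix ι ι ℂ) * y) -
      (y * (h.offDiag Z : Matrix ι ι ℂ) - (h.offDiag Z : Matrix ι ι ℂ) * y) * y) = _
    rw [coe_offDiag]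
    simp only [mul_sub, sub_mul, mul_add, add_mul, mul_smul_comm, smul_mul_assoc, mul_one, one_mul,
      mul_assoc, hy1, hy2, h1, h2]
    module

end Off

end IsClassicalPair

end Classical

/-! ### Polarization of the Einstein condition. -/

section Criterion

variable {L : Type*} [LieRing L] [LieAlgebra ℝ L] [FiniteDimensional ℝ L] {k : LieSubalgebra ℝ L}

theorem trP_add_left (X Y Z : tang k) : trP k (X + Y) Z = trP k X Z + trP k Y Z := by
  simp only [trP_eq, Submodule.coe_add, map_add, mul_add, add_mul]

theorem trP_add_right (X Y Z : tang k) : trP k X (Y + Z) = trP k X Y + trP k X Z := by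
  rw [trP_symm, trP_add_left, trP_symm Y, trP_symm Z]

/-- The Einstein condition only has to be checked on the diagonal. -/
theorem isEinstein_of_trP_self (hL : IsInner (-(killingForm ℝ L))) {ρ : ℝ}
    (h : ∀ Y : tang k, trP k Y Y = (2 - 4 * ρ) * killingForm ℝ L Y Y) :
    IsEinstein k (stdMetric k) ρ := by
  refine (isEinstein_iff hL ρ).2 fun Y Z => ?_
  have h1 := h (Y + Z)
  simp only [trP_add_left, trP_add_right, Submodule.coe_add, map_add, LinearMap.add_apply, h Y, h Z,
    trP_symm Z Y, killing_symm (Z : L) Y] at h1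
  linarith

end Criterion

/-! ### Einstein constant and reducibility of the classical pairs. -/

section Classical

variable {ι : Type*} [Fintype ι] [DecidableEq ι] {G K : Subgroup (unitaryGroup ι ℂ)}
  {C S q : Matrix ι ι ℂ} {ε d₀ d₁ : ℝ}

theorem trace_projL_add_eq {V : Type*} [AddCommGroup V] [Module ℝ V] (P Q a b : Module.End ℝ V) :
    LinearMap.trace ℝ V ((P + Q) * a * (P + Q) * b) =
      LinearMap.trace ℝ V (P * a * P * b) + LinearMap.trace ℝ V (Q * a * Q * b) +
      (LinearMap.trace ℝ V (P * a * Q * b) + LinearMap.trace ℝ V (P * b * Q * a)) := by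
  have h : LinearMap.trace ℝ V (P * b * Q * a) = LinearMap.trace ℝ V (Q * a * P * b) := by
    rw [mul_assoc (P * b), LinearMap.trace_mul_comm]
    simp only [mul_assoc]
  rw [h]
  simp only [add_mul, mul_add, map_add]
  ring

namespace IsClassicalPair

/-- For off-diagonal Y only the two paths exchanging the isotropy summands contribute, each d₀/2;
for anticommuting Y only the off-diagonal summand contributes, with d₀. The common factor is what
makes the metric Einstein. -/
theorem trP_self (h : IsClassicalPair G K C S q ε d₀ d₁) (Y : tang (subK G K)) :
    trP (subK G K) Y Y = d₀ * (((Y : lieAlg G) : Matrix ι ι ℂ) * (Y : lieAlg G)).trace.re := by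
  have hL := h.killing_isInner
  set Y₁ : tang (subK G K) := ⟨h.offDiag Y, h.offDiag_mem Y⟩ with hY₁
  set Y₂ : tang (subK G K) := ⟨h.anti Y, h.anti_mem Y⟩ with hY₂
  have hYY : Y = Y₁ + Y₂ := by
    have h1 := LinearMap.congr_fun h.projL_eq (Y : lieAlg G)
    rw [projL_apply, projP_coe hL] at h1
    exact Subtype.ext h1
  have a₁ : IsOff q ((Y₁ : lieAlg G) : Matrix ι ι ℂ) := h.isOff_offDiag Y
  have a₂ : IsAnti S q ((Y₂ : lieAlg G) : Matrix ι ι ℂ) := h.isAnti_anti Y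
  have t₁ : trP (subK G K) Y₁ Y₁ = d₀ *
      (((Y₁ : lieAlg G) : Matrix ι ι ℂ) * (Y₁ : lieAlg G)).trace.re := by
    rw [trP_eq, h.projL_eq, trace_projL_add_eq, h.offDiag_ad_offDiag_of_off a₁,
      h.anti_ad_anti_of_off a₁, h.offDiag_ad_anti_of_off a₁, zero_mul, map_zero, zero_add, zero_add,
      mul_assoc, LinearMap.trace_mul_comm, mul_assoc, LinearMap.trace_mul_comm,
      h.trace_anti_of_off a₁]
    ring
  have t₂ : trP (subK G K) Y₂ Y₂ = d₀ *
      (((Y₂ : lieAlg G) : Matrix ι ι ℂ) * (Y₂ : lieAlg G)).trace.re := by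
    rw [trP_eq, h.projL_eq, trace_projL_add_eq, h.anti_ad_anti_of_anti a₂,
      h.offDiag_ad_anti_of_anti a₂, h.offDiag_ad_offDiag_of_anti a₂, zero_mul, map_zero, add_zero,
      add_zero, add_zero, mul_assoc, LinearMap.trace_mul_comm, mul_assoc, LinearMap.trace_mul_comm,
      h.trace_offDiag_of_anti a₂]
  -- An off-diagonal and an anticommuting element are orthogonal: each composition returning to its
  -- summand contains a vanishing block.
  have t₁₂ : trP (subK G K) Y₁ Y₂ = 0 := by
    rw [trP_eq, h.projL_eq, trace_projL_add_eq, h.offDiag_ad_offDiag_of_off a₁,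
      h.anti_ad_anti_of_off a₁, h.offDiag_ad_anti_of_anti a₂, mul_assoc (h.offDiag * _),
      mul_assoc h.offDiag, LinearMap.trace_mul_comm ℝ h.offDiag]
    have : LieAlgebra.ad ℝ (lieAlg G) (Y₁ : lieAlg G) *
        (h.anti * LieAlgebra.ad ℝ (lieAlg G) (Y₂ : lieAlg G)) * h.offDiag = 0 := by
      rw [mul_assoc, h.anti_ad_offDiag_of_anti a₂, mul_zero]
    rw [this]
    simp
  have k₁₂ : killingForm ℝ (lieAlg G) Y₁ Y₂ = 0 := by
    have e1 := h.killing_eq Y₁ Y₂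
    obtain ⟨h1, h2⟩ := a₁
    obtain ⟨h3, h4, -⟩ := a₂
    rw [e1]
    have : (((Y₁ : lieAlg G) : Matrix ι ι ℂ) * ((Y₂ : lieAlg G) : Matrix ι ι ℂ)).trace = 0 := by
      rw [← h3, ← h4, ← mul_assoc, ← mul_assoc, Matrix.trace_mul_comm, ← mul_assoc, ← mul_assoc,
        h1, zero_mul, trace_zero]
    rw [this]
    simp
  have k₁₂' := h.killing_eq (Y : lieAlg G) Y
  have k₁ := h.killing_eq Y₁ Y₁
  have k₂ := h.killing_eq Y₂ Y₂
  have k₃ : killingForm ℝ (lieAlg G) (Y : lieAlg G) Y = killingForm ℝ (lieAlg G) Y₁ Y₁ +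
      killingForm ℝ (lieAlg G) Y₂ Y₂ := by
    conv_lhs => rw [hYY]
    simp only [Submodule.coe_add, map_add, LinearMap.add_apply, k₁₂,
      killing_symm (Y₂ : lieAlg G) Y₁]
    ring
  have k₄ : trP (subK G K) Y Y = trP (subK G K) Y₁ Y₁ + trP (subK G K) Y₂ Y₂ := by
    conv_lhs => rw [hYY]
    rw [trP_add_left, trP_add_right, trP_add_right, t₁₂, trP_symm Y₂ Y₁, t₁₂]
    ring
  rw [k₄, t₁, t₂]
  linarith

/-- The ratio of `trP` to the Killing form is d₀/(3d₀) = 1/3 = 2 - 4 · 5/12. -/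
theorem isEinstein (h : IsClassicalPair G K C S q ε d₀ d₁) :
    IsEinstein (subK G K) (stdMetric (subK G K)) (5 / 12) := by
  refine isEinstein_of_trP_self h.killing_isInner fun Y => ?_
  rw [h.trP_self, h.killing_eq]
  ring

/-- The dimension of the summand, as the trace of its projection; with `trace_anti` it serves to
show that both summands are nonzero. -/
theorem trace_offDiag (h : IsClassicalPair G K C S q ε d₀ d₁) :
    LinearMap.trace ℝ (lieAlg G) h.offDiag = 2 * d₀ * d₁ := by
  have t1 : (1 - q).trace = d₀ := by
    rw [trace_sub, trace_one, h.card, h.trace_q]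
    ring
  have t2 : q * (1 - q) = 0 := by rw [mul_sub, mul_one, h.q_sq, sub_self]
  have t3 : (1 - q) * q = 0 := by rw [sub_mul, one_mul, h.q_sq, sub_self]
  rw [trace_eq_of_sandwich h.form h.mem_G ![1 - q, q] ![q, 1 - q]]
  · simp only [Fin.sum_univ_two, Matrix.cons_val, map_sub, h.adjC_one, h.q_adj, t1, t2, t3,
      h.trace_q, trace_zero, mul_zero, sub_zero]
    simp
    ring
  · intro Z
    simp only [Fin.sum_univ_two, Matrix.cons_val, coe_offDiag]
    simp only [sub_mul, mul_sub, one_mul, mul_one, two_smul]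
    abel

theorem trace_anti (h : IsClassicalPair G K C S q ε d₀ d₁) :
    LinearMap.trace ℝ (lieAlg G) h.anti = d₀ * d₁ := by
  rw [trace_eq_of_sandwich h.form h.mem_G ![(1 / 2 : ℂ) • q, (1 / 2 : ℂ) • S] ![q, S]]
  · simp only [Fin.sum_univ_two, Matrix.cons_val, h.adj, h.q_adj, smul_mul_assoc, h.q_sq, mul_neg,
      h.sq, smul_neg, trace_smul, h.trace_q, h.trace_eq_zero h.adj, neg_neg, smul_eq_mul, mul_zero,
      ← Complex.add_re]
    rw [← Complex.ofReal_re (d₀ * d₁), ← Complex.re_ofReal_mul, h.eq_add]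
    congr 1
    push_cast
    ring
  · intro Z
    have : ∀ W : Matrix ι ι ℂ, (1 / 2 : ℝ) • W = (1 / 2 : ℂ) • W := fun W => by
      ext; simp
    simp only [Fin.sum_univ_two, Matrix.cons_val, coe_anti, this, smul_add, smul_mul_assoc]

/-- The kernel of `anti` in `p` contains the nonzero off-diagonal part but not the nonzero
anticommuting part. It is invariant because elements of `K` commute with `S`, hence with `q`. -/
theorem isotropyReducible (h : IsClassicalPair G K C S q ε d₀ d₁) :
    IsotropyReducible (subK G K) (AdK G K) := by
  have hL := h.killing_isInner
  let W : Submodule ℝ (tang (subK G K)) := LinearMap.ker (h.anti ∘ₗ (tang (subK G K)).subtype)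
  have hne : ∀ f : Module.End ℝ (lieAlg G), LinearMap.trace ℝ (lieAlg G) f ≠ 0 → ∃ Z, f Z ≠ 0 :=
    fun f hf => by
      by_contra! h0
      exact hf (by rw [show f = 0 from LinearMap.ext h0, map_zero])
  refine ⟨W, fun hW => ?_, fun hW => ?_, ?_⟩
  · obtain ⟨Z, hZ⟩ := hne h.offDiag (by
      rw [h.trace_offDiag]
      have := mul_pos h.pos₀ h.pos₁
      nlinarith)
    have h1 : (⟨h.offDiag Z, h.offDiag_mem Z⟩ : tang (subK G K)) ∈ W :=
      h.anti_eq_of_off (h.isOff_offDiag Z)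
    rw [hW, Submodule.mem_bot] at h1
    exact hZ (congrArg Subtype.val h1)
  · obtain ⟨Z, hZ⟩ := hne h.anti (by rw [h.trace_anti]; exact (mul_pos h.pos₀ h.pos₁).ne')
    have h1 : (⟨h.anti Z, h.anti_mem Z⟩ : tang (subK G K)) ∈ W := hW ▸ Submodule.mem_top
    have h2 : h.anti (h.anti Z) = 0 := h1
    refine hZ (Eq.trans (Subtype.ext ?_) h2)
    obtain ⟨h3, h4, h5⟩ := h.isAnti_anti Z
    rw [coe_anti h (h.anti Z), h3, h4, h5, neg_mul, mul_assoc, h.sq, mul_neg, neg_neg, h4,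
      ← two_smul ℝ, smul_smul]
    norm_num
  · rintro φ ⟨g, hg, rfl⟩ X hX
    change h.anti (projP (subK G K) (Ad G g X) : lieAlg G) = 0
    have hφ : Ad G g ∈ AdK G K := ⟨g, hg, rfl⟩
    have h1 := coe_autP hL isAutSet_AdK hφ X
    rw [autP_apply] at h1
    rw [h1]
    have hS := h.comm g hg
    have hi : (((g : unitaryGroup ι ℂ)⁻¹ : unitaryGroup ι ℂ) : Matrix ι ι ℂ) * S =
        S * (((g : unitaryGroup ι ℂ)⁻¹ : unitaryGroup ι ℂ) : Matrix ι ι ℂ) :=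
      (commutant S).inv_mem (x := (g : unitaryGroup ι ℂ)) hS
    have hq := h.commute_q hS
    have hiq := h.commute_q hi
    have h2 : h.anti (Ad G g X) = Ad G g (h.anti X) := Subtype.ext <| by
      rw [coe_anti, coe_Ad, coe_Ad, coe_anti, mul_smul_comm, smul_mul_assoc, mul_add, add_mul]
      congr 2
      · simp only [← mul_assoc, ← hq]
        simp only [mul_assoc, ← hiq]
      · simp only [← mul_assoc, ← hS]
        simp only [mul_assoc, ← hi]
    rw [h2, show h.anti X = 0 from hX, map_zero]

end IsClassicalPair

/-- Conclusions for Einstein constant `5/12`. -/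
theorem unstable_localMin_of_isEinstein (hL : IsInner (-(killingForm ℝ (lieAlg G))))
    (hρ : IsEinstein (subK G K) (stdMetric (subK G K)) (5 / 12))
    (hr : IsotropyReducible (subK G K) (AdK G K)) :
    IsEinstein (subK G K) (stdMetric (subK G K)) (5 / 12) ∧
      GUnstable (subK G K) (AdK G K) ∧ IsLocalMinScal (subK G K) (AdK G K) :=
  ⟨hρ, gUnstable_of_lt hL isAutSet_AdK hρ (by norm_num) hr,
    isLocalMinScal_of_lt hL isAutSet_AdK hρ (by norm_num)⟩

end Classical

/-! ### Lie algebras of groups preserving a form and of centralizers. -/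

section LieAlgebras

variable {ι : Type*} [Fintype ι] [DecidableEq ι] {G K : Subgroup (unitaryGroup ι ℂ)}
  {C X : Matrix ι ι ℂ} {ε : ℝ}

theorem exp_smul_mem_unitary (hX : Xᴴ = -X) (t : ℝ) :
    NormedSpace.exp (t • X) ∈ unitaryGroup ι ℂ := by
  rw [mem_unitaryGroup_iff, Matrix.star_eq_conjTranspose, ← Matrix.exp_conjTranspose,
    conjTranspose_smul, hX, star_trivial, exp_smul_mul_exp_smul_neg]

theorem mem_lieAlg_of_exp (h : ∀ t : ℝ, ∃ g ∈ G, (g : Matrix ι ι ℂ) = NormedSpace.exp (t • X)) :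
    X ∈ lieAlg G := LieSubalgebra.subset_lieSpan h

theorem adjC_exp (hC : IsForm C ε) (Y : Matrix ι ι ℂ) :
    adjC C (NormedSpace.exp Y) = NormedSpace.exp (adjC C Y) := by
  have hu : IsUnit C := (Matrix.isUnit_iff_isUnit_det C).2
    (Matrix.isUnit_det_of_right_inverse hC.mul_transpose)
  have hi : C⁻¹ = Cᵀ := Matrix.inv_eq_right_inv hC.mul_transpose
  rw [adjC_apply, adjC_apply, ← mul_assoc, ← mul_assoc, ← hi, Matrix.exp_conj' _ _ hu,
    Matrix.exp_transpose]

/-- The Lie algebra of the matrices that are skew with respect to `C`. -/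
def formAlg (hC : IsForm C ε) : LieSubalgebra ℝ (Matrix ι ι ℂ) where
  carrier := {X | adjC C X = -X}
  add_mem' := fun {a b} ha hb => by
    simp only [Set.mem_ofPred_eq] at *
    rw [map_add, ha, hb, neg_add]
  zero_mem' := by simp
  smul_mem' := fun c X hX => by
    simp only [Set.mem_ofPred_eq] at *
    rw [LinearMap.map_smul_of_tower, hX, smul_neg]
  lie_mem' := fun {a b} ha hb => by
    change adjC C a = -a at ha
    change adjC C b = -b at hb
    change adjC C (a * b - b * a) = -(a * b - b * a)
    rw [map_sub, adjC_mul hC, adjC_mul hC, ha, hb]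
    noncomm_ring

/-- One inclusion is obtained by differentiating the defining equation on generators, the other by
exponentiating. -/
theorem mem_lieAlg_iff (hC : IsForm C ε)
    (hG : ∀ g ∈ G, adjC C (g : Matrix ι ι ℂ) = (g : Matrix ι ι ℂ)ᴴ)
    (hG' : ∀ g : unitaryGroup ι ℂ, ∀ X : Matrix ι ι ℂ, Xᴴ = -X → adjC C X = -X →
      (g : Matrix ι ι ℂ) = NormedSpace.exp X → g ∈ G) :
    X ∈ lieAlg G ↔ Xᴴ = -X ∧ adjC C X = -X := by
  constructor
  · intro hX
    refine ⟨lieAlg_le_skewHerm hX, ?_⟩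
    have hle : lieAlg G ≤ formAlg hC := by
      refine LieSubalgebra.lieSpan_le.2 fun X hX => ?_
      change adjC C X = -X
      ext i j
      let f' : Matrix ι ι ℂ →ₗ[ℝ] ℂ :=
        { toFun := fun A => A i j, map_add' := by simp, map_smul' := by simp }
      let f : Matrix ι ι ℂ →ₗ[ℝ] ℂ := f' ∘ₗ (adjC C).restrictScalars ℝ
      have h1 := hasDerivAt_exp f X
      have h2 := hasDerivAt_exp f' (-X)
      have h3 : (fun t : ℝ => f (NormedSpace.exp (t • X))) =
          fun t : ℝ => f' (NormedSpace.exp (t • -X)) := funext fun t => by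
        obtain ⟨g, hg, hge⟩ := hX t
        rw [← conjTranspose_exp_smul hge, ← hge, ← hG g hg]
        rfl
      rw [h3] at h1
      exact h1.unique h2
    exact hle hX
  · rintro ⟨h1, h2⟩
    refine mem_lieAlg_of_exp fun t => ⟨⟨_, exp_smul_mem_unitary h1 t⟩, ?_, rfl⟩
    refine hG' _ (t • X) ?_ ?_ rfl
    · rw [conjTranspose_smul, h1, star_trivial, smul_neg]
    · rw [LinearMap.map_smul_of_tower, h2, smul_neg]

/-- The Lie algebra of the matrices that commute with `S`. -/
def centralizerAlg (S : Matrix ι ι ℂ) : LieSubalgebra ℝ (Matrix ι ι ℂ) where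
  carrier := {X | X * S = S * X}
  add_mem' := fun {a b} ha hb => by
    simp only [Set.mem_ofPred_eq] at *
    rw [add_mul, mul_add, ha, hb]
  zero_mem' := by simp
  smul_mem' := fun c X hX => by
    simp only [Set.mem_ofPred_eq] at *
    rw [smul_mul_assoc, mul_smul_comm, hX]
  lie_mem' := fun {a b} ha hb => by
    change a * S = S * a at ha
    change b * S = S * b at hb
    change (a * b - b * a) * S = S * (a * b - b * a)
    rw [sub_mul, mul_sub, mul_assoc, hb, ← mul_assoc, ha, mul_assoc b, ha, ← mul_assoc b, hb]
    simp only [mul_assoc]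

theorem lieAlg_le_centralizerAlg {S : Matrix ι ι ℂ} (h : G ≤ commutant S) :
    lieAlg G ≤ centralizerAlg S := by
  refine LieSubalgebra.lieSpan_le.2 fun X hX => ?_
  change X * S = S * X
  ext i j
  let f' : Matrix ι ι ℂ →ₗ[ℝ] ℂ :=
    { toFun := fun A => (A * S) i j - (S * A) i j
      map_add' := fun A B => by simp only [add_mul, mul_add, Matrix.add_apply]; ring
      map_smul' := fun c A => by
        simp only [smul_mul_assoc, mul_smul_comm, Matrix.smul_apply, smul_sub, RingHom.id_apply] }
  refine sub_eq_zero.1 (map_generator_eq_zero f' X fun t => ?_)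
  obtain ⟨g, hg, hge⟩ := hX t
  rw [← hge]
  change ((g : Matrix ι ι ℂ) * S) i j - (S * (g : Matrix ι ι ℂ)) i j = 0
  rw [show (g : Matrix ι ι ℂ) * S = S * (g : Matrix ι ι ℂ) from h hg, sub_self]

theorem exp_mem_commutant {S : Matrix ι ι ℂ} {g : unitaryGroup ι ℂ} (hX : X * S = S * X)
    (hg : (g : Matrix ι ι ℂ) = NormedSpace.exp X) : g ∈ commutant S := by
  change (g : Matrix ι ι ℂ) * S = S * (g : Matrix ι ι ℂ)
  rw [hg]
  exact ((show Commute S X from hX.symm).exp_right).symm.eq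

/-- The hypothesis says that the Lie span defining `lieAlg G` adds nothing to the generators; an
element commuting with `S` then exponentiates into the intersection. -/
theorem mem_lieAlg_inf_commutant {S : Matrix ι ι ℂ}
    (h : ∀ X ∈ lieAlg G, ∀ t : ℝ, ∃ g ∈ G, (g : Matrix ι ι ℂ) = NormedSpace.exp (t • X)) :
    X ∈ lieAlg (G ⊓ commutant S) ↔ X ∈ lieAlg G ∧ X * S = S * X := by
  refine ⟨fun hX => ⟨lieAlg_mono inf_le_left hX, lieAlg_le_centralizerAlg inf_le_right hX⟩,
    fun ⟨h1, h2⟩ => mem_lieAlg_of_exp fun t => ?_⟩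
  obtain ⟨g, hg, hge⟩ := h X h1 t
  exact ⟨g, ⟨hg, exp_mem_commutant (by rw [smul_mul_assoc, mul_smul_comm, h2]) hge⟩, hge⟩

theorem exists_exp_mem (hG' : ∀ g : unitaryGroup ι ℂ, ∀ X : Matrix ι ι ℂ, Xᴴ = -X →
      adjC C X = -X → (g : Matrix ι ι ℂ) = NormedSpace.exp X → g ∈ G)
    (h1 : Xᴴ = -X) (h2 : adjC C X = -X) (t : ℝ) :
    ∃ g ∈ G, (g : Matrix ι ι ℂ) = NormedSpace.exp (t • X) := by
  refine ⟨⟨_, exp_smul_mem_unitary h1 t⟩, hG' _ (t • X) ?_ ?_ rfl, rfl⟩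
  · rw [conjTranspose_smul, h1, star_trivial, smul_neg]
  · rw [LinearMap.map_smul_of_tower, h2, smul_neg]

theorem isForm_one : IsForm (1 : Matrix ι ι ℂ) 1 := ⟨by simp, by simp, by simp, by simp⟩

theorem isForm_J : IsForm (J ι ℂ) (-1) := by
  refine ⟨by simp [J_transpose], by simp [J_transpose, J_squared], ?_, by simp⟩
  ext i j
  rcases i with i | i <;> rcases j with j | j <;> simp [J, Matrix.one_apply, apply_ite, eq_comm]

theorem exp_mem_soGroup (g : unitaryGroup ι ℂ) (X : Matrix ι ι ℂ) (h1 : Xᴴ = -X)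
    (h2 : adjC 1 X = -X) (hg : (g : Matrix ι ι ℂ) = NormedSpace.exp X) : g ∈ soGroup ι := by
  have h3 : Xᵀ = -X := by simpa [adjC_apply] using h2
  refine ⟨fun i j => ?_, ?_⟩
  · rw [← Complex.conj_eq_iff_im, hg]
    have : (NormedSpace.exp X)ᴴ = (NormedSpace.exp X)ᵀ := by
      rw [← Matrix.exp_conjTranspose, ← Matrix.exp_transpose, h1, h3]
    exact congrFun (congrFun this j) i
  -- exp(X) is the square of the orthogonal matrix exp(X/2), whose determinant squares to 1.
  · have h4 : X = (2 : ℕ) • ((1 / 2 : ℝ) • X) := by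
      rw [← Nat.cast_smul_eq_nsmul ℝ, smul_smul]
      norm_num
    have h5 : (NormedSpace.exp ((1 / 2 : ℝ) • X))ᵀ * NormedSpace.exp ((1 / 2 : ℝ) • X) = 1 := by
      rw [← Matrix.exp_transpose, transpose_smul, h3, ← neg_neg ((1 / 2 : ℝ) • X), ← smul_neg]
      have := exp_smul_mul_exp_smul_neg (-X) (1 / 2 : ℝ)
      simpa using this
    have h6 := congrArg Matrix.det h5
    rw [Matrix.det_mul, Matrix.det_transpose, Matrix.det_one] at h6
    rw [hg, h4, Matrix.exp_nsmul, Matrix.det_pow, sq, h6]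

theorem adjC_of_mem_soGroup {g : unitaryGroup ι ℂ} (hg : g ∈ soGroup ι) :
    adjC 1 (g : Matrix ι ι ℂ) = (g : Matrix ι ι ℂ)ᴴ := by
  ext i j
  simpa [adjC_apply] using (Complex.conj_eq_iff_im.2 (hg.1 j i)).symm

theorem exp_mem_spGroup (g : unitaryGroup (ι ⊕ ι) ℂ) (X : Matrix (ι ⊕ ι) (ι ⊕ ι) ℂ)
    (_ : Xᴴ = -X) (h2 : adjC (J ι ℂ) X = -X)
    (hg : (g : Matrix (ι ⊕ ι) (ι ⊕ ι) ℂ) = NormedSpace.exp X) : g ∈ spGroup ι := by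
  have h3 : adjC (J ι ℂ) (g : Matrix (ι ⊕ ι) (ι ⊕ ι) ℂ) * (g : Matrix (ι ⊕ ι) (ι ⊕ ι) ℂ) = 1 := by
    rw [hg, adjC_exp isForm_J, h2]
    have := exp_smul_mul_exp_smul_neg (-X) (1 : ℝ)
    simpa using this
  change (g : Matrix (ι ⊕ ι) (ι ⊕ ι) ℂ)ᵀ * J ι ℂ * (g : Matrix (ι ⊕ ι) (ι ⊕ ι) ℂ) = J ι ℂ
  calc _ = J ι ℂ * (J ι ℂ)ᵀ * ((g : Matrix (ι ⊕ ι) (ι ⊕ ι) ℂ)ᵀ * J ι ℂ *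
        (g : Matrix (ι ⊕ ι) (ι ⊕ ι) ℂ)) := by rw [isForm_J.mul_transpose, one_mul]
    _ = J ι ℂ * (adjC (J ι ℂ) (g : Matrix (ι ⊕ ι) (ι ⊕ ι) ℂ) * (g : Matrix (ι ⊕ ι) (ι ⊕ ι) ℂ)) := by
        rw [adjC_apply]
        simp only [mul_assoc]
    _ = _ := by rw [h3, mul_one]

theorem adjC_of_mem_spGroup {g : unitaryGroup (ι ⊕ ι) ℂ} (hg : g ∈ spGroup ι) :
    adjC (J ι ℂ) (g : Matrix (ι ⊕ ι) (ι ⊕ ι) ℂ) = (g : Matrix (ι ⊕ ι) (ι ⊕ ι) ℂ)ᴴ := by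
  have h1 : (g : Matrix (ι ⊕ ι) (ι ⊕ ι) ℂ)ᵀ * J ι ℂ * (g : Matrix (ι ⊕ ι) (ι ⊕ ι) ℂ) = J ι ℂ := hg
  have h2 : (g : Matrix (ι ⊕ ι) (ι ⊕ ι) ℂ) * (g : Matrix (ι ⊕ ι) (ι ⊕ ι) ℂ)ᴴ = 1 :=
    (Unitary.mem_iff.1 g.2).2
  have h3 : adjC (J ι ℂ) (g : Matrix (ι ⊕ ι) (ι ⊕ ι) ℂ) * (g : Matrix (ι ⊕ ι) (ι ⊕ ι) ℂ) = 1 := by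
    rw [adjC_apply, mul_assoc, h1, isForm_J.transpose_mul]
  calc _ = adjC (J ι ℂ) (g : Matrix (ι ⊕ ι) (ι ⊕ ι) ℂ) * ((g : Matrix (ι ⊕ ι) (ι ⊕ ι) ℂ) *
        (g : Matrix (ι ⊕ ι) (ι ⊕ ι) ℂ)ᴴ) := by rw [h2, mul_one]
    _ = _ := by rw [← mul_assoc, h3, one_mul]

end LieAlgebras

/-! ### The orthogonal and symplectic families. -/

section Families

theorem isClassicalPair_so (n : ℕ) (hn : 0 < n) :
    IsClassicalPair (soG n) (soK n) 1 (Matrix.fromBlocks 0 0 0 (J (Fin (n + 1)) ℂ))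
      (Matrix.fromBlocks 0 0 0 1) 1 n (n + 1) where
  form := isForm_one
  mem_G _ := mem_lieAlg_iff isForm_one (fun _ hg => adjC_of_mem_soGroup hg) exp_mem_soGroup
  mem_K _ := mem_lieAlg_inf_commutant fun X hX => by
    have := (mem_lieAlg_iff isForm_one (fun _ hg => adjC_of_mem_soGroup hg) exp_mem_soGroup).1 hX
    exact exists_exp_mem exp_mem_soGroup this.1 this.2
  comm _ hg := hg.2
  conj := by
    rw [fromBlocks_conjTranspose, isForm_J.real, J_transpose, fromBlocks_neg]
    simp
  adj := by
    rw [adjC_apply, transpose_one, mul_one, one_mul, fromBlocks_transpose, J_transpose,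
      fromBlocks_neg]
    simp
  sq := by
    rw [fromBlocks_multiply, fromBlocks_neg]
    simp [J_squared]
  mul_q := by
    rw [fromBlocks_multiply]
    simp
  q_mul := by
    rw [fromBlocks_multiply]
    simp
  card := by
    simp
    ring
  trace_q := by
    rw [Matrix.trace, Fintype.sum_sum_type]
    simp
    ring
  eq_add := rfl
  pos₀ := Nat.cast_pos.2 hn
  pos₁ := by positivity

/-- Used to replace the Hermitian matrix diag(0, 1, 0, -1) by I times it, which is skew-Hermitian
with square `-q`. -/
theorem commutant_smul {ι : Type*} [Fintype ι] [DecidableEq ι] (S : Matrix ι ι ℂ) {c : ℂ}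
    (hc : c ≠ 0) : commutant (c • S) = commutant S := by
  ext g
  change (g : Matrix ι ι ℂ) * (c • S) = (c • S) * (g : Matrix ι ι ℂ) ↔
    (g : Matrix ι ι ℂ) * S = S * (g : Matrix ι ι ℂ)
  rw [mul_smul_comm, smul_mul_assoc]
  exact (smul_right_injective _ hc).eq_iff

/-- The diagonal matrix with entries `(0, 1, 0, -1)`. -/
theorem diagonal_sumElim {α β : Type*} [DecidableEq α] [DecidableEq β] :
    (Matrix.diagonal (Sum.elim (Sum.elim (fun _ => 0) (fun _ => 1))
      (Sum.elim (fun _ => 0) (fun _ => -1))) : Matrix ((α ⊕ β) ⊕ (α ⊕ β)) ((α ⊕ β) ⊕ (α ⊕ β)) ℂ) =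
    Matrix.fromBlocks (Matrix.fromBlocks 0 0 0 1) 0 0 (-Matrix.fromBlocks 0 0 0 1) := by
  rw [fromBlocks_neg]
  ext i j
  rcases i with (i | i) | (i | i) <;> rcases j with (j | j) | (j | j) <;>
    simp [Matrix.diagonal_apply, Matrix.one_apply, apply_ite]

/-- Here d₀ = 2n is the size of the block where `S` vanishes and d₁ = 2n - 1 that of each eigenspace
for ±I. -/
theorem isClassicalPair_sp (n : ℕ) (hn : 0 < n) :
    IsClassicalPair (spG n) (spK n) (J (Fin n ⊕ Fin (2 * n - 1)) ℂ)
      (Complex.I • Matrix.fromBlocks (Matrix.fromBlocks 0 0 0 1) 0 0 (-Matrix.fromBlocks 0 0 0 1))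
      (Matrix.fromBlocks (Matrix.fromBlocks 0 0 0 1) 0 0 (Matrix.fromBlocks 0 0 0 1))
      (-1) (2 * n) (2 * n - 1) := by
  have hK : spK n = spG n ⊓ commutant (Complex.I •
      Matrix.fromBlocks (Matrix.fromBlocks 0 0 0 1) 0 0 (-Matrix.fromBlocks 0 0 0 1)) := by
    rw [commutant_smul _ Complex.I_ne_zero, ← diagonal_sumElim]
    rfl
  set P : Matrix (Fin n ⊕ Fin (2 * n - 1)) (Fin n ⊕ Fin (2 * n - 1)) ℂ :=
    Matrix.fromBlocks 0 0 0 1 with hP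
  have hPP : P * P = P := by rw [hP, fromBlocks_multiply]; simp
  have hPt : Pᵀ = P := by rw [hP, fromBlocks_transpose]; simp
  have hPc : Pᴴ = P := by rw [hP, fromBlocks_conjTranspose]; simp
  -- Truncated subtraction in `Fin (2 * n - 1)` agrees with the complex one because n ≥ 1.
  have hc : ((2 * n - 1 : ℕ) : ℂ) = 2 * n - 1 := by
    rw [Nat.cast_sub (by omega)]
    simp
  exact
  { form := isForm_J
    mem_G := fun _ => mem_lieAlg_iff isForm_J (fun _ hg => adjC_of_mem_spGroup hg) exp_mem_spGroup
    mem_K := fun _ => by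
      rw [hK]
      refine mem_lieAlg_inf_commutant fun X hX => ?_
      have := (mem_lieAlg_iff isForm_J (fun _ hg => adjC_of_mem_spGroup hg) exp_mem_spGroup).1 hX
      exact exists_exp_mem exp_mem_spGroup this.1 this.2
    comm := fun _ hg => by
      rw [hK] at hg
      exact hg.2
    conj := by
      rw [conjTranspose_smul, fromBlocks_conjTranspose, conjTranspose_neg, hPc]
      simp
    adj := by
      rw [map_smul, adjC_apply, J_transpose, J, fromBlocks_transpose, fromBlocks_multiply,
        fromBlocks_neg, fromBlocks_multiply, transpose_neg, hPt, ← smul_neg, fromBlocks_neg (A := P)]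
      simp
    sq := by
      rw [smul_mul_smul_comm, Complex.I_mul_I, fromBlocks_multiply]
      simp [hPP]
    mul_q := by
      rw [smul_mul_assoc, fromBlocks_multiply]
      simp [hPP]
    q_mul := by
      rw [mul_smul_comm, fromBlocks_multiply]
      simp [hPP]
    card := by
      simp [hc]
      ring
    trace_q := by
      rw [hP, Matrix.trace, Fintype.sum_sum_type, Fintype.sum_sum_type]
      simp [hc]
      ring
    eq_add := by ring
    pos₀ := by positivity
    pos₁ := by
      have : (1 : ℝ) ≤ n := by exact_mod_cast hn
      linarith }

end Families

/-! ### The cubic form, its polarization and the adjoint identity. -/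

section Cubic

/-- The index set of the coordinates of the 27-dimensional space. -/
abbrev Idx : Type := Fin 3 × Fin 3 × Fin 3

/-- The symmetric bilinear product obtained by polarizing the gradient of the cubic form. -/
def cross : (Idx → ℂ) →ₗ[ℂ] (Idx → ℂ) →ₗ[ℂ] (Idx → ℂ) :=
  LinearMap.mk₂ ℂ (fun u v p =>
      u (p.1, p.2.1 + 1, p.2.2 + 1) * v (p.1, p.2.1 + 2, p.2.2 + 2) +
      u (p.1, p.2.1 + 2, p.2.2 + 2) * v (p.1, p.2.1 + 1, p.2.2 + 1) -
      u (p.1, p.2.1 + 1, p.2.2 + 2) * v (p.1, p.2.1 + 2, p.2.2 + 1) -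
      u (p.1, p.2.1 + 2, p.2.2 + 1) * v (p.1, p.2.1 + 1, p.2.2 + 2) -
      ∑ k, (u (p.1 + 1, p.2.2, k) * v (p.1 + 2, k, p.2.1) +
        u (p.1 + 2, k, p.2.1) * v (p.1 + 1, p.2.2, k)))
    (fun u u' v => by ext p; simp [add_mul, Finset.sum_add_distrib]; ring)
    (fun c u v => by ext p; simp only [Pi.smul_apply, smul_eq_mul, mul_add, mul_sub, Finset.mul_sum, mul_assoc])
    (fun u v v' => by ext p; simp [mul_add, Finset.sum_add_distrib]; ring)
    (fun c u v => by ext p; simp only [Pi.smul_apply, smul_eq_mul, mul_add, mul_sub, Finset.mul_sum, mul_left_comm])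

theorem cross_apply (u v : Idx → ℂ) (p : Idx) : cross u v p =
      u (p.1, p.2.1 + 1, p.2.2 + 1) * v (p.1, p.2.1 + 2, p.2.2 + 2) +
      u (p.1, p.2.1 + 2, p.2.2 + 2) * v (p.1, p.2.1 + 1, p.2.2 + 1) -
      u (p.1, p.2.1 + 1, p.2.2 + 2) * v (p.1, p.2.1 + 2, p.2.2 + 1) -
      u (p.1, p.2.1 + 2, p.2.2 + 1) * v (p.1, p.2.1 + 1, p.2.2 + 2) -
      ∑ k, (u (p.1 + 1, p.2.2, k) * v (p.1 + 2, k, p.2.1) +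
        u (p.1 + 2, k, p.2.1) * v (p.1 + 1, p.2.2, k)) := rfl

theorem cross_comm (u v : Idx → ℂ) : cross u v = cross v u := by
  ext p
  simp only [cross_apply, Fin.sum_univ_three]
  ring

/-- The symmetric trilinear form belonging to the cubic form. -/
def tri (u v w : Idx → ℂ) : ℂ := ∑ p, cross u v p * w p

theorem tri_comm_left (u v w : Idx → ℂ) : tri u v w = tri v u w := by
  rw [tri, cross_comm, tri]

theorem fin3_arith : (0 + 1 : Fin 3) = 1 ∧ (0 + 2 : Fin 3) = 2 ∧ (1 + 1 : Fin 3) = 2 ∧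
    (1 + 2 : Fin 3) = 0 ∧ (2 + 1 : Fin 3) = 0 ∧ (2 + 2 : Fin 3) = 1 := by decide

theorem tri_comm_right (u v w : Idx → ℂ) : tri u v w = tri u w v := by
  obtain ⟨h1, h2, h3, h4, h5, h6⟩ := fin3_arith
  simp only [tri, cross_apply, Fintype.sum_prod_type, Fin.sum_univ_three, h1, h2, h3, h4, h5, h6]
  ring

theorem cubicForm_eq (v : Idx → ℂ) : cubicForm v = tri v v v / 6 := by
  obtain ⟨h1, h2, h3, h4, h5, h6⟩ := fin3_arith
  simp only [tri, cross_apply, Fintype.sum_prod_type, Fin.sum_univ_three, h1, h2, h3, h4, h5, h6]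
  simp only [cubicForm, triple, Matrix.det_fin_three, Matrix.of_apply, Matrix.trace_fin_three, Matrix.mul_apply, Fin.sum_univ_three]
  ring

set_option maxHeartbeats 1000000 in
-- The adjoint identity (z#)# = N(z)z of the Albert algebra, with z × z = 2z#, which accounts for
-- the factor 8. It is checked coordinatewise.
theorem cross_cross_self (z : Idx → ℂ) (p : Idx) :
    cross (cross z z) (cross z z) p = 8 * cubicForm z * z p := by
  obtain ⟨h1, h2, h3, h4, h5, h6⟩ := fin3_arith
  simp only [cubicForm, triple, Matrix.det_fin_three, Matrix.of_apply, Matrix.trace_fin_three,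
    Matrix.mul_apply, Fin.sum_univ_three]
  obtain ⟨m, i, j⟩ := p
  fin_cases m <;> fin_cases i <;> fin_cases j <;>
  · simp only [cross_apply, Fin.sum_univ_three, Fin.zero_eta, Fin.mk_one, Fin.reduceFinMk, h1, h2,
      h3, h4, h5, h6]
    ring

theorem tri_eq (u v w : Idx → ℂ) : tri u v w = cross u v ⬝ᵥ w := rfl

theorem cross_add_smul_self (z x : Idx → ℂ) (t : ℂ) : cross (z + t • x) (z + t • x) =
    cross z z + (2 * t) • cross z x + t ^ 2 • cross x x := by
  simp only [map_add, map_smul, LinearMap.add_apply, LinearMap.smul_apply, cross_comm x z]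
  module

theorem tri_add_smul_self (z x : Idx → ℂ) (t : ℂ) :
    tri (z + t • x) (z + t • x) (z + t • x) =
      tri z z z + 3 * t * tri z z x + 3 * t ^ 2 * tri x x z + t ^ 3 * tri x x x := by
  have h1 : tri z x z = tri z z x := tri_comm_right _ _ _
  have h2 : tri z x x = tri x x z := by rw [tri_comm_left, tri_comm_right]
  simp only [tri_eq] at h1 h2 ⊢
  simp only [cross_add_smul_self, add_dotProduct, dotProduct_add, smul_dotProduct, dotProduct_smul,
    smul_eq_mul, h1, h2]
  ring

theorem cross_cross (z x : Idx → ℂ) :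
    cross (cross z z) (cross z x) = tri z z x • z + (1 / 3 * tri z z z) • x := by
  ext p
  have key : ∀ t : ℂ, cross (cross z z) (cross z z) p + 4 * t * cross (cross z z) (cross z x) p +
      t ^ 2 * (2 * cross (cross z z) (cross x x) p + 4 * cross (cross z x) (cross z x) p) +
      4 * t ^ 3 * cross (cross z x) (cross x x) p + t ^ 4 * cross (cross x x) (cross x x) p =
      4 / 3 * (tri z z z + 3 * t * tri z z x + 3 * t ^ 2 * tri x x z + t ^ 3 * tri x x x) *
        (z p + t * x p) := fun t => by
    have h := cross_cross_self (z + t • x) p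
    rw [cubicForm_eq, tri_add_smul_self, cross_add_smul_self] at h
    simp only [map_add, map_smul, LinearMap.add_apply, LinearMap.smul_apply, Pi.add_apply,
      Pi.smul_apply, smul_eq_mul, cross_comm (cross x x) (cross z z),
      cross_comm (cross x x) (cross z x), cross_comm (cross z x) (cross z z)] at h
    linear_combination h
  simp only [Pi.add_apply, Pi.smul_apply, smul_eq_mul]
  -- Both sides are polynomials of degree at most 4 in t; this combination of values at ±1 and ±2
  -- isolates the linear coefficient.
  linear_combination (8 * (key 1 - key (-1)) - (key 2 - key (-2))) / 48

/-- The index of the complex conjugate coordinate of the octonion to which `p` belongs. -/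
def bar (p : Idx) : Idx := (-p.1, p.2.2, p.2.1)

/-- The diagonal indices. -/
abbrev dg (k : Fin 3) : Idx := (0, k, k)

/-- The number of the octonion to which a non-diagonal index belongs. -/
def gr (p : Idx) : Option (Fin 3) :=
  if p.1 = 0 then (if p.2.1 = p.2.2 then none else some (-(p.2.1 + p.2.2)))
  else if p.1 = 1 then some p.2.1 else some p.2.2

/-- The basis vectors. -/
abbrev bv (p : Idx) : Idx → ℂ := Pi.single p 1

theorem fin3_neg : (-1 : Fin 3) = 2 ∧ (-2 : Fin 3) = 1 := by decide

/-- The Peirce decomposition for the k-th idempotent; together with the trilinear identities this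
table governs all later computations. -/
theorem cross_bv_dg (k : Fin 3) (v : Idx → ℂ) (p : Idx) : cross (bv (dg k)) v p =
    if gr p = some k then -v (bar p) else if p = dg (k + 1) then v (dg (k + 2)) else
      if p = dg (k + 2) then v (dg (k + 1)) else 0 := by
  obtain ⟨h1, h2, h3, h4, h5, h6⟩ := fin3_arith
  obtain ⟨m, i, j⟩ := p
  fin_cases k <;> fin_cases m <;> fin_cases i <;> fin_cases j <;>
  simp [cross_apply, Fin.sum_univ_three, h1, h2, h3, h4, h5, h6, fin3_neg.1, fin3_neg.2, gr, bar,
    Pi.single_apply]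

end Cubic

/-! ### The Lie algebras of E₆ and of its subgroup. -/

section CubicAlgebra

theorem hasDerivAt_bilin {E F : Type*} [NormedAddCommGroup E] [NormedSpace ℝ E]
    [FiniteDimensional ℝ E] [NormedAddCommGroup F] [NormedSpace ℝ F] (B : E →ₗ[ℝ] E →ₗ[ℝ] F)
    {u v : ℝ → E} {u' v' : E} {t : ℝ} (hu : HasDerivAt u u' t) (hv : HasDerivAt v v' t) :
    HasDerivAt (fun s => B (u s) (v s)) (B (u t) v' + B u' (v t)) t :=
  B.toContinuousBilinearMap.hasDerivAt_of_bilinear (fun _ => hu) (fun _ => hv)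

theorem hasDerivAt_tri {y : ℝ → Idx → ℂ} {y' : Idx → ℂ} {t : ℝ} (hy : HasDerivAt y y' t) :
    HasDerivAt (fun s => tri (y s) (y s) (y s)) (3 * tri (y t) (y t) y') t := by
  let B : (Idx → ℂ) →ₗ[ℝ] (Idx → ℂ) →ₗ[ℝ] (Idx → ℂ) :=
    LinearMap.mk₂ ℝ (fun u v => cross u v) (by simp) (by simp) (by simp) (by simp)
  let D : (Idx → ℂ) →ₗ[ℝ] (Idx → ℂ) →ₗ[ℝ] ℂ :=
    LinearMap.mk₂ ℝ (fun u v => u ⬝ᵥ v) (by simp [add_dotProduct]) (by simp [smul_dotProduct])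
      (by simp [dotProduct_add]) (by simp [dotProduct_smul])
  refine (hasDerivAt_bilin D (hasDerivAt_bilin B hy hy) hy).congr_deriv ?_
  have h1 : tri (y t) y' (y t) = tri (y t) (y t) y' := tri_comm_right _ _ _
  have h2 : tri y' (y t) (y t) = tri (y t) (y t) y' := by rw [tri_comm_left, tri_comm_right]
  change tri (y t) (y t) y' + (cross (y t) y' + cross y' (y t)) ⬝ᵥ y t = _
  rw [add_dotProduct, ← tri_eq, ← tri_eq, h1, h2]
  ring

theorem hasDerivAt_exp_mulVec (X : Matrix Idx Idx ℂ) (v : Idx → ℂ) (t : ℝ) :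
    HasDerivAt (fun t : ℝ => NormedSpace.exp (t • X) *ᵥ v)
      (X *ᵥ (NormedSpace.exp (t • X) *ᵥ v)) t := by
  let f : Matrix Idx Idx ℂ →ₗ[ℝ] (Idx → ℂ) :=
    { toFun := fun A => A *ᵥ v
      map_add' := fun A B => add_mulVec A B v
      map_smul' := fun c A => smul_mulVec c A v }
  have := hasDerivAt_exp_mul f X t
  rw [mulVec_mulVec]
  exact this

/-- The infinitesimal symmetries of the cubic form. -/
def IsCubicDer (X : Matrix Idx Idx ℂ) : Prop :=
  ∀ u v w, tri (X *ᵥ u) v w + tri u (X *ᵥ v) w + tri u v (X *ᵥ w) = 0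

/-- Polarization of the cubic polynomial v ↦ tri(v, v, Xv). -/
theorem isCubicDer_iff {X : Matrix Idx Idx ℂ} : IsCubicDer X ↔ ∀ v, tri v v (X *ᵥ v) = 0 := by
  constructor
  · intro h v
    have h1 := h v v v
    rw [tri_comm_right v (X *ᵥ v), tri_comm_left (X *ᵥ v), tri_comm_right v (X *ᵥ v)] at h1
    linear_combination h1 / 3
  · intro h
    -- The part linear in v: the odd part of the identity at u + v, minus its cubic part, which is
    -- the identity at v.
    have h2 : ∀ u v, 2 * tri u v (X *ᵥ u) + tri u u (X *ᵥ v) = 0 := fun u v => by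
      have e1 := h (u + v)
      have e2 := h (u - v)
      have e3 := h v
      have e4 : tri v u (X *ᵥ u) = tri u v (X *ᵥ u) := tri_comm_left _ _ _
      have e5 : tri v u (X *ᵥ v) = tri u v (X *ᵥ v) := tri_comm_left _ _ _
      simp only [tri_eq] at e1 e2 e3 e4 e5 ⊢
      simp only [map_add, map_sub, LinearMap.add_apply, LinearMap.sub_apply, mulVec_add, mulVec_sub,
        add_dotProduct, sub_dotProduct, dotProduct_add, dotProduct_sub] at e1 e2
      linear_combination (e1 - e2) / 2 - e3 - e4
    intro u v w
    have e1 := h2 (u + w) v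
    have e2 := h2 u v
    have e3 := h2 w v
    have e4 : tri (X *ᵥ u) v w = tri w v (X *ᵥ u) := by
      rw [tri_comm_right, tri_comm_left, tri_comm_right, tri_comm_left]
    have e5 : tri u (X *ᵥ v) w = tri u w (X *ᵥ v) := tri_comm_right _ _ _
    have e6 : tri w u (X *ᵥ v) = tri u w (X *ᵥ v) := tri_comm_left _ _ _
    rw [e4, e5]
    simp only [tri_eq] at e1 e2 e3 e6 ⊢
    simp only [map_add, LinearMap.add_apply, mulVec_add, add_dotProduct, dotProduct_add] at e1
    linear_combination (e1 - e2 - e3 - e6) / 2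

/-- The Lie algebra of the infinitesimal symmetries of the cubic form. -/
def cubicAlg : LieSubalgebra ℝ (Matrix Idx Idx ℂ) where
  carrier := {X | IsCubicDer X}
  add_mem' := fun {a b} ha hb u v w => by
    have h1 := ha u v w
    have h2 := hb u v w
    simp only [tri_eq] at *
    simp only [add_mulVec, map_add, LinearMap.add_apply, add_dotProduct, dotProduct_add]
    linear_combination h1 + h2
  zero_mem' := fun u v w => by simp [tri_eq]
  smul_mem' := fun c X hX u v w => by
    have h1 := hX u v w
    have : c • X = (c : ℂ) • X := by ext; simp
    simp only [tri_eq] at *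
    simp only [this, smul_mulVec, map_smul, LinearMap.smul_apply, smul_dotProduct, dotProduct_smul,
      smul_eq_mul]
    linear_combination (c : ℂ) * h1
  lie_mem' := fun {a b} ha hb u v w => by
    change tri ((a * b - b * a) *ᵥ u) v w + tri u ((a * b - b * a) *ᵥ v) w +
      tri u v ((a * b - b * a) *ᵥ w) = 0
    have a1 := ha (b *ᵥ u) v w
    have a2 := ha u (b *ᵥ v) w
    have a3 := ha u v (b *ᵥ w)
    have b1 := hb (a *ᵥ u) v w
    have b2 := hb u (a *ᵥ v) w
    have b3 := hb u v (a *ᵥ w)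
    simp only [tri_eq] at *
    simp only [sub_mulVec, ← mulVec_mulVec, map_sub, LinearMap.sub_apply, sub_dotProduct,
      dotProduct_sub]
    linear_combination a1 + a2 + a3 - b1 - b2 - b3

/-- The derivative of the cubic form along exp(tX)v is tri(y, y, Xy)/2 at y = exp(tX)v, which
vanishes for all t. -/
theorem cubicForm_exp {X : Matrix Idx Idx ℂ} (hX : IsCubicDer X) (t : ℝ) (v : Idx → ℂ) :
    cubicForm (NormedSpace.exp (t • X) *ᵥ v) = cubicForm v := by
  have hd : ∀ s : ℝ, HasDerivAt (fun s : ℝ => tri (NormedSpace.exp (s • X) *ᵥ v)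
      (NormedSpace.exp (s • X) *ᵥ v) (NormedSpace.exp (s • X) *ᵥ v)) 0 s := fun s =>
    (hasDerivAt_tri (hasDerivAt_exp_mulVec X v s)).congr_deriv (by
      rw [isCubicDer_iff.1 hX, mul_zero])
  have h := is_const_of_deriv_eq_zero (fun s => (hd s).differentiableAt) (fun s => (hd s).deriv) t 0
  rw [cubicForm_eq, cubicForm_eq]
  simp only [zero_smul, NormedSpace.exp_zero, one_mulVec] at h
  rw [h]

theorem exp_mem_e6G {X : Matrix Idx Idx ℂ} (h1 : Xᴴ = -X) (h2 : IsCubicDer X) (t : ℝ) :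
    ∃ g ∈ e6G, (g : Matrix Idx Idx ℂ) = NormedSpace.exp (t • X) :=
  ⟨⟨_, exp_smul_mem_unitary h1 t⟩, fun v => cubicForm_exp h2 t v, rfl⟩

theorem mem_lieAlg_e6G {X : Matrix Idx Idx ℂ} : X ∈ lieAlg e6G ↔ Xᴴ = -X ∧ IsCubicDer X := by
  refine ⟨fun hX => ⟨lieAlg_le_skewHerm hX, ?_⟩, fun h => mem_lieAlg_of_exp (exp_mem_e6G h.1 h.2)⟩
  have hle : lieAlg e6G ≤ cubicAlg := by
    refine LieSubalgebra.lieSpan_le.2 fun X hX => isCubicDer_iff.2 fun v => ?_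
    have h1 := hasDerivAt_tri (hasDerivAt_exp_mulVec X v 0)
    have h2 : (fun s : ℝ => tri (NormedSpace.exp (s • X) *ᵥ v)
        (NormedSpace.exp (s • X) *ᵥ v) (NormedSpace.exp (s • X) *ᵥ v)) =
        fun _ => tri v v v := funext fun t => by
      obtain ⟨g, hg, hge⟩ := hX t
      have h3 := hg v
      rw [cubicForm_eq, cubicForm_eq, hge] at h3
      linear_combination 6 * h3
    rw [h2] at h1
    have h4 := h1.unique (hasDerivAt_const (0 : ℝ) _)
    simp only [zero_smul, NormedSpace.exp_zero, one_mulVec] at h4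
    linear_combination h4 / 3
  exact hle hX

theorem mem_lieAlg_e6K {X : Matrix Idx Idx ℂ} : X ∈ lieAlg e6K ↔ X ∈ lieAlg e6G ∧
    ∀ i : Fin 3, X * Matrix.diagonal (bv (dg i)) = Matrix.diagonal (bv (dg i)) * X := by
  refine ⟨fun hX => ⟨lieAlg_mono inf_le_left hX, fun i => lieAlg_le_centralizerAlg
    (inf_le_right.trans (iInf_le _ i)) hX⟩, fun ⟨h1, h2⟩ => mem_lieAlg_of_exp fun t => ?_⟩
  obtain ⟨h3, h4⟩ := mem_lieAlg_e6G.1 h1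
  obtain ⟨g, hg, hge⟩ := exp_mem_e6G h3 h4 t
  exact ⟨g, ⟨hg, Subgroup.mem_iInf.2 fun i => exp_mem_commutant
    (by rw [smul_mul_assoc, mul_smul_comm, h2]) hge⟩, hge⟩

end CubicAlgebra

/-! ### The three octonions and the products with the idempotents. -/

section Grading

theorem gr_dg (k : Fin 3) : gr (dg k) = none := by simp [gr]

theorem bar_bar (p : Idx) : bar (bar p) = p := by simp [bar]

theorem gr_bar (p : Idx) : gr (bar p) = gr p := by
  revert p; decide

theorem eq_dg_of_gr {p : Idx} (h : gr p = none) : ∃ k, p = dg k := by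
  revert p; decide

theorem ne_dg_of_gr {p : Idx} {l : Fin 3} (h : gr p = some l) (k : Fin 3) : p ≠ dg k := by
  rintro rfl
  simp [gr_dg] at h

theorem dg_injective : Function.Injective dg := fun i j h => by simpa using h

theorem fin3_cases (k i : Fin 3) : i = k ∨ i = k + 1 ∨ i = k + 2 := by
  revert k i; decide

theorem fin3_add (k : Fin 3) : k + 1 ≠ k ∧ k + 2 ≠ k ∧ k + 1 ≠ k + 2 ∧ k + 1 + 1 = k + 2 ∧
    k + 1 + 2 = k ∧ k + 2 + 1 = k ∧ k + 2 + 2 = k + 1 := by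
  revert k; decide

theorem cross_bv_dg_of_gr {k : Fin 3} {p : Idx} (h : gr p = some k) (v : Idx → ℂ) :
    cross (bv (dg k)) v p = -v (bar p) := by
  rw [cross_bv_dg, if_pos h]

theorem cross_bv_dg_of_ne {k l : Fin 3} {p : Idx} (h : gr p = some l) (hl : l ≠ k) (v : Idx → ℂ) :
    cross (bv (dg k)) v p = 0 := by
  rw [cross_bv_dg, if_neg (by simp [h, hl]), if_neg (ne_dg_of_gr h _), if_neg (ne_dg_of_gr h _)]

theorem cross_bv_dg_self (k : Fin 3) (v : Idx → ℂ) : cross (bv (dg k)) v (dg k) = 0 := by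
  obtain ⟨h1, h2, -⟩ := fin3_add k
  rw [cross_bv_dg, if_neg (by simp [gr_dg]), if_neg (by simpa using h1.symm),
    if_neg (by simpa using h2.symm)]

theorem cross_bv_dg_add_one (k : Fin 3) (v : Idx → ℂ) :
    cross (bv (dg k)) v (dg (k + 1)) = v (dg (k + 2)) := by
  rw [cross_bv_dg, if_neg (by simp [gr_dg]), if_pos rfl]

theorem cross_bv_dg_add_two (k : Fin 3) (v : Idx → ℂ) :
    cross (bv (dg k)) v (dg (k + 2)) = v (dg (k + 1)) := by
  obtain ⟨h1, h2, h3, -⟩ := fin3_add k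
  rw [cross_bv_dg, if_neg (by simp [gr_dg]), if_neg (by simpa using h3.symm), if_pos rfl]

theorem bv_self (p : Idx) : bv p p = 1 := Pi.single_eq_same _ _

theorem bv_ne {p q : Idx} (h : p ≠ q) : bv q p = 0 := Pi.single_eq_of_ne h _

theorem bv_dg_ne {i j : Fin 3} (h : i ≠ j) : bv (dg j) (dg i) = 0 :=
  bv_ne (dg_injective.ne h)

theorem star_bv (q : Idx) : star (bv q) = bv q := by
  ext r
  simp only [Pi.star_apply, Pi.single_apply]
  split_ifs <;> simp

/-- The projection to the coordinates of one octonion. -/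
def restr (l : Fin 3) (u : Idx → ℂ) : Idx → ℂ := fun p => if gr p = some l then u p else 0

theorem restr_apply {l : Fin 3} {p : Idx} (h : gr p = some l) (u : Idx → ℂ) :
    restr l u p = u p := if_pos h

theorem restr_apply_of_ne {l : Fin 3} {p : Idx} (h : gr p ≠ some l) (u : Idx → ℂ) :
    restr l u p = 0 := if_neg h

theorem restr_dg (l k : Fin 3) (u : Idx → ℂ) : restr l u (dg k) = 0 :=
  restr_apply_of_ne (by simp [gr_dg]) u

theorem star_restr (l : Fin 3) (u : Idx → ℂ) : star (restr l u) = restr l (star u) := by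
  ext p
  by_cases h : gr p = some l <;> simp [restr, h]

theorem cross_bv_restr {k l : Fin 3} (h : l ≠ k) (u : Idx → ℂ) :
    cross (bv (dg k)) (restr l u) = 0 := by
  ext p
  rw [cross_bv_dg]
  split_ifs with h1
  · rw [restr_apply_of_ne (by rw [gr_bar, h1]; simpa using h.symm), neg_zero]; rfl
  · rw [restr_dg]; rfl
  · rw [restr_dg]; rfl
  · rfl

theorem cross_bv_bv_self (k : Fin 3) : cross (bv (dg k)) (bv (dg k)) = 0 := by
  obtain ⟨h1, h2, -⟩ := fin3_add k
  ext p
  rw [cross_bv_dg]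
  split_ifs with h
  · rw [bv_ne (ne_dg_of_gr (by rw [gr_bar, h]) k), neg_zero]; rfl
  · rw [bv_dg_ne h2]; rfl
  · rw [bv_dg_ne h1]; rfl
  · rfl

theorem cross_bv_bv_add_one (k : Fin 3) :
    cross (bv (dg k)) (bv (dg (k + 1))) = bv (dg (k + 2)) := by
  obtain ⟨h1, h2, h3, -⟩ := fin3_add k
  ext p
  rw [cross_bv_dg]
  split_ifs with h h4 h5
  · rw [bv_ne (ne_dg_of_gr (by rw [gr_bar, h]) _), bv_ne (ne_dg_of_gr h _), neg_zero]
  · rw [h4, bv_dg_ne h3.symm, bv_dg_ne h3]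
  · rw [h5, bv_self, bv_self]
  · rw [bv_ne h5]

end Grading

/-! ### Explicit elements of the Lie algebra of E₆. -/

section Rotations

theorem star_cross (u v : Idx → ℂ) : star (cross u v) = cross (star u) (star v) := by
  ext p
  simp only [Pi.star_apply, cross_apply, Fin.sum_univ_three, star_add, star_sub, star_mul']

/-- The linear map `z ↦ ⟨x, z⟩ y - x × (y × z)`. -/
noncomputable def rmap (x y : Idx → ℂ) : (Idx → ℂ) →ₗ[ℂ] (Idx → ℂ) where
  toFun z := (x ⬝ᵥ z) • y - cross x (cross y z)
  map_add' z w := by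
    simp only [dotProduct_add, map_add]
    module
  map_smul' c z := by
    simp only [dotProduct_smul, map_smul, RingHom.id_apply, smul_eq_mul]
    module

theorem rmap_apply (x y z : Idx → ℂ) : rmap x y z = (x ⬝ᵥ z) • y - cross x (cross y z) := rfl

theorem rmap_transpose (x y z w : Idx → ℂ) : rmap x y z ⬝ᵥ w = rmap y x w ⬝ᵥ z := by
  have h1 : cross x (cross y z) ⬝ᵥ w = cross y (cross x w) ⬝ᵥ z := by
    rw [← tri_eq, ← tri_eq, tri_comm_right, tri_comm_right y, tri_eq, tri_eq, dotProduct_comm]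
  rw [rmap_apply, rmap_apply, sub_dotProduct, sub_dotProduct, h1, smul_dotProduct, smul_dotProduct, smul_eq_mul,
    smul_eq_mul, mul_comm]

theorem star_rmap (x y z : Idx → ℂ) : star (rmap x y z) = rmap (star x) (star y) (star z) := by
  rw [rmap_apply, rmap_apply, star_sub, star_cross, star_cross, star_smul, star_dotProduct_star,
    dotProduct_comm z]

/-- By symmetry of the trilinear form the second term of `rmap` is x paired with (z × z) × (z × y),
which `cross_cross` evaluates; it cancels the first term up to a multiple of the pairing of x and y.
-/
theorem tri_rmap {x y : Idx → ℂ} (h : x ⬝ᵥ y = 0) (z : Idx → ℂ) : tri z z (rmap x y z) = 0 := by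
  have h1 : cross z z ⬝ᵥ cross x (cross y z) = tri z z y * (x ⬝ᵥ z) := by
    rw [dotProduct_comm, ← tri_eq, tri_comm_left, tri_comm_right, tri_comm_left, tri_eq,
      cross_comm y z, cross_cross, add_dotProduct, smul_dotProduct, smul_dotProduct,
      dotProduct_comm y x, h, dotProduct_comm z x, smul_zero, add_zero, smul_eq_mul]
  rw [tri_eq, rmap_apply, dotProduct_sub, h1, dotProduct_smul, ← tri_eq, smul_eq_mul]
  ring

/-- The skew-Hermitian part of `rmap`. -/
noncomputable def dmat (x y : Idx → ℂ) : Matrix Idx Idx ℂ :=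
  LinearMap.toMatrix' (rmap x y) - LinearMap.toMatrix' (rmap (star y) (star x))

theorem dmat_mulVec (x y z : Idx → ℂ) :
    dmat x y *ᵥ z = rmap x y z - rmap (star y) (star x) z := by
  rw [dmat, sub_mulVec, LinearMap.toMatrix'_mulVec, LinearMap.toMatrix'_mulVec]

theorem conjTranspose_rmap (x y : Idx → ℂ) :
    (LinearMap.toMatrix' (rmap x y))ᴴ = LinearMap.toMatrix' (rmap (star y) (star x)) := by
  ext p q
  rw [conjTranspose_apply, LinearMap.toMatrix'_apply, LinearMap.toMatrix'_apply]
  have h := rmap_transpose x y (bv p) (bv q)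
  rw [dotProduct_single_one, dotProduct_single_one] at h
  have h2 := congrFun (star_rmap y x (bv q)) p
  rw [star_bv] at h2
  exact (congrArg star h).trans h2

/-- The conjugate transpose of `rmap x y` is `rmap (star y) (star x)`, again an infinitesimal
symmetry, so the difference is skew-Hermitian. -/
theorem dmat_mem {x y : Idx → ℂ} (h : x ⬝ᵥ y = 0) : dmat x y ∈ lieAlg e6G := by
  refine mem_lieAlg_e6G.2 ⟨?_, isCubicDer_iff.2 fun v => ?_⟩
  · rw [dmat, ← conjTranspose_rmap, conjTranspose_sub, conjTranspose_conjTranspose, neg_sub]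
  · rw [dmat_mulVec, tri_eq, dotProduct_sub, ← tri_eq, ← tri_eq, tri_rmap h, tri_rmap, sub_zero]
    rw [star_dotProduct_star, h, star_zero]

theorem bv_dotProduct_restr (k l : Fin 3) (u : Idx → ℂ) : bv (dg k) ⬝ᵥ restr l u = 0 := by
  rw [single_one_dotProduct, restr_dg]

/-- The embedding of an octonion into the Lie algebra. -/
noncomputable def yv (l : Fin 3) : (Idx → ℂ) →ₗ[ℝ] lieAlg e6G where
  toFun u := ⟨dmat (bv (dg (l + 2))) (restr l u), dmat_mem (bv_dotProduct_restr _ _ _)⟩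
  map_add' u v := Subtype.ext <| by
    have hr : restr l (u + v) = restr l u + restr l v := by
      ext p
      by_cases h : gr p = some l <;> simp [restr, h]
    change dmat _ _ = dmat _ _ + dmat _ _
    refine Matrix.ext_of_mulVec_single fun p => ?_
    rw [add_mulVec]
    simp only [dmat_mulVec, hr, rmap_apply, star_add, map_add, LinearMap.add_apply, add_dotProduct]
    module
  map_smul' c u := Subtype.ext <| by
    have hr : restr l (c • u) = (c : ℂ) • restr l u := by
      ext p
      by_cases h : gr p = some l <;> simp [restr, h]
    have hc : ∀ A : Matrix Idx Idx ℂ, c • A = (c : ℂ) • A := fun A => by ext; simp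
    change dmat _ _ = c • dmat _ _
    refine Matrix.ext_of_mulVec_single fun p => ?_
    rw [hc, smul_mulVec]
    simp only [dmat_mulVec, hr, rmap_apply, star_smul, map_smul, LinearMap.smul_apply,
      smul_dotProduct, smul_eq_mul, RCLike.star_def, Complex.conj_ofReal]
    module

theorem coe_yv (l : Fin 3) (u : Idx → ℂ) :
    (yv l u : Matrix Idx Idx ℂ) = dmat (bv (dg (l + 2))) (restr l u) := rfl

theorem yv_mulVec (l : Fin 3) (u z : Idx → ℂ) : (yv l u : Matrix Idx Idx ℂ) *ᵥ z =
    z (dg (l + 2)) • restr l u - cross (bv (dg (l + 2))) (cross (restr l u) z) -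
      ((restr l (star u) ⬝ᵥ z) • bv (dg (l + 2)) -
        cross (restr l (star u)) (cross (bv (dg (l + 2))) z)) := by
  rw [coe_yv, dmat_mulVec, rmap_apply, rmap_apply, star_restr, star_bv, single_one_dotProduct]

/-- This and the two next lemmas compute the action on the three idempotents; these columns serve as
coordinates on the isotropy representation. -/
theorem yv_mulVec_add_two (l : Fin 3) (u : Idx → ℂ) :
    (yv l u : Matrix Idx Idx ℂ) *ᵥ bv (dg (l + 2)) = restr l u := by
  rw [yv_mulVec, cross_comm (restr l u), cross_bv_restr (fin3_add l).2.1.symm, cross_bv_bv_self,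
    dotProduct_comm, bv_dotProduct_restr]
  simp

theorem yv_mulVec_self (l : Fin 3) (u : Idx → ℂ) :
    (yv l u : Matrix Idx Idx ℂ) *ᵥ bv (dg l) = 0 := by
  obtain ⟨h1, h2, h3, h4, h5, h6, h7⟩ := fin3_add l
  have e1 : cross (bv (dg (l + 2))) (bv (dg l)) = bv (dg (l + 1)) := by
    have := cross_bv_bv_add_one (l + 2)
    rwa [h6, h7] at this
  have e2 : cross (bv (dg (l + 2))) (cross (restr l u) (bv (dg l))) = 0 := by
    ext p
    rw [cross_comm (restr l u), cross_bv_dg]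
    split_ifs with h8
    · rw [cross_bv_dg_of_ne (l := l + 2) (by rw [gr_bar, h8]) h2, neg_zero]; rfl
    · rw [h7, cross_bv_dg_add_one, restr_dg]; rfl
    · rw [h6, cross_bv_dg_self]; rfl
    · rfl
  rw [yv_mulVec, e1, e2, cross_comm (restr l (star u)), cross_bv_restr h1.symm, dotProduct_comm,
    bv_dotProduct_restr, bv_dg_ne h2]
  simp

theorem yv_mulVec_add_one (l : Fin 3) (u : Idx → ℂ) :
    (yv l u : Matrix Idx Idx ℂ) *ᵥ bv (dg (l + 1)) = restr l fun p => -star (u (bar p)) := by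
  obtain ⟨h1, h2, h3, h4, h5, h6, h7⟩ := fin3_add l
  have e1 : cross (bv (dg (l + 2))) (bv (dg (l + 1))) = bv (dg l) := by
    have := cross_bv_bv_add_one (l + 1)
    rwa [h4, h5, cross_comm] at this
  rw [yv_mulVec, e1, cross_comm (restr l u), cross_bv_restr h1.symm, dotProduct_comm,
    bv_dotProduct_restr, bv_dg_ne h3.symm]
  ext p
  simp only [map_zero, zero_smul, zero_sub, sub_zero, neg_neg]
  rw [cross_comm]
  by_cases h8 : gr p = some l
  · rw [cross_bv_dg_of_gr h8, restr_apply (by rw [gr_bar, h8]), restr_apply h8]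
    rfl
  · rw [restr_apply_of_ne h8, cross_bv_dg, if_neg h8]
    split_ifs
    · exact restr_dg _ _ _
    · exact restr_dg _ _ _
    · rfl

end Rotations

/-! ### Relations between matrix entries, and sign changes. -/

section Entries

variable {X : Matrix Idx Idx ℂ}

theorem entry_star (hX : X ∈ lieAlg e6G) (p q : Idx) : X p q = -star (X q p) := by
  have h := congrFun (congrFun (mem_lieAlg_e6G.1 hX).1 p) q
  rw [conjTranspose_apply, neg_apply] at h
  rw [h, neg_neg]

/-- The derivation identity at two idempotents; with `cross_bv_dg` each choice of indices becomes a
linear relation between columns. -/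
theorem cubicDer_dg (hX : X ∈ lieAlg e6G) (i j : Fin 3) (p : Idx) :
    cross (bv (dg j)) (X.col (dg i)) p + cross (bv (dg i)) (X.col (dg j)) p +
      cross (bv (dg i)) (bv (dg j)) ⬝ᵥ X.col p = 0 := by
  have h := (mem_lieAlg_e6G.1 hX).2 (bv (dg i)) (bv (dg j)) (bv p)
  rw [tri_comm_left] at h
  simpa only [tri_eq, mulVec_single_one, dotProduct_single_one] using h

theorem entry_eq_zero_of_gr (hX : X ∈ lieAlg e6G) {i : Fin 3} {p : Idx} (h : gr p = some i) :
    X p (dg i) = 0 := by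
  have h1 := cubicDer_dg hX i i (bar p)
  rw [cross_bv_dg_of_gr (by rw [gr_bar, h]), cross_bv_bv_self, bar_bar, zero_dotProduct,
    Matrix.col_apply] at h1
  linear_combination -h1 / 2

theorem entry_dg_eq_zero (hX : X ∈ lieAlg e6G) {i l : Fin 3} (h : l ≠ i) :
    X (dg l) (dg i) = 0 := by
  rcases fin3_cases i l with rfl | rfl | rfl
  · exact absurd rfl h
  · have h1 := cubicDer_dg hX i i (dg (i + 2))
    rw [cross_bv_bv_self, zero_dotProduct, cross_bv_dg_add_two, Matrix.col_apply] at h1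
    linear_combination h1 / 2
  · have h1 := cubicDer_dg hX i i (dg (i + 1))
    rw [cross_bv_bv_self, zero_dotProduct, cross_bv_dg_add_one, Matrix.col_apply] at h1
    linear_combination h1 / 2

/-- The relation for the idempotents l and l + 1, whose product is the third one; skew-Hermitian
symmetry turns the remaining row entry into a conjugate. So the column at l + 1 carries no new
information on the l-th octonion. -/
theorem entry_bar (hX : X ∈ lieAlg e6G) {l : Fin 3} {p : Idx} (h : gr p = some l) :
    X p (dg (l + 1)) = -star (X (bar p) (dg (l + 2))) := by
  obtain ⟨h1, h2, -⟩ := fin3_add l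
  have h3 := cubicDer_dg hX (l + 1) l (bar p)
  rw [cross_bv_dg_of_gr (by rw [gr_bar, h]), bar_bar, cross_bv_dg_of_ne (by rw [gr_bar, h]) h1.symm,
    cross_comm, cross_bv_bv_add_one, single_one_dotProduct, Matrix.col_apply, Matrix.col_apply,
    entry_star hX (dg (l + 2))] at h3
  linear_combination -h3

theorem entry_dg_sum (hX : X ∈ lieAlg e6G) :
    X (dg 0) (dg 0) + X (dg 1) (dg 1) + X (dg 2) (dg 2) = 0 := by
  have h1 := cubicDer_dg hX 1 2 (dg 0)
  have h2 := cross_bv_dg_add_one 2 (X.col (dg 1))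
  have h3 := cross_bv_dg_add_two 1 (X.col (dg 2))
  have h4 := cross_bv_bv_add_one 1
  obtain ⟨a1, a2, a3, a4, a5, a6⟩ := fin3_arith
  simp only [a1, a2, a3, a4, a5, a6] at h2 h3 h4
  rw [h2, h3, h4, single_one_dotProduct] at h1
  simp only [Matrix.col_apply] at h1
  linear_combination h1

/-- The matrices that map the diagonal basis vectors to multiples of themselves. -/
def FixesLines (X : Matrix Idx Idx ℂ) : Prop := ∀ k p, p ≠ dg k → X p (dg k) = 0

/-- The idempotent e_k is an eigenvector of X and multiplies the l-th octonion to zero, so the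
derivation identity at e_k, p and the conjugate of r has a single surviving term. -/
theorem FixesLines.entry_eq_zero (h : FixesLines X) (hX : X ∈ lieAlg e6G) {p r : Idx} {k l : Fin 3}
    (hp : gr p = some l) (hr : gr r = some k) (hkl : k ≠ l) : X r p = 0 := by
  have h1 := (mem_lieAlg_e6G.1 hX).2 (bv (dg k)) (bv p) (bv (bar r))
  have h2 : bv p = restr l (bv p) := by
    ext q
    rw [restr]
    split_ifs with hq
    · rfl
    · refine bv_ne ?_
      rintro rfl
      exact hq hp
  have h3 : cross (bv (dg k)) (bv p) = 0 := by rw [h2, cross_bv_restr hkl.symm]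
  have h4 : X *ᵥ bv (dg k) = X (dg k) (dg k) • bv (dg k) := by
    ext q
    rw [mulVec_single_one, Matrix.col_apply, Pi.smul_apply, smul_eq_mul]
    by_cases hq : q = dg k
    · rw [hq, bv_self, mul_one]
    · rw [h k q hq, bv_ne hq, mul_zero]
  rw [h4, tri_eq, map_smul, LinearMap.smul_apply, h3, smul_zero, zero_dotProduct, tri_eq, tri_eq, h3,
    zero_dotProduct, dotProduct_single_one, cross_bv_dg_of_gr (by rw [gr_bar, hr]), bar_bar,
    mulVec_single_one, Matrix.col_apply] at h1
  linear_combination -h1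

theorem commute_diagonal_bv_iff (hX : X ∈ lieAlg e6G) (k : Fin 3) :
    X * Matrix.diagonal (bv (dg k)) = Matrix.diagonal (bv (dg k)) * X ↔
      ∀ p, p ≠ dg k → X p (dg k) = 0 := by
  constructor
  · intro h p hp
    have h1 := congrFun (congrFun h p) (dg k)
    rwa [mul_diagonal, diagonal_mul, bv_self, bv_ne hp, mul_one, zero_mul] at h1
  · intro h
    ext p q
    rw [mul_diagonal, diagonal_mul]
    by_cases hp : p = dg k <;> by_cases hq : q = dg k
    · rw [hp, hq, mul_comm]
    · rw [hp, bv_ne hq, entry_star hX, h q hq]; simp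
    · rw [hq, bv_ne hp, h p hp]; simp
    · rw [bv_ne hp, bv_ne hq]; simp

theorem mem_lieAlg_e6K_iff (hX : X ∈ lieAlg e6G) : X ∈ lieAlg e6K ↔ FixesLines X := by
  rw [mem_lieAlg_e6K, and_iff_right hX]
  exact forall_congr' fun k => commute_diagonal_bv_iff hX k

/-- The character of the `l`-th octonion. -/
def chi (l n : Fin 3) : ℤ := if n = l then 1 else -1

/-- The signs by which the basis vectors are multiplied. -/
def sgn (n : Fin 3) (p : Idx) : ℤ := (gr p).elim 1 fun l => chi l n

theorem sgn_dg (n k : Fin 3) : sgn n (dg k) = 1 := by rw [sgn, gr_dg]; rfl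

theorem sgn_of_gr {p : Idx} {l : Fin 3} (h : gr p = some l) (n : Fin 3) : sgn n p = chi l n := by
  rw [sgn, h]; rfl

theorem chi_sq (l n : Fin 3) : chi l n * chi l n = 1 := by
  revert l n; decide

theorem sgn_sq (n : Fin 3) (p : Idx) : sgn n p * sgn n p = 1 := by
  revert n p; decide

/-- Every monomial of the product is compatible with the signs, so the sign changes are
automorphisms of it. -/
theorem sgn_mul (n : Fin 3) (p : Idx) :
    sgn n (p.1, p.2.1 + 1, p.2.2 + 1) * sgn n (p.1, p.2.1 + 2, p.2.2 + 2) = sgn n p ∧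
    sgn n (p.1, p.2.1 + 1, p.2.2 + 2) * sgn n (p.1, p.2.1 + 2, p.2.2 + 1) = sgn n p ∧
    ∀ k, sgn n (p.1 + 1, p.2.2, k) * sgn n (p.1 + 2, k, p.2.1) = sgn n p := by
  revert n p; decide

/-- The sign changes. -/
def theta (n : Fin 3) (u : Idx → ℂ) : Idx → ℂ := fun p => sgn n p * u p

theorem cross_theta (n : Fin 3) (u v : Idx → ℂ) :
    cross (theta n u) (theta n v) = theta n (cross u v) := by
  ext p
  obtain ⟨h1, h2, h3⟩ := sgn_mul n p
  have h1' := congrArg (Int.cast : ℤ → ℂ) h1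
  have h2' := congrArg (Int.cast : ℤ → ℂ) h2
  have h3' := fun k => congrArg (Int.cast : ℤ → ℂ) (h3 k)
  push_cast at h1' h2' h3'
  simp only [theta, cross_apply, mul_add, mul_sub, Finset.mul_sum]
  congr 1
  · linear_combination (u (p.1, p.2.1 + 1, p.2.2 + 1) * v (p.1, p.2.1 + 2, p.2.2 + 2) +
      u (p.1, p.2.1 + 2, p.2.2 + 2) * v (p.1, p.2.1 + 1, p.2.2 + 1)) * h1' -
      (u (p.1, p.2.1 + 1, p.2.2 + 2) * v (p.1, p.2.1 + 2, p.2.2 + 1) +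
      u (p.1, p.2.1 + 2, p.2.2 + 1) * v (p.1, p.2.1 + 1, p.2.2 + 2)) * h2'
  · refine Finset.sum_congr rfl fun k _ => ?_
    rw [← h3' k]
    ring

end Entries

/-! ### Sign types and triviality of the center. -/

section Center

theorem theta_dotProduct (n : Fin 3) (u v : Idx → ℂ) : theta n u ⬝ᵥ theta n v = u ⬝ᵥ v := by
  refine Finset.sum_congr rfl fun p _ => ?_
  have := congrArg (Int.cast : ℤ → ℂ) (sgn_sq n p)
  push_cast at this
  simp only [theta]
  linear_combination u p * v p * this

theorem star_theta (n : Fin 3) (u : Idx → ℂ) : star (theta n u) = theta n (star u) := by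
  ext p
  simp [theta]

theorem theta_bv (n : Fin 3) (p : Idx) : theta n (bv p) = (sgn n p : ℂ) • bv p := by
  ext q
  rw [theta, Pi.smul_apply, smul_eq_mul]
  by_cases h : q = p
  · rw [h]
  · rw [bv_ne h, mul_zero, mul_zero]

theorem theta_restr (n l : Fin 3) (u : Idx → ℂ) :
    theta n (restr l u) = restr l ((chi l n : ℝ) • u) := by
  ext p
  by_cases h : gr p = some l
  · rw [theta, restr_apply h, restr_apply h, sgn_of_gr h]
    simp
  · rw [theta, restr_apply_of_ne h, restr_apply_of_ne h, mul_zero]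

theorem rmap_theta (n : Fin 3) (x y z : Idx → ℂ) :
    rmap (theta n x) (theta n y) (theta n z) = theta n (rmap x y z) := by
  rw [rmap_apply, rmap_apply, theta_dotProduct, cross_theta, cross_theta]
  ext p
  simp only [theta, Pi.sub_apply, Pi.smul_apply, smul_eq_mul]
  ring

theorem dmat_theta (n : Fin 3) (x y z : Idx → ℂ) :
    dmat (theta n x) (theta n y) *ᵥ theta n z = theta n (dmat x y *ᵥ z) := by
  rw [dmat_mulVec, dmat_mulVec, star_theta, star_theta, rmap_theta, rmap_theta]
  ext p
  simp only [theta, Pi.sub_apply]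
  ring

/-- Eigenvectors of the conjugations with the sign changes. -/
def HasType (c : Fin 3 → ℤ) (X : Matrix Idx Idx ℂ) : Prop :=
  ∀ n p q, sgn n p * X p q * sgn n q = c n * X p q

theorem HasType.mul {c c' : Fin 3 → ℤ} {X Y : Matrix Idx Idx ℂ} (hX : HasType c X)
    (hY : HasType c' Y) : HasType (c * c') (X * Y) := fun n p q => by
  rw [Matrix.mul_apply, Finset.mul_sum, Finset.sum_mul, Finset.mul_sum]
  refine Finset.sum_congr rfl fun r _ => ?_
  have h := congrArg (Int.cast : ℤ → ℂ) (sgn_sq n r)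
  push_cast at h
  rw [Pi.mul_apply]
  push_cast
  linear_combination -(sgn n p * X p r * Y r q * sgn n q) * h + (sgn n r * Y r q * sgn n q) *
    hX n p r + (c n : ℂ) * X p r * hY n r q

theorem HasType.sub {c : Fin 3 → ℤ} {X Y : Matrix Idx Idx ℂ} (hX : HasType c X)
    (hY : HasType c Y) : HasType c (X - Y) := fun n p q => by
  rw [Matrix.sub_apply]
  linear_combination hX n p q - hY n p q

theorem HasType.add {c : Fin 3 → ℤ} {X Y : Matrix Idx Idx ℂ} (hX : HasType c X)
    (hY : HasType c Y) : HasType c (X + Y) := fun n p q => by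
  rw [Matrix.add_apply]
  linear_combination hX n p q + hY n p q

theorem hasType_zero (c : Fin 3 → ℤ) : HasType c 0 := fun n p q => by simp

theorem HasType.lie {c c' : Fin 3 → ℤ} {X Y : lieAlg e6G} (hX : HasType c (X : Matrix Idx Idx ℂ))
    (hY : HasType c' (Y : Matrix Idx Idx ℂ)) : HasType (c * c') (⁅X, Y⁆ : lieAlg e6G) := by
  have h := hY.mul hX
  rw [mul_comm c'] at h
  exact (hX.mul hY).sub h

theorem hasType_yv (l : Fin 3) (u : Idx → ℂ) : HasType (chi l) (yv l u : Matrix Idx Idx ℂ) :=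
    fun n p q => by
  have h1 := congrFun (dmat_theta n (bv (dg (l + 2))) (restr l u) (bv q)) p
  have h2 : theta n (bv (dg (l + 2))) = bv (dg (l + 2)) := by
    rw [theta_bv, sgn_dg, Int.cast_one, one_smul]
  rw [h2, theta_restr, ← coe_yv, ← coe_yv, map_smul, theta_bv, mulVec_smul, mulVec_single_one,
    mulVec_single_one, theta, Pi.smul_apply] at h1
  have h3 : sgn n q * (chi l n * (yv l u : Matrix Idx Idx ℂ) p q) =
      sgn n p * (yv l u : Matrix Idx Idx ℂ) p q := by simpa using h1
  have h4 := congrArg (Int.cast : ℤ → ℂ) (sgn_sq n q)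
  push_cast at h4
  linear_combination -(sgn n q : ℂ) * h3 + chi l n * (yv l u : Matrix Idx Idx ℂ) p q * h4

theorem entry_yv (l : Fin 3) (u : Idx → ℂ) (p : Idx) :
    (yv l u : Matrix Idx Idx ℂ) p (dg (l + 2)) = restr l u p := by
  have := congrFun (yv_mulVec_add_two l u) p
  rwa [mulVec_single_one] at this

theorem restr_smul_bv {l : Fin 3} {p : Idx} (h : gr p = some l) (c : ℂ) :
    restr l (c • bv p) = c • bv p := by
  ext q
  by_cases hq : q = p
  · rw [hq, restr_apply h]
  · rw [Pi.smul_apply, bv_ne hq, restr]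
    split_ifs
    · rw [Pi.smul_apply, bv_ne hq]
    · rw [smul_zero]

theorem exists_gr (l : Fin 3) : ∃ p, gr p = some l := by
  revert l; decide

/-- By the relations between entries, the column of the idempotent l + 2 on the l-th octonion, for
each l, is all that can obstruct preservation of the lines. -/
theorem fixesLines_of {X : Matrix Idx Idx ℂ} (hX : X ∈ lieAlg e6G)
    (h : ∀ l p, gr p = some l → X p (dg (l + 2)) = 0) : FixesLines X := fun k p hp => by
  rcases h0 : gr p with _ | l
  · obtain ⟨j, rfl⟩ := eq_dg_of_gr h0
    exact entry_dg_eq_zero hX fun hj => hp (by rw [hj])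
  · rcases fin3_cases l k with rfl | rfl | rfl
    · exact entry_eq_zero_of_gr hX h0
    · rw [entry_bar hX h0, h l _ (by rw [gr_bar, h0]), star_zero, neg_zero]
    · exact h l p h0

theorem FixesLines.mulVec {X : Matrix Idx Idx ℂ} (h : FixesLines X) (k : Fin 3) :
    X *ᵥ bv (dg k) = X (dg k) (dg k) • bv (dg k) := by
  ext q
  rw [mulVec_single_one, Matrix.col_apply, Pi.smul_apply, smul_eq_mul]
  by_cases hq : q = dg k
  · rw [hq, bv_self, mul_one]
  · rw [h k q hq, bv_ne hq, mul_zero]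

/-- A central X preserves the three lines. Commuting with the elements `yv`, it acts on the l-th
octonion by its eigenvalue at the idempotent l + 2 and also by that at l + 1; so the three
eigenvalues coincide, and their sum is zero. -/
theorem eq_zero_of_central (X : lieAlg e6G) (hX : ∀ Y : lieAlg e6G, ⁅X, Y⁆ = 0) : X = 0 := by
  have hc : ∀ Y : lieAlg e6G, (X : Matrix Idx Idx ℂ) * Y = Y * X := fun Y =>
    sub_eq_zero.1 (congrArg Subtype.val (hX Y))
  have hfix : FixesLines (X : Matrix Idx Idx ℂ) := fixesLines_of X.2 fun l p hp => by
    -- A diagonal entry of the commutator with `yv`; c = 1 makes the entry of X real and c = I makes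
    -- it imaginary.
    have key : ∀ c : ℂ, c * star ((X : Matrix Idx Idx ℂ) p (dg (l + 2))) =
        star c * (X : Matrix Idx Idx ℂ) p (dg (l + 2)) := fun c => by
      have h1 := congrFun (congrFun (hc (yv l (c • bv p))) (dg (l + 2))) (dg (l + 2))
      simp only [Matrix.mul_apply, entry_star (yv l (c • bv p)).2 (dg (l + 2)), entry_yv,
        restr_smul_bv hp] at h1
      rw [Finset.sum_eq_single p, Finset.sum_eq_single p, entry_star X.2] at h1
      · simp only [Pi.smul_apply, bv_self, smul_eq_mul, mul_one] at h1
        linear_combination -h1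
      · intro q _ hq
        rw [Pi.smul_apply, bv_ne hq]; simp
      · simp
      · intro q _ hq
        rw [Pi.smul_apply, bv_ne hq]; simp
      · simp
    have h1 := key 1
    have h2 := key Complex.I
    simp only [star_one, one_mul, RCLike.star_def, Complex.conj_I] at h1 h2
    rw [h1] at h2
    have h3 : 2 * Complex.I * (X : Matrix Idx Idx ℂ) p (dg (l + 2)) = 0 := by
      linear_combination h2
    exact (mul_eq_zero.1 h3).resolve_left (by simp)
  have hv : ∀ Y : lieAlg e6G, ∀ k, (X : Matrix Idx Idx ℂ) *ᵥ ((Y : Matrix Idx Idx ℂ) *ᵥ bv (dg k)) =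
      (X : Matrix Idx Idx ℂ) (dg k) (dg k) • ((Y : Matrix Idx Idx ℂ) *ᵥ bv (dg k)) := fun Y k => by
    rw [mulVec_mulVec, hc, ← mulVec_mulVec, hfix.mulVec, mulVec_smul]
  have h2 : ∀ {l : Fin 3} {p : Idx}, gr p = some l → (X : Matrix Idx Idx ℂ) *ᵥ bv p =
      (X : Matrix Idx Idx ℂ) (dg (l + 2)) (dg (l + 2)) • bv p := fun {l p} hp => by
    have := hv (yv l ((1 : ℂ) • bv p)) (l + 2)
    rwa [yv_mulVec_add_two, restr_smul_bv hp, one_smul] at this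
  have h1 : ∀ {l : Fin 3} {p : Idx}, gr p = some l → (X : Matrix Idx Idx ℂ) *ᵥ bv p =
      (X : Matrix Idx Idx ℂ) (dg (l + 1)) (dg (l + 1)) • bv p := fun {l p} hp => by
    have := hv (yv l ((-1 : ℂ) • bv (bar p))) (l + 1)
    have h3 : (fun q => -star (((-1 : ℂ) • bv (bar p)) (bar q))) = (1 : ℂ) • bv p := by
      ext q
      by_cases hq : q = p
      · rw [hq]; simp [bv_self]
      · have : bar q ≠ bar p := fun h => hq (by rw [← bar_bar q, h, bar_bar])
        rw [Pi.smul_apply, Pi.smul_apply, bv_ne hq, bv_ne this]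
        simp
    rwa [yv_mulVec_add_one, h3, restr_smul_bv hp, one_smul] at this
  have h3 : ∀ l : Fin 3, (X : Matrix Idx Idx ℂ) (dg (l + 1)) (dg (l + 1)) =
      (X : Matrix Idx Idx ℂ) (dg (l + 2)) (dg (l + 2)) := fun l => by
    obtain ⟨p, hp⟩ := exists_gr l
    have := congrFun ((h1 hp).symm.trans (h2 hp)) p
    simpa [bv_self] using this
  have e1 := h3 0
  have e2 := h3 1
  have e3 := entry_dg_sum X.2
  obtain ⟨a1, a2, a3, a4, a5, a6⟩ := fin3_arith
  simp only [a1, a2, a3, a4] at e1 e2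
  have h0 : (X : Matrix Idx Idx ℂ) (dg 0) (dg 0) = 0 := by linear_combination (e3 - e1 - 2 * e2) / 3
  have h4 : ∀ k, (X : Matrix Idx Idx ℂ) (dg k) (dg k) = 0 := fun k => by
    fin_cases k
    · exact h0
    · exact e1.trans (e2.trans h0)
    · exact e2.trans h0
  refine Subtype.ext (Matrix.ext_of_mulVec_single fun p => ?_)
  change (X : Matrix Idx Idx ℂ) *ᵥ bv p = (0 : Matrix Idx Idx ℂ) *ᵥ bv p
  rw [zero_mulVec]
  rcases hp : gr p with _ | l
  · obtain ⟨k, rfl⟩ := eq_dg_of_gr hp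
    rw [hfix.mulVec, h4, zero_smul]
  · rw [h2 hp, h4, zero_smul]

theorem killing_e6_isInner : IsInner (-(killingForm ℝ (lieAlg e6G))) :=
  killing_isInner_of_center eq_zero_of_central

end Center

/-! ### The grading and the three isotropy summands. -/

section Components

/-- The sign changes, as unitary matrices. -/
def thetaU (n : Fin 3) : unitaryGroup Idx ℂ :=
  ⟨Matrix.diagonal fun p => (sgn n p : ℂ), by
    rw [mem_unitaryGroup_iff, Matrix.star_eq_conjTranspose, diagonal_conjTranspose,
      diagonal_mul_diagonal, ← diagonal_one]
    congr 1
    ext p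
    have := congrArg (Int.cast : ℤ → ℂ) (sgn_sq n p)
    push_cast at this
    simpa using this⟩

theorem coe_thetaU (n : Fin 3) :
    (thetaU n : Matrix Idx Idx ℂ) = Matrix.diagonal fun p => (sgn n p : ℂ) := rfl

theorem thetaU_mulVec (n : Fin 3) (v : Idx → ℂ) : (thetaU n : Matrix Idx Idx ℂ) *ᵥ v = theta n v := by
  ext p
  rw [coe_thetaU, mulVec_diagonal, theta]

theorem thetaU_mem_e6G (n : Fin 3) : thetaU n ∈ e6G := fun v => by
  rw [thetaU_mulVec, cubicForm_eq, cubicForm_eq, tri_eq, tri_eq, cross_theta, theta_dotProduct]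

theorem thetaU_mem_e6K (n : Fin 3) : thetaU n ∈ e6K := by
  refine ⟨thetaU_mem_e6G n, Subgroup.mem_iInf.2 fun i => ?_⟩
  change (thetaU n : Matrix Idx Idx ℂ) * _ = _ * (thetaU n : Matrix Idx Idx ℂ)
  rw [coe_thetaU, diagonal_mul_diagonal, diagonal_mul_diagonal]
  congr 1
  ext p
  rw [mul_comm]

theorem Ad_thetaU {c : Fin 3 → ℤ} {X : lieAlg e6G} (hX : HasType c (X : Matrix Idx Idx ℂ))
    (n : Fin 3) : Ad e6G ⟨thetaU n, thetaU_mem_e6G n⟩ X = (c n : ℝ) • X := by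
  refine Subtype.ext ?_
  rw [coe_Ad]
  ext p q
  have h : ((((⟨thetaU n, thetaU_mem_e6G n⟩ : e6G) : unitaryGroup Idx ℂ)⁻¹ : unitaryGroup Idx ℂ) :
      Matrix Idx Idx ℂ) = Matrix.diagonal fun p => (sgn n p : ℂ) := by
    rw [UnitaryGroup.inv_val, Matrix.star_eq_conjTranspose, coe_thetaU, diagonal_conjTranspose]
    congr 1
    ext p
    simp
  rw [h, mul_diagonal, coe_thetaU, diagonal_mul, hX]
  simp

theorem HasType.entry_dg {c : Fin 3 → ℤ} {X : Matrix Idx Idx ℂ} (hX : HasType c X) {p : Idx}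
    {l : Fin 3} (hp : gr p = some l) (hc : c ≠ chi l) (k : Fin 3) : X p (dg k) = 0 := by
  obtain ⟨n, hn⟩ := Function.ne_iff.1 hc
  have h1 := hX n p (dg k)
  rw [sgn_dg, sgn_of_gr hp, Int.cast_one, mul_one] at h1
  have h2 : ((chi l n - c n : ℤ) : ℂ) * X p (dg k) = 0 := by
    push_cast
    linear_combination h1
  refine (mul_eq_zero.1 h2).resolve_left ?_
  exact_mod_cast sub_ne_zero.2 hn.symm

theorem chi_ne_one (l : Fin 3) : (1 : Fin 3 → ℤ) ≠ chi l := by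
  revert l; decide

theorem chi_ne {l m : Fin 3} (h : l ≠ m) : chi l ≠ chi m := by
  revert l m; decide

theorem chi_mul_self (l : Fin 3) : chi l * chi l = 1 := by
  revert l; decide

theorem chi_mul (l : Fin 3) : chi l * chi (l + 1) = chi (l + 2) ∧
    chi l * chi (l + 2) = chi (l + 1) := by
  revert l; decide

theorem HasType.mem_subK {X : lieAlg e6G} (hX : HasType 1 (X : Matrix Idx Idx ℂ)) :
    X ∈ subK e6G e6K := by
  rw [HomGeom.mem_subK, mem_lieAlg_e6K_iff X.2]
  exact fixesLines_of X.2 fun l p hp => hX.entry_dg hp (chi_ne_one l) _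

/-- An element preserving the lines also preserves each octonion, and the signs are constant on
these. With `HasType.mem_subK`, `k` is exactly the part of trivial type. -/
theorem hasType_one_of_mem {X : lieAlg e6G} (hX : X ∈ subK e6G e6K) :
    HasType 1 (X : Matrix Idx Idx ℂ) := by
  rw [HomGeom.mem_subK, mem_lieAlg_e6K_iff X.2] at hX
  intro n p q
  rw [Pi.one_apply, Int.cast_one, one_mul]
  have hs : ∀ p, (sgn n p : ℂ) * sgn n p = 1 := fun p => by exact_mod_cast sgn_sq n p
  by_cases hpq : sgn n p = sgn n q
  · rw [hpq]
    linear_combination (X : Matrix Idx Idx ℂ) p q * hs q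
  · suffices h : (X : Matrix Idx Idx ℂ) p q = 0 by rw [h]; simp
    rcases hp : gr p with _ | l
    · obtain ⟨k, rfl⟩ := eq_dg_of_gr hp
      rw [entry_star X.2, hX k q (fun h => hpq (by rw [h])), star_zero, neg_zero]
    · rcases hq : gr q with _ | m
      · obtain ⟨k, rfl⟩ := eq_dg_of_gr hq
        exact hX k p (fun h => hpq (by rw [h]))
      · refine hX.entry_eq_zero X.2 hq hp fun h => hpq ?_
        rw [sgn_of_gr hp, sgn_of_gr hq, h]

/-- Conjugation by the sign change with index l + 1 preserves the Killing form, fixes `k` and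
negates X. -/
theorem HasType.mem_tang {l : Fin 3} {X : lieAlg e6G} (hX : HasType (chi l) (X : Matrix Idx Idx ℂ)) :
    X ∈ tang (subK e6G e6K) := by
  rw [mem_tang_iff]
  intro z hz
  have h := (isAutSet_AdK (G := e6G) (K := e6K)).killing
    ⟨⟨thetaU (l + 1), thetaU_mem_e6G _⟩, thetaU_mem_e6K _, rfl⟩ z X
  rw [Ad_thetaU hX, Ad_thetaU (hasType_one_of_mem hz), chi, if_neg (fin3_add l).1] at h
  simp only [Pi.one_apply, Int.cast_one, one_smul, map_smul, Int.cast_neg, neg_smul, map_neg] at h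
  linarith

/-- A column of a matrix in the Lie algebra. -/
def colL (l : Fin 3) : lieAlg e6G →ₗ[ℝ] (Idx → ℂ) where
  toFun X := (X : Matrix Idx Idx ℂ).col (dg (l + 2))
  map_add' _ _ := rfl
  map_smul' _ _ := rfl

theorem colL_apply (l : Fin 3) (X : lieAlg e6G) (p : Idx) :
    colL l X p = (X : Matrix Idx Idx ℂ) p (dg (l + 2)) := rfl

/-- The projections to the summands of the isotropy representation. -/
noncomputable def compL (l : Fin 3) : Module.End ℝ (lieAlg e6G) := yv l ∘ₗ colL l

theorem compL_apply (l : Fin 3) (X : lieAlg e6G) : compL l X = yv l (colL l X) := rfl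

theorem hasType_compL (l : Fin 3) (X : lieAlg e6G) :
    HasType (chi l) (compL l X : Matrix Idx Idx ℂ) := hasType_yv _ _

theorem yv_eq_zero {l : Fin 3} {u : Idx → ℂ} (h : restr l u = 0) : yv l u = 0 := by
  have h1 : restr l u = restr l 0 := by
    rw [h]
    ext p
    by_cases hp : gr p = some l <;> simp [restr, hp]
  rw [← map_zero (yv l)]
  exact Subtype.ext (by rw [coe_yv, coe_yv, h1])

theorem compL_of_ne {l : Fin 3} {c : Fin 3 → ℤ} {X : lieAlg e6G}
    (hX : HasType c (X : Matrix Idx Idx ℂ)) (hc : c ≠ chi l) : compL l X = 0 := by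
  refine yv_eq_zero ?_
  ext p
  rw [restr]
  split_ifs with hp
  · rw [colL_apply, hX.entry_dg hp hc]; rfl
  · rfl

/-- Each `compL l` reproduces the column that determines the l-th summand, so after subtracting them
all the lines are preserved and an element of `k` remains. -/
theorem projL_e6 : projL (subK e6G e6K) = ∑ l, compL l := by
  refine LinearMap.ext fun Z => ?_
  rw [projL_apply]
  refine projP_eq killing_e6_isInner ?_ ?_
  · rw [LinearMap.sum_apply]
    exact Submodule.sum_mem _ fun l _ => (hasType_compL l Z).mem_tang
  · rw [HomGeom.mem_subK, mem_lieAlg_e6K_iff (Subtype.prop _)]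
    refine fixesLines_of (Subtype.prop _) fun l p hp => ?_
    change colL l (Z - (∑ j, compL j) Z) p = 0
    rw [map_sub, LinearMap.sum_apply, map_sum, Pi.sub_apply, Finset.sum_apply,
      Finset.sum_eq_single l]
    · rw [colL_apply, compL_apply, colL_apply, entry_yv, restr_apply hp, colL_apply, sub_self]
    · intro j _ hj
      exact (hasType_compL j Z).entry_dg hp (chi_ne hj) _
    · simp

theorem projL_of_hasType {l : Fin 3} {X : lieAlg e6G} (hX : HasType (chi l) (X : Matrix Idx Idx ℂ)) :
    projL (subK e6G e6K) X = X := by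
  rw [projL_apply]
  exact congrArg Subtype.val (projP_coe killing_e6_isInner ⟨X, hX.mem_tang⟩)

theorem projL_of_hasType_one {X : lieAlg e6G} (hX : HasType 1 (X : Matrix Idx Idx ℂ)) :
    projL (subK e6G e6K) X = 0 := by
  rw [projL_apply, projP_of_mem killing_e6_isInner hX.mem_subK]
  rfl

theorem compL_of_hasType {l : Fin 3} {X : lieAlg e6G} (hX : HasType (chi l) (X : Matrix Idx Idx ℂ)) :
    compL l X = X := by
  have h := projL_of_hasType hX
  rw [projL_e6, LinearMap.sum_apply, Finset.sum_eq_single l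
    (fun j _ hj => compL_of_ne hX (chi_ne hj.symm)) (by simp)] at h
  exact h

theorem compL_mul_compL (l : Fin 3) : compL l * compL l = compL l :=
  LinearMap.ext fun X => by
    rw [Module.End.mul_apply]
    exact compL_of_hasType (hasType_compL l X)

/-- Operators that multiply types by `c`. -/
def Shifts (c : Fin 3 → ℤ) (F : Module.End ℝ (lieAlg e6G)) : Prop :=
  ∀ c' (X : lieAlg e6G), HasType c' (X : Matrix Idx Idx ℂ) →
    HasType (c * c') (F X : Matrix Idx Idx ℂ)

theorem shifts_ad {c : Fin 3 → ℤ} {Y : lieAlg e6G} (hY : HasType c (Y : Matrix Idx Idx ℂ)) :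
    Shifts c (LieAlgebra.ad ℝ (lieAlg e6G) Y) := fun _ _ hX => hY.lie hX

theorem Shifts.mul {c c' : Fin 3 → ℤ} {F F' : Module.End ℝ (lieAlg e6G)} (hF : Shifts c F)
    (hF' : Shifts c' F') : Shifts (c * c') (F * F') := fun c'' X hX => by
  rw [mul_assoc, Module.End.mul_apply]
  exact hF _ _ (hF' _ _ hX)

theorem shifts_compL (l : Fin 3) : Shifts 1 (compL l) := fun c X hX => by
  rw [one_mul]
  by_cases h : c = chi l
  · rw [h]
    exact hasType_compL l X
  · rw [compL_of_ne hX h]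
    exact hasType_zero c

theorem shifts_projL : Shifts 1 (projL (subK e6G e6K)) := fun c X hX => by
  rw [projL_e6, Fin.sum_univ_three]
  exact ((shifts_compL 0 c X hX).add (shifts_compL 1 c X hX)).add (shifts_compL 2 c X hX)

theorem shifts_one_sub_projL : Shifts 1 (1 - projL (subK e6G e6K)) := fun c X hX =>
  HasType.sub (by rwa [one_mul]) (shifts_projL c X hX)

/-- An operator of nontrivial type moves the l-th summand into other types, so its diagonal block
there is zero. -/
theorem Shifts.trace_eq_zero {c : Fin 3 → ℤ} {F : Module.End ℝ (lieAlg e6G)} (hF : Shifts c F)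
    (hc : c ≠ 1) (l : Fin 3) : LinearMap.trace ℝ (lieAlg e6G) (F * compL l) = 0 := by
  rw [← compL_mul_compL, ← mul_assoc, LinearMap.trace_mul_comm]
  have h : compL l * (F * compL l) = 0 := LinearMap.ext fun X => by
    rw [Module.End.mul_apply, Module.End.mul_apply, LinearMap.zero_apply]
    refine compL_of_ne (hF _ _ (hasType_compL l X)) fun h => hc ?_
    calc c = c * (chi l * chi l) := by rw [chi_mul_self, mul_one]
      _ = 1 := by rw [← mul_assoc, h, chi_mul_self]
  rw [h, map_zero]

/-- `compL l` factors through the real space ℂ²⁷, so by cyclicity the trace is computed there in the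
real basis of the vectors `bv p` and `I • bv p`. -/
theorem trace_mul_compL (F : Module.End ℝ (lieAlg e6G)) (l : Fin 3) :
    LinearMap.trace ℝ (lieAlg e6G) (F * compL l) =
      ∑ p, ((colL l (F (yv l (bv p))) p).re +
        (colL l (F (yv l (Complex.I • bv p))) p).im) := by
  have h1 : LinearMap.trace ℝ (lieAlg e6G) (F * compL l) =
      LinearMap.trace ℝ (Idx → ℂ) (colL l ∘ₗ F ∘ₗ yv l) := by
    rw [LinearMap.trace_mul_comm]
    exact LinearMap.trace_comp_comm' (colL l ∘ₗ F) (yv l)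
  rw [h1, LinearMap.trace_eq_matrix_trace ℝ (Pi.basis fun _ : Idx => Complex.basisOneI),
    Matrix.trace, Fintype.sum_sigma]
  refine Finset.sum_congr rfl fun p _ => ?_
  have h2 : Pi.single p Complex.I = Complex.I • bv p := by
    rw [← Pi.single_smul, smul_eq_mul, mul_one]
  simp [LinearMap.toMatrix_apply, Fin.sum_univ_two, h2]

end Components

/-! ### Traces of (ad Y)² on the isotropy summands. -/

section Traces

theorem coe_lie_lie_mulVec (Y V : lieAlg e6G) (z : Idx → ℂ) :
    ((⁅Y, ⁅Y, V⁆⁆ : lieAlg e6G) : Matrix Idx Idx ℂ) *ᵥ z =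
      (Y : Matrix Idx Idx ℂ) *ᵥ ((Y : Matrix Idx Idx ℂ) *ᵥ ((V : Matrix Idx Idx ℂ) *ᵥ z)) -
      (2 : ℂ) • ((Y : Matrix Idx Idx ℂ) *ᵥ ((V : Matrix Idx Idx ℂ) *ᵥ
        ((Y : Matrix Idx Idx ℂ) *ᵥ z))) +
      (V : Matrix Idx Idx ℂ) *ᵥ ((Y : Matrix Idx Idx ℂ) *ᵥ ((Y : Matrix Idx Idx ℂ) *ᵥ z)) := by
  change ((Y : Matrix Idx Idx ℂ) * ((Y : Matrix Idx Idx ℂ) * (V : Matrix Idx Idx ℂ) -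
    (V : Matrix Idx Idx ℂ) * (Y : Matrix Idx Idx ℂ)) - ((Y : Matrix Idx Idx ℂ) *
    (V : Matrix Idx Idx ℂ) - (V : Matrix Idx Idx ℂ) * (Y : Matrix Idx Idx ℂ)) *
    (Y : Matrix Idx Idx ℂ)) *ᵥ z = _
  simp only [sub_mulVec, ← mulVec_mulVec, mulVec_sub]
  module

theorem colL_eq (l : Fin 3) (X : lieAlg e6G) (p : Idx) :
    colL l X p = ((X : Matrix Idx Idx ℂ) *ᵥ bv (dg (l + 2))) p := by
  rw [mulVec_single_one]
  rfl

theorem HasType.entry_gr {l m : Fin 3} {X : Matrix Idx Idx ℂ} {c : Fin 3 → ℤ} (hX : HasType c X)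
    {p q : Idx} (hp : gr p = some l) (hq : gr q = some m) (h : c * chi m ≠ chi l) : X p q = 0 := by
  obtain ⟨n, hn⟩ := Function.ne_iff.1 h
  have h1 := hX n p q
  have h2 : (chi m n : ℂ) * chi m n = 1 := by exact_mod_cast chi_sq m n
  rw [sgn_of_gr hq, sgn_of_gr hp] at h1
  have h3 : ((chi l n - c n * chi m n : ℤ) : ℂ) * X p q = 0 := by
    push_cast
    linear_combination chi m n * h1 - chi l n * X p q * h2
  refine (mul_eq_zero.1 h3).resolve_left ?_
  exact_mod_cast sub_ne_zero.2 hn.symm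

theorem entry_yv_add_one (l : Fin 3) (u : Idx → ℂ) (p : Idx) :
    (yv l u : Matrix Idx Idx ℂ) p (dg (l + 1)) = -star (restr l u (bar p)) := by
  have h := congrFun (yv_mulVec_add_one l u) p
  rw [mulVec_single_one, Matrix.col_apply] at h
  rw [h]
  by_cases hp : gr p = some l
  · rw [restr_apply hp, restr_apply (by rw [gr_bar, hp])]
  · rw [restr_apply_of_ne hp, restr_apply_of_ne (by rwa [gr_bar]), star_zero, neg_zero]

theorem entry_yv_self (l : Fin 3) (u : Idx → ℂ) (p : Idx) :
    (yv l u : Matrix Idx Idx ℂ) p (dg l) = 0 := by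
  have h := congrFun (yv_mulVec_self l u) p
  rwa [mulVec_single_one, Matrix.col_apply] at h

/-- By its type `yv m u` has no entries from the m-th octonion to any octonion; the diagonal rows
are the negative conjugates of the known columns. -/
theorem yv_mulVec_restr (m : Fin 3) (u z : Idx → ℂ) :
    (yv m u : Matrix Idx Idx ℂ) *ᵥ restr m z =
      -(∑ q, star (restr m u q) * restr m z q) • bv (dg (m + 2)) +
        (∑ q, restr m u (bar q) * restr m z q) • bv (dg (m + 1)) := by
  obtain ⟨h1, h2, h3, -⟩ := fin3_add m
  ext r
  simp only [Pi.add_apply, Pi.smul_apply, smul_eq_mul]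
  change ∑ q, (yv m u : Matrix Idx Idx ℂ) r q * restr m z q = _
  rcases hr : gr r with _ | j
  · obtain ⟨k, rfl⟩ := eq_dg_of_gr hr
    simp only [entry_star (yv m u).2 (dg k)]
    rcases fin3_cases m k with rfl | rfl | rfl
    · simp only [entry_yv_self]
      rw [bv_dg_ne h2.symm, bv_dg_ne h1.symm]
      simp
    · simp only [entry_yv_add_one]
      rw [bv_dg_ne h3, bv_self]
      simp
    · simp only [entry_yv]
      rw [bv_dg_ne h3.symm, bv_self]
      simp
  · rw [bv_ne (ne_dg_of_gr hr _), bv_ne (ne_dg_of_gr hr _), mul_zero, mul_zero, add_zero]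
    refine Finset.sum_eq_zero fun q _ => ?_
    by_cases hq : gr q = some m
    · rw [(hasType_yv m u).entry_gr hr hq (by rw [chi_mul_self]; exact chi_ne_one j), zero_mul]
    · rw [restr_apply_of_ne hq, mul_zero]

/-- The derivation identity at the idempotent m + 2, p and q: between the two other octonions the
operator is octonion multiplication by u. -/
theorem entry_yv_cross (m : Fin 3) (u : Idx → ℂ) {p q : Idx} (hp : gr p = some (m + 1))
    (hq : gr q = some (m + 2)) :
    (yv m u : Matrix Idx Idx ℂ) (bar q) p = cross (restr m u) (bv p) q := by
  obtain ⟨h1, h2, h3, -⟩ := fin3_add m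
  have h4 := (mem_lieAlg_e6G.1 (yv m u).2).2 (bv (dg (m + 2))) (bv p) (bv q)
  have h5 : cross (bv (dg (m + 2))) (bv p) = 0 := by
    have := restr_smul_bv hp 1
    rw [one_smul] at this
    rw [← this, cross_bv_restr h3]
  rw [yv_mulVec_add_two, tri_eq, tri_eq, tri_eq, h5, zero_dotProduct, dotProduct_single_one,
    dotProduct_single_one, cross_bv_dg_of_gr hq, mulVec_single_one, Matrix.col_apply] at h4
  linear_combination -h4

/-- The real map c ↦ αc + β·conj(c) of ℂ has trace 2 Re α. -/
theorem trace_mul_compL_eq {F : Module.End ℝ (lieAlg e6G)} {l : Fin 3} {α β : Idx → ℂ}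
    (h : ∀ c p, gr p = some l → colL l (F (yv l (c • bv p))) p = α p * c + β p * star c) :
    LinearMap.trace ℝ (lieAlg e6G) (F * compL l) =
      2 * ∑ p, if gr p = some l then (α p).re else 0 := by
  rw [trace_mul_compL, Finset.mul_sum]
  refine Finset.sum_congr rfl fun p _ => ?_
  split_ifs with hp
  · have h1 := h 1 p hp
    rw [one_smul] at h1
    rw [h1, h _ p hp]
    simp
    ring
  · have h1 : ∀ c : ℂ, yv l (c • bv p) = 0 := fun c => yv_eq_zero (by
      ext q
      rw [restr]
      split_ifs with hq
      · rw [Pi.smul_apply, bv_ne (by rintro rfl; exact hp hq), smul_zero]; rfl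
      · rfl)
    have h2 := h1 1
    rw [one_smul] at h2
    rw [h1, h2]
    simp

theorem sum_restr_bar (m : Fin 3) (u : Idx → ℂ) :
    ∑ p, Complex.normSq (restr m u (bar p)) = ∑ p, Complex.normSq (restr m u p) :=
  Fintype.sum_equiv ⟨bar, bar, bar_bar, bar_bar⟩ _ _ fun _ => rfl

theorem card_gr (m : Fin 3) : (Finset.univ.filter fun p : Idx => gr p = some m).card = 8 := by
  revert m; decide

theorem gr_eq_none_of_bar {p : Idx} (h : p = bar p) : gr p = none := by
  revert p; decide

/-- In α the terms |u_p|² and |u_p̄|² have opposite signs and cancel in the sum over the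
conjugation-invariant octonion; the remaining -N occurs for 8 indices and is doubled over the reals.
-/
theorem trace_sq_compL_self (m : Fin 3) (u : Idx → ℂ) :
    LinearMap.trace ℝ (lieAlg e6G) (LieAlgebra.ad ℝ (lieAlg e6G) (yv m u) *
      LieAlgebra.ad ℝ (lieAlg e6G) (yv m u) * compL m) =
      -16 * ∑ p, Complex.normSq (restr m u p) := by
  set N : ℝ := ∑ p, Complex.normSq (restr m u p) with hN
  rw [trace_mul_compL_eq (α := fun p => ((-Complex.normSq (restr m u p) +
    Complex.normSq (restr m u (bar p)) - N : ℝ) : ℂ)) (β := fun p => 2 * restr m u p ^ 2)]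
  · have h1 : ∀ p, (if gr p = some m then ((((-Complex.normSq (restr m u p) +
        Complex.normSq (restr m u (bar p)) - N : ℝ) : ℂ)).re) else 0) =
        -Complex.normSq (restr m u p) + Complex.normSq (restr m u (bar p)) -
          (if gr p = some m then 1 else 0) * N := fun p => by
      split_ifs with hp
      · simp
      · rw [restr_apply_of_ne hp, restr_apply_of_ne (by rwa [gr_bar])]
        simp
    have h2 : ∑ p : Idx, (if gr p = some m then (1 : ℝ) else 0) = 8 := by
      rw [Finset.sum_boole]
      rw [card_gr]
      norm_num
    rw [Finset.sum_congr rfl fun p _ => h1 p, Finset.sum_sub_distrib, Finset.sum_add_distrib,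
      ← Finset.sum_mul, h2, sum_restr_bar, Finset.sum_neg_distrib]
    ring
  · intro c p hp
    have hbp : p ≠ bar p := by
      intro h
      rw [gr_eq_none_of_bar h] at hp
      simp at hp
    have e1 : ∀ f : Idx → ℂ, ∑ q, f q * restr m (c • bv p) q = f p * c := fun f => by
      rw [Finset.sum_eq_single p]
      · rw [restr_smul_bv hp, Pi.smul_apply, bv_self, smul_eq_mul, mul_one]
      · intro q _ hq
        rw [restr_smul_bv hp, Pi.smul_apply, bv_ne hq, smul_zero, mul_zero]
      · simp
    have e2 : ∑ q, star (restr m (c • bv p) q) * restr m u q = star c * restr m u p := by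
      rw [Finset.sum_eq_single p]
      · rw [restr_smul_bv hp, Pi.smul_apply, bv_self, smul_eq_mul, mul_one]
      · intro q _ hq
        rw [restr_smul_bv hp, Pi.smul_apply, bv_ne hq, smul_zero, star_zero, zero_mul]
      · simp
    have e3 : ∑ q, restr m (c • bv p) (bar q) * restr m u q = c * restr m u (bar p) := by
      rw [Finset.sum_eq_single (bar p)]
      · rw [restr_smul_bv hp, Pi.smul_apply, bar_bar, bv_self, smul_eq_mul, mul_one]
      · intro q _ hq
        rw [restr_smul_bv hp, Pi.smul_apply, bv_ne (fun h => hq (by rw [← h, bar_bar])),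
          smul_zero, zero_mul]
      · simp
    have e4 : ∑ q, star (restr m u q) * restr m u q = (N : ℂ) := by
      rw [hN]
      push_cast
      exact Finset.sum_congr rfl fun q _ => by
        rw [Complex.normSq_eq_conj_mul_self, RCLike.star_def]
    have e5 : ∀ z : ℂ, z * star z = (Complex.normSq z : ℂ) := fun z => by
      rw [RCLike.star_def, Complex.mul_conj]
    have e6 : restr m (c • bv p) (bar p) = 0 := by
      rw [restr_smul_bv hp, Pi.smul_apply, bv_ne hbp.symm, smul_zero]
    have e7 : restr m (c • bv p) p = c := by
      rw [restr_smul_bv hp, Pi.smul_apply, bv_self, smul_eq_mul, mul_one]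
    rw [colL_eq, Module.End.mul_apply, LieAlgebra.ad_apply, LieAlgebra.ad_apply,
      coe_lie_lie_mulVec, yv_mulVec_add_two, yv_mulVec_add_two]
    simp only [yv_mulVec_restr, e1 fun q => star (restr m u q), e1 fun q => restr m u (bar q), e2,
      e3, e4, mulVec_add, mulVec_smul, mulVec_single_one, Pi.add_apply, Pi.sub_apply, Pi.smul_apply,
      smul_eq_mul, Matrix.col_apply, entry_yv, entry_yv_add_one, e6, e7]
    push_cast
    rw [← e5, ← e5, star_zero]
    ring

/-- Each coordinate of A on the m-th octonion enters exactly four of these entries, with coefficient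
±1. -/
theorem sum_normSq_cross (m : Fin 3) (A : Idx → ℂ) :
    (∑ p, ∑ q, if gr p = some (m + 1) ∧ gr q = some (m + 2) then
      Complex.normSq (cross A (bv p) q) else 0) =
      4 * ∑ r, if gr r = some m then Complex.normSq (A r) else 0 := by
  obtain ⟨h1, h2, h3, h4, h5, h6⟩ := fin3_arith
  fin_cases m <;>
  · simp [Fintype.sum_prod_type, Fin.sum_univ_three, h1, h2, h3, h4, h5, h6, fin3_neg.1, fin3_neg.2,
      gr, cross_apply, Pi.single_apply]
    ring

/-- `yv m u` kills the idempotent m that reads off the summand m + 1, so (ad Y)² acts there as Y² on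
columns, and the trace is minus twice the Hilbert-Schmidt norm of multiplication by u. -/
theorem trace_sq_compL_add_one (m : Fin 3) (u : Idx → ℂ) :
    LinearMap.trace ℝ (lieAlg e6G) (LieAlgebra.ad ℝ (lieAlg e6G) (yv m u) *
      LieAlgebra.ad ℝ (lieAlg e6G) (yv m u) * compL (m + 1)) =
      -8 * ∑ p, Complex.normSq (restr m u p) := by
  obtain ⟨h1, h2, h3, h4, h5, h6, h7⟩ := fin3_add m
  rw [trace_mul_compL_eq (α := fun p => ((-∑ q, Complex.normSq
    ((yv m u : Matrix Idx Idx ℂ) q p) : ℝ) : ℂ)) (β := 0)]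
  · have e1 : ∀ p, (if gr p = some (m + 1) then (((-∑ q, Complex.normSq
        ((yv m u : Matrix Idx Idx ℂ) q p) : ℝ) : ℂ)).re else 0) =
        -∑ q, if gr p = some (m + 1) ∧ gr q = some (m + 2) then
          Complex.normSq (cross (restr m u) (bv p) q) else 0 := fun p => by
      split_ifs with hp
      · rw [Complex.ofReal_re, neg_inj]
        refine Fintype.sum_equiv ⟨bar, bar, bar_bar, bar_bar⟩ _ _ fun q => ?_
        rw [Equiv.coe_fn_mk]
        by_cases hq : gr (bar q) = some (m + 2)
        · rw [if_pos ⟨hp, hq⟩, ← entry_yv_cross m u hp hq, bar_bar]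
        · rw [if_neg fun h => hq h.2, Complex.normSq_eq_zero]
          rw [gr_bar] at hq
          rcases h0 : gr q with _ | j
          · obtain ⟨k, rfl⟩ := eq_dg_of_gr h0
            rw [entry_star (yv m u).2,
              (hasType_yv m u).entry_dg hp (chi_ne h1.symm), star_zero, neg_zero]
          · refine (hasType_yv m u).entry_gr h0 hp ?_
            rw [(chi_mul m).1]
            refine chi_ne fun h => hq ?_
            rw [h0, h]
      · rw [Finset.sum_eq_zero fun q _ => if_neg fun h => hp h.1, neg_zero]
    have e2 : ∀ r, (if gr r = some m then Complex.normSq (restr m u r) else 0) =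
        Complex.normSq (restr m u r) := fun r => by
      split_ifs with hr
      · rfl
      · rw [restr_apply_of_ne hr, map_zero]
    rw [Finset.sum_congr rfl fun p _ => e1 p, Finset.sum_neg_distrib, sum_normSq_cross,
      Finset.sum_congr rfl fun r _ => e2 r]
    ring
  · intro c p hp
    have e0 := yv_mulVec_add_two (m + 1) (c • bv p)
    rw [colL_eq, Module.End.mul_apply, LieAlgebra.ad_apply, LieAlgebra.ad_apply,
      coe_lie_lie_mulVec, e0, h5, yv_mulVec_self, restr_smul_bv hp]
    simp only [mulVec_zero, smul_zero, sub_zero, add_zero, mulVec_smul, mulVec_single_one,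
      Pi.zero_apply, zero_mul, Pi.smul_apply, smul_eq_mul]
    rw [mul_comm]
    congr 1
    rw [Complex.ofReal_neg, Complex.ofReal_sum, ← Finset.sum_neg_distrib, Matrix.mulVec, dotProduct]
    refine Finset.sum_congr rfl fun q _ => ?_
    rw [Matrix.col_apply, entry_star (yv m u).2 p q, RCLike.star_def, neg_mul,
      Complex.normSq_eq_conj_mul_self]

end Traces

/-! ### Einstein constant and reducibility for E₆. -/

section Exceptional

theorem sum_fin3 {A : Type*} [AddCommMonoid A] (m : Fin 3) (f : Fin 3 → A) :
    ∑ l, f l = f m + f (m + 1) + f (m + 2) := by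
  obtain ⟨h1, h2, h3, h4, h5, h6⟩ := fin3_arith
  rw [Fin.sum_univ_three]
  fin_cases m <;> simp [h3, h4, h5, h6] <;> abel

theorem compL_mul_ad {c : Fin 3 → ℤ} {l j : Fin 3} {Y : lieAlg e6G}
    (hY : HasType c (Y : Matrix Idx Idx ℂ)) (h : c * chi l = chi j) :
    compL j * (LieAlgebra.ad ℝ (lieAlg e6G) Y * compL l) =
      LieAlgebra.ad ℝ (lieAlg e6G) Y * compL l := LinearMap.ext fun X => by
  have h1 := hY.lie (hasType_compL l X)
  rw [h] at h1
  rw [Module.End.mul_apply, Module.End.mul_apply, LieAlgebra.ad_apply]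
  exact compL_of_hasType h1

theorem projL_mul_ad {c : Fin 3 → ℤ} {l j : Fin 3} {Y : lieAlg e6G}
    (hY : HasType c (Y : Matrix Idx Idx ℂ)) (h : c * chi l = chi j) :
    projL (subK e6G e6K) * (LieAlgebra.ad ℝ (lieAlg e6G) Y * compL l) =
      LieAlgebra.ad ℝ (lieAlg e6G) Y * compL l := LinearMap.ext fun X => by
  have h1 := hY.lie (hasType_compL l X)
  rw [h] at h1
  rw [Module.End.mul_apply, Module.End.mul_apply, LieAlgebra.ad_apply]
  exact projL_of_hasType h1

theorem projL_mul_ad_self {l : Fin 3} {Y : lieAlg e6G}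
    (hY : HasType (chi l) (Y : Matrix Idx Idx ℂ)) :
    projL (subK e6G e6K) * (LieAlgebra.ad ℝ (lieAlg e6G) Y * compL l) = 0 :=
  LinearMap.ext fun X => by
    have h1 := hY.lie (hasType_compL l X)
    rw [chi_mul_self] at h1
    rw [Module.End.mul_apply, Module.End.mul_apply, LieAlgebra.ad_apply]
    exact projL_of_hasType_one h1

/-- `ad Y` exchanges the two other summands, so both traces are the same trace read cyclically. -/
theorem trace_sq_compL_add_two {m : Fin 3} {Y : lieAlg e6G}
    (hY : HasType (chi m) (Y : Matrix Idx Idx ℂ)) :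
    LinearMap.trace ℝ (lieAlg e6G) (LieAlgebra.ad ℝ (lieAlg e6G) Y *
      LieAlgebra.ad ℝ (lieAlg e6G) Y * compL (m + 2)) =
    LinearMap.trace ℝ (lieAlg e6G) (LieAlgebra.ad ℝ (lieAlg e6G) Y *
      LieAlgebra.ad ℝ (lieAlg e6G) Y * compL (m + 1)) := by
  have h1 := compL_mul_ad hY (chi_mul m).1
  have h2 := compL_mul_ad hY (chi_mul m).2
  set a := LieAlgebra.ad ℝ (lieAlg e6G) Y
  rw [mul_assoc, mul_assoc, ← h1, ← h2, ← mul_assoc a, ← mul_assoc a, LinearMap.trace_mul_comm]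

/-- The trace form on the Lie algebra defined by an operator `σ`. -/
noncomputable def traceForm (σ : Module.End ℝ (lieAlg e6G)) (X Y : lieAlg e6G) : ℝ :=
  LinearMap.trace ℝ (lieAlg e6G) (LieAlgebra.ad ℝ (lieAlg e6G) X * σ *
    LieAlgebra.ad ℝ (lieAlg e6G) Y * projL (subK e6G e6K))

theorem traceForm_eq_sum (σ : Module.End ℝ (lieAlg e6G)) (X Y : lieAlg e6G) :
    traceForm σ X Y = ∑ l, LinearMap.trace ℝ (lieAlg e6G) (LieAlgebra.ad ℝ (lieAlg e6G) X * σ *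
      LieAlgebra.ad ℝ (lieAlg e6G) Y * compL l) := by
  rw [traceForm, projL_e6, Finset.mul_sum, map_sum]

/-- The product of two different nontrivial types is nontrivial, so the operator has no diagonal
blocks. -/
theorem traceForm_eq_zero {σ : Module.End ℝ (lieAlg e6G)} (hσ : Shifts 1 σ) {l m : Fin 3}
    (h : l ≠ m) {X Y : lieAlg e6G} (hX : HasType (chi l) (X : Matrix Idx Idx ℂ))
    (hY : HasType (chi m) (Y : Matrix Idx Idx ℂ)) : traceForm σ X Y = 0 := by
  rw [traceForm_eq_sum]
  refine Finset.sum_eq_zero fun j _ =>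
    (((shifts_ad hX).mul hσ).mul (shifts_ad hY)).trace_eq_zero (fun h1 => h ?_) j
  by_contra h2
  refine chi_ne h2 ?_
  rw [mul_one] at h1
  calc chi l = chi l * (chi m * chi m) := by rw [chi_mul_self, mul_one]
    _ = chi m := by rw [← mul_assoc, h1, one_mul]

/-- On its own summand `ad Y` lands in `k`, where the projection vanishes; on the other two it stays
in `p`. The complementary projection in `traceForm_one_sub_self` keeps exactly the first part. -/
theorem traceForm_projL_self {m : Fin 3} {Y : lieAlg e6G}
    (hY : HasType (chi m) (Y : Matrix Idx Idx ℂ)) :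
    traceForm (projL (subK e6G e6K)) Y Y = 2 *
      LinearMap.trace ℝ (lieAlg e6G) (LieAlgebra.ad ℝ (lieAlg e6G) Y *
        LieAlgebra.ad ℝ (lieAlg e6G) Y * compL (m + 1)) := by
  rw [traceForm_eq_sum, sum_fin3 m]
  simp only [mul_assoc]
  rw [projL_mul_ad_self hY, projL_mul_ad hY (chi_mul m).1, projL_mul_ad hY (chi_mul m).2, mul_zero,
    map_zero, zero_add, ← mul_assoc, ← mul_assoc, trace_sq_compL_add_two hY]
  ring

theorem traceForm_one_sub_self {m : Fin 3} {Y : lieAlg e6G}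
    (hY : HasType (chi m) (Y : Matrix Idx Idx ℂ)) :
    traceForm (1 - projL (subK e6G e6K)) Y Y =
      LinearMap.trace ℝ (lieAlg e6G) (LieAlgebra.ad ℝ (lieAlg e6G) Y *
        LieAlgebra.ad ℝ (lieAlg e6G) Y * compL m) := by
  rw [traceForm_eq_sum, sum_fin3 m]
  have h0 := projL_mul_ad_self hY
  have h1 := projL_mul_ad hY (chi_mul m).1
  have h2 := projL_mul_ad hY (chi_mul m).2
  set a := LieAlgebra.ad ℝ (lieAlg e6G) Y
  set π := projL (subK e6G e6K)
  have e0 : a * (1 - π) * a * compL m = a * a * compL m := by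
    rw [mul_assoc, mul_assoc, sub_mul, one_mul, h0, sub_zero, mul_assoc]
  have e1 : a * (1 - π) * a * compL (m + 1) = 0 := by
    rw [mul_assoc, mul_assoc, sub_mul, one_mul, h1, sub_self, mul_zero]
  have e2 : a * (1 - π) * a * compL (m + 2) = 0 := by
    rw [mul_assoc, mul_assoc, sub_mul, one_mul, h2, sub_self, mul_zero]
  rw [e0, e1, e2, map_zero, add_zero, add_zero]

theorem traceForm_sum {σ : Module.End ℝ (lieAlg e6G)} (hσ : Shifts 1 σ) (u : Fin 3 → Idx → ℂ) :
    traceForm σ (∑ l, yv l (u l)) (∑ l, yv l (u l)) = ∑ l, traceForm σ (yv l (u l)) (yv l (u l)) := by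
  have h : traceForm σ (∑ l, yv l (u l)) (∑ l, yv l (u l)) =
      ∑ l, ∑ m, traceForm σ (yv l (u l)) (yv m (u m)) := by
    simp only [traceForm, map_sum, Finset.sum_mul, Finset.mul_sum]
    exact Finset.sum_comm
  rw [h]
  refine Finset.sum_congr rfl fun l _ => Finset.sum_eq_single l (fun m _ hm => ?_) (by simp)
  exact traceForm_eq_zero hσ hm.symm (hasType_yv l _) (hasType_yv m _)

/-- On each summand 2 · (-8) = -16, so `trP` and `isoForm` agree on the diagonal and B = 3 `trP`. -/
theorem isEinstein_e6 : IsEinstein (subK e6G e6K) (stdMetric (subK e6G e6K)) (5 / 12) := by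
  refine isEinstein_of_trP_self killing_e6_isInner fun Y => ?_
  have hY : (Y : lieAlg e6G) = ∑ l, yv l (colL l Y) := by
    have h := congrArg Subtype.val (projP_coe killing_e6_isInner Y)
    rw [← projL_apply, projL_e6, LinearMap.sum_apply] at h
    exact h.symm
  have h1 : trP (subK e6G e6K) Y Y = traceForm (projL (subK e6G e6K)) Y Y := by
    rw [trP_eq, mul_assoc (projL _), mul_assoc (projL _), LinearMap.trace_mul_comm, traceForm]
  have h2 : isoForm (subK e6G e6K) Y Y = traceForm (1 - projL (subK e6G e6K)) Y Y := by
    rw [isoForm, mul_assoc (projL _), mul_assoc (projL _), LinearMap.trace_mul_comm, traceForm]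
  have h3 : traceForm (projL (subK e6G e6K)) Y Y = traceForm (1 - projL (subK e6G e6K)) Y Y := by
    rw [hY, traceForm_sum shifts_projL, traceForm_sum shifts_one_sub_projL]
    refine Finset.sum_congr rfl fun l _ => ?_
    rw [traceForm_projL_self (hasType_yv l _), traceForm_one_sub_self (hasType_yv l _),
      trace_sq_compL_self, trace_sq_compL_add_one]
    ring
  rw [killing_eq_trP_add killing_e6_isInner, h2, ← h3, ← h1]
  ring

/-- The elements commuting with the projection onto the line of the idempotent 0 form an invariant
subspace, which contains the summand 0 and not the summand 1. -/
theorem isotropyReducible_e6 : IsotropyReducible (subK e6G e6K) (AdK e6G e6K) := by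
  set E : Matrix Idx Idx ℂ := Matrix.diagonal (bv (dg 0)) with hE
  let W : Submodule ℝ (tang (subK e6G e6K)) :=
    { carrier := {Y | ((Y : lieAlg e6G) : Matrix Idx Idx ℂ) * E =
        E * ((Y : lieAlg e6G) : Matrix Idx Idx ℂ)}
      add_mem' := fun {a b} ha hb => by
        change (((a : lieAlg e6G) : Matrix Idx Idx ℂ) + ((b : lieAlg e6G) : Matrix Idx Idx ℂ)) * E =
          E * (((a : lieAlg e6G) : Matrix Idx Idx ℂ) + ((b : lieAlg e6G) : Matrix Idx Idx ℂ))
        rw [add_mul, mul_add, ha, hb]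
      zero_mem' := by simp
      smul_mem' := fun c a ha => by
        change (c • ((a : lieAlg e6G) : Matrix Idx Idx ℂ)) * E =
          E * (c • ((a : lieAlg e6G) : Matrix Idx Idx ℂ))
        rw [smul_mul_assoc, mul_smul_comm, ha] }
  have hW : ∀ Y : tang (subK e6G e6K), Y ∈ W ↔ ((Y : lieAlg e6G) : Matrix Idx Idx ℂ) * E =
      E * ((Y : lieAlg e6G) : Matrix Idx Idx ℂ) := fun Y => Iff.rfl
  have hy : ∀ l p, gr p = some l → (yv l (bv p) : Matrix Idx Idx ℂ) p (dg (l + 2)) = 1 :=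
    fun l p hp => by rw [entry_yv, restr_apply hp, bv_self]
  refine ⟨W, fun h0 => ?_, fun h0 => ?_, ?_⟩
  · obtain ⟨p, hp⟩ := exists_gr 0
    have h1 : (⟨yv 0 (bv p), (hasType_yv 0 _).mem_tang⟩ : tang (subK e6G e6K)) ∈ W := by
      rw [hW, hE, commute_diagonal_bv_iff (Subtype.prop _)]
      exact fun q _ => entry_yv_self 0 _ q
    rw [h0, Submodule.mem_bot] at h1
    have h2 := hy 0 p hp
    have h3 : yv 0 (bv p) = 0 := congrArg Subtype.val h1
    rw [h3] at h2
    exact zero_ne_one h2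
  · obtain ⟨p, hp⟩ := exists_gr 1
    have h1 : (⟨yv 1 (bv p), (hasType_yv 1 _).mem_tang⟩ : tang (subK e6G e6K)) ∈ W :=
      h0 ▸ Submodule.mem_top
    rw [hW, hE, commute_diagonal_bv_iff (Subtype.prop _)] at h1
    have h2 := hy 1 p hp
    rw [fin3_arith.2.2.2.1] at h2
    exact zero_ne_one ((h1 p (ne_dg_of_gr hp 0)).symm.trans h2)
  · rintro φ ⟨g, hg, rfl⟩ X hX
    rw [hW] at hX ⊢
    have h1 := coe_autP killing_e6_isInner isAutSet_AdK ⟨g, hg, rfl⟩ X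
    rw [autP_apply] at h1
    rw [h1, coe_Ad]
    have hg0 : (g : unitaryGroup Idx ℂ) ∈ commutant E := Subgroup.mem_iInf.1 hg.2 0
    have hS : ((g : unitaryGroup Idx ℂ) : Matrix Idx Idx ℂ) * E = E * (g : unitaryGroup Idx ℂ) := hg0
    have hi : (((g : unitaryGroup Idx ℂ)⁻¹ : unitaryGroup Idx ℂ) : Matrix Idx Idx ℂ) * E =
        E * (((g : unitaryGroup Idx ℂ)⁻¹ : unitaryGroup Idx ℂ) : Matrix Idx Idx ℂ) :=
      (commutant E).inv_mem hg0
    rw [mul_assoc, hi, ← mul_assoc, mul_assoc _ _ E, hX, ← mul_assoc, hS]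
    simp only [mul_assoc]

end Exceptional

end HomGeom

theorem corollary4p5 :
    (∀ {ι : Type*} [Fintype ι] [DecidableEq ι] (G K : Subgroup (Matrix.unitaryGroup ι ℂ)),
      IsClosed (G : Set (Matrix.unitaryGroup ι ℂ)) →
      IsClosed (K : Set (Matrix.unitaryGroup ι ℂ)) →
      K ≤ G →
      LieAlgebra.IsSemisimple ℝ (lieAlg G) →
      ∀ ρ : ℝ, IsEinstein (subK G K) (stdMetric (subK G K)) ρ →
        (8 * ρ - 1 < lamTau (lieAlg G) →
          GStable (subK G K) (AdK G K) ∧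
          (IsotropyReducible (subK G K) (AdK G K) → 2 * ρ < lamP (subK G K) (AdK G K))) ∧
        (8 * ρ - 1 = lamTau (lieAlg G) →
          GSemistable (subK G K) (AdK G K) ∧
          (IsotropyReducible (subK G K) (AdK G K) → 2 * ρ ≤ lamP (subK G K) (AdK G K))) ∧
        (lamTauMax (lieAlg G) < 8 * ρ - 1 →
          IsLocalMinScal (subK G K) (AdK G K) ∧
          (IsotropyReducible (subK G K) (AdK G K) →
            lamPMax (subK G K) (AdK G K) < 2 * ρ ∧ GUnstable (subK G K) (AdK G K))) ∧
        (lamTauMax (lieAlg G) = 8 * ρ - 1 →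
          IsotropyReducible (subK G K) (AdK G K) → lamPMax (subK G K) (AdK G K) ≤ 2 * ρ)) ∧
    (∀ n : ℕ, 3 ≤ n →
      IsEinstein (subK (spG n) (spK n)) (stdMetric (subK (spG n) (spK n))) (5 / 12) ∧
      GUnstable (subK (spG n) (spK n)) (AdK (spG n) (spK n)) ∧
      IsLocalMinScal (subK (spG n) (spK n)) (AdK (spG n) (spK n))) ∧
    (∀ n : ℕ, 3 ≤ n →
      IsEinstein (subK (soG n) (soK n)) (stdMetric (subK (soG n) (soK n))) (5 / 12) ∧
      GUnstable (subK (soG n) (soK n)) (AdK (soG n) (soK n)) ∧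
      IsLocalMinScal (subK (soG n) (soK n)) (AdK (soG n) (soK n))) ∧
    (IsEinstein (subK e6G e6K) (stdMetric (subK e6G e6K)) (5 / 12) ∧
      GUnstable (subK e6G e6K) (AdK e6G e6K) ∧
      IsLocalMinScal (subK e6G e6K) (AdK e6G e6K)) := by
  refine ⟨?_, fun n hn => ?_, fun n hn => ?_, ?_⟩
  · intro ι _ _ G K _ _ hKG hss ρ hρ
    have hL := killing_isInner_of_semisimple hss
    exact stability_criteria hL isAutSet_AdK (isAdInvariant_of_isInvariant hL hKG) hρ
  · have h := isClassicalPair_sp n (by omega)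
    exact unstable_localMin_of_isEinstein h.killing_isInner h.isEinstein h.isotropyReducible
  · have h := isClassicalPair_so n (by omega)
    exact unstable_localMin_of_isEinstein h.killing_isInner h.isEinstein h.isotropyReducible
  · exact unstable_localMin_of_isEinstein killing_e6_isInner isEinstein_e6 isotropyReducible_e6
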